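/- Let $\Omega=(0,\infty)\times(0,\pi/2)$ with points $(R,\theta)$ and measure $dR\,d\theta$, and let $L^2=L^2(\Omega)$. Put $\eta=\tfrac{99}{100}$, $w(R)=\frac{(1+R)^2}{R^2}$, $D_R=R\partial_R$, $D_\theta=\sin(2\theta)\partial_\theta$. For $\gamma>1$ and $k\in\mathbb N$ let $$|f|_{\mathcal H^k}^2=\sum_{i=0}^k\Big|D_R^i f\,\frac{w}{\sin(2\theta)^{\eta/2}}\Big|_{L^2}^2+\sum_{\substack{i+j\le k\\ i\ge1,\ j\ge 0}}\Big|D_R^jD_\theta^i f\,\frac{w}{\sin(2\theta)^{\gamma/2}}\Big|_{L^2}^2,$$ with derivatives in the weak sense and $|f|_{\mathcal H^k}=\infty$ if one of them is not a locally integrable function. Proposition. For every integer $k\ge2$ there is a constant $C_k>0$, depending only on $k$ (in particular independent of $\alpha$ and $\gamma$), such that the following holds for all $0<\alpha\le\frac14$ and $1<\gamma\le\frac54$. Let $F\in L^2$ satisfy $$\int_0^{\pi/2}F(R,\theta)\cos^2(\theta)\sin(\theta)\,d\theta=0\quad\text{for almost every }R>0,\qquad |F|_{\mathcal H^k}<\infty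 .$$ Then the equation $$-\alpha^2R^2\partial_{RR}\Psi-\alpha(5+\alpha)R\partial_R\Psi-\partial_{\theta\theta}\Psi+\partial_\theta\big(\tan(\theta)\Psi\big)-6\Psi=F\quad\text{in }\Omega$$ with the boundary conditions $\Psi(R,0)=\Psi(R,\pi/2)=0$ has exactly one $L^2$ solution $\Psi$ (that is, $\Psi,\partial_\theta\Psi\in L^2$, the equation holds almost everywhere with locally integrable weak derivatives, and the boundary values are taken in the sense of traces), and $$\alpha^2\,|R^2\partial_{RR}\Psi|_{\mathcal H^k}+|\partial_{\theta\theta}\Psi|_{\mathcal H^k}\le C_k\,|F|_{\mathcal H^k}.$$ -/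

import Mathlib

open MeasureTheory Set
open scoped ENNReal ContDiff

noncomputable section

namespace PolarBS

/-- The open strip `{(R, θ) : 0 < R, 0 < θ < π/2}`. -/
def strip : Set (ℝ × ℝ) := Ioi 0 ×ˢ Ioo 0 (Real.pi / 2)

/-- The measure `dR dθ` on the strip. -/
def stripMeasure : Measure (ℝ × ℝ) := volume.restrict strip

/-- Smooth functions with compact support contained in `U`. -/
def IsTest (U : Set (ℝ × ℝ)) (φ : ℝ × ℝ → ℝ) : Prop :=
  ContDiff ℝ ∞ φ ∧ HasCompactSupport φ ∧ tsupport φ ⊆ U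

/-- The radial direction, `∂_R`. -/
def dirR : ℝ × ℝ := (1, 0)

/-- The angular direction, `∂_θ`. -/
def dirTheta : ℝ × ℝ := (0, 1)

/-- `g` is the weak directional derivative of `f` in the direction `v` on the open strip
(both locally integrable there). -/
def HasWeakDeriv (v : ℝ × ℝ) (f g : ℝ × ℝ → ℝ) : Prop :=
  LocallyIntegrableOn f strip ∧ LocallyIntegrableOn g strip ∧
    ∀ φ : ℝ × ℝ → ℝ, IsTest strip φ →
      ∫ p, f p * fderiv ℝ φ p v ∂stripMeasure = -∫ p, g p * φ p ∂stripMeasure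

/-- `g` is the second weak derivative of `f` in the direction `v`. -/
def HasWeakDeriv2 (v : ℝ × ℝ) (f g : ℝ × ℝ → ℝ) : Prop :=
  ∃ h, HasWeakDeriv v f h ∧ HasWeakDeriv v h g

/-- `g = D_R f`, where `D_R = R ∂_R`. -/
def IsDR (f g : ℝ × ℝ → ℝ) : Prop :=
  ∃ u, HasWeakDeriv dirR f u ∧ g =ᵐ[stripMeasure] fun p => p.1 * u p

/-- `g = D_θ f`, where `D_θ = sin(2θ) ∂_θ`. -/
def IsDTheta (f g : ℝ × ℝ → ℝ) : Prop :=
  ∃ u, HasWeakDeriv dirTheta f u ∧ g =ᵐ[stripMeasure] fun p => Real.sin (2 * p.2) * u p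

/-- `g = D^n f`, for an operator `D` given by its graph. -/
def IsIterate (D : (ℝ × ℝ → ℝ) → (ℝ × ℝ → ℝ) → Prop) :
    ℕ → (ℝ × ℝ → ℝ) → (ℝ × ℝ → ℝ) → Prop
  | 0, f, g => LocallyIntegrableOn f strip ∧ g =ᵐ[stripMeasure] f
  | n + 1, f, g => ∃ h, IsIterate D n f h ∧ D h g

/-- `g = D_R^j D_θ^i f`. -/
def IsMixed (j i : ℕ) (f g : ℝ × ℝ → ℝ) : Prop :=
  ∃ h, IsIterate IsDTheta i f h ∧ IsIterate IsDR j h g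

/-- The radial weight `w(R) = (1+R)²/R²`. -/
def w (R : ℝ) : ℝ := (1 + R) ^ 2 / R ^ 2

/-- `|D_R^j D_θ^i f · w / sin(2θ)^{β/2}|_{L²}`, equal to `∞` if `D_R^j D_θ^i f` is not a (locally
integrable) function. The infimum is over the representatives of `D_R^j D_θ^i f`, which all agree
almost everywhere. -/
def mixedNorm (β : ℝ) (j i : ℕ) (f : ℝ × ℝ → ℝ) : ℝ≥0∞ :=
  ⨅ (g : ℝ × ℝ → ℝ) (_ : IsMixed j i f g),
    eLpNorm (fun p => g p * (w p.1 / Real.sin (2 * p.2) ^ (β / 2))) 2 stripMeasure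

/-- The fixed exponent `η = 99/100`. -/
def eta : ℝ := 99 / 100

/-- The `ℋ^k` norm with angular exponents `η` and `γ`, with values in `[0, ∞]`:
the square root of `∑_{0 ≤ i ≤ k} |D_R^i f w / sin(2θ)^{η/2}|²
+ ∑_{i + j ≤ k, i ≥ 1} |D_R^j D_θ^i f w / sin(2θ)^{γ/2}|²`. -/
def hkNorm (γ : ℝ) (k : ℕ) (f : ℝ × ℝ → ℝ) : ℝ≥0∞ :=
  ((∑ i ∈ Finset.range (k + 1), mixedNorm eta i 0 f ^ 2) +
    ∑ i ∈ Finset.Icc 1 k, ∑ j ∈ Finset.range (k - i + 1), mixedNorm γ j i f ^ 2) ^ (1 / 2 : ℝ)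

/-- `Ψ(R, 0) = Ψ(R, π/2) = 0` in the sense of traces: `∂_θ Ψ` is in `L²`, and integrating by parts
in `θ` produces no boundary term at `θ = 0` and `θ = π/2`, even against test functions on
`(0, ∞) × ℝ`, which need not vanish there. -/
def IsDirichlet (Ψ : ℝ × ℝ → ℝ) : Prop :=
  ∃ Ψθ : ℝ × ℝ → ℝ, MemLp Ψθ 2 stripMeasure ∧
    ∀ φ : ℝ × ℝ → ℝ, IsTest (Ioi 0 ×ˢ univ) φ →
      ∫ p, Ψ p * fderiv ℝ φ p dirTheta ∂stripMeasure = -∫ p, Ψθ p * φ p ∂stripMeasure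

/-- `Ψ` is an `L²` solution, with Dirichlet conditions at `θ = 0` and `θ = π/2`, of
`-α²R²∂_RRΨ - α(5+α)R∂_RΨ - ∂_θθΨ + ∂_θ(tan θ Ψ) - 6Ψ = F`. -/
structure IsL2Solution (α : ℝ) (F Ψ : ℝ × ℝ → ℝ) : Prop where
  memLp : MemLp Ψ 2 stripMeasure
  dirichlet : IsDirichlet Ψ
  equation : ∃ ΨR ΨRR Ψθθ T : ℝ × ℝ → ℝ,
    HasWeakDeriv dirR Ψ ΨR ∧ HasWeakDeriv dirR ΨR ΨRR ∧ HasWeakDeriv2 dirTheta Ψ Ψθθ ∧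
    HasWeakDeriv dirTheta (fun p => Real.tan p.2 * Ψ p) T ∧
    ∀ᵐ p ∂stripMeasure,
      -α ^ 2 * p.1 ^ 2 * ΨRR p - α * (5 + α) * p.1 * ΨR p - Ψθθ p + T p - 6 * Ψ p = F p

end PolarBS

end

/-!
The radial derivative enters the equation only through the scale-invariant field `α R ∂_R`: with
`Ψ₁ = α R ∂_R Ψ` and `Ψ₂ = α R ∂_R Ψ₁` it reads `-Ψ₂ - 5 Ψ₁ + A Ψ = F`, where
`A Ψ = -∂_θθ Ψ + ∂_θ (tan θ Ψ) - 6 Ψ` acts in the angle alone. Everything is bounded uniformly in `α` for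
the triple `Ψ, Ψ₁, Ψ₂`, so no power of `α` is ever lost.

*The angular operator.* On functions `sin(2θ) p(sin² θ)` with `p` a polynomial, `A` becomes the
hypergeometric operator `angOp` on `p`. It is triangular in the monomials, with eigenvalues
`lam n = 4 n² + 10 n`; its eigenpolynomials `eigenpoly n` are Jacobi polynomials `Jₙ`, orthogonal for the
form `Ac`. The kernel is spanned by `J₀ = 1`, and the adjoint eigenfunctions are `cos θ sin(2θ) Jₙ(sin² θ)`,
so that the orthogonality of `F` to `cos² θ sin θ` removes exactly the mode `n = 0`. In the weight
`sin(2θ)^{-η}` the operator is coercive up to a term of lower order (`angOp_weighted_lower_bound`);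
adding a large multiple of the form `Ac`, in which it has the spectral gap `lam 1 = 14` (`Ac_angOp_fam`),
turns this into genuine coercivity above the kernel (`aForm_coercive`).

*The weighted estimate and existence.* The radial weight squared is `(1 + R)⁴ / R⁴`, a sum of multiples of
`R^{m-4}` with `m ≤ 4`. Integration by parts against `R^{m-4}` turns `α R ∂_R` into its negative up to the
constant `τ = α (m - 3)`, and `α ≤ 1/4` keeps `τ` between `-3/4` and `1/4`, which the angular coercivity
absorbs (`energy_estimate`). This gives the a priori estimate `NiceSol.nrm_le` for finite sums of modes,
whose coefficients solve an explicit Euler equation in `R`. Such sums are dense among the admissible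
right-hand sides (`exists_modes_near`), and the solution for general `F` is a limit (`exists_sol`).

*Uniqueness.* A solution can be tested against a radial test function times an adjoint eigenfunction: the
boundary terms vanish by the Dirichlet condition (`IsL2Solution.vw`). For the difference of two solutions,
each angular moment is then a square integrable solution of the homogeneous Euler equation on the
half-line, hence zero; as the moments against all `n` determine the function, the difference vanishes
(`VW.unique`).

*Higher regularity.* The operator commutes with `D_R`, so by uniqueness `D_R` of the solution is the
solution for `D_R F` (`Sol.radial`). In the angle, `Y = ∂_θ (Ψ / cos θ)` satisfies the first order equation
`D_θ Y = 6 sin² θ Y - 2 sin θ Q` with `Q = F + 4 Ψ + Ψ₂ + 5 Ψ₁` (`Sol.isDTheta_Y`), which exchanges an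
angular derivative for none. The `ℋ^k` norm asks for the weight `γ > 1` as soon as an angular derivative is
present, whereas the energy estimate only yields `η < 1`. Near `θ = 0` the right-hand side carries a
factor `sin θ` that compensates the difference; near `θ = π/2` a Hardy inequality for the first order
equation does (`nrm_sin_sq_mul_le`, `nrm_dTheta_Y_le`), with a constant uniform in `1 ≤ γ ≤ 5/4`. An
induction over the number of derivatives gives `exists_regSol`, and
`∂_θθ Ψ = sin θ Y - 5 Ψ - (F + Ψ₂ + 5 Ψ₁)` together with `α² R² ∂_RR Ψ = Ψ₂ - α Ψ₁` yields the two norms of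
the claim (`tower_of_hkNorm`, `RTower.hkNorm_le`).
-/


noncomputable section

open Filter Topology
open scoped NNReal

namespace PolarBS

/-! ### Weak derivatives on the strip -/

lemma isOpen_strip : IsOpen strip := isOpen_Ioi.prod isOpen_Ioo

lemma measurableSet_strip : MeasurableSet strip := isOpen_strip.measurableSet

lemma ae_strip_of_forall {P : ℝ × ℝ → Prop} (h : ∀ p ∈ strip, P p) : ∀ᵐ p ∂stripMeasure, P p :=
  (ae_restrict_mem measurableSet_strip).mono h

lemma LocInt.congr {f g : ℝ × ℝ → ℝ} (hf : LocallyIntegrableOn f strip)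
    (h : f =ᵐ[stripMeasure] g) : LocallyIntegrableOn g strip := by
  intro p hp
  obtain ⟨U, hU, hfU⟩ := hf p hp
  refine ⟨U ∩ strip, inter_mem hU self_mem_nhdsWithin, ?_⟩
  exact (hfU.mono_set inter_subset_left).congr_fun_ae
    (ae_mono (Measure.restrict_mono inter_subset_right le_rfl) h)

instance : IsLocallyFiniteMeasure stripMeasure :=
  inferInstanceAs (IsLocallyFiniteMeasure (volume.restrict strip))

lemma LocInt.of_memLp {f : ℝ × ℝ → ℝ} (hf : MemLp f 2 stripMeasure) :
    LocallyIntegrableOn f strip :=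
  locallyIntegrableOn_of_locallyIntegrable_restrict (hf.locallyIntegrable (by norm_num))

lemma LocInt.mul {f b : ℝ × ℝ → ℝ} (hf : LocallyIntegrableOn f strip)
    (hb : ContinuousOn b strip) : LocallyIntegrableOn (fun p => b p * f p) strip :=
  hf.continuousOn_mul hb isOpen_strip.isLocallyClosed

lemma LocInt.const_mul {f : ℝ × ℝ → ℝ} (hf : LocallyIntegrableOn f strip) (c : ℝ) :
    LocallyIntegrableOn (fun p => c * f p) strip :=
  LocInt.mul hf continuousOn_const

lemma LocInt.aesm {f : ℝ × ℝ → ℝ} (hf : LocallyIntegrableOn f strip) :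
    AEStronglyMeasurable f stripMeasure := hf.aestronglyMeasurable

lemma LocInt.integrable_mul {f φ : ℝ × ℝ → ℝ} (hf : LocallyIntegrableOn f strip)
    (hφ : Continuous φ) (hc : HasCompactSupport φ) (hs : tsupport φ ⊆ strip) :
    Integrable (fun p => f p * φ p) stripMeasure := by
  have h1 : IntegrableOn f (tsupport φ) := hf.integrableOn_compact_subset hs hc
  have h2 : IntegrableOn (fun p => f p * φ p) (tsupport φ) :=
    h1.mul_continuousOn hφ.continuousOn hc
  have h3 : Integrable (fun p => f p * φ p) :=
    (integrableOn_iff_integrable_of_support_subset (fun p hp => subset_tsupport φ (by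
      intro h0; exact hp (by simp [h0])))).1 h2
  exact h3.restrict

/-- A function smooth on `U` times a test function on `U` is a test function. -/
lemma IsTest.mul_contDiffOn {U : Set (ℝ × ℝ)} (hU : IsOpen U) {a φ : ℝ × ℝ → ℝ}
    (ha : ContDiffOn ℝ ∞ a U) (hφ : IsTest U φ) : IsTest U (fun p => a p * φ p) := by
  refine ⟨?_, hφ.2.1.mul_left, (closure_mono (Function.support_mul_subset_right _ _)).trans hφ.2.2⟩
  rw [contDiff_iff_contDiffAt]
  intro p
  by_cases hp : p ∈ tsupport φ
  · exact (ha.contDiffAt (hU.mem_nhds (hφ.2.2 hp))).mul hφ.1.contDiffAt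
  · have : (fun p => a p * φ p) =ᶠ[𝓝 p] fun _ => 0 := by
      filter_upwards [notMem_tsupport_iff_eventuallyEq.1 hp] with q hq
      simp [hq]
    exact contDiffAt_const.congr_of_eventuallyEq this

lemma IsTest.fderiv {U : Set (ℝ × ℝ)} {φ : ℝ × ℝ → ℝ} (hφ : IsTest U φ) (v : ℝ × ℝ) :
    IsTest U (fun p => fderiv ℝ φ p v) := by
  refine ⟨?_, hφ.2.1.fderiv_apply ℝ v, (tsupport_fderiv_apply_subset ℝ v).trans hφ.2.2⟩
  exact (hφ.1.fderiv_right (m := ∞) (by norm_cast)).clm_apply contDiff_const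

lemma IsTest.differentiable {U : Set (ℝ × ℝ)} {φ : ℝ × ℝ → ℝ} (hφ : IsTest U φ) :
    Differentiable ℝ φ := hφ.1.differentiable (by norm_num)

lemma IsTest.integrable_mul {φ f : ℝ × ℝ → ℝ} (hφ : IsTest strip φ)
    (hf : LocallyIntegrableOn f strip) : Integrable (fun p => f p * φ p) stripMeasure :=
  LocInt.integrable_mul hf hφ.1.continuous hφ.2.1 hφ.2.2

lemma IsTest.memLp {U : Set (ℝ × ℝ)} {φ : ℝ × ℝ → ℝ} (hφ : IsTest U φ) :
    MemLp φ 2 stripMeasure :=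
  (hφ.1.continuous.memLp_of_hasCompactSupport hφ.2.1).restrict _

/-- The fundamental lemma of the calculus of variations on the strip. -/
lemma ae_eq_of_forall_test {f g : ℝ × ℝ → ℝ} (hf : LocallyIntegrableOn f strip)
    (hg : LocallyIntegrableOn g strip)
    (h : ∀ φ, IsTest strip φ → ∫ p, f p * φ p ∂stripMeasure = ∫ p, g p * φ p ∂stripMeasure) :
    f =ᵐ[stripMeasure] g := by
  have := isOpen_strip.ae_eq_zero_of_integral_contDiff_smul_eq_zero (hf.sub hg) (μ := volume) (by
    intro φ h1 h2 h3
    have hφ : IsTest strip φ := ⟨h1, h2, h3⟩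
    have e : ∫ x, φ x • (f - g) x = ∫ x in strip, φ x • (f - g) x := by
      refine (setIntegral_eq_integral_of_forall_compl_eq_zero fun x hx => ?_).symm
      have : φ x = 0 := image_eq_zero_of_notMem_tsupport fun hh => hx (h3 hh)
      simp [this]
    rw [e]
    have : ∀ x, φ x • (f - g) x = f x * φ x - g x * φ x := by
      intro x; simp; ring
    simp_rw [this]
    have := integral_sub (hφ.integrable_mul hf) (hφ.integrable_mul hg)
    unfold stripMeasure at this
    rw [this, sub_eq_zero]
    exact h φ hφ)
  unfold stripMeasure
  refine (ae_restrict_iff' measurableSet_strip).2 ?_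
  filter_upwards [this] with x hx hxs
  have := hx hxs
  simpa [sub_eq_zero] using this

lemma HasWeakDeriv.unique {v : ℝ × ℝ} {f g h : ℝ × ℝ → ℝ} (hg : HasWeakDeriv v f g)
    (hh : HasWeakDeriv v f h) : g =ᵐ[stripMeasure] h :=
  ae_eq_of_forall_test hg.2.1 hh.2.1 fun φ hφ => by
    have := (hg.2.2 φ hφ).symm.trans (hh.2.2 φ hφ)
    linarith

lemma HasWeakDeriv.congr {v : ℝ × ℝ} {f g f' g' : ℝ × ℝ → ℝ} (h : HasWeakDeriv v f g)
    (hf : f =ᵐ[stripMeasure] f') (hg : g =ᵐ[stripMeasure] g') : HasWeakDeriv v f' g' := by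
  refine ⟨LocInt.congr h.1 hf, LocInt.congr h.2.1 hg, fun φ hφ => ?_⟩
  have e1 : ∫ p, f p * fderiv ℝ φ p v ∂stripMeasure = ∫ p, f' p * fderiv ℝ φ p v ∂stripMeasure :=
    integral_congr_ae (hf.mono fun p hp => by simp only [hp])
  have e2 : ∫ p, g p * φ p ∂stripMeasure = ∫ p, g' p * φ p ∂stripMeasure :=
    integral_congr_ae (hg.mono fun p hp => by simp only [hp])
  rw [← e1, ← e2]
  exact h.2.2 φ hφ

lemma HasWeakDeriv.add {v : ℝ × ℝ} {f g f' g' : ℝ × ℝ → ℝ} (h : HasWeakDeriv v f g)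
    (h' : HasWeakDeriv v f' g') :
    HasWeakDeriv v (fun p => f p + f' p) (fun p => g p + g' p) := by
  refine ⟨h.1.add h'.1, h.2.1.add h'.2.1, fun φ hφ => ?_⟩
  simp_rw [add_mul]
  rw [integral_add ((hφ.fderiv v).integrable_mul h.1) ((hφ.fderiv v).integrable_mul h'.1),
    integral_add (hφ.integrable_mul h.2.1) (hφ.integrable_mul h'.2.1), h.2.2 φ hφ, h'.2.2 φ hφ]
  ring

lemma HasWeakDeriv.const_mul {v : ℝ × ℝ} {f g : ℝ × ℝ → ℝ} (h : HasWeakDeriv v f g) (c : ℝ) :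
    HasWeakDeriv v (fun p => c * f p) (fun p => c * g p) := by
  refine ⟨LocInt.const_mul h.1 c, LocInt.const_mul h.2.1 c, fun φ hφ => ?_⟩
  simp_rw [mul_assoc]
  rw [integral_const_mul, integral_const_mul, h.2.2 φ hφ]
  ring

/-- The product rule for a weak derivative and a smooth factor. -/
lemma HasWeakDeriv.mul_smooth {v : ℝ × ℝ} {f g a a' : ℝ × ℝ → ℝ} (h : HasWeakDeriv v f g)
    (ha : ContDiffOn ℝ ∞ a strip) (ha' : ∀ p ∈ strip, fderiv ℝ a p v = a' p) :
    HasWeakDeriv v (fun p => a p * f p) (fun p => a p * g p + a' p * f p) := by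
  have hac : ContinuousOn a strip := ha.continuousOn
  have hc' : ContinuousOn a' strip := by
    have h1 : ContDiffOn ℝ ∞ (fun p => fderiv ℝ a p v) strip :=
      (ha.fderiv_of_isOpen isOpen_strip (m := ∞) (by norm_cast)).clm_apply contDiffOn_const
    exact h1.continuousOn.congr fun p hp => (ha' p hp).symm
  refine ⟨LocInt.mul h.1 hac, (LocInt.mul h.2.1 hac).add (LocInt.mul h.1 hc'), fun φ hφ => ?_⟩
  have haφ := hφ.mul_contDiffOn isOpen_strip ha
  have key := h.2.2 _ haφ
  have e : ∀ p ∈ strip, fderiv ℝ (fun p => a p * φ p) p v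
      = a p * fderiv ℝ φ p v + φ p * a' p := by
    intro p hp
    have hd : DifferentiableAt ℝ a p :=
      (ha.contDiffAt (isOpen_strip.mem_nhds hp)).differentiableAt (by norm_num)
    rw [fderiv_fun_mul hd hφ.differentiable.differentiableAt]
    simp [ha' p hp]
  have e1 : ∫ p, f p * fderiv ℝ (fun p => a p * φ p) p v ∂stripMeasure
      = ∫ p, (a p * f p * fderiv ℝ φ p v + a' p * f p * φ p) ∂stripMeasure :=
    integral_congr_ae (ae_strip_of_forall fun p hp => by
      simp only [e p hp]; ring)
  rw [e1, integral_add ((hφ.fderiv v).integrable_mul (LocInt.mul h.1 hac))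
    (hφ.integrable_mul (LocInt.mul h.1 hc'))] at key
  simp_rw [add_mul]
  rw [integral_add (hφ.integrable_mul (LocInt.mul h.2.1 hac))
    (hφ.integrable_mul (LocInt.mul h.1 hc'))]
  have e2 : ∫ p, g p * (a p * φ p) ∂stripMeasure = ∫ p, a p * g p * φ p ∂stripMeasure := by
    congr 1; ext p; ring
  rw [e2] at key
  linarith

/-- Weak derivatives commute as soon as the functions involved exist. -/
lemma HasWeakDeriv.swap {v u : ℝ × ℝ} {f fv fu fuv : ℝ × ℝ → ℝ} (hv : HasWeakDeriv v f fv)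
    (hu : HasWeakDeriv u f fu) (huv : HasWeakDeriv v fu fuv) : HasWeakDeriv u fv fuv := by
  refine ⟨hv.2.1, huv.2.1, fun φ hφ => ?_⟩
  have e1 := hv.2.2 _ (hφ.fderiv u)
  have e2 := hu.2.2 _ (hφ.fderiv v)
  have e3 := huv.2.2 _ hφ
  have sym : ∀ p, fderiv ℝ (fun q => fderiv ℝ φ q u) p v = fderiv ℝ (fun q => fderiv ℝ φ q v) p u := by
    intro p
    have h2 : ContDiffAt ℝ 2 φ p := hφ.1.contDiffAt.of_le (by norm_cast)
    have hs := h2.isSymmSndFDerivAt (by simp)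
    have hd : DifferentiableAt ℝ (fderiv ℝ φ) p :=
      (hφ.1.fderiv_right (m := ∞) (by norm_cast)).differentiable (by norm_num) p
    rw [fderiv_clm_apply hd (differentiableAt_const _),
      fderiv_clm_apply hd (differentiableAt_const _)]
    simpa using hs v u
  simp_rw [sym] at e1
  linarith

/-- The weak derivative of a continuously differentiable function is its derivative. -/
lemma hasWeakDeriv_of_differentiableAt {v : ℝ × ℝ} {f g : ℝ × ℝ → ℝ}
    (hf : ∀ p ∈ strip, DifferentiableAt ℝ f p) (hg : ∀ p ∈ strip, fderiv ℝ f p v = g p)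
    (hgc : ContinuousOn g strip) : HasWeakDeriv v f g := by
  have hfc : ContinuousOn f strip := fun p hp => (hf p hp).continuousAt.continuousWithinAt
  have hfl := hfc.locallyIntegrableOn (μ := volume) measurableSet_strip
  have hgl := hgc.locallyIntegrableOn (μ := volume) measurableSet_strip
  refine ⟨hfl, hgl, fun φ hφ => ?_⟩
  have r : ∀ h : ℝ × ℝ → ℝ, ∀ χ, IsTest strip χ → ∫ p, h p * χ p ∂stripMeasure = ∫ p, h p * χ p := by
    intro h χ hχ
    refine setIntegral_eq_integral_of_forall_compl_eq_zero fun x hx => ?_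
    have : χ x = 0 := image_eq_zero_of_notMem_tsupport fun hh => hx (hχ.2.2 hh)
    simp [this]
  have i : ∀ h : ℝ × ℝ → ℝ, LocallyIntegrableOn h strip → ∀ χ, IsTest strip χ →
      Integrable fun p => h p * χ p := by
    intro h hh χ hχ
    refine (integrableOn_iff_integrable_of_support_subset (s := strip) fun x hx => ?_).1
      (hχ.integrable_mul hh)
    by_contra hxs
    exact hx (by simp [image_eq_zero_of_notMem_tsupport fun hh => hxs (hχ.2.2 hh)])
  have eq : (fun p => fderiv ℝ f p v * φ p) = fun p => g p * φ p := by
    ext p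
    by_cases hp : p ∈ strip
    · rw [hg p hp]
    · simp [image_eq_zero_of_notMem_tsupport fun hh => hp (hφ.2.2 hh)]
  rw [r _ _ (hφ.fderiv v), r _ _ hφ, integral_mul_fderiv_eq_neg_fderiv_mul_of_integrable
    (by rw [eq]; exact i _ hgl _ hφ) (i _ hfl _ (hφ.fderiv v)) (i _ hfl _ hφ)
    (fun p hp => hf p (hφ.2.2 hp)) (fun p _ => hφ.differentiable p), eq]

/-- Convergence in `L²` implies convergence of the pairings with an `L²` function. -/
lemma tendsto_integral_mul_of_eLpNorm {f : ℕ → ℝ × ℝ → ℝ} {f₀ φ : ℝ × ℝ → ℝ}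
    (hf : ∀ n, MemLp (f n) 2 stripMeasure) (hf₀ : MemLp f₀ 2 stripMeasure)
    (hφ : MemLp φ 2 stripMeasure)
    (h : Tendsto (fun n => eLpNorm (fun p => f n p - f₀ p) 2 stripMeasure) atTop (𝓝 0)) :
    Tendsto (fun n => ∫ p, f n p * φ p ∂stripMeasure) atTop
      (𝓝 (∫ p, f₀ p * φ p ∂stripMeasure)) := by
  have hi : ∀ n, Integrable (fun p => f n p * φ p) stripMeasure := fun n =>
    (hf n).integrable_mul hφ
  have hi₀ : Integrable (fun p => f₀ p * φ p) stripMeasure := hf₀.integrable_mul hφ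
  rw [tendsto_iff_edist_tendsto_0]
  have bd : ∀ n, edist (∫ p, f n p * φ p ∂stripMeasure) (∫ p, f₀ p * φ p ∂stripMeasure)
      ≤ eLpNorm (fun p => f n p - f₀ p) 2 stripMeasure * eLpNorm φ 2 stripMeasure := by
    intro n
    rw [edist_eq_enorm_sub, ← integral_sub (hi n) hi₀]
    refine (enorm_integral_le_lintegral_enorm _).trans ?_
    have := eLpNorm_smul_le_mul_eLpNorm (p := 2) (q := 2) (r := 1) hφ.1
      ((hf n).1.sub hf₀.1)
    rw [eLpNorm_one_eq_lintegral_enorm] at this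
    refine le_trans (le_of_eq ?_) this
    congr 1; ext p
    simp [sub_mul]
  refine tendsto_of_tendsto_of_tendsto_of_le_of_le tendsto_const_nhds ?_ (fun _ => bot_le) bd
  have := ENNReal.Tendsto.mul_const h (b := eLpNorm φ 2 stripMeasure) (Or.inr hφ.2.ne)
  simpa using this

lemma hasFDerivAt_comp_snd {b : ℝ → ℝ} {b' : ℝ} {p : ℝ × ℝ} (h : HasDerivAt b b' p.2) :
    HasFDerivAt (fun q : ℝ × ℝ => b q.2) (b' • ContinuousLinearMap.snd ℝ ℝ ℝ) p :=
  h.comp_hasFDerivAt p hasFDerivAt_snd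

lemma hasFDerivAt_comp_fst {b : ℝ → ℝ} {b' : ℝ} {p : ℝ × ℝ} (h : HasDerivAt b b' p.1) :
    HasFDerivAt (fun q : ℝ × ℝ => b q.1) (b' • ContinuousLinearMap.fst ℝ ℝ ℝ) p :=
  h.comp_hasFDerivAt p hasFDerivAt_fst

lemma contDiffOn_comp_snd {b : ℝ → ℝ} (hb : ContDiffOn ℝ ∞ b (Ioo 0 (Real.pi / 2))) :
    ContDiffOn ℝ ∞ (fun p : ℝ × ℝ => b p.2) strip :=
  hb.comp contDiff_snd.contDiffOn fun _ hp => hp.2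

lemma contDiffOn_comp_fst {b : ℝ → ℝ} (hb : ContDiffOn ℝ ∞ b (Ioi 0)) :
    ContDiffOn ℝ ∞ (fun p : ℝ × ℝ => b p.1) strip :=
  hb.comp contDiff_fst.contDiffOn fun _ hp => hp.1

lemma HasWeakDeriv.mul_theta {f g : ℝ × ℝ → ℝ} {b b' : ℝ → ℝ} (h : HasWeakDeriv dirTheta f g)
    (hb : ContDiffOn ℝ ∞ b (Ioo 0 (Real.pi / 2)))
    (hb' : ∀ θ ∈ Ioo 0 (Real.pi / 2), HasDerivAt b (b' θ) θ) :
    HasWeakDeriv dirTheta (fun p => b p.2 * f p) (fun p => b p.2 * g p + b' p.2 * f p) :=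
  h.mul_smooth (a := fun p => b p.2) (a' := fun p => b' p.2) (contDiffOn_comp_snd hb) fun p hp => by
    rw [(hasFDerivAt_comp_snd (hb' p.2 hp.2)).fderiv]; simp [dirTheta]

lemma HasWeakDeriv.mul_theta_dirR {f g : ℝ × ℝ → ℝ} {b : ℝ → ℝ} (h : HasWeakDeriv dirR f g)
    (hb : ContDiffOn ℝ ∞ b (Ioo 0 (Real.pi / 2))) :
    HasWeakDeriv dirR (fun p => b p.2 * f p) (fun p => b p.2 * g p) := by
  have := h.mul_smooth (a := fun p => b p.2) (a' := fun _ => 0) (contDiffOn_comp_snd hb) fun p hp => by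
    have hd : DifferentiableAt ℝ b p.2 :=
      (hb.contDiffAt (isOpen_Ioo.mem_nhds hp.2)).differentiableAt (by norm_num)
    rw [(hasFDerivAt_comp_snd hd.hasDerivAt).fderiv]; simp [dirR]
  simpa using this

lemma HasWeakDeriv.mul_R {f g : ℝ × ℝ → ℝ} {b b' : ℝ → ℝ} (h : HasWeakDeriv dirR f g)
    (hb : ContDiffOn ℝ ∞ b (Ioi 0)) (hb' : ∀ R ∈ Ioi (0 : ℝ), HasDerivAt b (b' R) R) :
    HasWeakDeriv dirR (fun p => b p.1 * f p) (fun p => b p.1 * g p + b' p.1 * f p) :=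
  h.mul_smooth (a := fun p => b p.1) (a' := fun p => b' p.1) (contDiffOn_comp_fst hb) fun p hp => by
    rw [(hasFDerivAt_comp_fst (hb' p.1 hp.1)).fderiv]; simp [dirR]

lemma HasWeakDeriv.mul_R_dirTheta {f g : ℝ × ℝ → ℝ} {b : ℝ → ℝ} (h : HasWeakDeriv dirTheta f g)
    (hb : ContDiffOn ℝ ∞ b (Ioi 0)) :
    HasWeakDeriv dirTheta (fun p => b p.1 * f p) (fun p => b p.1 * g p) := by
  have := h.mul_smooth (a := fun p => b p.1) (a' := fun _ => 0) (contDiffOn_comp_fst hb) fun p hp => by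
    have hd : DifferentiableAt ℝ b p.1 :=
      (hb.contDiffAt (isOpen_Ioi.mem_nhds hp.1)).differentiableAt (by norm_num)
    rw [(hasFDerivAt_comp_fst hd.hasDerivAt).fderiv]; simp [dirTheta]
  simpa using this

/-! ### Cutoff functions -/

/-- A smooth step on the line: `0` for `x ≤ 1` and `1` for `x ≥ 2`. -/
def stepUp (x : ℝ) : ℝ := Real.smoothTransition (x - 1)

lemma stepUp_contDiff : ContDiff ℝ ∞ stepUp :=
  Real.smoothTransition.contDiff.comp (contDiff_id.sub contDiff_const)

lemma stepUp_nonneg (x : ℝ) : 0 ≤ stepUp x := Real.smoothTransition.nonneg _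
lemma stepUp_le_one (x : ℝ) : stepUp x ≤ 1 := Real.smoothTransition.le_one _
lemma stepUp_of_le {x : ℝ} (h : x ≤ 1) : stepUp x = 0 :=
  Real.smoothTransition.zero_of_nonpos (by linarith)
lemma stepUp_of_ge {x : ℝ} (h : 2 ≤ x) : stepUp x = 1 :=
  Real.smoothTransition.one_of_one_le (by linarith)

lemma stepUp_abs_le (x : ℝ) : |stepUp x| ≤ 1 := by
  rw [abs_of_nonneg (stepUp_nonneg x)]; exact stepUp_le_one x

lemma deriv_stepUp_of_lt {x : ℝ} (h : x < 1) : deriv stepUp x = 0 := by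
  have : stepUp =ᶠ[𝓝 x] fun _ => 0 := by
    filter_upwards [Iio_mem_nhds h] with y hy using stepUp_of_le (le_of_lt hy)
  rw [this.deriv_eq]; simp

lemma deriv_stepUp_of_gt {x : ℝ} (h : 2 < x) : deriv stepUp x = 0 := by
  have : stepUp =ᶠ[𝓝 x] fun _ => 1 := by
    filter_upwards [Ioi_mem_nhds h] with y hy using stepUp_of_ge (le_of_lt hy)
  rw [this.deriv_eq]; simp

lemma contDiff_deriv_of_contDiff {f : ℝ → ℝ} (hf : ContDiff ℝ ∞ f) : ContDiff ℝ ∞ (deriv f) :=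
  (contDiff_infty_iff_deriv.1 hf).2

/-- `x S'(x)` for the smooth step `S`. -/
def stepUp1 (x : ℝ) : ℝ := x * deriv stepUp x

/-- `x (x S'(x))'` for the smooth step `S`. -/
def stepUp2 (x : ℝ) : ℝ := x * deriv stepUp1 x

lemma stepUp1_contDiff : ContDiff ℝ ∞ stepUp1 :=
  contDiff_id.mul (contDiff_deriv_of_contDiff stepUp_contDiff)

lemma stepUp2_contDiff : ContDiff ℝ ∞ stepUp2 :=
  contDiff_id.mul (contDiff_deriv_of_contDiff stepUp1_contDiff)

lemma stepUp1_eq_zero {x : ℝ} (h : x < 1 ∨ 2 < x) : stepUp1 x = 0 := by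
  rcases h with h | h
  · simp [stepUp1, deriv_stepUp_of_lt h]
  · simp [stepUp1, deriv_stepUp_of_gt h]

lemma stepUp2_eq_zero {x : ℝ} (h : x < 1 ∨ 2 < x) : stepUp2 x = 0 := by
  have : stepUp1 =ᶠ[𝓝 x] fun _ => 0 := by
    rcases h with h | h
    · filter_upwards [Iio_mem_nhds h] with y hy using stepUp1_eq_zero (Or.inl hy)
    · filter_upwards [Ioi_mem_nhds h] with y hy using stepUp1_eq_zero (Or.inr hy)
  simp [stepUp2, this.deriv_eq]

lemma exists_bound_of_eq_zero {f : ℝ → ℝ} (hf : Continuous f)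
    (h0 : ∀ x, (x < 1 ∨ 2 < x) → f x = 0) : ∃ B, 0 ≤ B ∧ ∀ x, |f x| ≤ B := by
  obtain ⟨B, hB⟩ := (isCompact_Icc (a := (1 : ℝ)) (b := 2)).exists_bound_of_continuousOn
    hf.continuousOn
  refine ⟨max B 0, le_max_right _ _, fun x => ?_⟩
  by_cases hx : x ∈ Icc (1 : ℝ) 2
  · exact (hB x hx).trans (le_max_left _ _)
  · rw [h0 x (by rw [mem_Icc, not_and_or, not_le, not_le] at hx; exact hx)]
    simp

lemma exists_stepUp_bound : ∃ B, 0 ≤ B ∧ (∀ x, |stepUp1 x| ≤ B) ∧ ∀ x, |stepUp2 x| ≤ B := by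
  obtain ⟨B1, h1, h1'⟩ := exists_bound_of_eq_zero stepUp1_contDiff.continuous
    fun x hx => stepUp1_eq_zero hx
  obtain ⟨B2, h2, h2'⟩ := exists_bound_of_eq_zero stepUp2_contDiff.continuous
    fun x hx => stepUp2_eq_zero hx
  exact ⟨max B1 B2, h1.trans (le_max_left _ _), fun x => (h1' x).trans (le_max_left _ _),
    fun x => (h2' x).trans (le_max_right _ _)⟩

lemma hasDerivAt_stepUp (x : ℝ) : HasDerivAt stepUp (deriv stepUp x) x :=
  (stepUp_contDiff.differentiable (by norm_num) x).hasDerivAt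

lemma hasDerivAt_stepUp1 (x : ℝ) : HasDerivAt stepUp1 (deriv stepUp1 x) x :=
  (stepUp1_contDiff.differentiable (by norm_num) x).hasDerivAt

/-- Cutoffs exhausting `(0, π/2)`. -/
def cutTheta (j : ℕ) (θ : ℝ) : ℝ :=
  stepUp ((j + 1) * θ) * stepUp ((j + 1) * (Real.pi / 2 - θ))

/-- The derivative of `cutTheta j`. -/
def cutTheta' (j : ℕ) (θ : ℝ) : ℝ :=
  (j + 1) * deriv stepUp ((j + 1) * θ) * stepUp ((j + 1) * (Real.pi / 2 - θ))
    - stepUp ((j + 1) * θ) * ((j + 1) * deriv stepUp ((j + 1) * (Real.pi / 2 - θ)))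

lemma cutTheta_contDiff (j : ℕ) : ContDiff ℝ ∞ (cutTheta j) :=
  (stepUp_contDiff.comp (contDiff_const.mul contDiff_id)).mul
    (stepUp_contDiff.comp (contDiff_const.mul (contDiff_const.sub contDiff_id)))

lemma hasDerivAt_cutTheta (j : ℕ) (θ : ℝ) : HasDerivAt (cutTheta j) (cutTheta' j θ) θ := by
  have h1 : HasDerivAt (fun θ : ℝ => (j + 1) * θ) ((j : ℝ) + 1) θ := by
    simpa using (hasDerivAt_id θ).const_mul ((j : ℝ) + 1)
  have h2 : HasDerivAt (fun θ : ℝ => (j + 1) * (Real.pi / 2 - θ)) (-((j : ℝ) + 1)) θ := by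
    simpa using ((hasDerivAt_id θ).const_sub (Real.pi / 2)).const_mul ((j : ℝ) + 1)
  refine (((hasDerivAt_stepUp _).comp θ h1).mul ((hasDerivAt_stepUp _).comp θ h2)).congr_deriv ?_
  simp only [cutTheta', Function.comp]; ring

lemma cutTheta'_continuous (j : ℕ) : Continuous (cutTheta' j) := by
  have := contDiff_deriv_of_contDiff (cutTheta_contDiff j)
  rw [show deriv (cutTheta j) = cutTheta' j from funext fun θ => (hasDerivAt_cutTheta j θ).deriv]
    at this
  exact this.continuous

lemma cutTheta_abs_le (j : ℕ) (θ : ℝ) : |cutTheta j θ| ≤ 1 := by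
  rw [cutTheta, abs_mul]
  exact mul_le_one₀ (stepUp_abs_le _) (abs_nonneg _) (stepUp_abs_le _)

lemma cutTheta_support (j : ℕ) :
    Function.support (cutTheta j) ⊆ Icc (1 / ((j : ℝ) + 1)) (Real.pi / 2 - 1 / ((j : ℝ) + 1)) := by
  intro θ hθ
  have hj : (0 : ℝ) < j + 1 := by positivity
  rw [mem_Icc]
  by_contra hn
  apply hθ
  rw [not_and_or, not_le, not_le] at hn
  rcases hn with hn | hn
  · rw [lt_div_iff₀ hj] at hn
    simp [cutTheta, stepUp_of_le (show ((j : ℝ) + 1) * θ ≤ 1 by linarith)]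
  · have : (Real.pi / 2 - θ) < 1 / ((j : ℝ) + 1) := by linarith
    rw [lt_div_iff₀ hj] at this
    simp [cutTheta, stepUp_of_le (show ((j : ℝ) + 1) * (Real.pi / 2 - θ) ≤ 1 by linarith)]

/-- The derivative of the angular cutoff is of the order of the inverse distance to the ends, which
`sin θ cos θ` compensates, uniformly in `j`. -/
lemma exists_cutTheta'_bound :
    ∃ B, ∀ j, ∀ θ ∈ Ioo 0 (Real.pi / 2), |Real.sin θ * Real.cos θ * cutTheta' j θ| ≤ B := by
  obtain ⟨B, hB, h1, -⟩ := exists_stepUp_bound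
  refine ⟨B + B, fun j θ hθ => ?_⟩
  have hs : 0 ≤ Real.sin θ := Real.sin_nonneg_of_nonneg_of_le_pi hθ.1.le (by linarith [hθ.2, Real.pi_pos])
  have hc : 0 ≤ Real.cos θ := Real.cos_nonneg_of_mem_Icc ⟨by linarith [hθ.1, Real.pi_pos], hθ.2.le⟩
  have hs' : Real.sin θ ≤ θ := Real.sin_le hθ.1.le
  have hc' : Real.cos θ ≤ Real.pi / 2 - θ := by
    rw [← Real.sin_pi_div_two_sub]; exact Real.sin_le (by linarith [hθ.2])
  have a1 := h1 ((j + 1) * θ)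
  have a2 := h1 ((j + 1) * (Real.pi / 2 - θ))
  simp only [stepUp1] at a1 a2
  set u := deriv stepUp ((j + 1) * θ)
  set v := deriv stepUp ((j + 1) * (Real.pi / 2 - θ))
  have hj : (0 : ℝ) < j + 1 := by positivity
  have b1 : |Real.sin θ * ((j + 1) * u)| ≤ B := by
    refine le_trans ?_ a1
    rw [abs_mul, show ((j : ℝ) + 1) * θ * u = θ * ((j + 1) * u) by ring, abs_mul θ, abs_of_nonneg hs,
      abs_of_pos hθ.1]
    gcongr
  have b2 : |Real.cos θ * ((j + 1) * v)| ≤ B := by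
    refine le_trans ?_ a2
    rw [abs_mul, show ((j : ℝ) + 1) * (Real.pi / 2 - θ) * v = (Real.pi / 2 - θ) * ((j + 1) * v) by ring,
      abs_mul (Real.pi / 2 - θ), abs_of_nonneg hc, abs_of_pos (by linarith [hθ.2] : 0 < Real.pi / 2 - θ)]
    gcongr
  have e : Real.sin θ * Real.cos θ * cutTheta' j θ
      = (Real.sin θ * ((j + 1) * u)) * (Real.cos θ * stepUp ((j + 1) * (Real.pi / 2 - θ)))
        - (Real.cos θ * ((j + 1) * v)) * (Real.sin θ * stepUp ((j + 1) * θ)) := by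
    simp only [cutTheta']; ring
  rw [e]
  refine (abs_sub _ _).trans (add_le_add ?_ ?_)
  · rw [abs_mul, ← mul_one B]
    refine mul_le_mul b1 ?_ (abs_nonneg _) hB
    rw [abs_mul]
    exact mul_le_one₀ (Real.abs_cos_le_one _) (abs_nonneg _) (stepUp_abs_le _)
  · rw [abs_mul, ← mul_one B]
    refine mul_le_mul b2 ?_ (abs_nonneg _) hB
    rw [abs_mul]
    exact mul_le_one₀ (Real.abs_sin_le_one _) (abs_nonneg _) (stepUp_abs_le _)

lemma eventually_cutTheta {θ : ℝ} (hθ : θ ∈ Ioo 0 (Real.pi / 2)) :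
    ∀ᶠ j : ℕ in atTop, cutTheta j θ = 1 ∧ cutTheta' j θ = 0 := by
  have t : ∀ x : ℝ, 0 < x → ∀ᶠ j : ℕ in atTop, 2 < ((j : ℝ) + 1) * x := by
    intro x hx
    have := (tendsto_natCast_atTop_atTop (R := ℝ)).eventually_gt_atTop (2 / x)
    filter_upwards [this] with j hj
    rw [div_lt_iff₀ hx] at hj
    nlinarith
  filter_upwards [t θ hθ.1, t (Real.pi / 2 - θ) (by linarith [hθ.2])] with j h1 h2
  constructor
  · simp [cutTheta, stepUp_of_ge h1.le, stepUp_of_ge h2.le]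
  · simp [cutTheta', deriv_stepUp_of_gt h1, deriv_stepUp_of_gt h2]

/-- Cutoffs exhausting `(0, ∞)`. -/
def cutR (j : ℕ) (R : ℝ) : ℝ := stepUp ((j + 1) * R) * (1 - stepUp (R / (j + 1)))

/-- `R ∂_R` of `cutR j`. -/
def cutR1 (j : ℕ) (R : ℝ) : ℝ :=
  stepUp1 ((j + 1) * R) * (1 - stepUp (R / (j + 1))) - stepUp ((j + 1) * R) * stepUp1 (R / (j + 1))

/-- `(R ∂_R)²` of `cutR j`. -/
def cutR2 (j : ℕ) (R : ℝ) : ℝ :=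
  stepUp2 ((j + 1) * R) * (1 - stepUp (R / (j + 1)))
    - 2 * (stepUp1 ((j + 1) * R) * stepUp1 (R / (j + 1)))
    - stepUp ((j + 1) * R) * stepUp2 (R / (j + 1))

lemma cutR_contDiff (j : ℕ) : ContDiff ℝ ∞ (cutR j) :=
  (stepUp_contDiff.comp (contDiff_const.mul contDiff_id)).mul
    (contDiff_const.sub (stepUp_contDiff.comp (contDiff_id.div_const _)))

lemma hasDerivAt_cutR (j : ℕ) {R : ℝ} (hR : 0 < R) :
    HasDerivAt (cutR j) (cutR1 j R / R) R ∧ HasDerivAt (cutR1 j) (cutR2 j R / R) R := by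
  have hj : (0 : ℝ) < j + 1 := by positivity
  have h1 : HasDerivAt (fun R : ℝ => ((j : ℝ) + 1) * R) ((j : ℝ) + 1) R := by
    simpa using (hasDerivAt_id R).const_mul ((j : ℝ) + 1)
  have h2 : HasDerivAt (fun R : ℝ => R / ((j : ℝ) + 1)) (1 / ((j : ℝ) + 1)) R := by
    simpa using (hasDerivAt_id R).div_const ((j : ℝ) + 1)
  have s1 := (hasDerivAt_stepUp _).comp R h1
  have s2 := (hasDerivAt_stepUp _).comp R h2
  have t1 := (hasDerivAt_stepUp1 _).comp R h1
  have t2 := (hasDerivAt_stepUp1 _).comp R h2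
  constructor
  · refine (s1.mul (s2.const_sub 1)).congr_deriv ?_
    simp only [cutR1, stepUp1, Function.comp]
    field_simp
    ring
  · refine ((t1.mul (s2.const_sub 1)).sub (s1.mul t2)).congr_deriv ?_
    simp only [cutR2, stepUp1, stepUp2, Function.comp]
    field_simp
    ring

/-- The radial cutoffs are bounded together with their scale-invariant derivatives, uniformly in `j`. -/
lemma exists_cutR_bound : ∃ B, ∀ j R, |cutR j R| ≤ B ∧ |cutR1 j R| ≤ B ∧ |cutR2 j R| ≤ B := by
  obtain ⟨B, hB, h1, h2⟩ := exists_stepUp_bound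
  have h0 := stepUp_abs_le
  have h0' : ∀ x, |1 - stepUp x| ≤ 1 := fun x => by
    rw [abs_of_nonneg (by linarith [stepUp_le_one x])]; linarith [stepUp_nonneg x]
  refine ⟨1 + 2 * B + 2 * B ^ 2, fun j R => ⟨?_, ?_, ?_⟩⟩
  · rw [cutR, abs_mul]
    have := mul_le_mul (h0 ((j + 1) * R)) (h0' (R / (j + 1))) (abs_nonneg _) zero_le_one
    nlinarith
  · refine (abs_sub _ _).trans ?_
    rw [abs_mul, abs_mul]
    have a := mul_le_mul (h1 ((j + 1) * R)) (h0' (R / (j + 1))) (abs_nonneg _) hB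
    have b := mul_le_mul (h0 ((j + 1) * R)) (h1 (R / (j + 1))) (abs_nonneg _) zero_le_one
    nlinarith
  · refine (abs_sub _ _).trans ((add_le_add_left (abs_sub _ _) _).trans ?_)
    rw [abs_mul, abs_mul, abs_mul, abs_mul]
    have a := mul_le_mul (h2 ((j + 1) * R)) (h0' (R / (j + 1))) (abs_nonneg _) hB
    have b := mul_le_mul (h0 ((j + 1) * R)) (h2 (R / (j + 1))) (abs_nonneg _) zero_le_one
    have c := mul_le_mul (h1 ((j + 1) * R)) (h1 (R / (j + 1))) (abs_nonneg _) hB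
    rw [abs_of_pos (two_pos : (0 : ℝ) < 2)]
    nlinarith

lemma cutR_support (j : ℕ) :
    Function.support (cutR j) ⊆ Icc (1 / ((j : ℝ) + 1)) (2 * ((j : ℝ) + 1)) := by
  intro R hR
  have hj : (0 : ℝ) < j + 1 := by positivity
  rw [mem_Icc]
  by_contra hn
  apply hR
  rw [not_and_or, not_le, not_le] at hn
  rcases hn with hn | hn
  · rw [lt_div_iff₀ hj] at hn
    simp [cutR, stepUp_of_le (show ((j : ℝ) + 1) * R ≤ 1 by linarith)]
  · have : 2 ≤ R / ((j : ℝ) + 1) := by rw [le_div_iff₀ hj]; linarith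
    simp [cutR, stepUp_of_ge this]

lemma eventually_cutR {R : ℝ} (hR : 0 < R) :
    ∀ᶠ j : ℕ in atTop, cutR j R = 1 ∧ cutR1 j R = 0 ∧ cutR2 j R = 0 := by
  have a := (tendsto_natCast_atTop_atTop (R := ℝ)).eventually_gt_atTop (2 / R)
  have b := (tendsto_natCast_atTop_atTop (R := ℝ)).eventually_gt_atTop R
  filter_upwards [a, b] with j h1 h2
  have hj : (0 : ℝ) < j + 1 := by positivity
  have h3 : 2 < ((j : ℝ) + 1) * R := by rw [div_lt_iff₀ hR] at h1; nlinarith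
  have h4 : R / ((j : ℝ) + 1) < 1 := by rw [div_lt_one hj]; linarith
  simp [cutR, cutR1, cutR2, stepUp_of_ge h3.le, stepUp_of_le h4.le, stepUp1_eq_zero (Or.inl h4),
    stepUp1_eq_zero (Or.inr h3), stepUp2_eq_zero (Or.inl h4), stepUp2_eq_zero (Or.inr h3)]

/-! ### The radial ordinary differential equation -/

/-- Smooth functions on the line with compact support in `(0, ∞)`. -/
def IsTestR (ψ : ℝ → ℝ) : Prop := ContDiff ℝ ∞ ψ ∧ HasCompactSupport ψ ∧ tsupport ψ ⊆ Ioi 0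

lemma IsTestR.mul_contDiffOn {a ψ : ℝ → ℝ} (ha : ContDiffOn ℝ ∞ a (Ioi 0)) (hψ : IsTestR ψ) :
    IsTestR (fun R => a R * ψ R) := by
  refine ⟨?_, hψ.2.1.mul_left, (closure_mono (Function.support_mul_subset_right _ _)).trans hψ.2.2⟩
  rw [contDiff_iff_contDiffAt]
  intro p
  by_cases hp : p ∈ tsupport ψ
  · exact (ha.contDiffAt (isOpen_Ioi.mem_nhds (hψ.2.2 hp))).mul hψ.1.contDiffAt
  · have : (fun p => a p * ψ p) =ᶠ[𝓝 p] fun _ => 0 := by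
      filter_upwards [notMem_tsupport_iff_eventuallyEq.1 hp] with q hq
      simp [hq]
    exact contDiffAt_const.congr_of_eventuallyEq this

lemma IsTestR.deriv {ψ : ℝ → ℝ} (hψ : IsTestR ψ) : IsTestR (deriv ψ) :=
  ⟨contDiff_deriv_of_contDiff hψ.1, hψ.2.1.deriv,
    (closure_minimal support_deriv_subset (isClosed_tsupport ψ)).trans hψ.2.2⟩

lemma IsTestR.hasDerivAt {ψ : ℝ → ℝ} (hψ : IsTestR ψ) (R : ℝ) : HasDerivAt ψ (_root_.deriv ψ R) R :=
  (hψ.1.differentiable (by norm_num) R).hasDerivAt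

lemma IsTestR.exists_bounds {ψ : ℝ → ℝ} (hψ : IsTestR ψ) :
    ∃ r₀ r₁ : ℝ, 0 < r₀ ∧ r₀ < r₁ ∧ ∀ R, (R ≤ r₀ ∨ r₁ ≤ R) → ψ R = 0 := by
  rcases (tsupport ψ).eq_empty_or_nonempty with h | h
  · refine ⟨1, 2, by norm_num, by norm_num, fun R _ => image_eq_zero_of_notMem_tsupport (by simp [h])⟩
  · obtain ⟨m, hm, hm'⟩ := hψ.2.1.exists_isLeast h
    obtain ⟨n, hn, hn'⟩ := hψ.2.1.exists_isGreatest h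
    have hm0 : 0 < m := hψ.2.2 hm
    have hmn : m ≤ n := hm' hn
    refine ⟨m / 2, n + 1, by linarith, by linarith, fun R hR => ?_⟩
    apply image_eq_zero_of_notMem_tsupport
    intro hRt
    have h1 := hm' hRt
    have h2 := hn' hRt
    rcases hR with hR | hR <;> linarith

lemma contDiff_primitive {h : ℝ → ℝ} (hh : ContDiff ℝ ∞ h) (x : ℝ) :
    ContDiff ℝ ∞ (fun R => ∫ r in x..R, h r) := by
  rw [contDiff_infty_iff_deriv]
  have e : deriv (fun R => ∫ r in x..R, h r) = h := by
    ext R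
    exact Continuous.deriv_integral h hh.continuous x R
  rw [e]
  exact ⟨fun R => (hh.continuous.integral_hasStrictDerivAt x R).hasDerivAt.differentiableAt, hh⟩

lemma contDiffOn_rpow (a : ℝ) : ContDiffOn ℝ ∞ (fun R : ℝ => R ^ a) (Ioi 0) :=
  fun _ hR => (Real.contDiffAt_rpow_const_of_ne (ne_of_gt hR)).contDiffWithinAt

/-- A continuous function on `(0, ∞)` equal to a multiple of `R ^ a` near `0` and of `R ^ (-b)` near
`∞` is dominated by both powers. -/
lemma exists_power_bound {a b : ℝ} (hab : 0 ≤ a + b) {f : ℝ → ℝ} (hf : ContinuousOn f (Ioi 0))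
    {r₀ r₁ k₀ k₁ : ℝ} (h0 : 0 < r₀) (h01 : r₀ < r₁) (hk0 : ∀ R, 0 < R → R ≤ r₀ → f R = k₀ * R ^ a)
    (hk1 : ∀ R, r₁ ≤ R → f R = k₁ * R ^ (-b)) :
    ∃ K, 0 ≤ K ∧ ∀ R, 0 < R → |f R| ≤ K * R ^ a ∧ |f R| ≤ K * R ^ (-b) := by
  have hsub : Icc r₀ r₁ ⊆ Ioi 0 := fun R hR => lt_of_lt_of_le h0 hR.1
  have key : ∀ e : ℝ, ∃ K, ∀ R ∈ Icc r₀ r₁, |f R| ≤ K * R ^ e := by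
    intro e
    have hc : ContinuousOn (fun R => f R * R ^ (-e)) (Icc r₀ r₁) :=
      (hf.mono hsub).mul ((contDiffOn_rpow (-e)).continuousOn.mono hsub)
    obtain ⟨K, hK⟩ := isCompact_Icc.exists_bound_of_continuousOn hc
    refine ⟨K, fun R hR => ?_⟩
    have hR0 : 0 < R := hsub hR
    have := hK R hR
    rw [Real.norm_eq_abs, abs_mul, abs_of_pos (Real.rpow_pos_of_pos hR0 _), Real.rpow_neg hR0.le,
      ← div_eq_mul_inv, div_le_iff₀ (Real.rpow_pos_of_pos hR0 _)] at this
    exact this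
  obtain ⟨K1, h1⟩ := key a
  obtain ⟨K2, h2⟩ := key (-b)
  have hr1 : 0 < r₁ := h0.trans h01
  refine ⟨max (max K1 K2) (max (max |k₀| |k₁|) (max (|k₁| * r₁ ^ (-(a + b))) (|k₀| * r₀ ^ (a + b)))), ?_, ?_⟩
  · exact le_max_of_le_right (le_max_of_le_left (le_max_of_le_left (abs_nonneg _)))
  · intro R hR
    have pa := Real.rpow_pos_of_pos hR a
    have pb := Real.rpow_pos_of_pos hR (-b)
    rcases le_or_gt R r₀ with hR0 | hR0
    · rw [hk0 R hR hR0, abs_mul, abs_of_pos pa]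
      refine ⟨?_, ?_⟩
      · gcongr
        exact le_max_of_le_right (le_max_of_le_left (le_max_left _ _))
      · have : |k₀| * R ^ a ≤ |k₀| * r₀ ^ (a + b) * R ^ (-b) := by
          have e : R ^ a = R ^ (a + b) * R ^ (-b) := by
            rw [← Real.rpow_add hR]; ring_nf
          rw [e, ← mul_assoc]
          gcongr
        refine this.trans ?_
        gcongr
        exact le_max_of_le_right (le_max_of_le_right (le_max_right _ _))
    · rcases le_or_gt r₁ R with hR1 | hR1
      · rw [hk1 R hR1, abs_mul, abs_of_pos pb]
        refine ⟨?_, ?_⟩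
        · have : |k₁| * R ^ (-b) ≤ |k₁| * r₁ ^ (-(a + b)) * R ^ a := by
            have e : R ^ (-b) = R ^ (-(a + b)) * R ^ a := by
              rw [← Real.rpow_add hR]; ring_nf
            rw [e, ← mul_assoc]
            gcongr ?_ * _
            gcongr ?_ * ?_
            exact Real.rpow_le_rpow_of_nonpos hr1 hR1 (by linarith)
          refine this.trans ?_
          gcongr
          exact le_max_of_le_right (le_max_of_le_right (le_max_left _ _))
        · gcongr
          exact le_max_of_le_right (le_max_of_le_left (le_max_right _ _))
      · refine ⟨(h1 R ⟨hR0.le, hR1.le⟩).trans ?_, (h2 R ⟨hR0.le, hR1.le⟩).trans ?_⟩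
        · gcongr
          exact le_max_of_le_left (le_max_left _ _)
        · gcongr
          exact le_max_of_le_left (le_max_right _ _)

/-- Solution of `(D - a)(D + b) c = -(a + b) g` for `D = R ∂_R`, by variation of constants; it
decays like `R ^ a` at `0` and like `R ^ (-b)` at infinity. -/
lemma exists_radial_solution {a b : ℝ} (hab : 0 < a + b) {g : ℝ → ℝ} (hg : IsTestR g) :
    ∃ c c₁ c₂ : ℝ → ℝ, ContDiffOn ℝ ∞ c (Ioi 0) ∧ ContDiffOn ℝ ∞ c₁ (Ioi 0) ∧
      ContDiffOn ℝ ∞ c₂ (Ioi 0) ∧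
      (∀ R, 0 < R → HasDerivAt c (c₁ R / R) R) ∧ (∀ R, 0 < R → HasDerivAt c₁ (c₂ R / R) R) ∧
      (∀ R, 0 < R → c₂ R + (b - a) * c₁ R - a * b * c R = -(a + b) * g R) ∧
      ∃ K, 0 ≤ K ∧ ∀ R, 0 < R → (|c R| ≤ K * R ^ a ∧ |c R| ≤ K * R ^ (-b)) ∧
        (|c₁ R| ≤ K * R ^ a ∧ |c₁ R| ≤ K * R ^ (-b)) ∧
        (|c₂ R| ≤ K * R ^ a ∧ |c₂ R| ≤ K * R ^ (-b)) := by
  obtain ⟨r₀, r₁, h0, h01, hz⟩ := hg.exists_bounds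
  have t1 := hg.mul_contDiffOn (contDiffOn_rpow (b - 1))
  have t2 := hg.mul_contDiffOn (contDiffOn_rpow (-a - 1))
  set h1 : ℝ → ℝ := fun R => R ^ (b - 1) * g R
  set h2 : ℝ → ℝ := fun R => R ^ (-a - 1) * g R
  set I1 : ℝ → ℝ := fun R => ∫ r in r₀..R, h1 r
  set I2 : ℝ → ℝ := fun R => -∫ r in r₁..R, h2 r
  have d1 : ContDiff ℝ ∞ I1 := contDiff_primitive t1.1 _
  have d2 : ContDiff ℝ ∞ I2 := (contDiff_primitive t2.1 _).neg
  have e1 : ∀ R, HasDerivAt I1 (h1 R) R := fun R =>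
    (t1.1.continuous.integral_hasStrictDerivAt r₀ R).hasDerivAt
  have e2 : ∀ R, HasDerivAt I2 (-h2 R) R := fun R =>
    (t2.1.continuous.integral_hasStrictDerivAt r₁ R).hasDerivAt.neg
  have z1 : ∀ R, R ≤ r₀ → I1 R = 0 := by
    intro R hR
    have : ∫ r in r₀..R, h1 r = ∫ r in r₀..R, (0 : ℝ) :=
      intervalIntegral.integral_congr fun r hr => by
        rw [uIcc_of_ge hR] at hr
        simp [h1, hz r (Or.inl hr.2)]
    simp only [I1, this]; simp
  have z2 : ∀ R, r₁ ≤ R → I2 R = 0 := by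
    intro R hR
    have : ∫ r in r₁..R, h2 r = ∫ r in r₁..R, (0 : ℝ) :=
      intervalIntegral.integral_congr fun r hr => by
        rw [uIcc_of_le hR] at hr
        simp [h2, hz r (Or.inr hr.1)]
    simp only [I2, this]; simp
  have y1 : ∀ R, r₁ ≤ R → I1 R = I1 r₁ := by
    intro R hR
    have : ∫ r in r₁..R, h1 r = ∫ r in r₁..R, (0 : ℝ) :=
      intervalIntegral.integral_congr fun r hr => by
        rw [uIcc_of_le hR] at hr
        simp [h1, hz r (Or.inr hr.1)]
    have a := intervalIntegral.integral_add_adjacent_intervals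
      (t1.1.continuous.intervalIntegrable r₀ r₁ (μ := volume)) (t1.1.continuous.intervalIntegrable r₁ R)
    simp only [I1, ← a, this]; simp
  have y2 : ∀ R, R ≤ r₀ → I2 R = I2 r₀ := by
    intro R hR
    have : ∫ r in r₀..R, h2 r = ∫ r in r₀..R, (0 : ℝ) :=
      intervalIntegral.integral_congr fun r hr => by
        rw [uIcc_of_ge hR] at hr
        simp [h2, hz r (Or.inl hr.2)]
    have a := intervalIntegral.integral_add_adjacent_intervals
      (t2.1.continuous.intervalIntegrable r₁ r₀ (μ := volume)) (t2.1.continuous.intervalIntegrable r₀ R)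
    simp only [I2, ← a, this]; simp
  have pb : ∀ (e R : ℝ), 0 < R → HasDerivAt (fun R : ℝ => R ^ e) (e * R ^ e / R) R := by
    intro e R hR
    refine (Real.hasDerivAt_rpow_const (p := e) (Or.inl hR.ne')).congr_deriv ?_
    rw [Real.rpow_sub hR, Real.rpow_one]; ring
  have c1 : ∀ R, 0 < R → R ^ (-b) * (h1 R) = g R / R := by
    intro R hR
    simp only [h1]
    rw [← mul_assoc, ← Real.rpow_add hR, show -b + (b - 1) = -1 by ring, Real.rpow_neg_one]
    field_simp
  have c2 : ∀ R, 0 < R → R ^ a * (h2 R) = g R / R := by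
    intro R hR
    simp only [h2]
    rw [← mul_assoc, ← Real.rpow_add hR, show a + (-a - 1) = -1 by ring, Real.rpow_neg_one]
    field_simp
  have sm : ∀ (x y z : ℝ), ContDiffOn ℝ ∞ (fun R => x * (R ^ (-b) * I1 R) + y * (R ^ a * I2 R)
      + z * g R) (Ioi 0) := fun x y z =>
    ((contDiffOn_const.mul ((contDiffOn_rpow (-b)).mul d1.contDiffOn)).add
      (contDiffOn_const.mul ((contDiffOn_rpow a).mul d2.contDiffOn))).add
      (contDiffOn_const.mul hg.1.contDiffOn)
  have dc : ∀ (x y R : ℝ), 0 < R → HasDerivAt (fun R => x * (R ^ (-b) * I1 R) + y * (R ^ a * I2 R)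
      + 0 * g R) ((-(b * x) * (R ^ (-b) * I1 R) + (a * y) * (R ^ a * I2 R) + (x - y) * g R) / R) R := by
    intro x y R hR
    have := ((((pb (-b) R hR).mul (e1 R)).const_mul x).add
      (((pb a R hR).mul (e2 R)).const_mul y)).add ((hg.hasDerivAt R).const_mul 0)
    refine this.congr_deriv ?_
    have q1 := c1 R hR
    have q2 := c2 R hR
    have q3 : R ^ a * -h2 R = -(g R / R) := by rw [mul_neg, q2]
    rw [q1, q3]
    field_simp
    ring
  have bd : ∀ (x y z : ℝ), ∃ K, 0 ≤ K ∧ ∀ R, 0 < R →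
      |x * (R ^ (-b) * I1 R) + y * (R ^ a * I2 R) + z * g R| ≤ K * R ^ a ∧
      |x * (R ^ (-b) * I1 R) + y * (R ^ a * I2 R) + z * g R| ≤ K * R ^ (-b) := by
    intro x y z
    refine exists_power_bound hab.le (sm x y z).continuousOn h0 h01 (k₀ := y * I2 r₀)
      (k₁ := x * I1 r₁) (fun _ _ hR => ?_) (fun R hR => ?_)
    · rw [z1 _ hR, y2 _ hR, hz _ (Or.inl hR)]; ring
    · rw [z2 R hR, y1 R hR, hz R (Or.inr hR)]; ring
  obtain ⟨K0, k0, b0⟩ := bd 1 1 0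
  obtain ⟨K1, k1, b1⟩ := bd (-b) a 0
  obtain ⟨K2, k2, b2⟩ := bd (b * b) (a * a) (-(a + b))
  refine ⟨_, _, _, sm 1 1 0, sm (-b) a 0, sm (b * b) (a * a) (-(a + b)), fun R hR => ?_, fun R hR => ?_,
    fun R hR => ?_, K0 + K1 + K2, by positivity, fun R hR => ?_⟩
  · exact (dc 1 1 R hR).congr_deriv (by ring)
  · exact (dc (-b) a R hR).congr_deriv (by ring)
  · ring
  · have pa := Real.rpow_pos_of_pos hR a
    have pb := Real.rpow_pos_of_pos hR (-b)
    have w : ∀ {K : ℝ}, K ≤ K0 + K1 + K2 → ∀ {x p : ℝ}, 0 < p → x ≤ K * p → x ≤ (K0 + K1 + K2) * p :=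
      fun hK x p hp hx => hx.trans (by gcongr)
    exact ⟨⟨w (by linarith) pa (b0 R hR).1, w (by linarith) pb (b0 R hR).2⟩,
      ⟨w (by linarith) pa (b1 R hR).1, w (by linarith) pb (b1 R hR).2⟩,
      ⟨w (by linarith) pa (b2 R hR).1, w (by linarith) pb (b2 R hR).2⟩⟩

/-! ### The angular operator on polynomials in `sin² θ` -/

open Polynomial in
/-- The angular operator in the variable `z = sin² θ`: if `U = sin(2θ) p(sin² θ)`, then
`-U'' + (tan θ U)' - 6 U = sin(2θ) (angOp p)(sin² θ)`. -/
def angOp (p : ℝ[X]) : ℝ[X] :=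
  -(4 * X * (1 - X)) * derivative (derivative p) - (6 - 14 * X) * derivative p

/-- The eigenvalues of the angular operator. -/
def lam (n : ℕ) : ℝ := 4 * (n : ℝ) ^ 2 + 10 * n

lemma lam_strictMono : StrictMono lam := by
  intro m n h
  have : (m : ℝ) < n := by exact_mod_cast h
  unfold lam
  nlinarith [(Nat.cast_nonneg m : (0 : ℝ) ≤ m)]

section Eigen

open Polynomial

lemma angOp_add (p q : ℝ[X]) : angOp (p + q) = angOp p + angOp q := by
  simp only [angOp, derivative_add]; ring

lemma angOp_C_mul (c : ℝ) (p : ℝ[X]) : angOp (C c * p) = C c * angOp p := by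
  simp only [angOp, derivative_C_mul]; ring

lemma angOp_sum {ι : Type*} (s : Finset ι) (f : ι → ℝ[X]) :
    angOp (∑ i ∈ s, f i) = ∑ i ∈ s, angOp (f i) := by
  simp only [angOp, derivative_sum, Finset.mul_sum, Finset.sum_sub_distrib]

lemma angOp_X_pow (n : ℕ) :
    angOp (X ^ n) = C (lam n) * X ^ n - C (4 * (n : ℝ) ^ 2 + 2 * n) * X ^ (n - 1) := by
  rcases n with _ | _ | n
  · simp [angOp, lam]
  · simp [angOp, lam]
    rw [show (C 10 : ℝ[X]) = 10 from rfl, show (C 4 : ℝ[X]) = 4 from rfl, show (C 2 : ℝ[X]) = 2 from rfl]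
    ring
  · simp only [angOp, derivative_X_pow, lam]
    simp only [Nat.add_sub_cancel, derivative_mul, derivative_C, derivative_X_pow, zero_mul, zero_add]
    push_cast
    simp only [map_add, map_mul, map_one, map_natCast, map_pow, map_ofNat]
    ring

/-- The operator is triangular in the monomials, with distinct diagonal entries `lam n`. -/
lemma exists_eigenpoly (n : ℕ) :
    ∃ p : ℝ[X], (p - X ^ n).degree < (n : WithBot ℕ) ∧ angOp p = C (lam n) * p := by
  have key : ∀ m, m ≤ n → ∃ (p : ℝ[X]) (c : ℝ), (p - X ^ n).degree < (n : WithBot ℕ) ∧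
      angOp p - C (lam n) * p = C (c * (4 * (m : ℝ) ^ 2 + 2 * m)) * X ^ (m - 1) := by
    intro m hm
    refine Nat.decreasingInduction (motive := fun m _ => ∃ (p : ℝ[X]) (c : ℝ), (p - X ^ n).degree < (n : WithBot ℕ) ∧
      angOp p - C (lam n) * p = C (c * (4 * (m : ℝ) ^ 2 + 2 * m)) * X ^ (m - 1)) ?_ ?_ hm
    · rintro k hk ⟨p, c, hp, hc⟩
      have hl : lam k - lam n ≠ 0 := sub_ne_zero.2 (lam_strictMono hk).ne
      set d := c * (4 * ((k + 1 : ℕ) : ℝ) ^ 2 + 2 * ((k + 1 : ℕ) : ℝ)) / (lam k - lam n) with hd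
      have hd' : c * (4 * ((k + 1 : ℕ) : ℝ) ^ 2 + 2 * ((k + 1 : ℕ) : ℝ)) = d * (lam k - lam n) := by
        rw [hd]; field_simp
      refine ⟨p + C (-d) * X ^ k, d, ?_, ?_⟩
      · have : p + C (-d) * X ^ k - X ^ n = (p - X ^ n) + C (-d) * X ^ k := by ring
        rw [this]
        refine (degree_add_le _ _).trans_lt (max_lt hp ?_)
        exact (degree_C_mul_X_pow_le k _).trans_lt (by exact_mod_cast hk)
      · rw [angOp_add, angOp_C_mul, angOp_X_pow]
        rw [hd', Nat.add_sub_cancel] at hc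
        have : angOp p = C (lam n) * p + C (d * (lam k - lam n)) * X ^ k := by rw [← hc]; ring
        rw [this]
        simp only [map_add, map_mul, map_sub, map_neg]
        ring
    · refine ⟨X ^ n, -1, by simp, ?_⟩
      rw [angOp_X_pow]
      simp only [neg_mul, one_mul, map_neg]
      ring
  obtain ⟨p, c, hp, hc⟩ := key 0 (Nat.zero_le n)
  refine ⟨p, hp, ?_⟩
  simpa [sub_eq_zero] using hc

/-- Eigenpolynomials of the angular operator (Jacobi polynomials, up to normalisation). -/
def eigenpoly (n : ℕ) : ℝ[X] := (exists_eigenpoly n).choose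

lemma eigenpoly_degree (n : ℕ) : (eigenpoly n - X ^ n).degree < (n : WithBot ℕ) :=
  (exists_eigenpoly n).choose_spec.1

lemma angOp_eigenpoly (n : ℕ) : angOp (eigenpoly n) = C (lam n) * eigenpoly n :=
  (exists_eigenpoly n).choose_spec.2

lemma eigenpoly_zero : eigenpoly 0 = 1 := by
  have := eigenpoly_degree 0
  simp only [Nat.cast_zero, pow_zero] at this
  have h : eigenpoly 0 - 1 = 0 := by
    rw [← degree_eq_bot]
    exact Nat.WithBot.lt_zero_iff.1 this
  exact sub_eq_zero.1 h

/-- The eigenpolynomials span all polynomials. -/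
lemma linearMap_eq_zero_of_eigenpoly {ℓ : ℝ[X] →ₗ[ℝ] ℝ} (h : ∀ n, ℓ (eigenpoly n) = 0) (p : ℝ[X]) :
    ℓ p = 0 := by
  have mono : ∀ n, ℓ (X ^ n) = 0 := by
    intro n
    induction n using Nat.strong_induction_on with
    | _ n ih =>
      have e : X ^ n = eigenpoly n - (eigenpoly n - X ^ n) := by ring
      rw [e, map_sub, h, zero_sub, neg_eq_zero]
      have hd := eigenpoly_degree n
      set r := eigenpoly n - X ^ n
      by_cases hr : r = 0
      · rw [hr, map_zero]
      rw [r.as_sum_range' n ((natDegree_lt_iff_degree_lt hr).2 hd), map_sum]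
      refine Finset.sum_eq_zero fun i hi => ?_
      rw [← C_mul_X_pow_eq_monomial, ← smul_eq_C_mul, map_smul, ih i (Finset.mem_range.1 hi), smul_zero]
  rw [p.as_sum_range, map_sum]
  refine Finset.sum_eq_zero fun i _ => ?_
  rw [← C_mul_X_pow_eq_monomial, ← smul_eq_C_mul, map_smul, mono, smul_zero]

end Eigen

/-! ### Weighted angular integrals -/

lemma sin_two_mul_pos {θ : ℝ} (h : θ ∈ Ioo 0 (Real.pi / 2)) : 0 < Real.sin (2 * θ) :=
  Real.sin_pos_of_pos_of_lt_pi (by linarith [h.1]) (by linarith [h.2])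

lemma sin_two_mul_nonneg {θ : ℝ} (h : θ ∈ Icc 0 (Real.pi / 2)) : 0 ≤ Real.sin (2 * θ) :=
  Real.sin_nonneg_of_nonneg_of_le_pi (by linarith [h.1]) (by linarith [h.2])

lemma sin_pos_of_mem {θ : ℝ} (h : θ ∈ Ioo 0 (Real.pi / 2)) : 0 < Real.sin θ :=
  Real.sin_pos_of_pos_of_lt_pi h.1 (by linarith [h.2, Real.pi_pos])

lemma cos_pos_of_mem {θ : ℝ} (h : θ ∈ Ioo 0 (Real.pi / 2)) : 0 < Real.cos θ :=
  Real.cos_pos_of_mem_Ioo ⟨by linarith [h.1, Real.pi_pos], h.2⟩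

lemma cos_nonneg_of_mem {θ : ℝ} (h : θ ∈ Icc 0 (Real.pi / 2)) : 0 ≤ Real.cos θ :=
  Real.cos_nonneg_of_mem_Icc ⟨by linarith [h.1, Real.pi_pos], h.2⟩

lemma eta_pos : 0 < eta := by norm_num [eta]
lemma eta_lt_one : eta < 1 := by norm_num [eta]

/-- The angular weight `sin(2θ)^{-η}`. -/
def angW (θ : ℝ) : ℝ := Real.sin (2 * θ) ^ (-eta)

lemma angW_nonneg {θ : ℝ} (h : θ ∈ Icc 0 (Real.pi / 2)) : 0 ≤ angW θ :=
  Real.rpow_nonneg (sin_two_mul_nonneg h) _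

lemma hasDerivAt_sin_two_mul (θ : ℝ) :
    HasDerivAt (fun θ => Real.sin (2 * θ)) (2 * Real.cos (2 * θ)) θ := by
  have h2 : HasDerivAt (fun θ : ℝ => 2 * θ) 2 θ := by simpa using (hasDerivAt_id θ).const_mul (2 : ℝ)
  exact ((Real.hasDerivAt_sin _).comp θ h2).congr_deriv (by ring)

lemma hasDerivAt_cos_two_mul (θ : ℝ) :
    HasDerivAt (fun θ => Real.cos (2 * θ)) (-2 * Real.sin (2 * θ)) θ := by
  have h2 : HasDerivAt (fun θ : ℝ => 2 * θ) 2 θ := by simpa using (hasDerivAt_id θ).const_mul (2 : ℝ)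
  exact ((Real.hasDerivAt_cos _).comp θ h2).congr_deriv (by ring)

lemma continuous_sin_rpow {a : ℝ} (ha : 0 ≤ a) : Continuous fun θ : ℝ => Real.sin (2 * θ) ^ a :=
  (Real.continuous_sin.comp (continuous_const.mul continuous_id)).rpow_const fun _ => Or.inr ha

lemma hasDerivAt_sin_rpow {θ : ℝ} (h : θ ∈ Ioo 0 (Real.pi / 2)) :
    HasDerivAt (fun θ => Real.sin (2 * θ) ^ (1 - eta))
      (2 * (1 - eta) * Real.cos (2 * θ) * angW θ) θ := by
  refine ((hasDerivAt_sin_two_mul θ).rpow_const (Or.inl (sin_two_mul_pos h).ne')).congr_deriv ?_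
  rw [show 1 - eta - 1 = -eta by ring, angW]; ring

lemma sin_mul_angW {θ : ℝ} (h : θ ∈ Ioo 0 (Real.pi / 2)) :
    Real.sin (2 * θ) * angW θ = Real.sin (2 * θ) ^ (1 - eta) := by
  have := sin_two_mul_pos h
  rw [angW, sub_eq_add_neg, Real.rpow_add this, Real.rpow_one]

/-- The weight is integrable because, up to a bounded term, it is the derivative of a continuous
function. -/
lemma angW_intervalIntegrable : IntervalIntegrable angW volume 0 (Real.pi / 2) := by
  have hpi : (0 : ℝ) ≤ Real.pi / 2 := by positivity
  have hd' : ∀ θ ∈ Ioo 0 (Real.pi / 2),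
      HasDerivAt (fun θ => 4 * θ + Real.cos (2 * θ) * Real.sin (2 * θ) ^ (1 - eta))
        (4 + ((-2 * Real.sin (2 * θ)) * Real.sin (2 * θ) ^ (1 - eta)
          + Real.cos (2 * θ) * (2 * (1 - eta) * Real.cos (2 * θ) * angW θ))) θ := by
    intro θ hθ
    have h4 : HasDerivAt (fun θ : ℝ => 4 * θ) 4 θ := by simpa using (hasDerivAt_id θ).const_mul (4 : ℝ)
    exact h4.add ((hasDerivAt_cos_two_mul θ).mul (hasDerivAt_sin_rpow hθ))
  have hle : ∀ θ : ℝ, θ ∈ Ioo 0 (Real.pi / 2) →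
      Real.sin (2 * θ) * Real.sin (2 * θ) ^ (1 - eta) ≤ 1 := by
    intro θ hθ
    have h0 := (sin_two_mul_pos hθ).le
    exact mul_le_one₀ (Real.sin_le_one _) (Real.rpow_nonneg h0 _)
      (Real.rpow_le_one h0 (Real.sin_le_one _) (by linarith [eta_lt_one]))
  have hi := intervalIntegral.integrableOn_deriv_of_nonneg (a := 0) (b := Real.pi / 2)
    (g := fun θ => 4 * θ + Real.cos (2 * θ) * Real.sin (2 * θ) ^ (1 - eta))
    (Continuous.continuousOn (by
      have := continuous_sin_rpow (a := 1 - eta) (by linarith [eta_lt_one])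
      fun_prop)) hd' (by
      intro θ hθ
      have h1 := hle θ hθ
      have h2 := angW_nonneg ⟨hθ.1.le, hθ.2.le⟩
      have h3 : 0 ≤ Real.cos (2 * θ) * (2 * (1 - eta) * Real.cos (2 * θ) * angW θ) := by
        have : 0 ≤ 1 - eta := by linarith [eta_lt_one]
        have : Real.cos (2 * θ) * (2 * (1 - eta) * Real.cos (2 * θ) * angW θ)
          = 2 * (1 - eta) * Real.cos (2 * θ) ^ 2 * angW θ := by ring
        rw [this]; positivity
      nlinarith)
  rw [intervalIntegrable_iff_integrableOn_Ioc_of_le hpi]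
  have hc : IntegrableOn (fun θ => -4 + (4 - 2 * eta) * (Real.sin (2 * θ) * Real.sin (2 * θ) ^ (1 - eta)))
      (Ioc 0 (Real.pi / 2)) := by
    have : Continuous (fun θ => -4 + (4 - 2 * eta) * (Real.sin (2 * θ) * Real.sin (2 * θ) ^ (1 - eta))) := by
      have := continuous_sin_rpow (a := 1 - eta) (by linarith [eta_lt_one])
      fun_prop
    exact (this.integrableOn_Icc).mono_set Ioc_subset_Icc_self
  have hs := (hi.add hc).const_mul (1 / (2 * (1 - eta)))
  replace hs : IntegrableOn _ (Ioc 0 (Real.pi / 2)) := hs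
  rw [integrableOn_Ioc_iff_integrableOn_Ioo] at hs ⊢
  refine hs.congr_fun (fun θ hθ => ?_) measurableSet_Ioo
  have h1 := sin_mul_angW hθ
  have h2 := Real.sin_sq_add_cos_sq (2 * θ)
  have h3 : 1 - eta ≠ 0 := by linarith [eta_lt_one]
  simp only [Pi.add_apply]
  rw [← h1]
  field_simp
  have : Real.cos (2 * θ) ^ 2 = 1 - Real.sin (2 * θ) ^ 2 := by linarith
  rw [this]
  ring

lemma angW_mul_intervalIntegrable {f : ℝ → ℝ} (hf : Continuous f) :
    IntervalIntegrable (fun θ => f θ * angW θ) volume 0 (Real.pi / 2) :=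
  angW_intervalIntegrable.continuousOn_mul hf.continuousOn

/-- Integration by parts against the weight `sin(2θ)^{1-η}`. -/
lemma integral_angW_by_parts {f f' : ℝ → ℝ} (hf : Continuous f) (hf' : Continuous f')
    (hd : ∀ θ, HasDerivAt f (f' θ) θ) :
    ∫ θ in (0 : ℝ)..(Real.pi / 2),
      (f' θ * Real.sin (2 * θ) + 2 * (1 - eta) * Real.cos (2 * θ) * f θ) * angW θ = 0 := by
  have hpi : (0 : ℝ) ≤ Real.pi / 2 := by positivity
  have h1e : 0 < 1 - eta := by linarith [eta_lt_one]
  have := intervalIntegral.integral_eq_sub_of_hasDerivAt_of_le hpi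
    (f := fun θ => f θ * Real.sin (2 * θ) ^ (1 - eta))
    (f' := fun θ => (f' θ * Real.sin (2 * θ) + 2 * (1 - eta) * Real.cos (2 * θ) * f θ) * angW θ)
    (hf.mul (continuous_sin_rpow h1e.le)).continuousOn (fun θ hθ => by
      refine ((hd θ).mul (hasDerivAt_sin_rpow hθ)).congr_deriv ?_
      rw [← sin_mul_angW hθ]; ring) (angW_mul_intervalIntegrable (by fun_prop))
  rw [this]
  simp [show 2 * (Real.pi / 2) = Real.pi by ring, Real.zero_rpow h1e.ne']

/-- The polynomial `p` as a function of `θ`, through `z = sin² θ`. -/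
def ang (p : Polynomial ℝ) (θ : ℝ) : ℝ := p.eval (Real.sin θ ^ 2)

lemma ang_continuous (p : Polynomial ℝ) : Continuous (ang p) :=
  p.continuous.comp (Real.continuous_sin.pow 2)

lemma ang_contDiff (p : Polynomial ℝ) : ContDiff ℝ ∞ (ang p) :=
  (show ContDiff ℝ ∞ (fun x => p.eval x) by
    simpa [Polynomial.coe_aeval_eq_eval] using p.contDiff_aeval (𝕜 := ℝ) ∞).comp (Real.contDiff_sin.pow 2)

lemma hasDerivAt_ang (p : Polynomial ℝ) (θ : ℝ) :
    HasDerivAt (ang p) (Real.sin (2 * θ) * ang p.derivative θ) θ := by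
  have h : HasDerivAt (fun θ => Real.sin θ ^ 2) (Real.sin (2 * θ)) θ := by
    refine ((Real.hasDerivAt_sin θ).pow 2).congr_deriv ?_
    rw [Real.sin_two_mul]; ring
  exact ((p.hasDerivAt _).comp θ h).congr_deriv (by simp [ang]; ring)

lemma sin_two_mul_sq (θ : ℝ) :
    Real.sin (2 * θ) ^ 2 = 4 * Real.sin θ ^ 2 * (1 - Real.sin θ ^ 2) := by
  rw [Real.sin_two_mul, mul_pow, mul_pow, Real.cos_sq']; ring

lemma cos_two_mul_eq (θ : ℝ) : Real.cos (2 * θ) = 1 - 2 * Real.sin θ ^ 2 := by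
  rw [Real.cos_two_mul, Real.cos_sq']; ring

lemma ang_angOp (p : Polynomial ℝ) (θ : ℝ) :
    ang (angOp p) θ = -Real.sin (2 * θ) ^ 2 * ang p.derivative.derivative θ
      - (6 - 14 * Real.sin θ ^ 2) * ang p.derivative θ := by
  rw [sin_two_mul_sq]
  simp [ang, angOp]

/-- The integral over `(0, π/2)` against the weight `sin(2θ)^{-η}`. -/
def IW (g : ℝ → ℝ) : ℝ := ∫ θ in (0 : ℝ)..(Real.pi / 2), g θ * angW θ

lemma IW_add {g h : ℝ → ℝ} (hg : Continuous g) (hh : Continuous h) :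
    IW (fun θ => g θ + h θ) = IW g + IW h := by
  simp only [IW, add_mul]
  exact intervalIntegral.integral_add (angW_mul_intervalIntegrable hg) (angW_mul_intervalIntegrable hh)

lemma IW_const_mul (c : ℝ) (g : ℝ → ℝ) : IW (fun θ => c * g θ) = c * IW g := by
  simp only [IW, mul_assoc]
  exact intervalIntegral.integral_const_mul _ _

lemma IW_nonneg {g : ℝ → ℝ} (h : ∀ θ ∈ Icc 0 (Real.pi / 2), 0 ≤ g θ) : 0 ≤ IW g :=
  intervalIntegral.integral_nonneg (by positivity) fun θ hθ => mul_nonneg (h θ hθ) (angW_nonneg hθ)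

/-- `∫ p² sin(2θ)^{-η}`. -/
def E0 (p : Polynomial ℝ) : ℝ := IW fun θ => ang p θ ^ 2

/-- `∫ (∂_θ p)² sin(2θ)^{2-η}`. -/
def E1 (p : Polynomial ℝ) : ℝ := IW fun θ => Real.sin (2 * θ) ^ 4 * ang p.derivative θ ^ 2

/-- `∫ sin² θ (∂_θ p)² sin(2θ)^{-η}`. -/
def E2 (p : Polynomial ℝ) : ℝ :=
  IW fun θ => Real.sin θ ^ 2 * (Real.sin (2 * θ) ^ 2 * ang p.derivative θ ^ 2)

/-- `∫ p q sin(2θ)^{2-η}`. -/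
def Aw (p q : Polynomial ℝ) : ℝ := IW fun θ => ang p θ * ang q θ * Real.sin (2 * θ) ^ 2

/-- `∫ p q sin(2θ)² cos θ`. -/
def Ac (p q : Polynomial ℝ) : ℝ :=
  ∫ θ in (0 : ℝ)..(Real.pi / 2), ang p θ * ang q θ * (Real.sin (2 * θ) ^ 2 * Real.cos θ)

/-- The energy identity of the angular operator in the weighted space, with the indefinite term
bounded below. -/
lemma angOp_weighted_lower_bound (p : Polynomial ℝ) :
    E1 p + 2 * eta * (1 - eta) * E0 p - 6 * Aw p p ≤ Aw (angOp p) p := by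
  have c0 := ang_continuous p
  have c1 := ang_continuous p.derivative
  have c2 := ang_continuous p.derivative.derivative
  have cM := ang_continuous (angOp p)
  have key := integral_angW_by_parts
    (f := fun θ => -(Real.sin (2 * θ) ^ 2 * ang p.derivative θ * ang p θ)
      + 1 / 2 * (1 - (1 + 2 * eta) * Real.cos (2 * θ)) * ang p θ ^ 2)
    (f' := fun θ => -(4 * Real.sin (2 * θ) * Real.cos (2 * θ) * ang p.derivative θ * ang p θ
        + Real.sin (2 * θ) ^ 2 * (Real.sin (2 * θ) * ang p.derivative.derivative θ) * ang p θ
        + Real.sin (2 * θ) ^ 2 * ang p.derivative θ * (Real.sin (2 * θ) * ang p.derivative θ))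
      + ((1 + 2 * eta) * Real.sin (2 * θ) * ang p θ ^ 2
        + (1 - (1 + 2 * eta) * Real.cos (2 * θ)) * ang p θ * (Real.sin (2 * θ) * ang p.derivative θ)))
    (by fun_prop) (by fun_prop) (fun θ => by
      refine ((((((hasDerivAt_sin_two_mul θ).pow 2).mul (hasDerivAt_ang p.derivative θ)).mul
        (hasDerivAt_ang p θ)).neg).add ((((((hasDerivAt_cos_two_mul θ).const_mul
        (1 + 2 * eta)).const_sub 1).const_mul (1 / 2)).mul ((hasDerivAt_ang p θ).pow 2)))).congr_deriv ?_
      simp only [Pi.mul_apply, Pi.pow_apply]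
      ring)
  change IW _ = 0 at key
  have pos := IW_nonneg (g := fun θ => ang p θ ^ 2 * ((1 - eta) * (1 - Real.cos (2 * θ))
    + (6 - (1 + 2 * eta) * (2 - eta)) * Real.sin (2 * θ) ^ 2)) (fun θ _ => by
      have h1 := Real.cos_le_one (2 * θ)
      have h2 : 0 ≤ (1 - eta) * (1 - Real.cos (2 * θ)) :=
        mul_nonneg (by linarith [eta_lt_one]) (by linarith)
      have h3 : 0 ≤ 6 - (1 + 2 * eta) * (2 - eta) := by norm_num [eta]
      positivity)
  have split : Aw (angOp p) p = ((E1 p + 2 * eta * (1 - eta) * E0 p) + (-6) * Aw p p)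
      + (IW (fun θ => ang p θ ^ 2 * ((1 - eta) * (1 - Real.cos (2 * θ))
    + (6 - (1 + 2 * eta) * (2 - eta)) * Real.sin (2 * θ) ^ 2)) + 0) := by
    rw [← key, E1, E0, Aw, Aw, ← IW_const_mul, ← IW_const_mul, ← IW_add, ← IW_add, ← IW_add, ← IW_add]
    · congr 1
      ext θ
      rw [ang_angOp]
      have h1 := Real.sin_sq_add_cos_sq (2 * θ)
      have h2 := cos_two_mul_eq θ
      have h3 : Real.sin θ ^ 2 = (1 - Real.cos (2 * θ)) / 2 := by rw [h2]; ring
      have h4 : Real.sin (2 * θ) ^ 2 = 1 - Real.cos (2 * θ) ^ 2 := by linarith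
      rw [h3]
      linear_combination (ang p θ ^ 2 * ((1 - eta) * (1 + 2 * eta))) * h1
    all_goals fun_prop
  linarith

/-- Symmetry of the angular operator in the measure `sin(2θ)² cos θ dθ`. -/
lemma Ac_angOp (p q : Polynomial ℝ) : Ac (angOp p) q
    = ∫ θ in (0 : ℝ)..(Real.pi / 2),
      ang p.derivative θ * ang q.derivative θ * (Real.sin (2 * θ) ^ 4 * Real.cos θ) := by
  have c0 := ang_continuous p
  have c1 := ang_continuous p.derivative
  have c2 := ang_continuous p.derivative.derivative
  have cq := ang_continuous q
  have cq1 := ang_continuous q.derivative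
  have cM := ang_continuous (angOp p)
  have hd : ∀ θ, HasDerivAt (fun θ => Real.sin (2 * θ) ^ 3 * Real.cos θ * ang p.derivative θ * ang q θ)
      (ang p.derivative θ * ang q.derivative θ * (Real.sin (2 * θ) ^ 4 * Real.cos θ)
        - ang (angOp p) θ * ang q θ * (Real.sin (2 * θ) ^ 2 * Real.cos θ)) θ := by
    intro θ
    refine (((((hasDerivAt_sin_two_mul θ).pow 3).mul (Real.hasDerivAt_cos θ)).mul
      (hasDerivAt_ang p.derivative θ)).mul (hasDerivAt_ang q θ)).congr_deriv ?_
    simp only [Pi.mul_apply, Pi.pow_apply]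
    rw [ang_angOp, cos_two_mul_eq]
    have h : Real.sin (2 * θ) ^ 3 * Real.sin θ = Real.sin (2 * θ) ^ 2 * Real.cos θ * (2 * Real.sin θ ^ 2) := by
      rw [pow_succ, Real.sin_two_mul]; ring
    linear_combination (-(ang p.derivative θ * ang q θ)) * h
  have := intervalIntegral.integral_eq_sub_of_hasDerivAt (a := 0) (b := Real.pi / 2)
    (fun θ _ => hd θ) (Continuous.intervalIntegrable (by fun_prop) _ _)
  rw [intervalIntegral.integral_sub (Continuous.intervalIntegrable (by fun_prop) _ _)
    (Continuous.intervalIntegrable (by fun_prop) _ _)] at this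
  simp at this
  rw [Ac]
  linarith

lemma Ac_comm (p q : Polynomial ℝ) : Ac p q = Ac q p := by
  simp only [Ac, mul_comm (ang p _)]

lemma Ac_C_mul (c : ℝ) (p q : Polynomial ℝ) : Ac (Polynomial.C c * p) q = c * Ac p q := by
  rw [Ac, Ac, ← intervalIntegral.integral_const_mul]
  congr 1; ext θ; simp [ang]; ring

lemma Ac_eigenpoly {m n : ℕ} (h : m ≠ n) : Ac (eigenpoly m) (eigenpoly n) = 0 := by
  have h1 : Ac (angOp (eigenpoly m)) (eigenpoly n) = Ac (angOp (eigenpoly n)) (eigenpoly m) := by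
    rw [Ac_angOp, Ac_angOp]; simp only [mul_comm (ang (Polynomial.derivative (eigenpoly m)) _)]
  rw [angOp_eigenpoly, angOp_eigenpoly, Ac_C_mul, Ac_C_mul, Ac_comm (eigenpoly n)] at h1
  have h2 : lam m - lam n ≠ 0 := sub_ne_zero.2 (lam_strictMono.injective.ne h)
  have h3 : (lam m - lam n) * Ac (eigenpoly m) (eigenpoly n) = 0 := by linarith
  exact (mul_eq_zero.1 h3).resolve_left h2

/-- Regularity at `θ = π/2`: the weighted bound of `sin θ ∂_θ p` by the angular operator. -/
lemma E2_le (p : Polynomial ℝ) : E2 p ≤ 4 * E1 p + Aw (angOp p) (angOp p) := by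
  have c0 := ang_continuous p
  have c1 := ang_continuous p.derivative
  have c2 := ang_continuous p.derivative.derivative
  have cM := ang_continuous (angOp p)
  have key := integral_angW_by_parts
    (f := fun θ => 1 / 2 * (Real.sin θ ^ 2 * (Real.sin (2 * θ) ^ 2 * ang p.derivative θ ^ 2)))
    (f' := fun θ => 1 / 2 * (Real.sin (2 * θ) * (Real.sin (2 * θ) ^ 2 * ang p.derivative θ ^ 2)
      + Real.sin θ ^ 2 * (4 * Real.sin (2 * θ) * Real.cos (2 * θ) * ang p.derivative θ ^ 2
        + Real.sin (2 * θ) ^ 2 * (2 * ang p.derivative θ *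
          (Real.sin (2 * θ) * ang p.derivative.derivative θ)))))
    (by fun_prop) (by fun_prop) (fun θ => by
      refine ((((Real.hasDerivAt_sin θ).pow 2).mul (((hasDerivAt_sin_two_mul θ).pow 2).mul
        ((hasDerivAt_ang p.derivative θ).pow 2))).const_mul (1 / 2)).congr_deriv ?_
      simp only [Pi.mul_apply, Pi.pow_apply, Real.sin_two_mul θ]
      ring)
  change IW _ = 0 at key
  -- the remainder is nonnegative: a square plus terms of one sign, as `cos (2θ) = cos² θ - sin² θ`
  have pos := IW_nonneg (g := fun θ => 4 * (Real.sin (2 * θ) ^ 4 * ang p.derivative θ ^ 2)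
      + (ang (angOp p) θ * ang (angOp p) θ * Real.sin (2 * θ) ^ 2
      + (-1) * (Real.sin θ ^ 2 * (Real.sin (2 * θ) ^ 2 * ang p.derivative θ ^ 2))
      + 2 * ((1 / 2 * (Real.sin (2 * θ) * (Real.sin (2 * θ) ^ 2 * ang p.derivative θ ^ 2)
      + Real.sin θ ^ 2 * (4 * Real.sin (2 * θ) * Real.cos (2 * θ) * ang p.derivative θ ^ 2
        + Real.sin (2 * θ) ^ 2 * (2 * ang p.derivative θ *
          (Real.sin (2 * θ) * ang p.derivative.derivative θ))))) * Real.sin (2 * θ) +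
          2 * (1 - eta) * Real.cos (2 * θ) *
            (1 / 2 * (Real.sin θ ^ 2 * (Real.sin (2 * θ) ^ 2 * ang p.derivative θ ^ 2)))))) (fun θ _ => by
      have h4 := sin_two_mul_sq θ
      rw [ang_angOp, cos_two_mul_eq]
      set z := Real.sin θ ^ 2 with hz
      have z0 : 0 ≤ z := sq_nonneg _
      have z1 : z ≤ 1 := Real.sin_sq_le_one θ
      set q := ang p.derivative θ
      set r := ang p.derivative.derivative θ
      have e1 : Real.sin (2 * θ) ^ 4 = (4 * z * (1 - z)) ^ 2 := by rw [← h4]; ring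
      have b : 0 ≤ 4 * z * (1 - z) * q ^ 2 * (z * (1 - z)
          + (20 * z * (1 - z) - 2 * z * (4 + eta) * (1 - 2 * z))) := by
        have : 0 ≤ z * (1 - z) := mul_nonneg z0 (by linarith)
        have h5 : 20 * z * (1 - z) - 2 * z * (4 + eta) * (1 - 2 * z)
            = 2 * (6 - eta) * (z * (1 - z)) + 2 * (4 + eta) * z ^ 2 := by ring
        have h6 : 0 ≤ 6 - eta := by norm_num [eta]
        have h7 : 0 ≤ 4 + eta := by norm_num [eta]
        rw [h5]
        have : 0 ≤ 4 * z * (1 - z) := by linarith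
        positivity
      have c : 0 ≤ 4 * z * (1 - z) * ((-(4 * z * (1 - z)) * r - (6 - 14 * z) * q) - z * q) ^ 2 := by
        have : 0 ≤ 4 * z * (1 - z) := by nlinarith
        positivity
      have e2 : ∀ x : ℝ, Real.sin (2 * θ) * (Real.sin (2 * θ) ^ 2 * x) * Real.sin (2 * θ)
        = Real.sin (2 * θ) ^ 4 * x := fun x => by ring
      have e3 : (1 / 2 * (Real.sin (2 * θ) * (Real.sin (2 * θ) ^ 2 * q ^ 2) +
          z * (4 * Real.sin (2 * θ) * (1 - 2 * z) * q ^ 2 +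
          Real.sin (2 * θ) ^ 2 * (2 * q * (Real.sin (2 * θ) * r))))) * Real.sin (2 * θ)
          = 1 / 2 * (Real.sin (2 * θ) ^ 4 * q ^ 2 + z * (4 * Real.sin (2 * θ) ^ 2 * (1 - 2 * z) * q ^ 2
            + 2 * q * Real.sin (2 * θ) ^ 4 * r)) := by ring
      rw [e3, e1, h4]
      nlinarith [b, c])
  rw [IW_add (by fun_prop) (by fun_prop), IW_add (by fun_prop) (by fun_prop),
    IW_add (by fun_prop) (by fun_prop), IW_const_mul, IW_const_mul, IW_const_mul, key] at pos
  rw [E1, E2, Aw]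
  linarith

/-! ### Coercivity of the angular form above the kernel -/

lemma one_le_angW {θ : ℝ} (h : θ ∈ Ioo 0 (Real.pi / 2)) : 1 ≤ angW θ :=
  Real.one_le_rpow_of_pos_of_le_one_of_nonpos (sin_two_mul_pos h) (Real.sin_le_one _)
    (by linarith [eta_pos])

lemma Aw_add_left (p q r : Polynomial ℝ) : Aw (p + q) r = Aw p r + Aw q r := by
  have := ang_continuous p
  have := ang_continuous q
  have := ang_continuous r
  rw [Aw, Aw, Aw, ← IW_add (by fun_prop) (by fun_prop)]
  congr 1; ext θ; simp [ang]; ring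

lemma Aw_C_mul (c : ℝ) (p q : Polynomial ℝ) : Aw (Polynomial.C c * p) q = c * Aw p q := by
  rw [Aw, Aw, ← IW_const_mul]
  congr 1; ext θ; simp [ang]; ring

lemma Aw_comm (p q : Polynomial ℝ) : Aw p q = Aw q p := by
  simp only [Aw, mul_comm (ang p _)]

lemma Ac_add_left (p q r : Polynomial ℝ) : Ac (p + q) r = Ac p r + Ac q r := by
  have := ang_continuous p
  have := ang_continuous q
  have := ang_continuous r
  rw [Ac, Ac, Ac, ← intervalIntegral.integral_add (Continuous.intervalIntegrable (by fun_prop) _ _)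
    (Continuous.intervalIntegrable (by fun_prop) _ _)]
  congr 1; ext θ; simp [ang]; ring

/-- The size of the unweighted part of the angular form; large enough to absorb the indefinite term of
the weighted energy identity. -/
def bigM : ℝ := 2000000

/-- The angular form `∫ p q sin(2θ)² (sin(2θ)^{-η} + M cos θ)`. -/
def aForm (p q : Polynomial ℝ) : ℝ := Aw p q + bigM * Ac p q

lemma aForm_comm (p q : Polynomial ℝ) : aForm p q = aForm q p := by
  rw [aForm, aForm, Aw_comm, Ac_comm]

lemma aForm_add_left (p q r : Polynomial ℝ) : aForm (p + q) r = aForm p r + aForm q r := by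
  simp only [aForm, Aw_add_left, Ac_add_left]; ring

lemma aForm_C_mul (c : ℝ) (p q : Polynomial ℝ) :
    aForm (Polynomial.C c * p) q = c * aForm p q := by
  simp only [aForm, Aw_C_mul, Ac_C_mul]; ring

lemma aForm_add_right (p q r : Polynomial ℝ) : aForm r (p + q) = aForm r p + aForm r q := by
  rw [aForm_comm, aForm_add_left, aForm_comm p, aForm_comm q]

lemma aForm_C_mul_right (c : ℝ) (p q : Polynomial ℝ) :
    aForm p (Polynomial.C c * q) = c * aForm p q := by
  rw [aForm_comm, aForm_C_mul, aForm_comm]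

lemma sum_left_of_add {B : Polynomial ℝ → Polynomial ℝ → ℝ}
    (hadd : ∀ p q r, B (p + q) r = B p r + B q r) (hmul : ∀ c p q, B (Polynomial.C c * p) q = c * B p q)
    {ι : Type*} (s : Finset ι) (x : ι → ℝ) (f : ι → Polynomial ℝ) (q : Polynomial ℝ) :
    B (∑ i ∈ s, Polynomial.C (x i) * f i) q = ∑ i ∈ s, x i * B (f i) q := by
  classical
  induction s using Finset.induction_on with
  | empty => simpa using hmul 0 0 q
  | insert i s hi ih => rw [Finset.sum_insert hi, Finset.sum_insert hi, hadd, hmul, ih]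

/-- The combination of the eigenpolynomials of positive eigenvalue with coefficients `x`. -/
def fam (N : ℕ) (x : ℕ → ℝ) : Polynomial ℝ :=
  ∑ i ∈ Finset.range N, Polynomial.C (x i) * eigenpoly (i + 1)

lemma fam_add (N : ℕ) (x y : ℕ → ℝ) : fam N (fun i => x i + y i) = fam N x + fam N y := by
  simp [fam, add_mul, Finset.sum_add_distrib]

lemma fam_smul (N : ℕ) (c : ℝ) (x : ℕ → ℝ) : fam N (fun i => c * x i) = Polynomial.C c * fam N x := by
  simp [fam, Finset.mul_sum, mul_assoc]

lemma angOp_fam (N : ℕ) (x : ℕ → ℝ) : angOp (fam N x) = fam N fun i => lam (i + 1) * x i := by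
  rw [fam, fam, angOp_sum]
  refine Finset.sum_congr rfl fun i _ => ?_
  rw [angOp_C_mul, angOp_eigenpoly, Polynomial.C_mul]; ring

lemma sum_fam {B : Polynomial ℝ → Polynomial ℝ → ℝ} (hadd : ∀ p q r, B (p + q) r = B p r + B q r)
    (hmul : ∀ c p q, B (Polynomial.C c * p) q = c * B p q) (hc : ∀ p q, B p q = B q p)
    (N : ℕ) (x y : ℕ → ℝ) : B (fam N x) (fam N y) = ∑ i ∈ Finset.range N, ∑ j ∈ Finset.range N,
      x i * y j * B (eigenpoly (i + 1)) (eigenpoly (j + 1)) := by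
  rw [fam, sum_left_of_add hadd hmul]
  refine Finset.sum_congr rfl fun i _ => ?_
  rw [hc, fam, sum_left_of_add hadd hmul, Finset.mul_sum]
  refine Finset.sum_congr rfl fun j _ => ?_
  rw [hc]; ring

lemma aForm_fam (N : ℕ) (x y : ℕ → ℝ) : aForm (fam N x) (fam N y) =
    ∑ i ∈ Finset.range N, ∑ j ∈ Finset.range N,
      x i * y j * aForm (eigenpoly (i + 1)) (eigenpoly (j + 1)) :=
  sum_fam aForm_add_left aForm_C_mul aForm_comm N x y

lemma Ac_self_nonneg (p : Polynomial ℝ) : 0 ≤ Ac p p :=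
  intervalIntegral.integral_nonneg (by positivity) fun θ hθ => by
    have := cos_nonneg_of_mem hθ
    rw [← sq]; positivity

lemma Aw_self_nonneg (p : Polynomial ℝ) : 0 ≤ Aw p p :=
  IW_nonneg fun θ _ => by rw [← sq]; positivity

lemma E0_nonneg (p : Polynomial ℝ) : 0 ≤ E0 p := IW_nonneg fun θ _ => by positivity

lemma E1_nonneg (p : Polynomial ℝ) : 0 ≤ E1 p := IW_nonneg fun θ _ => by positivity

lemma aForm_self_nonneg (p : Polynomial ℝ) : 0 ≤ aForm p p := by
  have := Ac_self_nonneg p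
  have := Aw_self_nonneg p
  have : 0 ≤ bigM := by norm_num [bigM]
  unfold aForm; positivity

/-- The spectral gap above the kernel of the angular operator. -/
lemma Ac_angOp_fam (N : ℕ) (x : ℕ → ℝ) :
    14 * Ac (fam N x) (fam N x) ≤ Ac (angOp (fam N x)) (fam N x) := by
  have diag : ∀ y : ℕ → ℝ, Ac (fam N y) (fam N x)
      = ∑ i ∈ Finset.range N, y i * x i * Ac (eigenpoly (i + 1)) (eigenpoly (i + 1)) := by
    intro y
    rw [sum_fam Ac_add_left Ac_C_mul Ac_comm]
    refine Finset.sum_congr rfl fun i hi => ?_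
    rw [Finset.sum_eq_single i (fun j _ hj => by rw [Ac_eigenpoly (by omega)]; ring)
      (fun h => absurd hi h)]
  rw [angOp_fam, diag, diag, Finset.mul_sum]
  refine Finset.sum_le_sum fun i _ => ?_
  have h1 : (14 : ℝ) ≤ lam (i + 1) := by
    unfold lam; push_cast; nlinarith [(Nat.cast_nonneg i : (0 : ℝ) ≤ i)]
  have h2 : 0 ≤ x i * x i * Ac (eigenpoly (i + 1)) (eigenpoly (i + 1)) :=
    mul_nonneg (mul_self_nonneg _) (Ac_self_nonneg _)
  nlinarith

lemma Ac_le_Aw (p : Polynomial ℝ) : Ac p p ≤ Aw p p := by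
  have := ang_continuous p
  refine intervalIntegral.integral_mono_on_of_le_Ioo (by positivity)
    (Continuous.intervalIntegrable (by fun_prop) _ _) (angW_mul_intervalIntegrable (by fun_prop))
    fun θ hθ => ?_
  have h1 := one_le_angW hθ
  have h2 := Real.cos_le_one θ
  rw [← mul_assoc]
  refine mul_le_mul_of_nonneg_left (h2.trans h1) ?_
  rw [← sq]; positivity

lemma Aw_le_E0 (p : Polynomial ℝ) : Aw p p ≤ E0 p := by
  have := ang_continuous p
  refine intervalIntegral.integral_mono_on (by positivity)
    (angW_mul_intervalIntegrable (by fun_prop)) (angW_mul_intervalIntegrable (by fun_prop))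
    fun θ hθ => ?_
  have h1 := angW_nonneg hθ
  have h2 := Real.sin_sq_le_one (2 * θ)
  refine mul_le_mul_of_nonneg_right ?_ h1
  nlinarith [sq_nonneg (ang p θ)]

lemma aForm_le_Aw (p : Polynomial ℝ) : aForm p p ≤ (1 + bigM) * Aw p p := by
  have := Ac_le_Aw p
  have h : 0 ≤ bigM := by norm_num [bigM]
  unfold aForm; nlinarith

lemma Aw_le_aForm (p : Polynomial ℝ) : Aw p p ≤ aForm p p := by
  have := Ac_self_nonneg p
  have h : 0 ≤ bigM := by norm_num [bigM]
  unfold aForm; nlinarith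

/-- The lower-order weighted norm is absorbed by the strong weight near the boundary and by the
unweighted norm away from it. -/
lemma Aw_le_eps (p : Polynomial ℝ) : Aw p p ≤ 1 / 1000 * E0 p + 2000000 * Ac p p := by
  have c0 := ang_continuous p
  have key : ∀ θ ∈ Ioo 0 (Real.pi / 2), ang p θ * ang p θ * Real.sin (2 * θ) ^ 2 * angW θ
      ≤ 1 / 1000 * (ang p θ ^ 2 * angW θ)
        + 2000000 * (ang p θ * ang p θ * (Real.sin (2 * θ) ^ 2 * Real.cos θ)) := by
    intro θ hθ
    have hs := sin_two_mul_pos hθ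
    have hc := cos_pos_of_mem hθ
    have hw := angW_nonneg ⟨hθ.1.le, hθ.2.le⟩
    have hp : 0 ≤ ang p θ ^ 2 := sq_nonneg _
    have hcs : Real.sin (2 * θ) ≤ 2 * Real.cos θ := by
      rw [Real.sin_two_mul]; nlinarith [Real.sin_le_one θ]
    set S := Real.sin (2 * θ)
    have goal' : S ^ 2 * angW θ ≤ 1 / 1000 * angW θ + 2000000 * (S ^ 2 * Real.cos θ) := by
      rcases le_or_gt (S ^ 2) (1 / 1000) with h | h
      · have : 0 ≤ 2000000 * (S ^ 2 * Real.cos θ) := by positivity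
        nlinarith
      · have w1 : angW θ ≤ (S ^ 2)⁻¹ := by
          rw [← Real.rpow_natCast S 2, ← Real.rpow_neg hs.le]
          exact Real.rpow_le_rpow_of_exponent_ge hs (Real.sin_le_one _) (by norm_num [eta])
        have w2 : S ^ 2 * angW θ ≤ 1 := by
          calc S ^ 2 * angW θ ≤ S ^ 2 * (S ^ 2)⁻¹ := by gcongr
            _ = 1 := mul_inv_cancel₀ (by positivity)
        have w3 : 1 / 1000 < S := by nlinarith [Real.sin_le_one (2 * θ)]
        have w4 : 1 / 2000 ≤ Real.cos θ := by linarith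
        have w5 : 1 ≤ 2000000 * (S ^ 2 * Real.cos θ) := by nlinarith
        have : 0 ≤ 1 / 1000 * angW θ := by positivity
        linarith
    nlinarith [mul_le_mul_of_nonneg_left goal' hp]
  have i1 : IntervalIntegrable (fun θ => 1 / 1000 * (ang p θ ^ 2 * angW θ)) volume 0 (Real.pi / 2) :=
    (angW_mul_intervalIntegrable (f := fun θ => ang p θ ^ 2) (by fun_prop)).const_mul _
  have i2 : IntervalIntegrable (fun θ => 2000000 * (ang p θ * ang p θ * (Real.sin (2 * θ) ^ 2 * Real.cos θ)))
      volume 0 (Real.pi / 2) := Continuous.intervalIntegrable (by fun_prop) _ _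
  have := intervalIntegral.integral_mono_on_of_le_Ioo (by positivity)
    (angW_mul_intervalIntegrable (f := fun θ => ang p θ * ang p θ * Real.sin (2 * θ) ^ 2) (by fun_prop))
    (i1.add i2) key
  rw [intervalIntegral.integral_add i1 i2, intervalIntegral.integral_const_mul,
    intervalIntegral.integral_const_mul] at this
  exact this

/-- Coercivity on the span of the eigenpolynomials of positive degree. The gap `14` of `Ac_angOp_fam`
exceeds `9 / 4`, and the part of the form carrying `Ac` is so large that this surplus pays for the term
`-6 Aw` of `angOp_weighted_lower_bound`. The shift by `9 / 4` leaves room for the radial part of the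
operator in the energy estimate. -/
lemma aForm_coercive (N : ℕ) (x : ℕ → ℝ) :
    1 / 100 * (E0 (fam N x) + E1 (fam N x)) ≤
      aForm (angOp (fam N x)) (fam N x) - 9 / 4 * aForm (fam N x) (fam N x) := by
  have h1 := angOp_weighted_lower_bound (fam N x)
  have h2 := Ac_angOp_fam N x
  have h3 := Aw_le_eps (fam N x)
  have h4 := Ac_self_nonneg (fam N x)
  have h5 := E0_nonneg (fam N x)
  have h6 := E1_nonneg (fam N x)
  have h7 : 2 * eta * (1 - eta) = 99 / 5000 := by norm_num [eta]
  rw [h7] at h1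
  unfold aForm bigM
  nlinarith

lemma aForm_self_le_E0 (p : Polynomial ℝ) : aForm p p ≤ (1 + bigM) * E0 p :=
  (aForm_le_Aw p).trans (mul_le_mul_of_nonneg_left (Aw_le_E0 p) (by norm_num [bigM]))

/-- Young's inequality for the angular form. -/
lemma aForm_le_young (p q : Polynomial ℝ) {t : ℝ} (ht : 0 < t) :
    2 * aForm p q ≤ t⁻¹ * aForm p p + t * aForm q q := by
  have h := aForm_self_nonneg (p + Polynomial.C (-t) * q)
  simp only [aForm_add_left, aForm_add_right, aForm_C_mul, aForm_C_mul_right] at h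
  rw [aForm_comm q p] at h
  have h2 : t⁻¹ * (2 * t * aForm p q) ≤ t⁻¹ * (aForm p p + t * t * aForm q q) := by
    gcongr
    linarith
  have e1 : t⁻¹ * (2 * t * aForm p q) = 2 * aForm p q := by field_simp
  have e2 : t⁻¹ * (aForm p p + t * t * aForm q q) = t⁻¹ * aForm p p + t * aForm q q := by
    field_simp
  rwa [e1, e2] at h2

/-! ### Radial integration by parts -/

/-- Continuous functions on `(0, ∞)` of order `R⁴` at `0` and `R⁻⁴` at infinity. -/
def Dec (f : ℝ → ℝ) : Prop :=
  ContinuousOn f (Ioi 0) ∧ ∃ K, 0 ≤ K ∧ ∀ R, 0 < R → |f R| ≤ K * (R ^ 4 / (1 + R ^ 8))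

lemma Dec.const_mul {f : ℝ → ℝ} (hf : Dec f) (c : ℝ) : Dec fun R => c * f R := by
  obtain ⟨h, K, hK, hb⟩ := hf
  refine ⟨continuousOn_const.mul h, |c| * K, by positivity, fun R hR => ?_⟩
  rw [abs_mul, mul_assoc]
  exact mul_le_mul_of_nonneg_left (hb R hR) (abs_nonneg c)

lemma Dec.add {f g : ℝ → ℝ} (hf : Dec f) (hg : Dec g) : Dec fun R => f R + g R := by
  obtain ⟨h, K, hK, hb⟩ := hf
  obtain ⟨h', K', hK', hb'⟩ := hg
  refine ⟨h.add h', K + K', by positivity, fun R hR => ?_⟩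
  rw [add_mul]
  exact (abs_add_le _ _).trans (add_le_add (hb R hR) (hb' R hR))

/-- Decay at both ends from two power bounds. -/
lemma Dec.of_power_bound {f : ℝ → ℝ} (hf : ContinuousOn f (Ioi 0)) {a b K : ℝ} (ha : 4 ≤ a)
    (hb : 4 ≤ b) (hK : 0 ≤ K) (h : ∀ R, 0 < R → |f R| ≤ K * R ^ a ∧ |f R| ≤ K * R ^ (-b)) : Dec f := by
  refine ⟨hf, 2 * K, by positivity, fun R hR => ?_⟩
  rw [show 2 * K * (R ^ 4 / (1 + R ^ 8)) = K * (R ^ 4 * 2) / (1 + R ^ 8) by ring,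
    le_div_iff₀ (by positivity)]
  have h4 : 0 < R ^ 4 := by positivity
  rcases le_or_gt R 1 with h1 | h1
  · have e : R ^ a ≤ R ^ 4 := by
      rw [← Real.rpow_natCast R 4]
      exact Real.rpow_le_rpow_of_exponent_ge hR h1 (by exact_mod_cast ha)
    have h8 : R ^ 8 ≤ 1 := pow_le_one₀ hR.le h1
    have := (h R hR).1.trans (mul_le_mul_of_nonneg_left e hK)
    nlinarith [abs_nonneg (f R)]
  · have e : R ^ (-b) ≤ (R ^ 4)⁻¹ := by
      rw [← Real.rpow_natCast R 4, ← Real.rpow_neg hR.le]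
      exact Real.rpow_le_rpow_of_exponent_le h1.le (by norm_num; linarith)
    have := (h R hR).2.trans (mul_le_mul_of_nonneg_left e hK)
    have h8 : 1 ≤ R ^ 8 := one_le_pow₀ h1.le
    calc |f R| * (1 + R ^ 8) ≤ (K * (R ^ 4)⁻¹) * (1 + R ^ 8) := by gcongr
      _ ≤ (K * (R ^ 4)⁻¹) * (2 * R ^ 8) := by gcongr; linarith
      _ = K * (R ^ 4 * 2) := by field_simp

/-- The pairing of two decaying functions against `R^{m-4}`, `m ≤ 4`, is dominated by an integrable
function. -/
lemma Dec.mul_bound {f g : ℝ → ℝ} (hf : Dec f) (hg : Dec g) {m : ℕ} (hm : m ≤ 4) :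
    ∃ K, 0 ≤ K ∧ ∀ R, 0 < R → |R ^ m / R ^ 4 * (f R * g R)| ≤ K * (1 + R ^ 2)⁻¹ := by
  obtain ⟨-, K, hK, hb⟩ := hf
  obtain ⟨-, K', hK', hb'⟩ := hg
  refine ⟨K * K' * 2, by positivity, fun R hR => ?_⟩
  have p1 : R ^ (m + 4) ≤ 1 + R ^ 8 := by
    rcases le_or_gt R 1 with h1 | h1
    · have := pow_le_one₀ (n := m + 4) hR.le h1
      have : 0 < R ^ 8 := by positivity
      linarith
    · have := pow_le_pow_right₀ h1.le (show m + 4 ≤ 8 by omega)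
      linarith
  have p2 : 1 + R ^ 2 ≤ 2 * (1 + R ^ 8) := by
    rcases le_or_gt R 1 with h1 | h1
    · have := pow_le_one₀ (n := 2) hR.le h1
      have : 0 < R ^ 8 := by positivity
      linarith
    · have := pow_le_pow_right₀ h1.le (show 2 ≤ 8 by omega)
      have : 1 ≤ R ^ 8 := one_le_pow₀ h1.le
      linarith
  rw [abs_mul, abs_mul, abs_of_pos (show 0 < R ^ m / R ^ 4 by positivity)]
  calc R ^ m / R ^ 4 * (|f R| * |g R|)
      ≤ R ^ m / R ^ 4 * ((K * (R ^ 4 / (1 + R ^ 8))) * (K' * (R ^ 4 / (1 + R ^ 8)))) := by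
        gcongr
        · exact hb R hR
        · exact hb' R hR
    _ = K * K' * (R ^ (m + 4) / (1 + R ^ 8) * (1 + R ^ 8)⁻¹) := by
        rw [pow_add]; field_simp
    _ ≤ K * K' * (1 * (2 * (1 + R ^ 2)⁻¹)) := by
        gcongr
        · exact (div_le_one (by positivity)).2 p1
        · rw [← div_eq_mul_inv, le_div_iff₀ (by positivity), inv_mul_le_iff₀ (by positivity)]
          linarith
    _ = K * K' * 2 * (1 + R ^ 2)⁻¹ := by ring

lemma Dec.integrableOn {f g : ℝ → ℝ} (hf : Dec f) (hg : Dec g) {m : ℕ} (hm : m ≤ 4) :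
    IntegrableOn (fun R => R ^ m / R ^ 4 * (f R * g R)) (Ioi 0) := by
  obtain ⟨K, hK, hb⟩ := hf.mul_bound hg hm
  refine Integrable.mono' ((integrable_inv_one_add_sq.const_mul K).restrict) ?_ ?_
  · refine ContinuousOn.aestronglyMeasurable ?_ measurableSet_Ioi
    refine ContinuousOn.mul (ContinuousOn.div (by fun_prop) (by fun_prop) fun R hR => ?_) (hf.1.mul hg.1)
    exact (pow_pos hR 4).ne'
  · exact (ae_restrict_mem measurableSet_Ioi).mono fun R hR => hb R hR

/-- Integration by parts in `R` against `R^{m-4}`; `f₁`, `g₁` are `R f'`, `R g'`. -/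
lemma integral_dec_by_parts {f g f₁ g₁ : ℝ → ℝ} (hf : Dec f) (hg : Dec g) (hf₁ : Dec f₁)
    (hg₁ : Dec g₁) (df : ∀ R, 0 < R → HasDerivAt f (f₁ R / R) R)
    (dg : ∀ R, 0 < R → HasDerivAt g (g₁ R / R) R) {m : ℕ} (hm : m ≤ 4) :
    ∫ R in Ioi (0 : ℝ), (R ^ m / R ^ 4 * (f₁ R * g R) + R ^ m / R ^ 4 * (f R * g₁ R)
      + ((m : ℝ) - 3) * (R ^ m / R ^ 4 * (f R * g R))) = 0 := by
  have hd : ∀ R ∈ Ioi (0 : ℝ), HasDerivAt (fun R => R ^ m / R ^ 3 * (f R * g R))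
      (R ^ m / R ^ 4 * (f₁ R * g R) + R ^ m / R ^ 4 * (f R * g₁ R)
      + ((m : ℝ) - 3) * (R ^ m / R ^ 4 * (f R * g R))) R := by
    intro R hR
    have hR0 : (R : ℝ) ≠ 0 := (ne_of_gt hR)
    refine ((((hasDerivAt_pow m R).div (hasDerivAt_pow 3 R) (pow_ne_zero 3 hR0))).mul
      ((df R hR).mul (dg R hR))).congr_deriv ?_
    have e : (m : ℝ) * R ^ (m - 1) = m * R ^ m / R := by
      rcases m with _ | m
      · simp
      · rw [Nat.add_sub_cancel, pow_succ]; field_simp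
    simp only [Pi.mul_apply, Pi.div_apply, e]
    field_simp
    ring
  obtain ⟨K, hK, hb⟩ := hf.mul_bound hg hm
  have hb' : ∀ R, 0 < R → |R ^ m / R ^ 3 * (f R * g R)| ≤ K * (R * (1 + R ^ 2)⁻¹) := by
    intro R hR
    have e : R ^ m / R ^ 3 * (f R * g R) = R * (R ^ m / R ^ 4 * (f R * g R)) := by field_simp
    rw [e, abs_mul, abs_of_pos hR]
    calc R * |R ^ m / R ^ 4 * (f R * g R)| ≤ R * (K * (1 + R ^ 2)⁻¹) := by
          gcongr; exact hb R hR
      _ = _ := by ring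
  have t0 : Tendsto (fun R : ℝ => K * (R * (1 + R ^ 2)⁻¹)) (𝓝[>] 0) (𝓝 0) := by
    have : Continuous fun R : ℝ => K * (R * (1 + R ^ 2)⁻¹) :=
      continuous_const.mul (continuous_id.mul (Continuous.inv₀ (by fun_prop) fun R => by positivity))
    simpa using (this.tendsto 0).mono_left nhdsWithin_le_nhds
  have t1 : Tendsto (fun R : ℝ => K * (R * (1 + R ^ 2)⁻¹)) atTop (𝓝 0) := by
    have : Tendsto (fun R : ℝ => K * R⁻¹) atTop (𝓝 0) := by
      simpa using tendsto_inv_atTop_zero.const_mul K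
    refine squeeze_zero' ?_ ?_ this
    · filter_upwards [eventually_gt_atTop 0] with R hR
      positivity
    · filter_upwards [eventually_gt_atTop 0] with R hR
      gcongr
      rw [← div_eq_mul_inv, div_le_iff₀ (by positivity)]
      field_simp
      nlinarith
  have s0 : Tendsto (fun R => R ^ m / R ^ 3 * (f R * g R)) (𝓝[>] 0) (𝓝 0) :=
    squeeze_zero_norm' (by filter_upwards [self_mem_nhdsWithin] with R hR using hb' R hR) t0
  have s1 : Tendsto (fun R => R ^ m / R ^ 3 * (f R * g R)) atTop (𝓝 0) :=
    squeeze_zero_norm' (by filter_upwards [eventually_gt_atTop 0] with R hR using hb' R hR) t1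
  have c0 : ContinuousWithinAt (fun R => R ^ m / R ^ 3 * (f R * g R)) (Ici 0) 0 := by
    rw [← continuousWithinAt_Ioi_iff_Ici]
    simpa [ContinuousWithinAt] using s0
  have := integral_Ioi_of_hasDerivAt_of_tendsto c0 hd (((hf₁.integrableOn hg hm).add
    (hf.integrableOn hg₁ hm)).add ((hf.integrableOn hg hm).const_mul _)) s1
  simpa using this

/-! ### The a priori estimate for finite sums of modes -/

/-- `∫₀^∞ R^{m-4} a(X, Y) dR` for curves of polynomials with coefficients `X` and `Y`. -/
def RI (m N : ℕ) (X Y : ℕ → ℝ → ℝ) : ℝ :=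
  ∫ R in Ioi (0 : ℝ), R ^ m / R ^ 4 * aForm (fam N fun i => X i R) (fam N fun i => Y i R)

lemma RI_eq_sum (m N : ℕ) (X Y : ℕ → ℝ → ℝ) (R : ℝ) :
    R ^ m / R ^ 4 * aForm (fam N fun i => X i R) (fam N fun i => Y i R) =
      ∑ i ∈ Finset.range N, ∑ j ∈ Finset.range N, aForm (eigenpoly (i + 1)) (eigenpoly (j + 1))
        * (R ^ m / R ^ 4 * (X i R * Y j R)) := by
  rw [aForm_fam, Finset.mul_sum]
  refine Finset.sum_congr rfl fun i _ => ?_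
  rw [Finset.mul_sum]
  refine Finset.sum_congr rfl fun j _ => ?_
  ring

lemma RI_integrable {m N : ℕ} (hm : m ≤ 4) {X Y : ℕ → ℝ → ℝ} (hX : ∀ i, Dec (X i))
    (hY : ∀ i, Dec (Y i)) : IntegrableOn (fun R => R ^ m / R ^ 4 *
      aForm (fam N fun i => X i R) (fam N fun i => Y i R)) (Ioi 0) := by
  simp_rw [RI_eq_sum]
  exact integrable_finsetSum _ fun i _ => integrable_finsetSum _ fun j _ =>
    ((hX i).integrableOn (hY j) hm).const_mul _

/-- Radial integration by parts for the angular form of two curves of polynomials; `X₁`, `Y₁` are the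
`R ∂_R` derivatives of `X`, `Y`. -/
lemma integral_fam_by_parts {m N : ℕ} (hm : m ≤ 4) {X Y X₁ Y₁ : ℕ → ℝ → ℝ} (hX : ∀ i, Dec (X i))
    (hY : ∀ i, Dec (Y i)) (hX₁ : ∀ i, Dec (X₁ i)) (hY₁ : ∀ i, Dec (Y₁ i))
    (dX : ∀ i R, 0 < R → HasDerivAt (X i) (X₁ i R / R) R)
    (dY : ∀ i R, 0 < R → HasDerivAt (Y i) (Y₁ i R / R) R) :
    RI m N X₁ Y + RI m N X Y₁ + ((m : ℝ) - 3) * RI m N X Y = 0 := by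
  have ii : ∀ {A B : ℕ → ℝ → ℝ}, (∀ i, Dec (A i)) → (∀ i, Dec (B i)) → RI m N A B =
      ∑ i ∈ Finset.range N, ∑ j ∈ Finset.range N, aForm (eigenpoly (i + 1)) (eigenpoly (j + 1))
        * ∫ R in Ioi (0 : ℝ), (R ^ m / R ^ 4 * (A i R * B j R)) := by
    intro A B hA hB
    rw [RI]
    simp_rw [RI_eq_sum]
    rw [integral_finsetSum _ fun i _ => integrable_finsetSum _ fun j _ =>
      ((hA i).integrableOn (hB j) hm).const_mul _]
    refine Finset.sum_congr rfl fun i _ => ?_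
    rw [integral_finsetSum _ fun j _ => ((hA i).integrableOn (hB j) hm).const_mul _]
    refine Finset.sum_congr rfl fun j _ => ?_
    rw [integral_const_mul]
  rw [ii hX₁ hY, ii hX hY₁, ii hX hY, Finset.mul_sum, ← Finset.sum_add_distrib,
    ← Finset.sum_add_distrib]
  refine Finset.sum_eq_zero fun i _ => ?_
  rw [Finset.mul_sum, ← Finset.sum_add_distrib, ← Finset.sum_add_distrib]
  refine Finset.sum_eq_zero fun j _ => ?_
  have := integral_dec_by_parts (hX i) (hY j) (hX₁ i) (hY₁ j) (dX i) (dY j) hm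
  have i1 := (hX₁ i).integrableOn (hY j) hm
  have i2 := (hX i).integrableOn (hY₁ j) hm
  have i3 := ((hX i).integrableOn (hY j) hm).const_mul ((m : ℝ) - 3)
  rw [integral_add (by exact i1.add i2) i3, integral_add i1 i2, integral_const_mul] at this
  linear_combination aForm (eigenpoly (i + 1)) (eigenpoly (j + 1)) * this

lemma RI_smul_left (m N : ℕ) (k : ℝ) (X Y : ℕ → ℝ → ℝ) :
    RI m N (fun i R => k * X i R) Y = k * RI m N X Y := by
  rw [RI, RI, ← integral_const_mul]
  congr 1; ext R
  rw [fam_smul, aForm_C_mul]; ring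

lemma RI_comm (m N : ℕ) (X Y : ℕ → ℝ → ℝ) : RI m N X Y = RI m N Y X := by
  simp only [RI, aForm_comm (fam N fun i => X i _)]

lemma RI_smul_right (m N : ℕ) (k : ℝ) (X Y : ℕ → ℝ → ℝ) :
    RI m N X (fun i R => k * Y i R) = k * RI m N X Y := by
  rw [RI_comm, RI_smul_left, RI_comm]

/-- Linear combinations of the integrals `RI`. -/
lemma integral_sum_RI {m N n : ℕ} (hm : m ≤ 4) (a : Fin n → ℝ) (X Y : Fin n → ℕ → ℝ → ℝ)
    (hX : ∀ k i, Dec (X k i)) (hY : ∀ k i, Dec (Y k i)) :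
    IntegrableOn (fun R => R ^ m / R ^ 4 *
      ∑ k, a k * aForm (fam N fun i => X k i R) (fam N fun i => Y k i R)) (Ioi 0) ∧
    ∫ R in Ioi (0 : ℝ), R ^ m / R ^ 4 *
      ∑ k, a k * aForm (fam N fun i => X k i R) (fam N fun i => Y k i R)
      = ∑ k, a k * RI m N (X k) (Y k) := by
  have e : ∀ R : ℝ, R ^ m / R ^ 4 *
      ∑ k, a k * aForm (fam N fun i => X k i R) (fam N fun i => Y k i R) =
      ∑ k, a k * (R ^ m / R ^ 4 * aForm (fam N fun i => X k i R) (fam N fun i => Y k i R)) := by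
    intro R
    rw [Finset.mul_sum]
    refine Finset.sum_congr rfl fun k _ => ?_
    ring
  simp_rw [e]
  have hi : ∀ k ∈ Finset.univ, IntegrableOn (fun R => a k * (R ^ m / R ^ 4 *
      aForm (fam N fun i => X k i R) (fam N fun i => Y k i R))) (Ioi 0) := fun k _ =>
    (RI_integrable hm (hX k) (hY k)).const_mul _
  refine ⟨integrable_finsetSum _ hi, ?_⟩
  rw [integral_finsetSum _ hi]
  refine Finset.sum_congr rfl fun k _ => ?_
  rw [integral_const_mul, RI]

/-- The constant of the energy estimate. -/
def energyC : ℝ := 20100 * (1 + bigM)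

/-- The pointwise inequality behind the energy estimate: up to the terms in the last two lines,
whose radial integrals vanish by integration by parts, the energy is controlled by the right-hand
side of the equation. Here `c`, `d`, `e` stand for a function and its first two derivatives. -/
lemma energy_pointwise (N : ℕ) (f c d e : ℕ → ℝ) {τ : ℝ} (h1 : -(3 / 4) ≤ τ) (h2 : τ ≤ 1 / 4)
    (eq : ∀ i, f i = -e i - 5 * d i + lam (i + 1) * c i) :
    aForm (fam N e) (fam N e) + (E0 (fam N d) + E1 (fam N d)) + (E0 (fam N c) + E1 (fam N c)) ≤
      energyC * aForm (fam N f) (fam N f)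
      + 100 * (2 * (aForm (fam N e) (fam N c) + aForm (fam N d) (fam N d)
          + τ * aForm (fam N d) (fam N c))
        - (τ - 5) * (2 * aForm (fam N d) (fam N c) + τ * aForm (fam N c) (fam N c))
      + (2 * (aForm (fam N fun i => lam (i + 1) * d i) (fam N d)
          + aForm (fam N fun i => lam (i + 1) * c i) (fam N e)
          + τ * aForm (fam N fun i => lam (i + 1) * c i) (fam N d))
        - (5 + τ) * (2 * aForm (fam N e) (fam N d) + τ * aForm (fam N d) (fam N d)))) := by
  have hM : 0 < 1 + bigM := by norm_num [bigM]
  have hf : fam N f = Polynomial.C (-1) * fam N e + (Polynomial.C (-5) * fam N d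
      + fam N fun i => lam (i + 1) * c i) := by
    rw [← fam_smul, ← fam_smul, ← fam_add, ← fam_add]
    congr 1; ext i; rw [eq]; ring
  have k1 := aForm_coercive N c
  have k2 := aForm_coercive N d
  rw [angOp_fam] at k1 k2
  have l1 := aForm_self_le_E0 (fam N c)
  have l2 := aForm_self_le_E0 (fam N d)
  have n1 := aForm_self_nonneg (fam N c)
  have n2 := aForm_self_nonneg (fam N d)
  have n3 := aForm_self_nonneg (fam N e)
  have n4 := aForm_self_nonneg (fam N f)
  have p1 := E1_nonneg (fam N c)
  have p2 := E1_nonneg (fam N d)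
  have q1 := E0_nonneg (fam N c)
  have q2 := E0_nonneg (fam N d)
  -- the weight in Young's inequality is the ratio of the coercivity constant to the size of the form
  have y1 := aForm_le_young (fam N f) (fam N c) (t := 1 / (100 * (1 + bigM))) (by positivity)
  have y2 := aForm_le_young (fam N f) (Polynomial.C (-1) * fam N e) (t := 1) (by positivity)
  have y3 := aForm_le_young (fam N f) (Polynomial.C (-τ) * fam N d) (t := 1 / (100 * (1 + bigM)))
    (by positivity)
  simp only [aForm_C_mul_right, aForm_C_mul] at y2 y3
  rw [one_div, inv_inv] at y1 y3
  have l1' : (100 * (1 + bigM))⁻¹ * aForm (fam N c) (fam N c) ≤ 1 / 100 * E0 (fam N c) := by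
    rw [inv_mul_le_iff₀ (by positivity)]; linarith
  have l2' : (100 * (1 + bigM))⁻¹ * aForm (fam N d) (fam N d) ≤ 1 / 100 * E0 (fam N d) := by
    rw [inv_mul_le_iff₀ (by positivity)]; linarith
  have l3 : (100 * (1 + bigM))⁻¹ * (-τ * (-τ * aForm (fam N d) (fam N d))) ≤ 1 / 100 * E0 (fam N d) := by
    refine le_trans (mul_le_mul_of_nonneg_left ?_ (by positivity)) l2'
    have : τ * τ ≤ 1 := by nlinarith
    nlinarith
  have fc : aForm (fam N f) (fam N c) = -aForm (fam N e) (fam N c) - 5 * aForm (fam N d) (fam N c)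
      + aForm (fam N fun i => lam (i + 1) * c i) (fam N c) := by
    rw [hf]; simp only [aForm_add_left, aForm_C_mul]; ring
  have fd : aForm (fam N f) (fam N d) = -aForm (fam N e) (fam N d) - 5 * aForm (fam N d) (fam N d)
      + aForm (fam N fun i => lam (i + 1) * c i) (fam N d) := by
    rw [hf]; simp only [aForm_add_left, aForm_C_mul]; ring
  have fe : aForm (fam N f) (fam N e) = -aForm (fam N e) (fam N e) - 5 * aForm (fam N e) (fam N d)
      + aForm (fam N fun i => lam (i + 1) * c i) (fam N e) := by
    rw [hf]; simp only [aForm_add_left, aForm_C_mul]; rw [aForm_comm (fam N d)]; ring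
  have κ : -(9 / 4) ≤ 5 / 2 * τ - τ ^ 2 / 2 := by nlinarith
  have κ1 := mul_le_mul_of_nonneg_right κ n1
  have κ2 := mul_le_mul_of_nonneg_right κ n2
  rw [fc] at y1
  rw [fe] at y2
  rw [fd] at y3
  have hE : energyC * aForm (fam N f) (fam N f) = 100 * (1 + bigM) * aForm (fam N f) (fam N f) * 201 := by
    rw [energyC]; ring
  rw [hE]
  have n5 : 100 * aForm (fam N f) (fam N f) ≤ 100 * (1 + bigM) * aForm (fam N f) (fam N f) := by
    gcongr; norm_num [bigM]
  linarith

/-- The energy estimate against the radial weight `R^{m-4}`, for finitely many modes. -/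
lemma energy_estimate {α : ℝ} (hα0 : 0 < α) (hα : α ≤ 1 / 4) {m N : ℕ} (hm : m ≤ 4)
    {f c c₁ c₂ : ℕ → ℝ → ℝ} (hf : ∀ i, Dec (f i)) (hc : ∀ i, Dec (c i)) (hc₁ : ∀ i, Dec (c₁ i))
    (hc₂ : ∀ i, Dec (c₂ i)) (dc : ∀ i R, 0 < R → HasDerivAt (c i) (α⁻¹ * c₁ i R / R) R)
    (dc₁ : ∀ i R, 0 < R → HasDerivAt (c₁ i) (α⁻¹ * c₂ i R / R) R)
    (eq : ∀ i R, 0 < R → f i R = -c₂ i R - 5 * c₁ i R + lam (i + 1) * c i R)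
    {G : ℝ → ℝ} (hGi : IntegrableOn (fun R => R ^ m / R ^ 4 * G R) (Ioi 0))
    (hG : ∀ R, 0 < R → G R ≤ aForm (fam N fun i => c₂ i R) (fam N fun i => c₂ i R)
      + (E0 (fam N fun i => c₁ i R) + E1 (fam N fun i => c₁ i R))
      + (E0 (fam N fun i => c i R) + E1 (fam N fun i => c i R))) :
    ∫ R in Ioi (0 : ℝ), R ^ m / R ^ 4 * G R ≤ energyC * RI m N f f := by
  set τ := α * ((m : ℝ) - 3) with hτ
  have hm0 : (0 : ℝ) ≤ m := Nat.cast_nonneg m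
  have hm4 : (m : ℝ) ≤ 4 := by exact_mod_cast hm
  have hτ1 : -(3 / 4) ≤ τ := by rw [hτ]; nlinarith
  have hτ2 : τ ≤ 1 / 4 := by rw [hτ]; nlinarith
  set Lc : ℕ → ℝ → ℝ := fun i R => lam (i + 1) * c i R
  set Ld : ℕ → ℝ → ℝ := fun i R => lam (i + 1) * c₁ i R
  have hLc : ∀ i, Dec (Lc i) := fun i => (hc i).const_mul _
  have hLd : ∀ i, Dec (Ld i) := fun i => (hc₁ i).const_mul _
  have dLc : ∀ i R, 0 < R → HasDerivAt (Lc i) (α⁻¹ * Ld i R / R) R := fun i R hR =>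
    ((dc i R hR).const_mul (lam (i + 1))).congr_deriv (by simp only [Ld]; ring)
  have ibp : ∀ {X Y X₁ Y₁ : ℕ → ℝ → ℝ}, (∀ i, Dec (X i)) → (∀ i, Dec (Y i)) → (∀ i, Dec (X₁ i)) →
      (∀ i, Dec (Y₁ i)) → (∀ i R, 0 < R → HasDerivAt (X i) (α⁻¹ * X₁ i R / R) R) →
      (∀ i R, 0 < R → HasDerivAt (Y i) (α⁻¹ * Y₁ i R / R) R) →
      RI m N X₁ Y + RI m N X Y₁ + τ * RI m N X Y = 0 := by
    intro X Y X₁ Y₁ hX hY hX₁ hY₁ dX dY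
    have := integral_fam_by_parts (N := N) hm hX hY (fun i => (hX₁ i).const_mul α⁻¹)
      (fun i => (hY₁ i).const_mul α⁻¹) dX dY
    rw [RI_smul_left, RI_smul_right] at this
    have h2 : α * (α⁻¹ * RI m N X₁ Y + α⁻¹ * RI m N X Y₁ + ((m : ℝ) - 3) * RI m N X Y) = 0 := by
      rw [this, mul_zero]
    rw [hτ]
    field_simp at h2
    linear_combination h2
  have z1 := ibp hc₁ hc hc₂ hc₁ dc₁ dc
  have z2 := ibp hc hc hc₁ hc₁ dc dc
  have w1 := ibp hLc hc₁ hLd hc₂ dLc dc₁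
  have w2 := ibp hc₁ hc₁ hc₂ hc₂ dc₁ dc₁
  rw [RI_comm m N c c₁] at z2
  rw [RI_comm m N c₁ c₂] at w2
  have S := integral_sum_RI (N := N) hm
    ![energyC, 200, 200, 200 * τ, -(100 * (τ - 5) * 2), -(100 * (τ - 5) * τ), 200, 200, 200 * τ,
      -(100 * (5 + τ) * 2), -(100 * (5 + τ) * τ)]
    ![f, c₂, c₁, c₁, c₁, c, Ld, Lc, Lc, c₂, c₁] ![f, c, c₁, c, c, c, c₁, c₂, c₁, c₁, c₁]
    (by simp [Fin.forall_fin_succ, hf, hc, hc₁, hc₂, hLc, hLd])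
    (by simp [Fin.forall_fin_succ, hf, hc, hc₁, hc₂])
  have hle := setIntegral_mono_on hGi S.1 measurableSet_Ioi (fun R hR => by
    refine mul_le_mul_of_nonneg_left ((hG R hR).trans ?_) (by
      have : 0 < R := hR
      positivity)
    refine (energy_pointwise N (fun i => f i R) _ _ _ hτ1 hτ2 (fun i => eq i R hR)).trans ?_
    simp only [Fin.sum_univ_succ, Matrix.cons_val_zero, Matrix.cons_val_succ, Fin.sum_univ_zero, Lc, Ld]
    apply le_of_eq
    simp
    ring)
  refine hle.trans ?_
  rw [S.2]
  simp only [Fin.sum_univ_succ, Matrix.cons_val_zero, Matrix.cons_val_succ, Fin.sum_univ_zero]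
  simp
  linear_combination 200 * z1 - 100 * (τ - 5) * z2 + 200 * w1 - 100 * (5 + τ) * w2

/-- The weight `w(R) / sin(2θ)^{β/2}`. -/
def wt (β : ℝ) (p : ℝ × ℝ) : ℝ := w p.1 / Real.sin (2 * p.2) ^ (β / 2)

/-- The weighted `L²` norm. -/
def nrm (β : ℝ) (f : ℝ × ℝ → ℝ) : ℝ≥0∞ := eLpNorm (fun p => f p * wt β p) 2 stripMeasure

/-- `sin(2θ) p(sin² θ)`. -/
def kU (p : Polynomial ℝ) (θ : ℝ) : ℝ := Real.sin (2 * θ) * ang p θ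

/-- The `θ`-derivative of `kU p`. -/
def kT (p : Polynomial ℝ) (θ : ℝ) : ℝ :=
  2 * Real.cos (2 * θ) * ang p θ + Real.sin (2 * θ) ^ 2 * ang p.derivative θ

/-- The `θ`-derivative of `kU p / cos θ`. -/
def kY (p : Polynomial ℝ) (θ : ℝ) : ℝ :=
  2 * Real.cos θ * ang p θ + 2 * Real.sin θ * Real.sin (2 * θ) * ang p.derivative θ

/-- A linear map from polynomials to continuous functions of the angle. -/
structure IsAng (k : Polynomial ℝ → ℝ → ℝ) : Prop where
  cont : ∀ p, Continuous (k p)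
  add : ∀ p q θ, k (p + q) θ = k p θ + k q θ
  smul : ∀ c p θ, k (Polynomial.C c * p) θ = c * k p θ

lemma isAng_kU : IsAng kU where
  cont p := by have := ang_continuous p; unfold kU; fun_prop
  add p q θ := by simp [kU, ang]; ring
  smul c p θ := by simp [kU, ang]; ring

lemma isAng_kT : IsAng kT where
  cont p := by
    have := ang_continuous p; have := ang_continuous p.derivative; unfold kT; fun_prop
  add p q θ := by simp [kT, ang]; ring
  smul c p θ := by simp [kT, ang]; ring

lemma isAng_kY : IsAng kY where
  cont p := by
    have := ang_continuous p; have := ang_continuous p.derivative; unfold kY; fun_prop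
  add p q θ := by simp [kY, ang]; ring
  smul c p θ := by simp [kY, ang]; ring

/-- The function `(R, θ) ↦ k (∑ Xᵢ(R) Jᵢ) (θ)`. -/
def mode (k : Polynomial ℝ → ℝ → ℝ) (N : ℕ) (X : ℕ → ℝ → ℝ) (p : ℝ × ℝ) : ℝ :=
  k (fam N fun i => X i p.1) p.2

lemma IsAng.fam {k : Polynomial ℝ → ℝ → ℝ} (hk : IsAng k) (N : ℕ) (x : ℕ → ℝ) (θ : ℝ) :
    k (fam N x) θ = ∑ i ∈ Finset.range N, x i * k (eigenpoly (i + 1)) θ :=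
  sum_left_of_add (B := fun p _ => k p θ) (fun p q _ => hk.add p q θ) (fun c p _ => hk.smul c p θ)
    _ _ _ 0

lemma IsAng.mode_eq {k : Polynomial ℝ → ℝ → ℝ} (hk : IsAng k) (N : ℕ) (X : ℕ → ℝ → ℝ) :
    mode k N X = fun p => ∑ i ∈ Finset.range N, X i p.1 * k (eigenpoly (i + 1)) p.2 :=
  funext fun p => hk.fam N _ p.2

lemma stripMeasure_eq_prod : stripMeasure =
    (volume.restrict (Ioi (0 : ℝ))).prod (volume.restrict (Ioo 0 (Real.pi / 2))) := by
  rw [stripMeasure, strip, Measure.prod_restrict]; rfl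

lemma eLpNorm_two_sq {f : ℝ × ℝ → ℝ} :
    eLpNorm f 2 stripMeasure ^ 2 = ∫⁻ p, ENNReal.ofReal (f p ^ 2) ∂stripMeasure := by
  have := eLpNorm_nnreal_pow_eq_lintegral (f := f) (μ := stripMeasure) (p := 2) two_ne_zero
  simp only [NNReal.coe_ofNat, ENNReal.coe_ofNat, ENNReal.rpow_ofNat] at this
  rw [this]
  congr 1; ext p
  rw [← ofReal_norm, ← ENNReal.ofReal_pow (norm_nonneg _), Real.norm_eq_abs, sq_abs]

lemma w_pos {R : ℝ} (h : 0 < R) : 0 < w R := by unfold w; positivity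

lemma wt_sq {p : ℝ × ℝ} (hp : p ∈ strip) : wt eta p ^ 2 = w p.1 ^ 2 * angW p.2 := by
  have hs := sin_two_mul_pos hp.2
  rw [wt, angW, div_pow, ← Real.rpow_natCast (Real.sin (2 * p.2) ^ (eta / 2)) 2, ← Real.rpow_mul hs.le,
    Real.rpow_neg hs.le]
  norm_num
  rw [div_eq_mul_inv]

lemma w_sq {R : ℝ} (h : 0 < R) : w R ^ 2 = ∑ m ∈ Finset.range 5, (Nat.choose 4 m : ℝ) * (R ^ m / R ^ 4) := by
  simp [Finset.sum_range_succ, w, Nat.choose]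
  field_simp
  ring

lemma IsAng.measurable_mode {k : Polynomial ℝ → ℝ → ℝ} (hk : IsAng k) {N : ℕ} {X : ℕ → ℝ → ℝ}
    (hX : ∀ i, Dec (X i)) : ContinuousOn (mode k N X) strip := by
  rw [hk.mode_eq]
  refine continuousOn_finsetSum _ fun i _ => ContinuousOn.mul ?_ ?_
  · exact (hX i).1.comp continuous_fst.continuousOn fun p hp => hp.1
  · exact ((hk.cont _).comp continuous_snd).continuousOn

lemma continuousOn_wt (β : ℝ) : ContinuousOn (wt β) strip := by
  have h1 : ContinuousOn (fun p : ℝ × ℝ => w p.1) strip := by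
    unfold w
    exact ContinuousOn.div (by fun_prop) (by fun_prop) fun p hp => (pow_pos hp.1 2).ne'
  have h2 : ContinuousOn (fun p : ℝ × ℝ => Real.sin (2 * p.2) ^ (β / 2)) strip :=
    ContinuousOn.rpow_const (by fun_prop) fun p hp => Or.inl (sin_two_mul_pos hp.2).ne'
  exact h1.div h2 fun p hp => (Real.rpow_pos_of_pos (sin_two_mul_pos hp.2) _).ne'

lemma wt_pos {β : ℝ} {p : ℝ × ℝ} (hp : p ∈ strip) : 0 < wt β p :=
  div_pos (w_pos hp.1) (Real.rpow_pos_of_pos (sin_two_mul_pos hp.2) _)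

lemma aesm_of_continuousOn {f : ℝ × ℝ → ℝ} (hf : ContinuousOn f strip) :
    AEStronglyMeasurable f stripMeasure := hf.aestronglyMeasurable measurableSet_strip

/-- Weighted angular square integrals of a combination of modes, as a quadratic form in the coefficients. -/
lemma IW_mode {k : Polynomial ℝ → ℝ → ℝ} (hk : IsAng k) (N : ℕ) (x : ℕ → ℝ) :
    IW (fun θ => k (fam N x) θ ^ 2) = ∑ i ∈ Finset.range N, ∑ j ∈ Finset.range N,
      IW (fun θ => k (eigenpoly (i + 1)) θ * k (eigenpoly (j + 1)) θ) * (x i * x j) := by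
  have e : (fun θ => k (fam N x) θ ^ 2 * angW θ) = fun θ => ∑ i ∈ Finset.range N,
      ∑ j ∈ Finset.range N, (x i * x j) * (k (eigenpoly (i + 1)) θ * k (eigenpoly (j + 1)) θ * angW θ) := by
    ext θ
    rw [hk.fam, sq, Finset.sum_mul_sum, Finset.sum_mul]
    refine Finset.sum_congr rfl fun i _ => ?_
    rw [Finset.sum_mul]
    refine Finset.sum_congr rfl fun j _ => ?_
    ring
  have hi : ∀ i j, IntervalIntegrable (fun θ => (x i * x j) *
      (k (eigenpoly (i + 1)) θ * k (eigenpoly (j + 1)) θ * angW θ)) volume 0 (Real.pi / 2) := fun i j =>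
    (angW_mul_intervalIntegrable ((hk.cont _).mul (hk.cont _))).const_mul _
  have hi' : ∀ i, IntervalIntegrable (fun θ => ∑ j ∈ Finset.range N, (x i * x j) *
      (k (eigenpoly (i + 1)) θ * k (eigenpoly (j + 1)) θ * angW θ)) volume 0 (Real.pi / 2) := by
    intro i
    have := IntervalIntegrable.sum (Finset.range N) fun j _ => hi i j
    rwa [show (∑ j ∈ Finset.range N, fun θ => (x i * x j) *
      (k (eigenpoly (i + 1)) θ * k (eigenpoly (j + 1)) θ * angW θ)) = _ from
      funext fun θ => Finset.sum_apply θ _ _] at this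
  rw [IW, e, intervalIntegral.integral_finsetSum fun i _ => hi' i]
  refine Finset.sum_congr rfl fun i _ => ?_
  rw [intervalIntegral.integral_finsetSum fun j _ => hi i j]
  refine Finset.sum_congr rfl fun j _ => ?_
  rw [intervalIntegral.integral_const_mul, IW]; ring

lemma IW_mode_integrable {k : Polynomial ℝ → ℝ → ℝ} (hk : IsAng k) {N : ℕ} {X : ℕ → ℝ → ℝ}
    (hX : ∀ i, Dec (X i)) {m : ℕ} (hm : m ≤ 4) :
    IntegrableOn (fun R => R ^ m / R ^ 4 * IW (fun θ => k (fam N fun i => X i R) θ ^ 2)) (Ioi 0) := by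
  simp_rw [IW_mode hk]
  simp_rw [Finset.mul_sum]
  refine integrable_finsetSum _ fun i _ => integrable_finsetSum _ fun j _ => ?_
  have := ((hX i).integrableOn (hX j) hm).const_mul
    (IW (fun θ => k (eigenpoly (i + 1)) θ * k (eigenpoly (j + 1)) θ))
  refine this.congr (Eventually.of_forall fun R => ?_)
  simp only []; ring

/-- The weighted norm of a finite sum of modes as an iterated integral. -/
lemma nrm_mode_sq {k : Polynomial ℝ → ℝ → ℝ} (hk : IsAng k) {N : ℕ} {X : ℕ → ℝ → ℝ}
    (hX : ∀ i, Dec (X i)) :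
    nrm eta (mode k N X) ^ 2 = ENNReal.ofReal (∑ m ∈ Finset.range 5, (Nat.choose 4 m : ℝ) *
      ∫ R in Ioi (0 : ℝ), R ^ m / R ^ 4 * IW (fun θ => k (fam N fun i => X i R) θ ^ 2)) := by
  have hcont : ContinuousOn (fun p => mode k N X p * wt eta p) strip :=
    (hk.measurable_mode hX).mul (continuousOn_wt eta)
  rw [nrm, eLpNorm_two_sq]
  have hm : AEMeasurable (fun p => ENNReal.ofReal ((mode k N X p * wt eta p) ^ 2)) stripMeasure :=
    ((aesm_of_continuousOn hcont).aemeasurable.pow_const 2).ennreal_ofReal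
  rw [stripMeasure_eq_prod] at hm ⊢
  rw [lintegral_prod _ hm]
  have inner : ∀ R ∈ Ioi (0 : ℝ), ∫⁻ θ in Ioo 0 (Real.pi / 2),
      ENNReal.ofReal ((mode k N X (R, θ) * wt eta (R, θ)) ^ 2)
      = ENNReal.ofReal (w R ^ 2 * IW (fun θ => k (fam N fun i => X i R) θ ^ 2)) := by
    intro R hR
    have hi : IntegrableOn (fun θ => w R ^ 2 * (k (fam N fun i => X i R) θ ^ 2 * angW θ))
        (Ioo 0 (Real.pi / 2)) := by
      rw [← integrableOn_Ioc_iff_integrableOn_Ioo,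
        ← intervalIntegrable_iff_integrableOn_Ioc_of_le (by positivity)]
      exact (angW_mul_intervalIntegrable ((hk.cont _).pow 2)).const_mul _
    rw [IW, ← intervalIntegral.integral_const_mul, intervalIntegral.integral_of_le (by positivity),
      integral_Ioc_eq_integral_Ioo, ofReal_integral_eq_lintegral_ofReal hi]
    · refine setLIntegral_congr_fun measurableSet_Ioo fun θ hθ => ?_
      have := wt_sq (p := (R, θ)) ⟨hR, hθ⟩
      simp only [mul_pow, this, mode]
      congr 1; ring
    · refine (ae_restrict_mem measurableSet_Ioo).mono fun θ hθ => ?_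
      have := angW_nonneg (θ := θ) ⟨hθ.1.le, hθ.2.le⟩
      simp only [Pi.zero_apply]; positivity
  rw [setLIntegral_congr_fun measurableSet_Ioi inner]
  have hsum : ∀ R ∈ Ioi (0 : ℝ), w R ^ 2 * IW (fun θ => k (fam N fun i => X i R) θ ^ 2)
      = ∑ m ∈ Finset.range 5, (Nat.choose 4 m : ℝ) *
        (R ^ m / R ^ 4 * IW (fun θ => k (fam N fun i => X i R) θ ^ 2)) := by
    intro R hR
    rw [w_sq hR, Finset.sum_mul]
    exact Finset.sum_congr rfl fun m _ => by ring
  have hint : ∀ m ∈ Finset.range 5, IntegrableOn (fun R => (Nat.choose 4 m : ℝ) *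
      (R ^ m / R ^ 4 * IW (fun θ => k (fam N fun i => X i R) θ ^ 2))) (Ioi 0) := fun m hm =>
    (IW_mode_integrable hk hX (by simp at hm; omega)).const_mul _
  rw [← ofReal_integral_eq_lintegral_ofReal]
  · rw [setIntegral_congr_fun measurableSet_Ioi hsum, integral_finsetSum _ hint]
    simp_rw [integral_const_mul]
  · exact (integrable_finsetSum _ hint).congr
      ((ae_restrict_mem measurableSet_Ioi).mono fun R hR => (hsum R hR).symm)
  · exact (ae_restrict_mem measurableSet_Ioi).mono fun R hR =>
      mul_nonneg (sq_nonneg _) (IW_nonneg fun θ _ => sq_nonneg _)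

lemma IW_mono {g h : ℝ → ℝ} (hg : Continuous g) (hh : Continuous h)
    (hle : ∀ θ ∈ Icc 0 (Real.pi / 2), g θ ≤ h θ) : IW g ≤ IW h :=
  intervalIntegral.integral_mono_on (by positivity) (angW_mul_intervalIntegrable hg)
    (angW_mul_intervalIntegrable hh) fun θ hθ => mul_le_mul_of_nonneg_right (hle θ hθ) (angW_nonneg hθ)

lemma IW_kU (p : Polynomial ℝ) : IW (fun θ => kU p θ ^ 2) = Aw p p := by
  unfold Aw kU; congr 1; ext θ; ring

lemma IW_kT_le (p : Polynomial ℝ) : IW (fun θ => kT p θ ^ 2) ≤ 8 * E0 p + 2 * E1 p := by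
  have h0 := ang_continuous p
  have h1 := ang_continuous p.derivative
  rw [E0, E1, ← IW_const_mul, ← IW_const_mul, ← IW_add (by fun_prop) (by fun_prop)]
  refine IW_mono ((isAng_kT.cont p).pow 2) (by fun_prop) fun θ _ => ?_
  have hc := Real.cos_sq_le_one (2 * θ)
  have : kT p θ ^ 2 ≤ 2 * (2 * Real.cos (2 * θ) * ang p θ) ^ 2
      + 2 * (Real.sin (2 * θ) ^ 2 * ang p.derivative θ) ^ 2 := by
    unfold kT
    nlinarith [sq_nonneg (2 * Real.cos (2 * θ) * ang p θ - Real.sin (2 * θ) ^ 2 * ang p.derivative θ)]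
  nlinarith [mul_le_mul_of_nonneg_right hc (sq_nonneg (ang p θ))]

lemma IW_kY_le (p : Polynomial ℝ) : IW (fun θ => kY p θ ^ 2) ≤ 8 * E0 p + 8 * E2 p := by
  have h0 := ang_continuous p
  have h1 := ang_continuous p.derivative
  rw [E0, E2, ← IW_const_mul, ← IW_const_mul, ← IW_add (by fun_prop) (by fun_prop)]
  refine IW_mono ((isAng_kY.cont p).pow 2) (by fun_prop) fun θ _ => ?_
  have hc := Real.cos_sq_le_one θ
  have : kY p θ ^ 2 ≤ 2 * (2 * Real.cos θ * ang p θ) ^ 2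
      + 2 * (2 * Real.sin θ * Real.sin (2 * θ) * ang p.derivative θ) ^ 2 := by
    unfold kY
    nlinarith [sq_nonneg (2 * Real.cos θ * ang p θ - 2 * Real.sin θ * Real.sin (2 * θ) * ang p.derivative θ)]
  nlinarith [mul_le_mul_of_nonneg_right hc (sq_nonneg (ang p θ))]

/-- The square of the constant of the a priori estimate. -/
def apC2 : ℝ := 600 * (energyC * (1 + bigM)) + 24

lemma apC2_pos : 0 < apC2 := by norm_num [apC2, energyC, bigM]

/-- The constant of the a priori estimate. -/
def apC : ℝ≥0∞ := ENNReal.ofReal (Real.sqrt apC2)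

/-- A finite sum of modes solving the equation: `c₁`, `c₂` stand for the first two derivatives
`(α R ∂_R) c`, `(α R ∂_R)² c` of the coefficients. -/
structure NiceSol (α : ℝ) (f c c₁ c₂ : ℕ → ℝ → ℝ) : Prop where
  hf : ∀ i, Dec (f i)
  hc : ∀ i, Dec (c i)
  hc₁ : ∀ i, Dec (c₁ i)
  hc₂ : ∀ i, Dec (c₂ i)
  dc : ∀ i R, 0 < R → HasDerivAt (c i) (α⁻¹ * c₁ i R / R) R
  dc₁ : ∀ i R, 0 < R → HasDerivAt (c₁ i) (α⁻¹ * c₂ i R / R) R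
  eq : ∀ i R, 0 < R → f i R = -c₂ i R - 5 * c₁ i R + lam (i + 1) * c i R

/-- The a priori estimate for the coefficients `X` under a map `k` into functions of the angle, when its
angular norm is controlled by the energy and the right-hand side. -/
lemma nrm_mode_le {α : ℝ} (hα0 : 0 < α) (hα : α ≤ 1 / 4) {f c c₁ c₂ : ℕ → ℝ → ℝ}
    (h : NiceSol α f c c₁ c₂) (N : ℕ) {k : Polynomial ℝ → ℝ → ℝ} (hk : IsAng k) {X : ℕ → ℝ → ℝ}
    (hX : ∀ i, Dec (X i))
    (hle : ∀ R, 0 < R → IW (fun θ => k (fam N fun i => X i R) θ ^ 2) ≤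
      600 * (aForm (fam N fun i => c₂ i R) (fam N fun i => c₂ i R)
      + (E0 (fam N fun i => c₁ i R) + E1 (fam N fun i => c₁ i R))
      + (E0 (fam N fun i => c i R) + E1 (fam N fun i => c i R)))
      + 24 * Aw (fam N fun i => f i R) (fam N fun i => f i R)) :
    nrm eta (mode k N X) ≤ apC * nrm eta (mode kU N f) := by
  have key : ∀ m ∈ Finset.range 5,
      ∫ R in Ioi (0 : ℝ), R ^ m / R ^ 4 * IW (fun θ => k (fam N fun i => X i R) θ ^ 2) ≤
      apC2 * ∫ R in Ioi (0 : ℝ), R ^ m / R ^ 4 * IW (fun θ => kU (fam N fun i => f i R) θ ^ 2) := by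
    intro m hm
    have hm : m ≤ 4 := by simp at hm; omega
    have i1 := IW_mode_integrable hk (N := N) hX hm
    have i2 := IW_mode_integrable isAng_kU (N := N) h.hf hm
    have := energy_estimate hα0 hα (N := N) hm h.hf h.hc h.hc₁ h.hc₂ h.dc h.dc₁ h.eq
      (G := fun R => 1 / 600 * (IW (fun θ => k (fam N fun i => X i R) θ ^ 2)
        - 24 * IW (fun θ => kU (fam N fun i => f i R) θ ^ 2)))
      (((i1.sub (i2.const_mul 24)).const_mul (1 / 600)).congr
        (Eventually.of_forall fun R => by simp only [Pi.sub_apply]; ring)) (fun R hR => by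
        have := hle R hR
        rw [IW_kU]; linarith)
    have e : ∫ R in Ioi (0 : ℝ), R ^ m / R ^ 4 * (1 / 600 * (IW (fun θ => k (fam N fun i => X i R) θ ^ 2)
        - 24 * IW (fun θ => kU (fam N fun i => f i R) θ ^ 2)))
        = 1 / 600 * (∫ R in Ioi (0 : ℝ), R ^ m / R ^ 4 * IW (fun θ => k (fam N fun i => X i R) θ ^ 2))
          - 24 / 600 * ∫ R in Ioi (0 : ℝ), R ^ m / R ^ 4 * IW (fun θ => kU (fam N fun i => f i R) θ ^ 2) := by
      rw [← integral_const_mul, ← integral_const_mul, ← integral_sub (i1.const_mul _) (i2.const_mul _)]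
      congr 1; ext R; ring
    have r : RI m N f f ≤ (1 + bigM) *
        ∫ R in Ioi (0 : ℝ), R ^ m / R ^ 4 * IW (fun θ => kU (fam N fun i => f i R) θ ^ 2) := by
      rw [RI, ← integral_const_mul]
      refine setIntegral_mono_on (RI_integrable hm h.hf h.hf) (i2.const_mul _) measurableSet_Ioi
        fun R hR => ?_
      have hR : (0 : ℝ) < R := hR
      rw [IW_kU, mul_left_comm]
      exact mul_le_mul_of_nonneg_left (aForm_le_Aw _) (by positivity)
    rw [e] at this
    have hE : 0 ≤ energyC := by norm_num [energyC, bigM]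
    have r' := mul_le_mul_of_nonneg_left r hE
    rw [apC2]
    linarith
  have hsq : nrm eta (mode k N X) ^ 2 ≤ (apC * nrm eta (mode kU N f)) ^ 2 := by
    rw [mul_pow, nrm_mode_sq hk hX, nrm_mode_sq isAng_kU h.hf, apC,
      ← ENNReal.ofReal_pow (Real.sqrt_nonneg _), Real.sq_sqrt apC2_pos.le,
      ← ENNReal.ofReal_mul apC2_pos.le]
    refine ENNReal.ofReal_le_ofReal ?_
    rw [Finset.mul_sum]
    refine Finset.sum_le_sum fun m hm => ?_
    have := mul_le_mul_of_nonneg_left (key m hm) (Nat.cast_nonneg (Nat.choose 4 m) : (0 : ℝ) ≤ _)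
    linarith
  exact (ENNReal.pow_le_pow_left_iff two_ne_zero).1 hsq

/-- The a priori estimate for finite sums of modes. -/
lemma NiceSol.nrm_le {α : ℝ} (hα0 : 0 < α) (hα : α ≤ 1 / 4) {f c c₁ c₂ : ℕ → ℝ → ℝ}
    (h : NiceSol α f c c₁ c₂) (N : ℕ) :
    nrm eta (mode kU N c) ≤ apC * nrm eta (mode kU N f) ∧
    nrm eta (mode kU N c₁) ≤ apC * nrm eta (mode kU N f) ∧
    nrm eta (mode kU N c₂) ≤ apC * nrm eta (mode kU N f) ∧
    nrm eta (mode kT N c) ≤ apC * nrm eta (mode kU N f) ∧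
    nrm eta (mode kT N c₁) ≤ apC * nrm eta (mode kU N f) ∧
    nrm eta (mode kY N c) ≤ apC * nrm eta (mode kU N f) := by
  have nn : ∀ p : Polynomial ℝ, 0 ≤ E0 p ∧ 0 ≤ E1 p ∧ 0 ≤ aForm p p ∧ 0 ≤ Aw p p ∧ Aw p p ≤ E0 p ∧
      Aw p p ≤ aForm p p := fun p =>
    ⟨E0_nonneg p, E1_nonneg p, aForm_self_nonneg p, Aw_self_nonneg p, Aw_le_E0 p, Aw_le_aForm p⟩
  refine ⟨nrm_mode_le hα0 hα h N isAng_kU h.hc fun R hR => ?_,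
    nrm_mode_le hα0 hα h N isAng_kU h.hc₁ fun R hR => ?_,
    nrm_mode_le hα0 hα h N isAng_kU h.hc₂ fun R hR => ?_,
    nrm_mode_le hα0 hα h N isAng_kT h.hc fun R hR => ?_,
    nrm_mode_le hα0 hα h N isAng_kT h.hc₁ fun R hR => ?_,
    nrm_mode_le hα0 hα h N isAng_kY h.hc fun R hR => ?_⟩
  all_goals
    obtain ⟨a1, a2, a3, a4, a5, a6⟩ := nn (fam N fun i => c i R)
    obtain ⟨b1, b2, b3, b4, b5, b6⟩ := nn (fam N fun i => c₁ i R)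
    obtain ⟨d1, d2, d3, d4, d5, d6⟩ := nn (fam N fun i => c₂ i R)
    obtain ⟨-, -, -, f4, -, -⟩ := nn (fam N fun i => f i R)
  · rw [IW_kU]; linarith
  · rw [IW_kU]; linarith
  · rw [IW_kU]; linarith
  · refine (IW_kT_le _).trans ?_; linarith
  · refine (IW_kT_le _).trans ?_; linarith
  · refine (IW_kY_le _).trans ?_
    have e2 := E2_le (fam N fun i => c i R)
    have hΛ : angOp (fam N fun i => c i R) = fam N (fun i => f i R)
        + (fam N (fun i => c₂ i R) + Polynomial.C 5 * fam N fun i => c₁ i R) := by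
      rw [angOp_fam, ← fam_smul, ← fam_add, ← fam_add]
      congr 1; ext i; rw [h.eq i R hR]; ring
    have h3 : Aw (angOp (fam N fun i => c i R)) (angOp (fam N fun i => c i R)) ≤
        3 * Aw (fam N fun i => f i R) (fam N fun i => f i R)
        + (3 * Aw (fam N fun i => c₂ i R) (fam N fun i => c₂ i R)
        + 75 * Aw (fam N fun i => c₁ i R) (fam N fun i => c₁ i R)) := by
      rw [hΛ]
      have c0 := ang_continuous (fam N fun i => f i R)
      have c1 := ang_continuous (fam N fun i => c₂ i R)
      have c2 := ang_continuous (fam N fun i => c₁ i R)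
      have c3 := ang_continuous (fam N (fun i => f i R)
        + (fam N (fun i => c₂ i R) + Polynomial.C 5 * fam N fun i => c₁ i R))
      rw [Aw, Aw, Aw, Aw, ← IW_const_mul, ← IW_const_mul, ← IW_const_mul,
        ← IW_add (by fun_prop) (by fun_prop), ← IW_add (by fun_prop) (by fun_prop)]
      refine IW_mono (by fun_prop) (by fun_prop) fun θ _ => ?_
      have hs : ang (fam N (fun i => f i R)
        + (fam N (fun i => c₂ i R) + Polynomial.C 5 * fam N fun i => c₁ i R)) θ
        = ang (fam N fun i => f i R) θ + ang (fam N fun i => c₂ i R) θ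
          + 5 * ang (fam N fun i => c₁ i R) θ := by simp [ang]; ring
      rw [hs]
      set x := ang (fam N fun i => f i R) θ
      set y := ang (fam N fun i => c₂ i R) θ
      set z := ang (fam N fun i => c₁ i R) θ
      have : (x + y + 5 * z) * (x + y + 5 * z) ≤ 3 * (x * x) + 3 * (y * y) + 75 * (z * z) := by
        nlinarith [sq_nonneg (x - y), sq_nonneg (x - 5 * z), sq_nonneg (y - 5 * z)]
      nlinarith [mul_le_mul_of_nonneg_right this (sq_nonneg (Real.sin (2 * θ)))]
    linarith

/-! ### Calculus of finite sums of modes -/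

lemma HasWeakDeriv.zero (v : ℝ × ℝ) : HasWeakDeriv v (fun _ => 0) (fun _ => 0) :=
  ⟨continuousOn_const.locallyIntegrableOn measurableSet_strip,
    continuousOn_const.locallyIntegrableOn measurableSet_strip, fun φ _ => by simp⟩

lemma HasWeakDeriv.sum {v : ℝ × ℝ} {ι : Type*} (s : Finset ι) {f g : ι → ℝ × ℝ → ℝ}
    (h : ∀ i, HasWeakDeriv v (f i) (g i)) :
    HasWeakDeriv v (fun p => ∑ i ∈ s, f i p) (fun p => ∑ i ∈ s, g i p) := by
  classical
  induction s using Finset.induction_on with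
  | empty => simpa using HasWeakDeriv.zero v
  | insert a s ha ih =>
    simp only [Finset.sum_insert ha]
    exact (h a).add ih

lemma IsAng.hasWeakDeriv_dirR {k : Polynomial ℝ → ℝ → ℝ} (hk : IsAng k) (N : ℕ) {c d : ℕ → ℝ → ℝ}
    (hkd : ∀ p, Differentiable ℝ (k p))
    (hd : ∀ i R, 0 < R → HasDerivAt (c i) (d i R) R) (hc : ∀ i, ContinuousOn (d i) (Ioi 0)) :
    HasWeakDeriv dirR (mode k N c) (mode k N d) := by
  rw [hk.mode_eq, hk.mode_eq]
  refine HasWeakDeriv.sum _ fun i => ?_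
  have hD : ∀ p ∈ strip, HasFDerivAt (fun p : ℝ × ℝ => c i p.1 * k (eigenpoly (i + 1)) p.2) _ p :=
    fun p hp => (hasFDerivAt_comp_fst (hd i p.1 hp.1)).mul
      (hasFDerivAt_comp_snd (hkd (eigenpoly (i + 1)) p.2).hasDerivAt)
  refine hasWeakDeriv_of_differentiableAt (fun p hp => (hD p hp).differentiableAt) (fun p hp => ?_) ?_
  · rw [(hD p hp).fderiv]; simp [dirR]; ring
  · exact ((hc i).comp continuous_fst.continuousOn fun p hp => hp.1).mul
      ((hk.cont _).comp continuous_snd).continuousOn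

lemma IsAng.hasWeakDeriv_dirTheta {k k' : Polynomial ℝ → ℝ → ℝ} (hk : IsAng k) (hk' : IsAng k')
    (N : ℕ) {c : ℕ → ℝ → ℝ} (hd : ∀ p θ, HasDerivAt (k p) (k' p θ) θ)
    (hc : ∀ i R, 0 < R → DifferentiableAt ℝ (c i) R) :
    HasWeakDeriv dirTheta (mode k N c) (mode k' N c) := by
  rw [hk.mode_eq, hk'.mode_eq]
  refine HasWeakDeriv.sum _ fun i => ?_
  have hD : ∀ p ∈ strip, HasFDerivAt (fun p : ℝ × ℝ => c i p.1 * k (eigenpoly (i + 1)) p.2) _ p :=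
    fun p hp => (hasFDerivAt_comp_fst (hc i p.1 hp.1).hasDerivAt).mul
      (hasFDerivAt_comp_snd (hd (eigenpoly (i + 1)) p.2))
  refine hasWeakDeriv_of_differentiableAt (fun p hp => (hD p hp).differentiableAt) (fun p hp => ?_) ?_
  · rw [(hD p hp).fderiv]; simp [dirTheta]
  · exact (ContinuousOn.comp (t := Ioi 0) (fun R hR => (hc i R hR).continuousAt.continuousWithinAt)
      continuous_fst.continuousOn fun p hp => hp.1).mul
      ((hk'.cont _).comp continuous_snd).continuousOn

lemma hasDerivAt_kU (p : Polynomial ℝ) (θ : ℝ) : HasDerivAt (kU p) (kT p θ) θ := by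
  refine ((hasDerivAt_sin_two_mul θ).mul (hasDerivAt_ang p θ)).congr_deriv ?_
  rw [kT]; ring

/-- The angular equation for `kU p`, with the derivative of `kU p / cos θ` singled out. -/
lemma hasDerivAt_kT (p : Polynomial ℝ) (θ : ℝ) :
    HasDerivAt (kT p) (Real.sin θ * kY p θ - 5 * kU p θ - kU (angOp p) θ) θ := by
  refine ((((hasDerivAt_cos_two_mul θ).const_mul 2).mul (hasDerivAt_ang p θ)).add
    (((hasDerivAt_sin_two_mul θ).pow 2).mul (hasDerivAt_ang p.derivative θ))).congr_deriv ?_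
  simp only [kY, kU, ang_angOp]
  have h1 : Real.sin (2 * θ) = 2 * Real.sin θ * Real.cos θ := Real.sin_two_mul θ
  have h2 := cos_two_mul_eq θ
  rw [h2, Pi.pow_apply]
  linear_combination ang p θ * h1

lemma cos_sq_mul_kY (p : Polynomial ℝ) (θ : ℝ) :
    Real.cos θ ^ 2 * kY p θ = Real.cos θ * kT p θ + Real.sin θ * kU p θ := by
  simp only [kY, kU, kT]
  have h1 : Real.sin (2 * θ) = 2 * Real.sin θ * Real.cos θ := Real.sin_two_mul θ
  rw [Real.cos_two_mul, h1]
  have h2 := Real.sin_sq_add_cos_sq θ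
  linear_combination (-2 * Real.cos θ * ang p θ) * h2

lemma isAng_kT' : IsAng fun p θ => Real.sin θ * kY p θ - 5 * kU p θ - kU (angOp p) θ where
  cont p := by
    have := isAng_kY.cont p; have := isAng_kU.cont p; have := isAng_kU.cont (angOp p); fun_prop
  add p q θ := by simp only [angOp_add, isAng_kY.add, isAng_kU.add]; ring
  smul c p θ := by simp only [angOp_C_mul, isAng_kY.smul, isAng_kU.smul]; ring

lemma mode_smul {k : Polynomial ℝ → ℝ → ℝ} (hk : IsAng k) (N : ℕ) (a : ℝ → ℝ) (X : ℕ → ℝ → ℝ) :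
    mode k N (fun i R => a R * X i R) = fun p => a p.1 * mode k N X p := by
  ext p; simp only [mode, fam_smul, hk.smul]

lemma mode_add {k : Polynomial ℝ → ℝ → ℝ} (hk : IsAng k) (N : ℕ) (X Y : ℕ → ℝ → ℝ) :
    mode k N (fun i R => X i R + Y i R) = fun p => mode k N X p + mode k N Y p := by
  ext p; simp only [mode, fam_add, hk.add]

lemma mode_eq_of_le {k : Polynomial ℝ → ℝ → ℝ} (hk : IsAng k) {N N' : ℕ} {X : ℕ → ℝ → ℝ} (h : N ≤ N')
    (hX : ∀ i, N ≤ i → X i = 0) : mode k N X = mode k N' X := by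
  rw [hk.mode_eq, hk.mode_eq]
  ext p
  refine Finset.sum_subset (Finset.range_mono h) fun i _ hi => ?_
  rw [hX i (by simpa using hi)]; simp

lemma NiceSol.sub {α : ℝ} {f c c₁ c₂ g d d₁ d₂ : ℕ → ℝ → ℝ} (h : NiceSol α f c c₁ c₂)
    (h' : NiceSol α g d d₁ d₂) : NiceSol α (fun i R => f i R + -1 * g i R) (fun i R => c i R + -1 * d i R)
      (fun i R => c₁ i R + -1 * d₁ i R) (fun i R => c₂ i R + -1 * d₂ i R) where
  hf i := (h.hf i).add ((h'.hf i).const_mul _)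
  hc i := (h.hc i).add ((h'.hc i).const_mul _)
  hc₁ i := (h.hc₁ i).add ((h'.hc₁ i).const_mul _)
  hc₂ i := (h.hc₂ i).add ((h'.hc₂ i).const_mul _)
  dc i R hR := ((h.dc i R hR).add ((h'.dc i R hR).const_mul (-1))).congr_deriv (by ring)
  dc₁ i R hR := ((h.dc₁ i R hR).add ((h'.dc₁ i R hR).const_mul (-1))).congr_deriv (by ring)
  eq i R hR := by rw [h.eq i R hR, h'.eq i R hR]; ring

lemma IsTestR.dec {g : ℝ → ℝ} (hg : IsTestR g) : Dec g := by
  obtain ⟨r₀, r₁, h0, h01, hz⟩ := hg.exists_bounds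
  obtain ⟨K, hK, hb⟩ := exists_power_bound (a := 4) (b := 4) (by norm_num) (f := g) (k₀ := 0) (k₁ := 0)
    hg.1.continuous.continuousOn h0 h01 (fun R _ hR => by simp [hz R (Or.inl hR)])
    (fun R hR => by simp [hz R (Or.inr hR)])
  exact Dec.of_power_bound hg.1.continuous.continuousOn le_rfl le_rfl hK hb

/-- Each coefficient is given by the Green's function of the radial equation, whose powers have exponents
of modulus at least `4` because `α ≤ 1/4`. -/
lemma exists_niceSol_coeff {α : ℝ} (hα0 : 0 < α) (hα : α ≤ 1 / 4) (i : ℕ) {f : ℝ → ℝ} (hf : IsTestR f) :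
    ∃ c c₁ c₂ : ℝ → ℝ, (Dec c ∧ Dec c₁ ∧ Dec c₂ ∧
      (∀ R, 0 < R → HasDerivAt c (α⁻¹ * c₁ R / R) R) ∧
      (∀ R, 0 < R → HasDerivAt c₁ (α⁻¹ * c₂ R / R) R) ∧
      ∀ R, 0 < R → f R = -c₂ R - 5 * c₁ R + lam (i + 1) * c R) ∧ (f = 0 → c = 0 ∧ c₁ = 0 ∧ c₂ = 0) := by
  by_cases h0 : f = 0
  · have d0 : Dec (0 : ℝ → ℝ) := ⟨continuousOn_const, 0, le_rfl, fun R _ => by simp⟩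
    refine ⟨0, 0, 0, ⟨d0, d0, d0, fun R _ => ?_, fun R _ => ?_, fun R _ => by simp [h0]⟩, fun _ => ⟨rfl, rfl, rfl⟩⟩
    · simp
    · simp
  set n : ℝ := (i : ℝ) + 1 with hn
  have hn1 : 1 ≤ n := by simp [hn]
  have ha : 4 ≤ 2 * n / α := by rw [le_div_iff₀ hα0]; linarith
  have hb : 4 ≤ (2 * n + 5) / α := by rw [le_div_iff₀ hα0]; linarith
  obtain ⟨c, c₁, c₂, s0, s1, s2, d0, d1, e, K, hK, bd⟩ :=
    exists_radial_solution (a := 2 * n / α) (b := (2 * n + 5) / α) (by linarith) hf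
  -- the two exponents are the roots of the indicial equation
  set κ : ℝ := ((4 * n + 5) * α)⁻¹ with hκ
  have D0 : Dec c := Dec.of_power_bound s0.continuousOn ha hb hK fun R hR => (bd R hR).1
  have D1 : Dec c₁ := Dec.of_power_bound s1.continuousOn ha hb hK fun R hR => (bd R hR).2.1
  have D2 : Dec c₂ := Dec.of_power_bound s2.continuousOn ha hb hK fun R hR => (bd R hR).2.2
  refine ⟨fun R => κ * c R, fun R => (κ * α) * c₁ R, fun R => (κ * α ^ 2) * c₂ R,
    ⟨D0.const_mul _, D1.const_mul _, D2.const_mul _, fun R hR => ?_, fun R hR => ?_, fun R hR => ?_⟩,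
    fun h => absurd h h0⟩
  · exact ((d0 R hR).const_mul κ).congr_deriv (by field_simp)
  · exact ((d1 R hR).const_mul (κ * α)).congr_deriv (by field_simp)
  · have e := e R hR
    have h5 : (4 * n + 5) ≠ 0 := by positivity
    have hl : lam (i + 1) = 2 * n * (2 * n + 5) := by rw [lam, hn]; push_cast; ring
    rw [hl, hκ]
    field_simp at e ⊢
    linear_combination e

/-- Every finite family of test functions is the right-hand side of a finite sum of modes. -/
lemma exists_niceSol {α : ℝ} (hα0 : 0 < α) (hα : α ≤ 1 / 4) {f : ℕ → ℝ → ℝ} (hf : ∀ i, IsTestR (f i)) :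
    ∃ c c₁ c₂ : ℕ → ℝ → ℝ, NiceSol α f c c₁ c₂ ∧
      ∀ i, f i = 0 → c i = 0 ∧ c₁ i = 0 ∧ c₂ i = 0 := by
  choose c c₁ c₂ h h0 using fun i => exists_niceSol_coeff hα0 hα i (hf i)
  exact ⟨c, c₁, c₂, ⟨fun i => (hf i).dec, fun i => (h i).1, fun i => (h i).2.1, fun i => (h i).2.2.1,
    fun i => (h i).2.2.2.1, fun i => (h i).2.2.2.2.1, fun i => (h i).2.2.2.2.2⟩, h0⟩

/-- The derivatives of a finite sum of modes, and the equation it satisfies, in the weak sense. -/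
lemma NiceSol.weak {α : ℝ} {f c c₁ c₂ : ℕ → ℝ → ℝ} (h : NiceSol α f c c₁ c₂) (N : ℕ) :
    HasWeakDeriv dirR (mode kU N c) (fun p => α⁻¹ / p.1 * mode kU N c₁ p) ∧
    HasWeakDeriv dirR (mode kU N c₁) (fun p => α⁻¹ / p.1 * mode kU N c₂ p) ∧
    HasWeakDeriv dirTheta (mode kU N c) (mode kT N c) ∧
    HasWeakDeriv dirTheta (mode kU N c₁) (mode kT N c₁) ∧
    HasWeakDeriv dirTheta (mode kT N c) (fun p => Real.sin p.2 * mode kY N c p - 5 * mode kU N c p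
      - (mode kU N f p + mode kU N c₂ p + 5 * mode kU N c₁ p)) := by
  have dU : ∀ p, Differentiable ℝ (kU p) := fun p θ => (hasDerivAt_kU p θ).differentiableAt
  have cont : ∀ {X : ℕ → ℝ → ℝ}, (∀ i, Dec (X i)) → ∀ i, ContinuousOn (fun R => α⁻¹ / R * X i R) (Ioi 0) :=
    fun hX i => (continuousOn_const.div continuousOn_id fun R hR => ne_of_gt hR).mul (hX i).1
  refine ⟨?_, ?_, ?_, ?_, ?_⟩
  · rw [← mode_smul isAng_kU N (fun R => α⁻¹ / R)]
    exact isAng_kU.hasWeakDeriv_dirR N dU (fun i R hR => (h.dc i R hR).congr_deriv (by ring)) (cont h.hc₁)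
  · rw [← mode_smul isAng_kU N (fun R => α⁻¹ / R)]
    exact isAng_kU.hasWeakDeriv_dirR N dU (fun i R hR => (h.dc₁ i R hR).congr_deriv (by ring)) (cont h.hc₂)
  · exact isAng_kU.hasWeakDeriv_dirTheta isAng_kT N hasDerivAt_kU fun i R hR => (h.dc i R hR).differentiableAt
  · exact isAng_kU.hasWeakDeriv_dirTheta isAng_kT N hasDerivAt_kU fun i R hR => (h.dc₁ i R hR).differentiableAt
  · refine (isAng_kT.hasWeakDeriv_dirTheta isAng_kT' N hasDerivAt_kT fun i R hR =>
      (h.dc i R hR).differentiableAt).congr (ae_of_all _ fun _ => rfl) (ae_strip_of_forall fun p hp => ?_)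
    simp only [mode]
    have hΛ : angOp (fam N fun i => c i p.1) = fam N (fun i => f i p.1)
        + (fam N (fun i => c₂ i p.1) + Polynomial.C 5 * fam N fun i => c₁ i p.1) := by
      rw [angOp_fam, ← fam_smul, ← fam_add, ← fam_add]
      congr 1; ext i; rw [h.eq i p.1 hp.1]; ring
    rw [hΛ, isAng_kU.add, isAng_kU.add, isAng_kU.smul]; ring

/-- Sums of modes vanish at the two ends of the angular interval. -/
lemma NiceSol.dirichlet {α : ℝ} {f c c₁ c₂ : ℕ → ℝ → ℝ} (h : NiceSol α f c c₁ c₂) (N : ℕ)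
    {φ : ℝ × ℝ → ℝ} (hφ : IsTest (Ioi 0 ×ˢ univ) φ) :
    ∫ p, mode kU N c p * fderiv ℝ φ p dirTheta ∂stripMeasure = -∫ p, mode kT N c p * φ p ∂stripMeasure := by
  have hpi : (0 : ℝ) ≤ Real.pi / 2 := by positivity
  have int : ∀ {k : Polynomial ℝ → ℝ → ℝ}, IsAng k → ∀ {χ : ℝ × ℝ → ℝ}, IsTest (Ioi 0 ×ˢ univ) χ →
      Integrable (fun p => mode k N c p * χ p) stripMeasure := by
    intro k hk χ hχ
    have hm : ContinuousOn (mode k N c) (Ioi 0 ×ˢ univ) := by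
      rw [hk.mode_eq]
      exact continuousOn_finsetSum _ fun i _ => ((h.hc i).1.comp continuous_fst.continuousOn
        fun p hp => hp.1).mul ((hk.cont _).comp continuous_snd).continuousOn
    have hcont : Continuous fun p => mode k N c p * χ p := by
      rw [continuous_iff_continuousAt]
      intro p
      by_cases hp : p ∈ tsupport χ
      · exact (hm.continuousAt ((isOpen_Ioi.prod isOpen_univ).mem_nhds (hχ.2.2 hp))).mul
          hχ.1.continuous.continuousAt
      · have : (fun p => mode k N c p * χ p) =ᶠ[𝓝 p] fun _ => 0 := by
          filter_upwards [notMem_tsupport_iff_eventuallyEq.1 hp] with q hq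
          simp [hq]
        exact continuousAt_const.congr this.symm
    exact (hcont.integrable_of_hasCompactSupport hχ.2.1.mul_left).restrict
  have i1 := int isAng_kU (hφ.fderiv dirTheta)
  have i2 := int isAng_kT hφ
  rw [stripMeasure_eq_prod] at i1 i2 ⊢
  rw [integral_prod _ i1, integral_prod _ i2, ← integral_neg]
  refine integral_congr_ae (Eventually.of_forall fun R => ?_)
  simp only [mode]
  set P := fam N fun i => c i R
  have hd : ∀ θ, HasDerivAt (fun θ => φ (R, θ)) (fderiv ℝ φ (R, θ) dirTheta) θ := by
    intro θ
    have h1 := (hφ.differentiable (R, θ)).hasFDerivAt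
    have h2 : HasDerivAt (fun θ : ℝ => (R, θ)) ((0 : ℝ), (1 : ℝ)) θ :=
      (hasDerivAt_const θ R).prodMk (hasDerivAt_id θ)
    exact h1.comp_hasDerivAt θ h2
  have hcR : Continuous fun θ : ℝ => (R, θ) := by fun_prop
  have hc1 : Continuous fun θ => fderiv ℝ φ (R, θ) dirTheta :=
    ((hφ.fderiv dirTheta).1.continuous).comp hcR
  have := intervalIntegral.integral_mul_deriv_eq_deriv_mul (a := 0) (b := Real.pi / 2)
    (u := kU P) (v := fun θ => φ (R, θ)) (fun θ _ => hasDerivAt_kU P θ) (fun θ _ => hd θ)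
    ((isAng_kT.cont P).intervalIntegrable _ _) (hc1.intervalIntegrable _ _)
  simp only [intervalIntegral.integral_of_le hpi, integral_Ioc_eq_integral_Ioo] at this
  rw [this]
  simp [kU, show 2 * (Real.pi / 2) = Real.pi by ring]

/-! ### Slices and moments -/

instance : IsFiniteMeasure (volume.restrict (Ioo (0 : ℝ) (Real.pi / 2))) :=
  ⟨by simp⟩

lemma integral_strip {f : ℝ × ℝ → ℝ} (hf : Integrable f stripMeasure) :
    ∫ p, f p ∂stripMeasure = ∫ R in Ioi (0 : ℝ), ∫ θ in Ioo 0 (Real.pi / 2), f (R, θ) := by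
  rw [stripMeasure_eq_prod] at hf ⊢
  exact integral_prod _ hf

lemma IsTestR.memLp {ψ : ℝ → ℝ} (hψ : IsTestR ψ) : MemLp (fun p : ℝ × ℝ => ψ p.1) 2 stripMeasure := by
  rw [stripMeasure_eq_prod]
  exact ((hψ.1.continuous.memLp_of_hasCompactSupport hψ.2.1).restrict _).comp_fst _

lemma IsTestR.exists_abs_le {ψ : ℝ → ℝ} (hψ : IsTestR ψ) : ∃ K, ∀ R, |ψ R| ≤ K := by
  obtain ⟨K, hK⟩ := hψ.2.1.exists_bound_of_continuous hψ.1.continuous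
  exact ⟨K, hK⟩

lemma MemLp.mul_bounded {f b : ℝ × ℝ → ℝ} (hf : MemLp f 2 stripMeasure) (hb : ContinuousOn b strip)
    {K : ℝ} (hK : ∀ p ∈ strip, |b p| ≤ K) : MemLp (fun p => b p * f p) 2 stripMeasure :=
  MemLp.of_le_mul (c := K) hf ((aesm_of_continuousOn hb).mul hf.1) (ae_strip_of_forall fun p hp => by
    rw [norm_mul]; exact mul_le_mul_of_nonneg_right (hK p hp) (norm_nonneg _))

lemma ae_slice_memLp {G : ℝ × ℝ → ℝ} (hG : MemLp G 2 stripMeasure) :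
    ∀ᵐ R ∂(volume.restrict (Ioi (0 : ℝ))),
      IntegrableOn (fun θ => G (R, θ)) (Ioo 0 (Real.pi / 2)) := by
  have h2 := hG.integrable_sq
  have hm := hG.1
  rw [stripMeasure_eq_prod] at h2 hm
  filter_upwards [h2.prod_right_ae, hm.prodMk_left] with R h h'
  exact ((memLp_two_iff_integrable_sq h').2 h).integrable one_le_two

/-- A square integrable function orthogonal to all radial test functions has vanishing slice
integrals. -/
lemma ae_slice_integral_eq_zero {G : ℝ × ℝ → ℝ} (hG : MemLp G 2 stripMeasure)
    (h : ∀ ψ, IsTestR ψ → ∫ p, G p * ψ p.1 ∂stripMeasure = 0) :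
    ∀ᵐ R ∂(volume.restrict (Ioi (0 : ℝ))), ∫ θ in Ioo 0 (Real.pi / 2), G (R, θ) = 0 := by
  set A : ℝ → ℝ := fun R => ∫ θ in Ioo 0 (Real.pi / 2), G (R, θ) with hA
  have hloc : LocallyIntegrableOn A (Ioi 0) := by
    refine (locallyIntegrableOn_iff isOpen_Ioi.isLocallyClosed).2 fun K hK hKc => ?_
    have hle : (volume.restrict K).prod (volume.restrict (Ioo (0 : ℝ) (Real.pi / 2))) ≤ stripMeasure := by
      rw [stripMeasure, strip, Measure.prod_restrict]
      exact Measure.restrict_mono (prod_mono hK le_rfl) le_rfl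
    have : IsFiniteMeasure (volume.restrict K) := ⟨by simpa using hKc.measure_lt_top⟩
    exact ((hG.mono_measure hle).integrable one_le_two).integral_prod_left
  have := isOpen_Ioi.ae_eq_zero_of_integral_contDiff_smul_eq_zero hloc (by
    intro ψ h1 h2 h3
    have hψ : IsTestR ψ := ⟨h1, h2, h3⟩
    have e := h ψ hψ
    have hi : Integrable (fun p => G p * ψ p.1) stripMeasure := hG.integrable_mul hψ.memLp
    rw [stripMeasure_eq_prod] at e hi
    rw [integral_prod _ hi] at e
    simp only [integral_mul_const] at e
    rw [← e, ← setIntegral_eq_integral_of_forall_compl_eq_zero (s := Ioi 0)]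
    · simp only [smul_eq_mul, hA, mul_comm]
    · intro R hR
      rw [image_eq_zero_of_notMem_tsupport fun hh => hR (h3 hh), zero_smul])
  exact (ae_restrict_iff' measurableSet_Ioi).2 this

lemma integrableOn_mul_continuous {H b : ℝ → ℝ} (hH : IntegrableOn H (Ioo 0 (Real.pi / 2)))
    (hb : Continuous b) : IntegrableOn (fun θ => H θ * b θ) (Ioo 0 (Real.pi / 2)) := by
  obtain ⟨K, hK⟩ := (isCompact_Icc (a := (0 : ℝ)) (b := Real.pi / 2)).exists_bound_of_continuousOn
    hb.continuousOn
  exact hH.mul_bdd (c := K) hb.aestronglyMeasurable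
    ((ae_restrict_mem measurableSet_Ioo).mono fun θ hθ => hK θ (Ioo_subset_Icc_self hθ))

/-- Functions on `(0, π/2)` are determined by their moments in `z = sin² θ`. -/
lemma ae_eq_zero_of_moments {H : ℝ → ℝ} (hH : IntegrableOn H (Ioo 0 (Real.pi / 2)))
    (h : ∀ p : Polynomial ℝ, ∫ θ in Ioo 0 (Real.pi / 2), H θ * ang p θ = 0) :
    ∀ᵐ θ ∂(volume.restrict (Ioo 0 (Real.pi / 2))), H θ = 0 := by
  refine (ae_restrict_iff' measurableSet_Ioo).2 ?_
  refine isOpen_Ioo.ae_eq_zero_of_integral_contDiff_smul_eq_zero hH.locallyIntegrableOn ?_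
  intro φ h1 h2 h3
  have hcont : Continuous φ := h1.continuous
  rw [← setIntegral_eq_integral_of_forall_compl_eq_zero (s := Ioo 0 (Real.pi / 2)) (fun θ hθ => by
    rw [image_eq_zero_of_notMem_tsupport fun hh => hθ (h3 hh), zero_smul])]
  have hiφ : IntegrableOn (fun θ => φ θ • H θ) (Ioo 0 (Real.pi / 2)) := by
    obtain ⟨K, hK⟩ := h2.exists_bound_of_continuous hcont
    exact hH.bdd_mul (c := K) hcont.aestronglyMeasurable (Eventually.of_forall hK)
  have hip := fun p => integrableOn_mul_continuous hH (ang_continuous p)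
  set J := ∫ θ in Ioo 0 (Real.pi / 2), |H θ| with hJ
  have hJ0 : 0 ≤ J := integral_nonneg fun _ => abs_nonneg _
  refine abs_eq_zero.1 (le_antisymm (le_of_forall_pos_le_add fun ε hε => ?_) (abs_nonneg _))
  rw [zero_add]
  obtain ⟨p, hp⟩ := exists_polynomial_near_of_continuousOn 0 1 (fun z => φ (Real.arcsin (Real.sqrt z)))
    (by have := Real.continuous_arcsin; fun_prop) (ε / (J + 1)) (by positivity)
  have hpt : ∀ θ ∈ Ioo 0 (Real.pi / 2), |φ θ - ang p θ| ≤ ε / (J + 1) := by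
    intro θ hθ
    have hs := (sin_pos_of_mem hθ).le
    have := hp (Real.sin θ ^ 2) ⟨by positivity, Real.sin_sq_le_one θ⟩
    rw [Real.sqrt_sq hs, Real.arcsin_sin (by linarith [hθ.1, Real.pi_pos]) hθ.2.le] at this
    rw [abs_sub_comm]
    exact this.le
  have e : ∫ θ in Ioo 0 (Real.pi / 2), φ θ • H θ
      = ∫ θ in Ioo 0 (Real.pi / 2), (φ θ - ang p θ) * H θ := by
    have e1 := integral_sub hiφ (hip p)
    rw [h p, sub_zero] at e1
    rw [← e1]
    congr 1; ext θ; simp; ring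
  rw [e]
  calc |∫ θ in Ioo 0 (Real.pi / 2), (φ θ - ang p θ) * H θ|
      ≤ ∫ θ in Ioo 0 (Real.pi / 2), ε / (J + 1) * |H θ| := by
        rw [← Real.norm_eq_abs]
        refine norm_integral_le_of_norm_le (hH.abs.const_mul _)
          ((ae_restrict_mem measurableSet_Ioo).mono fun θ hθ => ?_)
        rw [norm_mul]
        exact mul_le_mul_of_nonneg_right (hpt θ hθ) (norm_nonneg _)
    _ = ε * (J / (J + 1)) := by rw [integral_const_mul]; ring
    _ ≤ ε * 1 := by
        gcongr
        exact (div_le_one (by positivity)).2 (by linarith)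
    _ = ε := mul_one ε

/-- Slices of a function orthogonal to `g(R) Jₙ(sin² θ)` for all `n ∈ S` have vanishing moments. -/
lemma ae_slice_moments {G : ℝ × ℝ → ℝ} (hG : MemLp G 2 stripMeasure) (m : ℕ)
    (h : ∀ n, m ≤ n → ∀ ψ, IsTestR ψ → ∫ p, G p * ang (eigenpoly n) p.2 * ψ p.1 ∂stripMeasure = 0) :
    ∀ᵐ R ∂(volume.restrict (Ioi (0 : ℝ))), ∀ n, m ≤ n →
      ∫ θ in Ioo 0 (Real.pi / 2), G (R, θ) * ang (eigenpoly n) θ = 0 := by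
  refine ae_all_iff.2 fun n => ?_
  by_cases hn : m ≤ n
  · have : MemLp (fun p => G p * ang (eigenpoly n) p.2) 2 stripMeasure := by
      obtain ⟨K, hK⟩ := (isCompact_Icc (a := (0 : ℝ)) (b := Real.pi / 2)).exists_bound_of_continuousOn
        (ang_continuous (eigenpoly n)).continuousOn
      refine (MemLp.mul_bounded hG (b := fun p => ang (eigenpoly n) p.2)
        ((ang_continuous _).comp continuous_snd).continuousOn (K := K)
        fun p hp => hK _ (Ioo_subset_Icc_self hp.2)).ae_eq (ae_of_all _ fun p => mul_comm _ _)
    exact (ae_slice_integral_eq_zero this (h n hn)).mono fun R hR _ => hR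
  · exact ae_of_all _ fun R hh => absurd hh hn

/-- The moment functional. -/
def momentMap {H : ℝ → ℝ} (hH : IntegrableOn H (Ioo 0 (Real.pi / 2))) : Polynomial ℝ →ₗ[ℝ] ℝ where
  toFun p := ∫ θ in Ioo 0 (Real.pi / 2), H θ * ang p θ
  map_add' p q := by
    have hip := fun p => integrableOn_mul_continuous hH (ang_continuous p)
    rw [← integral_add (hip p) (hip q)]
    congr 1; ext θ; simp [ang]; ring
  map_smul' c p := by
    simp only [RingHom.id_apply, smul_eq_mul]
    rw [← integral_const_mul]
    congr 1; ext θ; simp [ang]; ring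

lemma ae_eq_zero_of_eigenpoly_moments {H : ℝ → ℝ} (hH : IntegrableOn H (Ioo 0 (Real.pi / 2)))
    (h : ∀ n, ∫ θ in Ioo 0 (Real.pi / 2), H θ * ang (eigenpoly n) θ = 0) :
    ∀ᵐ θ ∂(volume.restrict (Ioo 0 (Real.pi / 2))), H θ = 0 :=
  ae_eq_zero_of_moments hH fun p => linearMap_eq_zero_of_eigenpoly (ℓ := momentMap hH) h p

/-- If all moments of positive order vanish, the function is a multiple of `sin²(2θ) cos θ`. -/
lemma exists_eq_of_eigenpoly_moments {H : ℝ → ℝ} (hH : IntegrableOn H (Ioo 0 (Real.pi / 2)))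
    (h : ∀ n, 1 ≤ n → ∫ θ in Ioo 0 (Real.pi / 2), H θ * ang (eigenpoly n) θ = 0) :
    ∃ a, ∀ᵐ θ ∂(volume.restrict (Ioo 0 (Real.pi / 2))), H θ = a * (Real.sin (2 * θ) ^ 2 * Real.cos θ) := by
  have hpi : (0 : ℝ) < Real.pi / 2 := by positivity
  have eA : ∀ n, Ac (eigenpoly 0) (eigenpoly n) = ∫ θ in Ioo 0 (Real.pi / 2),
      Real.sin (2 * θ) ^ 2 * Real.cos θ * ang (eigenpoly n) θ := by
    intro n
    rw [Ac, intervalIntegral.integral_of_le hpi.le, integral_Ioc_eq_integral_Ioo]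
    congr 1; ext θ; rw [eigenpoly_zero]; simp [ang]; ring
  have hκ : Ac (eigenpoly 0) (eigenpoly 0) ≠ 0 := by
    refine ne_of_gt (intervalIntegral.intervalIntegral_pos_of_pos_on ?_ (fun θ hθ => ?_) hpi)
    · have := ang_continuous (eigenpoly 0)
      exact (by fun_prop : Continuous _).intervalIntegrable _ _
    · have := sin_two_mul_pos hθ
      have := cos_pos_of_mem hθ
      rw [eigenpoly_zero]; simp only [ang, Polynomial.eval_one]; positivity
  set κ := Ac (eigenpoly 0) (eigenpoly 0)
  set a := (∫ θ in Ioo 0 (Real.pi / 2), H θ * ang (eigenpoly 0) θ) / κ with ha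
  have hc : Continuous fun θ : ℝ => a * (Real.sin (2 * θ) ^ 2 * Real.cos θ) := by fun_prop
  have hci : IntegrableOn (fun θ : ℝ => a * (Real.sin (2 * θ) ^ 2 * Real.cos θ)) (Ioo 0 (Real.pi / 2)) :=
    hc.integrableOn_Icc.mono_set Ioo_subset_Icc_self
  refine ⟨a, (ae_eq_zero_of_eigenpoly_moments (hH.sub hci) fun n => ?_).mono fun θ hθ => sub_eq_zero.1 hθ⟩
  have e1 : ∀ θ, (H - fun θ : ℝ => a * (Real.sin (2 * θ) ^ 2 * Real.cos θ)) θ * ang (eigenpoly n) θ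
      = H θ * ang (eigenpoly n) θ - a * (Real.sin (2 * θ) ^ 2 * Real.cos θ * ang (eigenpoly n) θ) := by
    intro θ; simp only [Pi.sub_apply]; ring
  simp_rw [e1]
  have hc' : Continuous fun θ : ℝ => Real.sin (2 * θ) ^ 2 * Real.cos θ * ang (eigenpoly n) θ := by
    have := ang_continuous (eigenpoly n); fun_prop
  rw [integral_sub (integrableOn_mul_continuous hH (ang_continuous _))
    ((hc'.integrableOn_Icc.mono_set Ioo_subset_Icc_self).const_mul a), integral_const_mul, ← eA]
  rcases Nat.eq_zero_or_pos n with rfl | hn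
  · rw [ha, div_mul_cancel₀ _ hκ, sub_self]
  · rw [h n hn, Ac_eigenpoly hn.ne]; simp

/-! ### Density of finite sums of modes -/

/-- Orthogonality to `cos² θ sin θ`, in weak form. -/
def OrthW (F : ℝ × ℝ → ℝ) : Prop :=
  ∀ ψ, IsTestR ψ → ∫ p, F p * (Real.cos p.2 ^ 2 * Real.sin p.2) * ψ p.1 ∂stripMeasure = 0

/-- The weighted space `L²(w² sin(2θ)^{-β})`. -/
def MemX (β : ℝ) (f : ℝ × ℝ → ℝ) : Prop := MemLp (fun p => f p * wt β p) 2 stripMeasure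

lemma one_le_wt {β : ℝ} (hβ : 0 ≤ β) {p : ℝ × ℝ} (hp : p ∈ strip) : 1 ≤ wt β p := by
  have hs := sin_two_mul_pos hp.2
  have hR : 0 < p.1 := hp.1
  rw [wt, one_le_div (Real.rpow_pos_of_pos hs _)]
  refine (Real.rpow_le_one hs.le (Real.sin_le_one _) (by positivity)).trans ?_
  rw [w, one_le_div (by positivity)]
  nlinarith

lemma MemX.aesm {β : ℝ} {f : ℝ × ℝ → ℝ} (hf : MemX β f) : AEStronglyMeasurable f stripMeasure := by
  have h1 : AEStronglyMeasurable (fun p => (wt β p)⁻¹) stripMeasure :=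
    aesm_of_continuousOn ((continuousOn_wt β).inv₀ fun p hp => (wt_pos hp).ne')
  refine (hf.1.mul h1).congr (ae_strip_of_forall fun p hp => ?_)
  have := (wt_pos (β := β) hp).ne'
  simp only [Pi.mul_apply]; field_simp

lemma eLpNorm_le_nrm {β : ℝ} (hβ : 0 ≤ β) (f : ℝ × ℝ → ℝ) : eLpNorm f 2 stripMeasure ≤ nrm β f :=
  eLpNorm_mono_ae (ae_strip_of_forall fun p hp => by
    rw [norm_mul, Real.norm_of_nonneg (wt_pos hp).le]
    exact le_mul_of_one_le_right (norm_nonneg _) (one_le_wt hβ hp))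

lemma MemX.memLp {β : ℝ} (hβ : 0 ≤ β) {f : ℝ × ℝ → ℝ} (hf : MemX β f) : MemLp f 2 stripMeasure :=
  ⟨hf.aesm, (eLpNorm_le_nrm hβ f).trans_lt hf.2⟩

lemma memX_mode {k : Polynomial ℝ → ℝ → ℝ} (hk : IsAng k) {N : ℕ} {X : ℕ → ℝ → ℝ}
    (hX : ∀ i, Dec (X i)) : MemX eta (mode k N X) := by
  refine ⟨aesm_of_continuousOn ((hk.measurable_mode hX).mul (continuousOn_wt eta)), ?_⟩
  have h := nrm_mode_sq hk (N := N) hX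
  have h2 : nrm eta (mode k N X) ^ 2 < ⊤ := by rw [h]; exact ENNReal.ofReal_lt_top
  by_contra hn
  rw [nrm, not_lt_top_iff.1 hn] at h2
  simp at h2

/-- Finite families of radial test functions. -/
def IsFam (N : ℕ) (f : ℕ → ℝ → ℝ) : Prop := (∀ i, IsTestR (f i)) ∧ ∀ i, N ≤ i → f i = 0

lemma IsTestR.zero : IsTestR 0 :=
  ⟨contDiff_const, HasCompactSupport.zero, by simp [tsupport]⟩

lemma IsTestR.add {f g : ℝ → ℝ} (hf : IsTestR f) (hg : IsTestR g) : IsTestR (fun R => f R + g R) :=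
  ⟨hf.1.add hg.1, hf.2.1.add hg.2.1, (tsupport_add f g).trans (union_subset hf.2.2 hg.2.2)⟩

lemma IsTestR.const_mul {f : ℝ → ℝ} (hf : IsTestR f) (c : ℝ) : IsTestR (fun R => c * f R) :=
  IsTestR.mul_contDiffOn contDiffOn_const hf

/-- Finite sums of modes, as a subspace of `L²` through multiplication by the weight. -/
def modeSpace : Submodule ℝ (Lp ℝ 2 stripMeasure) where
  carrier := {x | ∃ N f, IsFam N f ∧ x =ᵐ[stripMeasure] fun p => mode kU N f p * wt eta p}
  zero_mem' := ⟨0, 0, ⟨fun _ => IsTestR.zero, fun _ _ => rfl⟩, by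
    filter_upwards [Lp.coeFn_zero ℝ 2 stripMeasure] with p hp
    rw [hp, isAng_kU.mode_eq]; simp⟩
  add_mem' := by
    rintro x y ⟨N, f, hf, hx⟩ ⟨M, g, hg, hy⟩
    have hf' : mode kU N f = mode kU (max N M) f := mode_eq_of_le isAng_kU (le_max_left _ _) hf.2
    have hg' : mode kU M g = mode kU (max N M) g := mode_eq_of_le isAng_kU (le_max_right _ _) hg.2
    refine ⟨max N M, fun i R => f i R + g i R, ⟨fun i => (hf.1 i).add (hg.1 i), fun i hi => ?_⟩, ?_⟩
    · ext R; simp [hf.2 i (le_of_max_le_left hi), hg.2 i (le_of_max_le_right hi)]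
    · filter_upwards [Lp.coeFn_add x y, hx, hy] with p h1 h2 h3
      rw [h1, Pi.add_apply, h2, h3, mode_add isAng_kU, hf', hg']; ring
  smul_mem' := by
    rintro c x ⟨N, f, hf, hx⟩
    refine ⟨N, fun i R => c * f i R, ⟨fun i => (hf.1 i).const_mul c, fun i hi => ?_⟩, ?_⟩
    · ext R; simp [hf.2 i hi]
    · filter_upwards [Lp.coeFn_smul c x, hx] with p h1 h2
      rw [h1, Pi.smul_apply, h2, mode_smul isAng_kU N (fun _ => c), smul_eq_mul]; ring

/-- An `L²` function orthogonal to all modes of positive eigenvalue has slices proportional, up to the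
weight, to `sin²(2θ) cos θ`; it is therefore orthogonal to every `F` with `OrthW F`. -/
lemma MemX.mem_closure_modeSpace {F : ℝ × ℝ → ℝ} (hF : MemX eta F) (hO : OrthW F) :
    MemLp.toLp _ hF ∈ modeSpace.topologicalClosure := by
  rw [← Submodule.orthogonal_orthogonal_eq_closure, Submodule.mem_orthogonal]
  intro h hh
  have hh' : ∀ n, 1 ≤ n → ∀ ψ, IsTestR ψ → ∫ p, (Real.sin (2 * p.2) ^ (1 - eta / 2) * h p)
      * ang (eigenpoly n) p.2 * ψ p.1 ∂stripMeasure = 0 := by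
    intro n hn ψ hψ
    have hw : ContDiffOn ℝ ∞ (fun R => (w R)⁻¹) (Ioi 0) := by
      refine ContDiffOn.inv ?_ fun R hR => (w_pos hR).ne'
      unfold w
      exact ContDiffOn.div (by fun_prop) (by fun_prop) fun R hR => (pow_pos hR 2).ne'
    have hg := IsTestR.mul_contDiffOn hw hψ
    set g : ℝ → ℝ := fun R => (w R)⁻¹ * ψ R
    set f : ℕ → ℝ → ℝ := fun i => if i = n - 1 then g else 0 with hfdef
    have hfam : IsFam n f := by
      refine ⟨fun i => ?_, fun i hi => if_neg (by omega)⟩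
      by_cases hi : i = n - 1
      · simpa [hfdef, hi] using hg
      · simpa [hfdef, hi] using IsTestR.zero
    have hm : MemX eta (mode kU n f) := memX_mode isAng_kU fun i => (hfam.1 i).dec
    have hmem : MemLp.toLp _ hm ∈ modeSpace := ⟨n, f, hfam, hm.coeFn_toLp⟩
    have e := (Submodule.mem_orthogonal _ _).1 hh _ hmem
    rw [L2.inner_def] at e
    rw [← e]
    refine integral_congr_ae ?_
    filter_upwards [hm.coeFn_toLp, ae_restrict_mem measurableSet_strip] with p h1 hp
    rw [h1]
    have hmode : mode kU n f p = g p.1 * kU (eigenpoly n) p.2 := by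
      rw [isAng_kU.mode_eq]
      simp only [hfdef]
      rw [Finset.sum_eq_single (n - 1)]
      · simp [show n - 1 + 1 = n by omega]
      · intro i _ hi; simp [hi]
      · intro hi; exact absurd (Finset.mem_range.2 (by omega)) hi
    have hs := sin_two_mul_pos hp.2
    have hσ : Real.sin (2 * p.2) ^ (1 - eta / 2) = Real.sin (2 * p.2) / Real.sin (2 * p.2) ^ (eta / 2) := by
      rw [Real.rpow_sub hs, Real.rpow_one]
    have hw0 := (w_pos hp.1).ne'
    rw [hmode, hσ, wt, kU]
    simp only [RCLike.inner_apply, conj_trivial, g]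
    field_simp
  have hσc : Continuous fun p : ℝ × ℝ => Real.sin (2 * p.2) ^ (1 - eta / 2) :=
    (continuous_sin_rpow (by linarith [eta_lt_one])).comp continuous_snd
  have hG : MemLp (fun p : ℝ × ℝ => Real.sin (2 * p.2) ^ (1 - eta / 2) * h p) 2 stripMeasure :=
    MemLp.mul_bounded (Lp.memLp h) hσc.continuousOn (K := 1) fun p hp => by
      have hs := sin_two_mul_pos hp.2
      rw [abs_of_nonneg (Real.rpow_nonneg hs.le _)]
      exact Real.rpow_le_one hs.le (Real.sin_le_one _) (by linarith [eta_lt_one])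
  have hF2 : MemLp F 2 stripMeasure := hF.memLp eta_pos.le
  have hFo : MemLp (fun p => Real.cos p.2 ^ 2 * Real.sin p.2 * F p) 2 stripMeasure :=
    MemLp.mul_bounded hF2 (b := fun p => Real.cos p.2 ^ 2 * Real.sin p.2)
      (by fun_prop) (K := 1) fun p hp => by
      rw [abs_mul, abs_pow]
      exact mul_le_one₀ (pow_le_one₀ (abs_nonneg _) (Real.abs_cos_le_one _)) (abs_nonneg _)
        (Real.abs_sin_le_one _)
  have a1 := ae_slice_moments hG 1 hh'
  have a2 := ae_slice_memLp hG
  have a3 := ae_slice_integral_eq_zero hFo fun ψ hψ => by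
    rw [← hO ψ hψ]; congr 1; ext p; ring
  rw [L2.inner_def]
  have e1 : ∫ p, inner ℝ (h p) ((MemLp.toLp _ hF : Lp ℝ 2 stripMeasure) p) ∂stripMeasure
      = ∫ p, h p * (F p * wt eta p) ∂stripMeasure := by
    refine integral_congr_ae ?_
    filter_upwards [hF.coeFn_toLp] with p hp
    rw [hp]; simp [mul_comm]
  rw [e1]
  have hi : Integrable (fun p => h p * (F p * wt eta p)) stripMeasure := (Lp.memLp h).integrable_mul hF
  rw [integral_strip hi]
  refine integral_eq_zero_of_ae ?_
  filter_upwards [a1, a2, a3, ae_restrict_mem measurableSet_Ioi] with R h1 h2 h3 hR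
  obtain ⟨a, ha⟩ := exists_eq_of_eigenpoly_moments h2 h1
  have e2 : ∫ θ in Ioo 0 (Real.pi / 2), h (R, θ) * (F (R, θ) * wt eta (R, θ))
      = ∫ θ in Ioo 0 (Real.pi / 2), 2 * a * w R * (Real.cos θ ^ 2 * Real.sin θ * F (R, θ)) := by
    refine integral_congr_ae ?_
    filter_upwards [ha, ae_restrict_mem measurableSet_Ioo] with θ hθ hm
    have hs := sin_two_mul_pos hm
    rw [Real.rpow_sub hs, Real.rpow_one] at hθ
    have h5 := Real.rpow_pos_of_pos hs (eta / 2)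
    have h6 : h (R, θ) * wt eta (R, θ) = w R * a * (Real.sin (2 * θ) * Real.cos θ) := by
      rw [wt]
      field_simp at hθ ⊢
      have : Real.sin (2 * θ) ≠ 0 := hs.ne'
      rw [hθ]
    rw [← mul_assoc, mul_comm (h (R, θ)), mul_assoc, h6, Real.sin_two_mul]; ring
  rw [e2, integral_const_mul, h3, mul_zero]; rfl

/-- Density of finite sums of modes. -/
lemma exists_modes_near {F : ℝ × ℝ → ℝ} (hF : MemX eta F) (hO : OrthW F) {ε : ℝ≥0∞} (hε : 0 < ε) :
    ∃ N f, IsFam N f ∧ nrm eta (fun p => mode kU N f p - F p) < ε := by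
  have := hF.mem_closure_modeSpace hO
  obtain ⟨x, ⟨N, f, hf, hx⟩, hlt⟩ := EMetric.mem_closure_iff.1 this ε hε
  refine ⟨N, f, hf, ?_⟩
  rw [edist_comm, Lp.edist_def] at hlt
  refine lt_of_eq_of_lt (eLpNorm_congr_ae ?_) hlt
  filter_upwards [hx, hF.coeFn_toLp] with p h1 h2
  rw [Pi.sub_apply, h1, h2]; ring

/-! ### Limits in the weighted space -/

lemma nrm_congr {β : ℝ} {f g : ℝ × ℝ → ℝ} (h : f =ᵐ[stripMeasure] g) : nrm β f = nrm β g :=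
  eLpNorm_congr_ae (h.mono fun p hp => by simp only [hp])

lemma MemX.congr {β : ℝ} {f g : ℝ × ℝ → ℝ} (hf : MemX β f) (h : f =ᵐ[stripMeasure] g) : MemX β g :=
  MemLp.ae_eq (h.mono fun p hp => by simp only [hp]) hf

lemma aesm_mul_wt {β : ℝ} {f : ℝ × ℝ → ℝ} (hf : AEStronglyMeasurable f stripMeasure) :
    AEStronglyMeasurable (fun p => f p * wt β p) stripMeasure :=
  hf.mul (aesm_of_continuousOn (continuousOn_wt β))

lemma nrm_add_le {β : ℝ} {f g : ℝ × ℝ → ℝ} (hf : AEStronglyMeasurable f stripMeasure)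
    (hg : AEStronglyMeasurable g stripMeasure) : nrm β (fun p => f p + g p) ≤ nrm β f + nrm β g := by
  have := eLpNorm_add_le (aesm_mul_wt (β := β) hf) (aesm_mul_wt (β := β) hg) (p := 2) (by norm_num)
  refine le_trans (le_of_eq ?_) this
  rw [nrm]; congr 1; ext p; simp only [Pi.add_apply]; ring

lemma nrm_mul_le {β : ℝ} {f b : ℝ × ℝ → ℝ} {K : ℝ} (hK : ∀ p ∈ strip, |b p| ≤ K) :
    nrm β (fun p => b p * f p) ≤ ENNReal.ofReal K * nrm β f :=
  eLpNorm_le_mul_eLpNorm_of_ae_le_mul (ae_strip_of_forall fun p hp => by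
    rw [norm_mul, norm_mul, norm_mul, mul_assoc]
    exact mul_le_mul_of_nonneg_right (hK p hp) (by positivity)) 2

lemma MemX.add {β : ℝ} {f g : ℝ × ℝ → ℝ} (hf : MemX β f) (hg : MemX β g) :
    MemX β (fun p => f p + g p) := by
  have := MemLp.add hf hg
  refine this.ae_eq (ae_of_all _ fun p => ?_)
  simp only [Pi.add_apply]; ring

lemma MemX.mul_bounded {β : ℝ} {f b : ℝ × ℝ → ℝ} (hf : MemX β f) (hb : ContinuousOn b strip) {K : ℝ}
    (hK : ∀ p ∈ strip, |b p| ≤ K) : MemX β (fun p => b p * f p) := by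
  have := MemLp.mul_bounded hf hb hK
  exact this.ae_eq (ae_of_all _ fun p => (mul_assoc _ _ _).symm)

lemma MemX.const_mul {β : ℝ} {f : ℝ × ℝ → ℝ} (hf : MemX β f) (c : ℝ) : MemX β (fun p => c * f p) :=
  hf.mul_bounded (b := fun _ => c) continuousOn_const (K := |c|) fun _ _ => le_rfl

lemma MemX.sub {β : ℝ} {f g : ℝ × ℝ → ℝ} (hf : MemX β f) (hg : MemX β g) :
    MemX β (fun p => f p - g p) :=
  (hf.add (hg.const_mul (-1))).congr (ae_of_all _ fun p => by ring)

/-- Convergence in the weighted space. -/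
def XT (f : ℕ → ℝ × ℝ → ℝ) (f₀ : ℝ × ℝ → ℝ) : Prop :=
  (∀ n, MemX eta (f n)) ∧ MemX eta f₀ ∧
    Tendsto (fun n => nrm eta (fun p => f n p - f₀ p)) atTop (𝓝 0)

lemma XT.mul_bounded {f : ℕ → ℝ × ℝ → ℝ} {f₀ b : ℝ × ℝ → ℝ} (h : XT f f₀) (hb : ContinuousOn b strip)
    {K : ℝ} (hK : ∀ p ∈ strip, |b p| ≤ K) :
    XT (fun n p => b p * f n p) (fun p => b p * f₀ p) := by
  refine ⟨fun n => (h.1 n).mul_bounded hb hK, h.2.1.mul_bounded hb hK, ?_⟩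
  have t := ENNReal.Tendsto.const_mul h.2.2 (a := ENNReal.ofReal K) (Or.inr ENNReal.ofReal_ne_top)
  rw [mul_zero] at t
  refine tendsto_of_tendsto_of_tendsto_of_le_of_le tendsto_const_nhds t (fun _ => bot_le) fun n => ?_
  simp_rw [← mul_sub]
  exact nrm_mul_le hK

lemma XT.const_mul {f : ℕ → ℝ × ℝ → ℝ} {f₀ : ℝ × ℝ → ℝ} (h : XT f f₀) (c : ℝ) :
    XT (fun n p => c * f n p) (fun p => c * f₀ p) :=
  h.mul_bounded (b := fun _ => c) continuousOn_const (K := |c|) fun _ _ => le_rfl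

lemma XT.add {f g : ℕ → ℝ × ℝ → ℝ} {f₀ g₀ : ℝ × ℝ → ℝ} (hf : XT f f₀) (hg : XT g g₀) :
    XT (fun n p => f n p + g n p) (fun p => f₀ p + g₀ p) := by
  refine ⟨fun n => (hf.1 n).add (hg.1 n), hf.2.1.add hg.2.1, ?_⟩
  have t := hf.2.2.add hg.2.2
  rw [add_zero] at t
  refine tendsto_of_tendsto_of_tendsto_of_le_of_le tendsto_const_nhds t (fun _ => bot_le) fun n => ?_
  refine le_trans (le_of_eq ?_) (nrm_add_le ((hf.1 n).sub hf.2.1).aesm ((hg.1 n).sub hg.2.1).aesm)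
  congr 1; ext p; ring

lemma XT.tendsto_integral {f : ℕ → ℝ × ℝ → ℝ} {f₀ φ : ℝ × ℝ → ℝ} (h : XT f f₀)
    (hφ : MemLp φ 2 stripMeasure) :
    Tendsto (fun n => ∫ p, f n p * φ p ∂stripMeasure) atTop (𝓝 (∫ p, f₀ p * φ p ∂stripMeasure)) :=
  tendsto_integral_mul_of_eLpNorm (fun n => (h.1 n).memLp eta_pos.le) (h.2.1.memLp eta_pos.le) hφ
    (tendsto_of_tendsto_of_tendsto_of_le_of_le tendsto_const_nhds h.2.2 (fun _ => bot_le)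
      fun _ => eLpNorm_le_nrm eta_pos.le _)

/-- A priori bounds pass to limits. -/
lemma XT.nrm_le {f g : ℕ → ℝ × ℝ → ℝ} {f₀ g₀ : ℝ × ℝ → ℝ} (hf : XT f f₀) (hg : XT g g₀) {C : ℝ≥0∞}
    (hC : C ≠ ⊤) (h : ∀ n, nrm eta (f n) ≤ C * nrm eta (g n)) : nrm eta f₀ ≤ C * nrm eta g₀ := by
  have b : ∀ n, nrm eta f₀ ≤ nrm eta (fun p => f n p - f₀ p)
      + C * (nrm eta (fun p => g n p - g₀ p) + nrm eta g₀) := by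
    intro n
    have e1 : nrm eta f₀ ≤ nrm eta (fun p => f n p - f₀ p) + nrm eta (f n) := by
      have := nrm_add_le (β := eta) ((((hf.1 n).sub hf.2.1).const_mul (-1)).aesm) (hf.1 n).aesm
      refine le_trans (le_of_eq ?_) (this.trans (add_le_add_left ?_ _))
      · congr 1; ext p; ring
      · refine (nrm_mul_le (b := fun _ => -1) (K := 1) fun _ _ => by simp).trans (by simp)
    have e2 : nrm eta (g n) ≤ nrm eta (fun p => g n p - g₀ p) + nrm eta g₀ := by
      refine le_trans (le_of_eq ?_) (nrm_add_le ((hg.1 n).sub hg.2.1).aesm hg.2.1.aesm)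
      congr 1; ext p; ring
    exact e1.trans (add_le_add_right ((h n).trans (mul_le_mul_right e2 _)) _)
  have t : Tendsto (fun n => nrm eta (fun p => f n p - f₀ p)
      + C * (nrm eta (fun p => g n p - g₀ p) + nrm eta g₀)) atTop (𝓝 (0 + C * (0 + nrm eta g₀))) :=
    hf.2.2.add (ENNReal.Tendsto.const_mul (hg.2.2.add tendsto_const_nhds) (Or.inr hC))
  simpa using ge_of_tendsto t (Eventually.of_forall b)

lemma IsTest.memLp_mul {φ c : ℝ × ℝ → ℝ} (hφ : IsTest strip φ) (hc : ContinuousOn c strip) :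
    MemLp (fun p => c p * φ p) 2 stripMeasure := by
  have cχ : Continuous fun p => c p * φ p := by
    rw [continuous_iff_continuousAt]
    intro p
    by_cases hp : p ∈ tsupport φ
    · exact (hc.continuousAt (isOpen_strip.mem_nhds (hφ.2.2 hp))).mul hφ.1.continuous.continuousAt
    · have : (fun p => c p * φ p) =ᶠ[𝓝 p] fun _ => 0 := by
        filter_upwards [notMem_tsupport_iff_eventuallyEq.1 hp] with q hq
        simp [hq]
      exact continuousAt_const.congr this.symm
  exact (cχ.memLp_of_hasCompactSupport hφ.2.1.mul_left).restrict _

lemma XT.hasWeakDeriv {v : ℝ × ℝ} {f g : ℕ → ℝ × ℝ → ℝ} {f₀ g₀ c : ℝ × ℝ → ℝ} (hf : XT f f₀)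
    (hg : XT g g₀) (hc : ContinuousOn c strip)
    (h : ∀ n, HasWeakDeriv v (f n) (fun p => c p * g n p)) :
    HasWeakDeriv v f₀ (fun p => c p * g₀ p) := by
  refine ⟨LocInt.of_memLp (hf.2.1.memLp eta_pos.le),
    LocInt.mul (LocInt.of_memLp (hg.2.1.memLp eta_pos.le)) hc, fun φ hφ => ?_⟩
  have t1 := hf.tendsto_integral (hφ.fderiv v).memLp
  have t2 := (hg.tendsto_integral (hφ.memLp_mul hc)).neg
  simp_rw [fun n => (h n).2.2 φ hφ] at t1
  have e : ∀ k : ℝ × ℝ → ℝ, ∫ p, c p * k p * φ p ∂stripMeasure = ∫ p, k p * (c p * φ p) ∂stripMeasure :=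
    fun k => by congr 1; ext p; ring
  simp_rw [e] at t1 ⊢
  exact tendsto_nhds_unique t1 t2

/-- A sequence dominated by a rapidly converging one converges. -/
lemma exists_XT {f g : ℕ → ℝ × ℝ → ℝ} {g₀ : ℝ × ℝ → ℝ} (hf : ∀ n, MemX eta (f n))
    (hg : ∀ n, MemX eta (g n)) (hg₀ : MemX eta g₀)
    (hn : ∀ n, nrm eta (fun p => g n p - g₀ p) < (1 / 2) ^ n) {C : ℝ≥0∞} (hC : C ≠ ⊤)
    (h : ∀ n m, nrm eta (fun p => f n p - f m p) ≤ C * nrm eta (fun p => g n p - g m p)) :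
    ∃ f₀, XT f f₀ := by
  have hB : ∑' n : ℕ, (C * 2 + 1) * (1 / 2 : ℝ≥0∞) ^ n ≠ ⊤ := by
    rw [ENNReal.tsum_mul_left, ENNReal.tsum_geometric]
    refine ENNReal.mul_ne_top (by finiteness) ?_
    simp
  obtain ⟨l, hl, hlim⟩ := Lp.cauchy_complete_eLpNorm (by norm_num) (f := fun n p => f n p * wt eta p) hf hB (by
    intro N n m hNn hNm
    have e0 : eLpNorm ((fun p => f n p * wt eta p) - fun p => f m p * wt eta p) 2 stripMeasure
        = nrm eta (fun p => f n p - f m p) := by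
      rw [nrm]; congr 1; ext p; simp only [Pi.sub_apply]; ring
    have e1 : nrm eta (fun p => g n p - g m p) ≤ (1 / 2) ^ N + (1 / 2) ^ N := by
      have := nrm_add_le (β := eta) ((hg n).sub hg₀).aesm ((((hg m).sub hg₀).const_mul (-1)).aesm)
      refine le_trans (le_of_eq ?_) (this.trans (add_le_add ?_ ?_))
      · congr 1; ext p; ring
      · exact (hn n).le.trans (pow_le_pow_right_of_le_one' (by simp) hNn)
      · refine (nrm_mul_le (b := fun _ => -1) (K := 1) fun _ _ => by simp).trans ?_
        rw [ENNReal.ofReal_one, one_mul]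
        exact (hn m).le.trans (pow_le_pow_right_of_le_one' (by simp) hNm)
    rw [e0]
    refine ((h n m).trans (mul_le_mul_right e1 C)).trans_lt ?_
    rw [add_mul, one_mul, ← two_mul, ← mul_assoc]
    refine ENNReal.lt_add_right ?_ ?_
    · finiteness
    · exact (ENNReal.pow_pos (by simp) _).ne')
  have ae : (fun p => l p / wt eta p * wt eta p) =ᵐ[stripMeasure] l := ae_strip_of_forall fun p hp => by
    have := (wt_pos (β := eta) hp).ne'
    field_simp
  refine ⟨fun p => l p / wt eta p, hf, hl.ae_eq ae.symm, hlim.congr fun n => ?_⟩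
  refine eLpNorm_congr_ae (ae.mono fun p hp => ?_)
  simp only [Pi.sub_apply]
  have hp' : l p / wt eta p * wt eta p = l p := hp
  rw [sub_mul, hp']

/-! ### Solutions with right-hand side in the weighted space -/

/-- A solution of the equation together with its derivatives: `Ψ₁ = α R ∂_R Ψ`, `Ψ₂ = α R ∂_R Ψ₁`,
`Θ = ∂_θ Ψ`, `Θ₁ = ∂_θ Ψ₁`, `Y = ∂_θ (Ψ / cos θ)`. -/
structure Sol (α : ℝ) (F Ψ Ψ₁ Ψ₂ Θ Θ₁ Y : ℝ × ℝ → ℝ) : Prop where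
  memΨ : MemX eta Ψ
  memΨ₁ : MemX eta Ψ₁
  memΨ₂ : MemX eta Ψ₂
  memΘ : MemX eta Θ
  memΘ₁ : MemX eta Θ₁
  memY : MemX eta Y
  leΨ : nrm eta Ψ ≤ apC * nrm eta F
  leΨ₁ : nrm eta Ψ₁ ≤ apC * nrm eta F
  leΨ₂ : nrm eta Ψ₂ ≤ apC * nrm eta F
  leΘ : nrm eta Θ ≤ apC * nrm eta F
  leΘ₁ : nrm eta Θ₁ ≤ apC * nrm eta F
  leY : nrm eta Y ≤ apC * nrm eta F
  dR : HasWeakDeriv dirR Ψ (fun p => α⁻¹ / p.1 * Ψ₁ p)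
  dR₁ : HasWeakDeriv dirR Ψ₁ (fun p => α⁻¹ / p.1 * Ψ₂ p)
  dT : HasWeakDeriv dirTheta Ψ Θ
  dT₁ : HasWeakDeriv dirTheta Ψ₁ Θ₁
  relY : ∀ᵐ p ∂stripMeasure, Real.cos p.2 ^ 2 * Y p = Real.cos p.2 * Θ p + Real.sin p.2 * Ψ p
  dTT : HasWeakDeriv dirTheta Θ
    (fun p => Real.sin p.2 * Y p - 5 * Ψ p - (F p + Ψ₂ p + 5 * Ψ₁ p))
  dir : ∀ φ, IsTest (Ioi 0 ×ˢ univ) φ →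
    ∫ p, Ψ p * fderiv ℝ φ p dirTheta ∂stripMeasure = -∫ p, Θ p * φ p ∂stripMeasure

lemma mode_sub {k : Polynomial ℝ → ℝ → ℝ} (hk : IsAng k) {N M : ℕ} {X Y : ℕ → ℝ → ℝ}
    (hX : ∀ i, N ≤ i → X i = 0) (hY : ∀ i, M ≤ i → Y i = 0) :
    (fun p => mode k N X p - mode k M Y p) = mode k (max N M) (fun i R => X i R + -1 * Y i R) := by
  rw [mode_add hk, mode_smul hk (max N M) (fun _ => -1), mode_eq_of_le hk (le_max_left N M) hX,
    mode_eq_of_le hk (le_max_right N M) hY]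
  ext p; ring

/-- Existence: the solutions for approximating finite sums of modes form a Cauchy sequence in the weighted
space, by the a priori estimate. -/
lemma exists_sol {α : ℝ} (hα0 : 0 < α) (hα : α ≤ 1 / 4) {F : ℝ × ℝ → ℝ} (hF : MemX eta F)
    (hO : OrthW F) : ∃ Ψ Ψ₁ Ψ₂ Θ Θ₁ Y, Sol α F Ψ Ψ₁ Ψ₂ Θ Θ₁ Y := by
  have hpos : ∀ n : ℕ, (0 : ℝ≥0∞) < (1 / 2) ^ n := fun n => ENNReal.pow_pos (by simp) n
  choose N f hfam hnear using fun n => exists_modes_near hF hO (hpos n)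
  choose c c₁ c₂ hs hz using fun n => exists_niceSol hα0 hα (hfam n).1
  have zc : ∀ n i, N n ≤ i → c n i = 0 := fun n i hi => (hz n i ((hfam n).2 i hi)).1
  have zc₁ : ∀ n i, N n ≤ i → c₁ n i = 0 := fun n i hi => (hz n i ((hfam n).2 i hi)).2.1
  have zc₂ : ∀ n i, N n ≤ i → c₂ n i = 0 := fun n i hi => (hz n i ((hfam n).2 i hi)).2.2
  have mF : ∀ n, MemX eta (mode kU (N n) (f n)) := fun n => memX_mode isAng_kU (hs n).hf
  have hC : apC ≠ ⊤ := ENNReal.ofReal_ne_top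
  have hd := fun n m => (hs n).sub (hs m) |>.nrm_le hα0 hα (max (N n) (N m))
  simp_rw [← fun n m => mode_sub isAng_kU (hfam n).2 (hfam m).2,
    ← fun n m => mode_sub isAng_kU (zc n) (zc m), ← fun n m => mode_sub isAng_kU (zc₁ n) (zc₁ m),
    ← fun n m => mode_sub isAng_kU (zc₂ n) (zc₂ m), ← fun n m => mode_sub isAng_kT (zc n) (zc m),
    ← fun n m => mode_sub isAng_kT (zc₁ n) (zc₁ m), ← fun n m => mode_sub isAng_kY (zc n) (zc m)] at hd
  have hb := fun n => (hs n).nrm_le hα0 hα (N n)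
  have tF : XT (fun n => mode kU (N n) (f n)) F := by
    refine ⟨mF, hF, tendsto_of_tendsto_of_tendsto_of_le_of_le tendsto_const_nhds
      (ENNReal.tendsto_pow_atTop_nhds_zero_of_lt_one (r := 1 / 2) ?_) (fun _ => bot_le)
      fun n => (hnear n).le⟩
    rw [one_div]; exact ENNReal.inv_lt_one.2 (by norm_num)
  obtain ⟨Ψ, tΨ⟩ := exists_XT (fun n => memX_mode isAng_kU (hs n).hc) mF hF hnear hC fun n m => (hd n m).1
  obtain ⟨Ψ₁, tΨ₁⟩ := exists_XT (fun n => memX_mode isAng_kU (hs n).hc₁) mF hF hnear hC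
    fun n m => (hd n m).2.1
  obtain ⟨Ψ₂, tΨ₂⟩ := exists_XT (fun n => memX_mode isAng_kU (hs n).hc₂) mF hF hnear hC
    fun n m => (hd n m).2.2.1
  obtain ⟨Θ, tΘ⟩ := exists_XT (fun n => memX_mode isAng_kT (hs n).hc) mF hF hnear hC
    fun n m => (hd n m).2.2.2.1
  obtain ⟨Θ₁, tΘ₁⟩ := exists_XT (fun n => memX_mode isAng_kT (hs n).hc₁) mF hF hnear hC
    fun n m => (hd n m).2.2.2.2.1
  obtain ⟨Y, tY⟩ := exists_XT (fun n => memX_mode isAng_kY (hs n).hc) mF hF hnear hC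
    fun n m => (hd n m).2.2.2.2.2
  have cR : ContinuousOn (fun p : ℝ × ℝ => α⁻¹ / p.1) strip :=
    continuousOn_const.div continuousOn_fst fun p hp => ne_of_gt hp.1
  have c1 : ContinuousOn (fun _ : ℝ × ℝ => (1 : ℝ)) strip := continuousOn_const
  have csin : ContinuousOn (fun p : ℝ × ℝ => Real.sin p.2) strip := by fun_prop
  have ccos : ContinuousOn (fun p : ℝ × ℝ => Real.cos p.2) strip := by fun_prop
  have bsin : ∀ p ∈ strip, |Real.sin p.2| ≤ 1 := fun p _ => Real.abs_sin_le_one _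
  have bcos : ∀ p ∈ strip, |Real.cos p.2| ≤ 1 := fun p _ => Real.abs_cos_le_one _
  refine ⟨Ψ, Ψ₁, Ψ₂, Θ, Θ₁, Y, ⟨tΨ.2.1, tΨ₁.2.1, tΨ₂.2.1, tΘ.2.1, tΘ₁.2.1, tY.2.1,
    tΨ.nrm_le tF hC fun n => (hb n).1, tΨ₁.nrm_le tF hC fun n => (hb n).2.1,
    tΨ₂.nrm_le tF hC fun n => (hb n).2.2.1, tΘ.nrm_le tF hC fun n => (hb n).2.2.2.1,
    tΘ₁.nrm_le tF hC fun n => (hb n).2.2.2.2.1, tY.nrm_le tF hC fun n => (hb n).2.2.2.2.2,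
    tΨ.hasWeakDeriv tΨ₁ cR fun n => ((hs n).weak (N n)).1,
    tΨ₁.hasWeakDeriv tΨ₂ cR fun n => ((hs n).weak (N n)).2.1, ?_, ?_, ?_, ?_, ?_⟩⟩
  · simpa using tΨ.hasWeakDeriv tΘ c1 fun n => by simpa using ((hs n).weak (N n)).2.2.1
  · simpa using tΨ₁.hasWeakDeriv tΘ₁ c1 fun n => by simpa using ((hs n).weak (N n)).2.2.2.1
  · have t1 := (tY.mul_bounded ccos bcos).mul_bounded ccos bcos
    have t2 := (tΘ.mul_bounded ccos bcos).add (tΨ.mul_bounded csin bsin)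
    have hl : ∀ {g}, MemX eta g → LocallyIntegrableOn g strip := fun hg => LocInt.of_memLp (hg.memLp eta_pos.le)
    have := ae_eq_of_forall_test (hl t1.2.1) (hl t2.2.1) fun φ hφ => by
      refine tendsto_nhds_unique (t1.tendsto_integral hφ.memLp) ((t2.tendsto_integral hφ.memLp).congr fun n => ?_)
      congr 1; ext p
      rw [← mul_assoc, ← sq, mode, mode, mode, cos_sq_mul_kY]
    exact this.mono fun p hp => by rw [sq, mul_assoc]; exact hp
  · have t := ((tY.mul_bounded csin bsin).add (tΨ.const_mul (-5))).add
      (((tF.add tΨ₂).add (tΨ₁.const_mul 5)).const_mul (-1))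
    have := tΘ.hasWeakDeriv t c1 fun n => by
      refine ((hs n).weak (N n)).2.2.2.2.congr (ae_of_all _ fun _ => rfl) (ae_of_all _ fun p => ?_)
      ring
    refine this.congr (ae_of_all _ fun _ => rfl) (ae_of_all _ fun p => ?_)
    ring
  · intro φ hφ
    refine tendsto_nhds_unique (tΨ.tendsto_integral (hφ.fderiv dirTheta).memLp)
      ((tΘ.tendsto_integral hφ.memLp).neg.congr fun n => ?_)
    exact ((hs n).dirichlet (N n) hφ).symm

/-! ### Tensor test functions -/

lemma IsTestR.tensor {ψ k : ℝ → ℝ} (hψ : IsTestR ψ) (hk : ContDiff ℝ ∞ k) {a b : ℝ} {V : Set ℝ}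
    (hs : Function.support k ⊆ Icc a b) (hV : Icc a b ⊆ V) :
    IsTest (Ioi 0 ×ˢ V) (fun p => ψ p.1 * k p.2) := by
  have hsub : tsupport (fun p : ℝ × ℝ => ψ p.1 * k p.2) ⊆ tsupport ψ ×ˢ Icc a b := by
    refine closure_minimal (fun p hp => ?_) ((isClosed_tsupport ψ).prod isClosed_Icc)
    have hp' := mul_ne_zero_iff.1 hp
    exact ⟨subset_tsupport ψ hp'.1, hs hp'.2⟩
  have hc : IsCompact (tsupport ψ ×ˢ Icc a b) := IsCompact.prod hψ.2.1 isCompact_Icc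
  exact ⟨(hψ.1.comp contDiff_fst).mul (hk.comp contDiff_snd),
    hc.of_isClosed_subset (isClosed_tsupport _) hsub, hsub.trans (prod_mono hψ.2.2 hV)⟩

lemma fderiv_tensor {ψ k : ℝ → ℝ} {ψ' k' : ℝ} {p : ℝ × ℝ} (hψ : HasDerivAt ψ ψ' p.1)
    (hk : HasDerivAt k k' p.2) :
    fderiv ℝ (fun p : ℝ × ℝ => ψ p.1 * k p.2) p dirR = ψ' * k p.2 ∧
    fderiv ℝ (fun p : ℝ × ℝ => ψ p.1 * k p.2) p dirTheta = ψ p.1 * k' := by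
  have : HasFDerivAt (fun p : ℝ × ℝ => ψ p.1 * k p.2) _ p :=
    (hasFDerivAt_comp_fst hψ).mul (hasFDerivAt_comp_snd hk)
  rw [this.fderiv]
  constructor
  · simp [dirR]; ring
  · simp [dirTheta]

lemma cutTheta_mul_support (j : ℕ) (k : ℝ → ℝ) : Function.support (fun θ => k θ * cutTheta j θ) ⊆
    Icc (1 / ((j : ℝ) + 1)) (Real.pi / 2 - 1 / ((j : ℝ) + 1)) :=
  (Function.support_mul_subset_right _ _).trans (cutTheta_support j)

lemma Icc_cut_subset (j : ℕ) :
    Icc (1 / ((j : ℝ) + 1)) (Real.pi / 2 - 1 / ((j : ℝ) + 1)) ⊆ Ioo 0 (Real.pi / 2) := fun θ hθ => by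
  have : 0 < 1 / ((j : ℝ) + 1) := by positivity
  exact ⟨by linarith [hθ.1], by linarith [hθ.2]⟩

/-- Smooth angular profiles, cut off near the two ends, give test functions. -/
lemma IsTestR.tensor_cut {ψ k : ℝ → ℝ} (hψ : IsTestR ψ) (hk : ContDiff ℝ ∞ k) (j : ℕ) :
    IsTest strip (fun p => ψ p.1 * (k p.2 * cutTheta j p.2)) :=
  hψ.tensor (k := fun θ => k θ * cutTheta j θ) (hk.mul (cutTheta_contDiff j)) (cutTheta_mul_support j k)
    (Icc_cut_subset j)

/-- Dominated convergence for pairings with tensor products. -/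
lemma tendsto_integral_tensor {f : ℝ × ℝ → ℝ} (hf : MemLp f 2 stripMeasure) {ψ : ℝ → ℝ}
    (hψ : IsTestR ψ) {b : ℕ → ℝ → ℝ} {b₀ : ℝ → ℝ} (hb : ∀ j, ContinuousOn (b j) (Ioo 0 (Real.pi / 2))) {K : ℝ}
    (hK : ∀ j, ∀ θ ∈ Ioo 0 (Real.pi / 2), |b j θ| ≤ K)
    (hlim : ∀ θ ∈ Ioo 0 (Real.pi / 2), ∀ᶠ j in atTop, b j θ = b₀ θ) :
    Tendsto (fun j => ∫ p, f p * (ψ p.1 * b j p.2) ∂stripMeasure) atTop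
      (𝓝 (∫ p, f p * (ψ p.1 * b₀ p.2) ∂stripMeasure)) := by
  have hi : Integrable (fun p => f p * ψ p.1) stripMeasure := hf.integrable_mul hψ.memLp
  refine tendsto_integral_of_dominated_convergence (fun p => K * ‖f p * ψ p.1‖) (fun j => ?_)
    (hi.norm.const_mul K) (fun j => ae_strip_of_forall fun p hp => ?_)
    (ae_strip_of_forall fun p hp => ?_)
  · refine (hi.1.mul (aesm_of_continuousOn ((hb j).comp continuous_snd.continuousOn
      fun p hp => hp.2))).congr (ae_of_all _ fun p => ?_)
    simp only [Pi.mul_apply, Function.comp]; ring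
  · rw [← mul_assoc, norm_mul, mul_comm]
    exact mul_le_mul_of_nonneg_right (hK j p.2 hp.2) (norm_nonneg _)
  · exact tendsto_const_nhds.congr' ((hlim p.2 hp.2).mono fun j hj => by simp only [hj])

lemma tendsto_integral_cut {f : ℝ × ℝ → ℝ} (hf : MemLp f 2 stripMeasure) {ψ : ℝ → ℝ}
    (hψ : IsTestR ψ) {k : ℝ → ℝ} (hk : Continuous k) :
    Tendsto (fun j => ∫ p, f p * (ψ p.1 * (k p.2 * cutTheta j p.2)) ∂stripMeasure) atTop
      (𝓝 (∫ p, f p * (ψ p.1 * k p.2) ∂stripMeasure)) := by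
  obtain ⟨K, hK⟩ := (isCompact_Icc (a := (0 : ℝ)) (b := Real.pi / 2)).exists_bound_of_continuousOn
    hk.continuousOn
  refine tendsto_integral_tensor hf hψ (b := fun j θ => k θ * cutTheta j θ) (K := K)
    (fun j => (hk.mul (cutTheta_contDiff j).continuous).continuousOn) (fun j θ hθ => ?_) fun θ hθ => ?_
  · rw [abs_mul]
    exact (mul_le_of_le_one_right (abs_nonneg _) (cutTheta_abs_le j θ)).trans (hK θ (Ioo_subset_Icc_self hθ))
  · exact (eventually_cutTheta hθ).mono fun j hj => by rw [hj.1, mul_one]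

/-- Profiles vanishing at the ends absorb the derivative of the cutoff. -/
lemma tendsto_integral_cut' {f : ℝ × ℝ → ℝ} (hf : MemLp f 2 stripMeasure) {ψ : ℝ → ℝ}
    (hψ : IsTestR ψ) {k : ℝ → ℝ} (hk : Continuous k) :
    Tendsto (fun j => ∫ p, f p * (ψ p.1 * (k p.2 * (Real.sin p.2 * Real.cos p.2 * cutTheta' j p.2)))
      ∂stripMeasure) atTop (𝓝 0) := by
  obtain ⟨K, hK⟩ := (isCompact_Icc (a := (0 : ℝ)) (b := Real.pi / 2)).exists_bound_of_continuousOn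
    hk.continuousOn
  obtain ⟨B, hB⟩ := exists_cutTheta'_bound
  have := tendsto_integral_tensor hf hψ (b := fun j θ => k θ * (Real.sin θ * Real.cos θ * cutTheta' j θ))
    (b₀ := fun _ => 0) (K := K * B)
    (fun j => by have := cutTheta'_continuous j; fun_prop) (fun j θ hθ => ?_) fun θ hθ => ?_
  · simpa using this
  · rw [abs_mul]
    have h1 := hK θ (Ioo_subset_Icc_self hθ)
    exact mul_le_mul h1 (hB j θ hθ) (abs_nonneg _) ((abs_nonneg _).trans h1)
  · exact (eventually_cutTheta hθ).mono fun j hj => by simp only [hj.2]; ring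

/-! ### Very weak solutions -/

/-- The adjoint of `-R ∂_R`. -/
def dlt (ψ : ℝ → ℝ) : ℝ → ℝ := deriv fun R => R * ψ R

lemma IsTestR.id_mul {ψ : ℝ → ℝ} (hψ : IsTestR ψ) : IsTestR (fun R => R * ψ R) :=
  IsTestR.mul_contDiffOn contDiffOn_id hψ

lemma IsTestR.dlt {ψ : ℝ → ℝ} (hψ : IsTestR ψ) : IsTestR (dlt ψ) :=
  hψ.id_mul.deriv

lemma IsTestR.hasDerivAt_dlt {ψ : ℝ → ℝ} (hψ : IsTestR ψ) (R : ℝ) :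
    HasDerivAt (fun R => R * ψ R) (PolarBS.dlt ψ R) R :=
  hψ.id_mul.hasDerivAt R

/-- The adjoint of the radial part of the operator on the `n`-th angular mode. -/
def adjOp (α : ℝ) (n : ℕ) (ψ : ℝ → ℝ) (R : ℝ) : ℝ :=
  -α ^ 2 * dlt (dlt ψ) R + 5 * α * dlt ψ R + lam n * ψ R

lemma IsTestR.adjOp {α : ℝ} {n : ℕ} {ψ : ℝ → ℝ} (hψ : IsTestR ψ) : IsTestR (adjOp α n ψ) :=
  ((hψ.dlt.dlt.const_mul _).add (hψ.dlt.const_mul _)).add (hψ.const_mul _)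

lemma dlt_adjOp {α : ℝ} {n : ℕ} {ψ : ℝ → ℝ} (hψ : IsTestR ψ) : dlt (adjOp α n ψ) = adjOp α n (dlt ψ) := by
  ext R
  have h := (((hψ.dlt.dlt.hasDerivAt_dlt R).const_mul (-α ^ 2)).add
    ((hψ.dlt.hasDerivAt_dlt R).const_mul (5 * α))).add ((hψ.hasDerivAt_dlt R).const_mul (lam n))
  refine Eq.trans (congrArg (fun f => deriv f R) ?_) h.deriv
  ext r; simp only [adjOp, Pi.add_apply]; ring

/-- The adjoint angular eigenfunctions `cos θ sin(2θ) Jₙ(sin² θ)`. -/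
def kK (n : ℕ) (θ : ℝ) : ℝ := Real.cos θ * kU (eigenpoly n) θ

lemma kU_contDiff (p : Polynomial ℝ) : ContDiff ℝ ∞ (kU p) :=
  (Real.contDiff_sin.comp (contDiff_const.mul contDiff_id)).mul (ang_contDiff p)

lemma kK_contDiff (n : ℕ) : ContDiff ℝ ∞ (kK n) := Real.contDiff_cos.mul (kU_contDiff _)

/-- The derivative of `kK n`. -/
def kK' (n : ℕ) (θ : ℝ) : ℝ := -Real.sin θ * kU (eigenpoly n) θ + Real.cos θ * kT (eigenpoly n) θ

lemma hasDerivAt_kK (n : ℕ) (θ : ℝ) : HasDerivAt (kK n) (kK' n θ) θ :=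
  (Real.hasDerivAt_cos θ).mul (hasDerivAt_kU _ θ)

lemma kK'_contDiff (n : ℕ) : ContDiff ℝ ∞ (kK' n) := by
  have := contDiff_deriv_of_contDiff (kK_contDiff n)
  rwa [show deriv (kK n) = kK' n from funext fun θ => (hasDerivAt_kK n θ).deriv] at this

/-- `tan θ` times the derivative of `kK n`. -/
def kKt (n : ℕ) (θ : ℝ) : ℝ :=
  -2 * Real.sin θ ^ 3 * ang (eigenpoly n) θ + Real.sin θ * kT (eigenpoly n) θ

lemma kKt_continuous (n : ℕ) : Continuous (kKt n) := by
  have := ang_continuous (eigenpoly n); have := isAng_kT.cont (eigenpoly n); unfold kKt; fun_prop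

lemma tan_mul_kK' (n : ℕ) {θ : ℝ} (hθ : θ ∈ Ioo 0 (Real.pi / 2)) : Real.tan θ * kK' n θ = kKt n θ := by
  have hc := (cos_pos_of_mem hθ).ne'
  rw [Real.tan_eq_sin_div_cos, kK', kKt, kU, Real.sin_two_mul]
  field_simp

/-- The adjoint eigenvalue equation. -/
lemma hasDerivAt_kK' (n : ℕ) {θ : ℝ} (hθ : θ ∈ Ioo 0 (Real.pi / 2)) :
    HasDerivAt (kK' n) (-(kKt n θ + 6 * kK n θ + lam n * kK n θ)) θ := by
  have hc := (cos_pos_of_mem hθ).ne'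
  refine (((Real.hasDerivAt_sin θ).neg.mul (hasDerivAt_kU (eigenpoly n) θ)).add
    ((Real.hasDerivAt_cos θ).mul (hasDerivAt_kT (eigenpoly n) θ))).congr_deriv ?_
  rw [angOp_eigenpoly, isAng_kU.smul]
  have h1 := cos_sq_mul_kY (eigenpoly n) θ
  have h2 : Real.cos θ * kY (eigenpoly n) θ = kT (eigenpoly n) θ + 2 * Real.sin θ ^ 2 * ang (eigenpoly n) θ := by
    have : Real.cos θ * (Real.cos θ * kY (eigenpoly n) θ) = Real.cos θ *
        (kT (eigenpoly n) θ + 2 * Real.sin θ ^ 2 * ang (eigenpoly n) θ) := by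
      rw [← mul_assoc, ← sq, h1, kU, Real.sin_two_mul]; ring
    exact mul_left_cancel₀ hc this
  simp only [kKt, kK, Pi.neg_apply]
  linear_combination Real.sin θ * h2

lemma integrable_tensor {f : ℝ × ℝ → ℝ} (hf : MemLp f 2 stripMeasure) {ψ b : ℝ → ℝ} (hψ : IsTestR ψ)
    (hb : Continuous b) : Integrable (fun p => f p * (ψ p.1 * b p.2)) stripMeasure := by
  obtain ⟨K, hK⟩ := (isCompact_Icc (a := (0 : ℝ)) (b := Real.pi / 2)).exists_bound_of_continuousOn
    hb.continuousOn
  refine hf.integrable_mul ((MemLp.mul_bounded hψ.memLp (b := fun p => b p.2)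
    (hb.comp continuous_snd).continuousOn (K := K)
    fun p hp => hK _ (Ioo_subset_Icc_self hp.2)).ae_eq (ae_of_all _ fun p => mul_comm _ _))

/-- Very weak solutions: the equation tested against adjoint eigenfunctions. -/
def VW (α : ℝ) (F Ψ : ℝ × ℝ → ℝ) : Prop :=
  ∀ n ψ, IsTestR ψ → ∫ p, Ψ p * (adjOp α n ψ p.1 * kK n p.2) ∂stripMeasure
    = ∫ p, F p * (ψ p.1 * kK n p.2) ∂stripMeasure

/-- Radial integration by parts against profiles that need not vanish at the ends. -/
lemma HasWeakDeriv.radial_parts {f u : ℝ × ℝ → ℝ} (h : HasWeakDeriv dirR f u)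
    (hf : MemLp f 2 stripMeasure) (hu : MemLp (fun p => p.1 * u p) 2 stripMeasure) {ψ k : ℝ → ℝ}
    (hψ : IsTestR ψ) (hk : ContDiff ℝ ∞ k) :
    ∫ p, f p * (dlt ψ p.1 * k p.2) ∂stripMeasure = -∫ p, (p.1 * u p) * (ψ p.1 * k p.2) ∂stripMeasure := by
  refine tendsto_nhds_unique (tendsto_integral_cut hf hψ.dlt hk.continuous)
    ((tendsto_integral_cut hu hψ hk.continuous).neg.congr fun j => ?_)
  have ht := hψ.id_mul.tensor_cut hk j
  have := h.2.2 _ ht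
  have hd : ∀ p : ℝ × ℝ, fderiv ℝ (fun p : ℝ × ℝ => p.1 * ψ p.1 * (k p.2 * cutTheta j p.2)) p dirR
      = dlt ψ p.1 * (k p.2 * cutTheta j p.2) := fun p =>
    (fderiv_tensor (ψ := fun R => R * ψ R) (k := fun θ => k θ * cutTheta j θ) (hψ.hasDerivAt_dlt p.1)
      ((hk.differentiable (by norm_num) p.2).hasDerivAt.mul (hasDerivAt_cutTheta j p.2))).1
  simp only [hd] at this
  rw [this]
  congr 2; ext p; ring

lemma IsTest.mono {U V : Set (ℝ × ℝ)} (h : U ⊆ V) {φ : ℝ × ℝ → ℝ} (hφ : IsTest U φ) : IsTest V φ :=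
  ⟨hφ.1, hφ.2.1, hφ.2.2.trans h⟩

lemma strip_subset : strip ⊆ Ioi 0 ×ˢ univ := prod_mono le_rfl (subset_univ _)

/-- Without boundary terms one may integrate by parts against any smooth angular profile. -/
lemma dirichlet_tensor {Ψ Θ : ℝ × ℝ → ℝ} (h : ∀ φ, IsTest (Ioi 0 ×ˢ univ) φ →
      ∫ p, Ψ p * fderiv ℝ φ p dirTheta ∂stripMeasure = -∫ p, Θ p * φ p ∂stripMeasure)
    {ψ k k' : ℝ → ℝ} (hψ : IsTestR ψ) (hk : ContDiff ℝ ∞ k)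
    (hd : ∀ θ ∈ Ioo 0 (Real.pi / 2), HasDerivAt k (k' θ) θ) :
    ∫ p, Ψ p * (ψ p.1 * k' p.2) ∂stripMeasure = -∫ p, Θ p * (ψ p.1 * k p.2) ∂stripMeasure := by
  -- a cutoff equal to `1` near `[0, π/2]`
  set ρ : ℝ → ℝ := fun θ => stepUp (θ + 3) * stepUp (5 - θ) with hρ
  have hρ1 : ∀ θ, -1 ≤ θ → θ ≤ 3 → ρ θ = 1 := fun θ h1 h2 => by
    simp only [hρ]; rw [stepUp_of_ge (by linarith), stepUp_of_ge (by linarith), one_mul]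
  have hρc : ContDiff ℝ ∞ ρ :=
    (stepUp_contDiff.comp (contDiff_id.add contDiff_const)).mul
      (stepUp_contDiff.comp (contDiff_const.sub contDiff_id))
  have hρs : Function.support (fun θ => k θ * ρ θ) ⊆ Icc (-2) 4 := by
    refine (Function.support_mul_subset_right _ _).trans fun θ hθ => ?_
    by_contra hn
    rw [mem_Icc, not_and_or, not_le, not_le] at hn
    apply hθ
    simp only [hρ]
    rcases hn with hn | hn
    · rw [stepUp_of_le (x := θ + 3) (by linarith), zero_mul]
    · rw [stepUp_of_le (x := 5 - θ) (by linarith), mul_zero]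
  have hT := hψ.tensor (hk.mul hρc) hρs (subset_univ _)
  have key := h _ hT
  have hpi := Real.pi_lt_four
  have e1 : ∫ p, Ψ p * fderiv ℝ (fun p : ℝ × ℝ => ψ p.1 * (k p.2 * ρ p.2)) p dirTheta ∂stripMeasure
      = ∫ p, Ψ p * (ψ p.1 * k' p.2) ∂stripMeasure := by
    refine integral_congr_ae (ae_strip_of_forall fun p hp => ?_)
    have hp2 : p.2 ∈ Ioo 0 (Real.pi / 2) := hp.2
    have hev : (fun θ => k θ * ρ θ) =ᶠ[𝓝 p.2] k := by
      filter_upwards [Ioo_mem_nhds hp2.1 hp2.2] with θ hθ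
      rw [hρ1 θ (by linarith [hθ.1]) (by linarith [hθ.2]), mul_one]
    simp only [(fderiv_tensor (hψ.hasDerivAt p.1) ((hd p.2 hp2).congr_of_eventuallyEq hev)).2]
  have e2 : ∫ p, Θ p * (ψ p.1 * (k p.2 * ρ p.2)) ∂stripMeasure
      = ∫ p, Θ p * (ψ p.1 * k p.2) ∂stripMeasure := by
    refine integral_congr_ae (ae_strip_of_forall fun p hp => ?_)
    have hp2 : p.2 ∈ Ioo 0 (Real.pi / 2) := hp.2
    simp only [hρ1 p.2 (by linarith [hp2.1]) (by linarith [hp2.2]), mul_one]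
  exact e1.symm.trans (key.trans (by rw [e2]))

/-- A solution may be tested against the adjoint eigenfunctions: the boundary terms at the cutoffs vanish
in the limit, the factor `cos θ` of the eigenfunctions compensating `tan θ`, and the Dirichlet condition
allows for one more integration by parts. -/
lemma IsL2Solution.vw {α : ℝ} {F Ψ : ℝ × ℝ → ℝ} (h : IsL2Solution α F Ψ)
    (hF : MemLp F 2 stripMeasure) : VW α F Ψ := by
  intro n ψ hψ
  obtain ⟨ΨR, ΨRR, Ψθθ, T, h1, h2, ⟨H, h3, h4⟩, h5, heq⟩ := h.equation
  obtain ⟨Θ, hΘ, hdir⟩ := h.dirichlet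
  have hΨ := h.memLp
  have hT0 : HasWeakDeriv dirTheta Ψ Θ := ⟨LocInt.of_memLp hΨ, LocInt.of_memLp hΘ,
    fun φ hφ => hdir φ (hφ.mono strip_subset)⟩
  have h6 : HasWeakDeriv dirTheta Θ Ψθθ := h4.congr (h3.unique hT0) ae_eq_rfl
  set k : ℕ → ℝ → ℝ := fun j θ => kK n θ * cutTheta j θ with hk
  set k' : ℕ → ℝ → ℝ := fun j θ => kK' n θ * cutTheta j θ + kK n θ * cutTheta' j θ with hk'
  have dk : ∀ j θ, HasDerivAt (k j) (k' j θ) θ := fun j θ =>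
    (hasDerivAt_kK n θ).mul (hasDerivAt_cutTheta j θ)
  have test : ∀ {χ : ℝ → ℝ}, IsTestR χ → ∀ j, IsTest strip (fun p => χ p.1 * k j p.2) :=
    fun hχ j => hχ.tensor_cut (kK_contDiff n) j
  have hX := hψ.id_mul
  have hX1 := hψ.dlt.id_mul
  have fR : ∀ {χ : ℝ → ℝ} (_ : IsTestR χ) j (p : ℝ × ℝ),
      fderiv ℝ (fun p : ℝ × ℝ => p.1 * χ p.1 * k j p.2) p dirR = dlt χ p.1 * k j p.2 := fun hχ j p =>
    (fderiv_tensor (ψ := fun R => R * _) (hχ.hasDerivAt_dlt p.1) (dk j p.2)).1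
  have fT : ∀ j (p : ℝ × ℝ), fderiv ℝ (fun p : ℝ × ℝ => ψ p.1 * k j p.2) p dirTheta = ψ p.1 * k' j p.2 :=
    fun j p => (fderiv_tensor (hψ.hasDerivAt p.1) (dk j p.2)).2
  -- integration by parts of the individual terms
  have A1 : ∀ j, ∫ p, ΨR p * (p.1 * ψ p.1 * k j p.2) ∂stripMeasure
      = -∫ p, Ψ p * (dlt ψ p.1 * k j p.2) ∂stripMeasure := by
    intro j
    have := h1.2.2 _ (test hX j)
    simp only [fR hψ j] at this
    linarith
  have A2 : ∀ j, ∫ p, ΨR p * (p.1 * dlt ψ p.1 * k j p.2) ∂stripMeasure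
      = -∫ p, Ψ p * (dlt (dlt ψ) p.1 * k j p.2) ∂stripMeasure := by
    intro j
    have := h1.2.2 _ (test hX1 j)
    simp only [fR hψ.dlt j] at this
    linarith
  have A3 : ∀ j, ∫ p, ΨRR p * (p.1 ^ 2 * ψ p.1 * k j p.2) ∂stripMeasure
      = ∫ p, Ψ p * (dlt ψ p.1 * k j p.2) ∂stripMeasure
        + ∫ p, Ψ p * (dlt (dlt ψ) p.1 * k j p.2) ∂stripMeasure := by
    intro j
    have := h2.2.2 _ (test hX.id_mul j)
    have e : ∀ R, dlt (fun R => R * ψ R) R = R * ψ R + R * dlt ψ R := by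
      intro R
      refine (((hasDerivAt_id' R).mul (hψ.hasDerivAt_dlt R)).congr_deriv ?_).deriv
      simp
    simp only [fR hX j, e] at this
    have s := integral_add ((test hX j).integrable_mul h1.2.1) ((test hX1 j).integrable_mul h1.2.1)
    rw [A1, A2] at s
    have c1 : ∫ p, ΨR p * ((p.1 * ψ p.1 + p.1 * dlt ψ p.1) * k j p.2) ∂stripMeasure
        = ∫ p, (ΨR p * (p.1 * ψ p.1 * k j p.2) + ΨR p * (p.1 * dlt ψ p.1 * k j p.2)) ∂stripMeasure := by
      congr 1; ext p; ring
    have c2 : ∫ p, ΨRR p * (p.1 ^ 2 * ψ p.1 * k j p.2) ∂stripMeasure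
        = ∫ p, ΨRR p * (p.1 * (p.1 * ψ p.1) * k j p.2) ∂stripMeasure := by
      congr 1; ext p; ring
    rw [c1, s] at this
    rw [c2]; linarith
  have A4 : ∀ j, ∫ p, Ψθθ p * (ψ p.1 * k j p.2) ∂stripMeasure
      = -∫ p, Θ p * (ψ p.1 * k' j p.2) ∂stripMeasure := by
    intro j
    have := h6.2.2 _ (test hψ j)
    simp only [fT] at this
    linarith
  have A5 : ∀ j, ∫ p, T p * (ψ p.1 * k j p.2) ∂stripMeasure
      = -∫ p, (Real.tan p.2 * Ψ p) * (ψ p.1 * k' j p.2) ∂stripMeasure := by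
    intro j
    have := h5.2.2 _ (test hψ j)
    simp only [fT] at this
    linarith
  have B : ∀ j, ∫ p, F p * (ψ p.1 * k j p.2) ∂stripMeasure
      = -α ^ 2 * ∫ p, Ψ p * (dlt (dlt ψ) p.1 * k j p.2) ∂stripMeasure
        + 5 * α * ∫ p, Ψ p * (dlt ψ p.1 * k j p.2) ∂stripMeasure
        + ∫ p, Θ p * (ψ p.1 * k' j p.2) ∂stripMeasure
        - ∫ p, (Real.tan p.2 * Ψ p) * (ψ p.1 * k' j p.2) ∂stripMeasure
        - 6 * ∫ p, Ψ p * (ψ p.1 * k j p.2) ∂stripMeasure := by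
    intro j
    have i1 := (test hX j).integrable_mul h1.2.1
    have i2 := (test (IsTestR.mul_contDiffOn (a := fun R => R ^ 2) (contDiffOn_id.pow 2) hψ) j).integrable_mul h2.2.1
    have i3 := (test hψ j).integrable_mul h4.2.1
    have i4 := (test hψ j).integrable_mul h5.2.1
    have i5 := (test hψ j).integrable_mul h1.1
    have e : ∫ p, F p * (ψ p.1 * k j p.2) ∂stripMeasure
        = ∫ p, (-α ^ 2 * (ΨRR p * (p.1 ^ 2 * ψ p.1 * k j p.2))
          + -(α * (5 + α)) * (ΨR p * (p.1 * ψ p.1 * k j p.2))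
          + -1 * (Ψθθ p * (ψ p.1 * k j p.2)) + T p * (ψ p.1 * k j p.2)
          + -6 * (Ψ p * (ψ p.1 * k j p.2))) ∂stripMeasure := by
      refine integral_congr_ae (heq.mono fun p hp => ?_)
      simp only [← hp]; ring
    have s : ∫ p, (-α ^ 2 * (ΨRR p * (p.1 ^ 2 * ψ p.1 * k j p.2))
          + -(α * (5 + α)) * (ΨR p * (p.1 * ψ p.1 * k j p.2))
          + -1 * (Ψθθ p * (ψ p.1 * k j p.2)) + T p * (ψ p.1 * k j p.2)
          + -6 * (Ψ p * (ψ p.1 * k j p.2))) ∂stripMeasure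
        = -α ^ 2 * ∫ p, ΨRR p * (p.1 ^ 2 * ψ p.1 * k j p.2) ∂stripMeasure
          + -(α * (5 + α)) * ∫ p, ΨR p * (p.1 * ψ p.1 * k j p.2) ∂stripMeasure
          + -1 * ∫ p, Ψθθ p * (ψ p.1 * k j p.2) ∂stripMeasure
          + ∫ p, T p * (ψ p.1 * k j p.2) ∂stripMeasure
          + -6 * ∫ p, Ψ p * (ψ p.1 * k j p.2) ∂stripMeasure := by
      rw [integral_add, integral_add, integral_add, integral_add, integral_const_mul,
        integral_const_mul, integral_const_mul, integral_const_mul]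
      all_goals first
        | exact i4
        | exact Integrable.const_mul (by assumption) _
        | skip
      · exact (i2.const_mul _).add (i1.const_mul _)
      · exact ((i2.const_mul _).add (i1.const_mul _)).add (i3.const_mul _)
      · exact (((i2.const_mul _).add (i1.const_mul _)).add (i3.const_mul _)).add i4
    rw [e, s, A1, A3, A4, A5]
    ring
  -- passage to the limit in the angular cutoff
  have hKc := (kK_contDiff n).continuous
  have hac := ang_continuous (eigenpoly n)
  have int : ∀ {f : ℝ × ℝ → ℝ}, MemLp f 2 stripMeasure → ∀ {χ : ℝ → ℝ}, IsTestR χ → ∀ {b : ℝ → ℝ},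
      Continuous b → Integrable (fun p => f p * (χ p.1 * b p.2)) stripMeasure :=
    fun hf _ hχ _ hb => integrable_tensor hf hχ hb
  have t0 := tendsto_integral_cut hF hψ hKc
  have t1 := tendsto_integral_cut hΨ hψ.dlt.dlt hKc
  have t2 := tendsto_integral_cut hΨ hψ.dlt hKc
  have t3 := tendsto_integral_cut hΨ hψ hKc
  have t4 : Tendsto (fun j => ∫ p, Θ p * (ψ p.1 * k' j p.2) ∂stripMeasure) atTop
      (𝓝 (∫ p, Θ p * (ψ p.1 * kK' n p.2) ∂stripMeasure)) := by
    have a := tendsto_integral_cut hΘ hψ (kK'_contDiff n).continuous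
    have b := tendsto_integral_cut' hΘ hψ (k := fun θ => 2 * Real.cos θ * ang (eigenpoly n) θ) (by fun_prop)
    rw [← add_zero (∫ p, Θ p * (ψ p.1 * kK' n p.2) ∂stripMeasure)]
    refine (a.add b).congr fun j => ?_
    have c1 := cutTheta'_continuous j
    have c2 := (cutTheta_contDiff j).continuous
    have c3 := (kK'_contDiff n).continuous
    rw [← integral_add (int hΘ hψ (b := fun θ => kK' n θ * cutTheta j θ) (by fun_prop))
      (int hΘ hψ (b := fun θ => 2 * Real.cos θ * ang (eigenpoly n) θ *
        (Real.sin θ * Real.cos θ * cutTheta' j θ)) (by fun_prop))]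
    congr 1; ext p
    simp only [hk', kK, kU, Real.sin_two_mul]; ring
  have t5 : Tendsto (fun j => ∫ p, (Real.tan p.2 * Ψ p) * (ψ p.1 * k' j p.2) ∂stripMeasure) atTop
      (𝓝 (∫ p, Ψ p * (ψ p.1 * kKt n p.2) ∂stripMeasure)) := by
    have a := tendsto_integral_cut hΨ hψ (kKt_continuous n)
    have b := tendsto_integral_cut' hΨ hψ (k := fun θ => 2 * Real.sin θ * ang (eigenpoly n) θ) (by fun_prop)
    rw [← add_zero (∫ p, Ψ p * (ψ p.1 * kKt n p.2) ∂stripMeasure)]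
    refine (a.add b).congr fun j => ?_
    have c1 := cutTheta'_continuous j
    have c2 := (cutTheta_contDiff j).continuous
    have c3 := kKt_continuous n
    rw [← integral_add (int hΨ hψ (b := fun θ => kKt n θ * cutTheta j θ) (by fun_prop))
      (int hΨ hψ (b := fun θ => 2 * Real.sin θ * ang (eigenpoly n) θ *
        (Real.sin θ * Real.cos θ * cutTheta' j θ)) (by fun_prop))]
    refine integral_congr_ae (ae_strip_of_forall fun p hp => ?_)
    have hc := (cos_pos_of_mem hp.2).ne'
    have ht : Real.tan p.2 * Real.cos p.2 = Real.sin p.2 := by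
      rw [Real.tan_eq_sin_div_cos]; field_simp
    simp only [hk', kK, kU, Real.sin_two_mul, ← tan_mul_kK' n hp.2]
    linear_combination (-2 * Ψ p * ψ p.1 * Real.sin p.2 * Real.cos p.2 * ang (eigenpoly n) p.2
      * cutTheta' j p.2) * ht
  have lim := ((((t1.const_mul (-α ^ 2)).add (t2.const_mul (5 * α))).add t4).sub t5).sub (t3.const_mul 6)
  rw [tendsto_nhds_unique t0 (lim.congr fun j => (B j).symm)]
  have dd := dirichlet_tensor hdir hψ (kK'_contDiff n) fun θ hθ => hasDerivAt_kK' n hθ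
  have j1 := int hΨ hψ.dlt.dlt hKc
  have j2 := int hΨ hψ.dlt hKc
  have j3 := int hΨ hψ hKc
  have j4 := int hΨ hψ (kKt_continuous n)
  have e1 : ∫ p, Ψ p * (ψ p.1 * -(kKt n p.2 + 6 * kK n p.2 + lam n * kK n p.2)) ∂stripMeasure
      = -1 * ∫ p, Ψ p * (ψ p.1 * kKt n p.2) ∂stripMeasure
        + -(6 + lam n) * ∫ p, Ψ p * (ψ p.1 * kK n p.2) ∂stripMeasure := by
    rw [← integral_const_mul, ← integral_const_mul, ← integral_add (j4.const_mul _) (j3.const_mul _)]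
    congr 1; ext p; ring
  have e2 : ∫ p, Ψ p * (adjOp α n ψ p.1 * kK n p.2) ∂stripMeasure
      = -α ^ 2 * ∫ p, Ψ p * (dlt (dlt ψ) p.1 * kK n p.2) ∂stripMeasure
        + 5 * α * ∫ p, Ψ p * (dlt ψ p.1 * kK n p.2) ∂stripMeasure
        + lam n * ∫ p, Ψ p * (ψ p.1 * kK n p.2) ∂stripMeasure := by
    have jj : Integrable (fun p => -α ^ 2 * (Ψ p * (dlt (dlt ψ) p.1 * kK n p.2))
        + 5 * α * (Ψ p * (dlt ψ p.1 * kK n p.2))) stripMeasure := (j1.const_mul _).add (j2.const_mul _)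
    rw [← integral_const_mul, ← integral_const_mul, ← integral_const_mul,
      ← integral_add (j1.const_mul _) (j2.const_mul _), ← integral_add jj (j3.const_mul _)]
    congr 1; ext p; simp only [adjOp]; ring
  rw [e2]
  rw [e1] at dd
  linarith

/-! ### Uniqueness -/

lemma cutR_isTestR (j : ℕ) : IsTestR (cutR j) := by
  have hj : (0 : ℝ) < 1 / ((j : ℝ) + 1) := by positivity
  have hs : tsupport (cutR j) ⊆ Icc (1 / ((j : ℝ) + 1)) (2 * ((j : ℝ) + 1)) :=
    closure_minimal (cutR_support j) isClosed_Icc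
  exact ⟨cutR_contDiff j, isCompact_Icc.of_isClosed_subset (isClosed_tsupport _) hs,
    hs.trans fun R hR => lt_of_lt_of_le hj hR.1⟩

/-- `(1 + R²)^{-1/2}`, a square integrable majorant of the radial profiles. -/
def radMaj (R : ℝ) : ℝ := Real.sqrt ((1 + R ^ 2)⁻¹)

lemma radMaj_continuous : Continuous radMaj := by
  unfold radMaj
  exact (Continuous.inv₀ (by fun_prop) fun R => by positivity).sqrt

lemma radMaj_memLp : MemLp (fun p : ℝ × ℝ => radMaj p.1) 2 stripMeasure := by
  rw [stripMeasure_eq_prod]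
  refine MemLp.comp_fst ((memLp_two_iff_integrable_sq radMaj_continuous.aestronglyMeasurable).2 ?_ |>.restrict _) _
  refine integrable_inv_one_add_sq.congr (ae_of_all _ fun R => ?_)
  simp only [radMaj]; rw [Real.sq_sqrt (by positivity)]

lemma abs_div_le_radMaj {a b K R x : ℝ} (ha : 1 ≤ a) (hb : 0 ≤ b) (hK : 0 ≤ K) (hR : 0 < R)
    (h1 : |x| ≤ K * R ^ a) (h2 : |x| ≤ K * R ^ (-b)) : |x / R| ≤ 2 * K * radMaj R := by
  have key : |x / R| ^ 2 * (1 + R ^ 2) ≤ (2 * K) ^ 2 := by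
    rw [abs_div, abs_of_pos hR, div_pow, div_mul_eq_mul_div, div_le_iff₀ (by positivity)]
    rcases le_or_gt R 1 with h | h
    · have e : R ^ a ≤ R := by
        simpa using Real.rpow_le_rpow_of_exponent_ge hR h ha
      have h3 : |x| ≤ K * R := h1.trans (mul_le_mul_of_nonneg_left e hK)
      have h4 : |x| ^ 2 ≤ (K * R) ^ 2 := pow_le_pow_left₀ (abs_nonneg _) h3 2
      have h5 : R ^ 2 ≤ 1 := pow_le_one₀ hR.le h
      nlinarith [sq_nonneg |x|, sq_nonneg (K * R)]
    · have e : R ^ (-b) ≤ 1 := Real.rpow_le_one_of_one_le_of_nonpos h.le (by linarith)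
      have h3 : |x| ≤ K := h2.trans (mul_le_of_le_one_right hK e)
      have h4 : |x| ^ 2 ≤ K ^ 2 := pow_le_pow_left₀ (abs_nonneg _) h3 2
      have h5 : 1 ≤ R ^ 2 := one_le_pow₀ h.le
      nlinarith [sq_nonneg |x|, sq_nonneg K]
  have hp : (0 : ℝ) < 1 + R ^ 2 := by positivity
  refine abs_le_of_sq_le_sq' ?_ (by unfold radMaj; positivity) |>.2
  rw [mul_pow, radMaj, Real.sq_sqrt (by positivity), ← div_eq_mul_inv, le_div_iff₀ hp]
  exact key

/-- The adjoint radial operators have dense range on test functions, so that a very weak solution of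
the homogeneous equation has vanishing angular moments. -/
lemma VW.moment_eq_zero {α : ℝ} (hα0 : 0 < α) (hα : α ≤ 1 / 4) {Ψ : ℝ × ℝ → ℝ}
    (hΨ : MemLp Ψ 2 stripMeasure) (h : VW α (fun _ => 0) Ψ) (n : ℕ) {g : ℝ → ℝ} (hg : IsTestR g) :
    ∫ p, Ψ p * (g p.1 * kK n p.2) ∂stripMeasure = 0 := by
  have ha : 1 ≤ (2 * (n : ℝ) + 5) / α := by rw [le_div_iff₀ hα0]; linarith [(Nat.cast_nonneg n : (0 : ℝ) ≤ n)]
  have hb : 0 ≤ 2 * (n : ℝ) / α := by positivity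
  obtain ⟨c, c₁, c₂, s0, s1, s2, d0, d1, e, K, hK, bd⟩ :=
    exists_radial_solution (a := (2 * (n : ℝ) + 5) / α) (b := 2 * n / α) (by linarith) hg.id_mul
  obtain ⟨B, hB⟩ := exists_cutR_bound
  have hB0 : 0 ≤ B := (abs_nonneg _).trans (hB 0 0).1
  set ψ : ℕ → ℝ → ℝ := fun j R => (c R / R) * cutR j R with hψdef
  have hψ : ∀ j, IsTestR (ψ j) := fun j => IsTestR.mul_contDiffOn
    (s0.div contDiffOn_id fun R hR => ne_of_gt hR) (cutR_isTestR j)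
  have D1 : ∀ j, ∀ R ∈ Ioi (0 : ℝ), dlt (ψ j) R = (c₁ R / R) * cutR j R + c R * (cutR1 j R / R) := by
    intro j R hR
    have := (d0 R hR).mul (hasDerivAt_cutR j hR).1
    refine HasDerivAt.deriv (this.congr_of_eventuallyEq ?_)
    filter_upwards [Ioi_mem_nhds hR] with r hr
    have : r ≠ 0 := ne_of_gt hr
    simp only [hψdef, Pi.mul_apply]; field_simp
  have D2 : ∀ j, ∀ R ∈ Ioi (0 : ℝ), dlt (dlt (ψ j)) R
      = (c₂ R / R) * cutR j R + 2 * (c₁ R / R * cutR1 j R) + c R / R * cutR2 j R := by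
    intro j R hR
    have hR0 : R ≠ 0 := ne_of_gt hR
    have := ((d1 R hR).mul (hasDerivAt_cutR j hR).1).add ((d0 R hR).mul (hasDerivAt_cutR j hR).2)
    refine (HasDerivAt.congr_deriv (this.congr_of_eventuallyEq ?_) ?_).deriv
    · filter_upwards [Ioi_mem_nhds hR] with r hr
      have : r ≠ 0 := ne_of_gt hr
      rw [D1 j r hr]
      simp only [Pi.mul_apply, Pi.add_apply]; field_simp
    · field_simp; ring
  set κ : ℝ := α * (4 * n + 5) with hκ
  have AD : ∀ j, ∀ R ∈ Ioi (0 : ℝ), adjOp α n (ψ j) R = κ * (g R * cutR j R)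
      + (-2 * α ^ 2 * (c₁ R / R * cutR1 j R) - α ^ 2 * (c R / R * cutR2 j R)
        + 5 * α * (c R / R * cutR1 j R)) := by
    intro j R hR
    have hR0 : R ≠ 0 := ne_of_gt hR
    have eq := e R hR
    rw [adjOp, D1 j R hR, D2 j R hR]
    simp only [hψdef, lam, hκ]
    field_simp at eq ⊢
    linear_combination (-cutR j R) * eq
  have key : Tendsto (fun j => ∫ p, Ψ p * (adjOp α n (ψ j) p.1 * kK n p.2) ∂stripMeasure) atTop
      (𝓝 (∫ p, Ψ p * ((κ * g p.1) * kK n p.2) ∂stripMeasure)) := by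
    obtain ⟨G, hG⟩ := hg.exists_abs_le
    obtain ⟨L, hL⟩ := (isCompact_Icc (a := (0 : ℝ)) (b := Real.pi / 2)).exists_bound_of_continuousOn
      (kK_contDiff n).continuous.continuousOn
    have m1 : MemLp (fun p : ℝ × ℝ => |κ| * B * |g p.1|
        + (2 * α ^ 2 + α ^ 2 + 5 * α) * (2 * K) * B * radMaj p.1) 2 stripMeasure :=
      (hg.memLp.abs.const_mul _).add (radMaj_memLp.const_mul _)
    refine tendsto_integral_of_dominated_convergence (fun p => L * ‖Ψ p * (|κ| * B * |g p.1|
        + (2 * α ^ 2 + α ^ 2 + 5 * α) * (2 * K) * B * radMaj p.1)‖) (fun j => ?_)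
      ((hΨ.integrable_mul m1).norm.const_mul L) (fun j => ae_strip_of_forall fun p hp => ?_)
      (ae_strip_of_forall fun p hp => ?_)
    · exact (integrable_tensor hΨ (hψ j).adjOp (kK_contDiff n).continuous).1
    · rw [norm_mul, norm_mul, norm_mul, mul_left_comm L]
      refine mul_le_mul_of_nonneg_left ?_ (norm_nonneg _)
      rw [mul_comm]
      refine mul_le_mul (hL _ (Ioo_subset_Icc_self hp.2)) ?_ (norm_nonneg _)
        ((norm_nonneg _).trans (hL _ (Ioo_subset_Icc_self hp.2)))
      rw [Real.norm_eq_abs, Real.norm_eq_abs, AD j p.1 hp.1]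
      refine le_trans ?_ (le_abs_self _)
      have u0 := abs_div_le_radMaj ha hb hK hp.1 (bd p.1 hp.1).1.1 (bd p.1 hp.1).1.2
      have u1 := abs_div_le_radMaj ha hb hK hp.1 (bd p.1 hp.1).2.1.1 (bd p.1 hp.1).2.1.2
      obtain ⟨b0, b1, b2⟩ := hB j p.1
      have v1 := mul_le_mul u1 b1 (abs_nonneg _) ((abs_nonneg _).trans u1)
      have v2 := mul_le_mul u0 b2 (abs_nonneg _) ((abs_nonneg _).trans u0)
      have v3 := mul_le_mul u0 b1 (abs_nonneg _) ((abs_nonneg _).trans u0)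
      have v0 := mul_le_mul_of_nonneg_left b0 (mul_nonneg (abs_nonneg κ) (abs_nonneg (g p.1)))
      rw [← abs_mul] at v1 v2 v3
      rw [← abs_mul, ← abs_mul] at v0
      have w1 := mul_le_mul_of_nonneg_left v1 (show 0 ≤ 2 * α ^ 2 by positivity)
      have w2 := mul_le_mul_of_nonneg_left v2 (show 0 ≤ α ^ 2 by positivity)
      have w3 := mul_le_mul_of_nonneg_left v3 (show 0 ≤ 5 * α by positivity)
      have z1 := abs_le.1 (le_refl |c₁ p.1 / p.1 * cutR1 j p.1|)
      rw [show κ * (g p.1 * cutR j p.1) = κ * g p.1 * cutR j p.1 by ring]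
      refine (abs_add_le _ _).trans ?_
      have z : |-2 * α ^ 2 * (c₁ p.1 / p.1 * cutR1 j p.1) - α ^ 2 * (c p.1 / p.1 * cutR2 j p.1)
          + 5 * α * (c p.1 / p.1 * cutR1 j p.1)| ≤ 2 * α ^ 2 * |c₁ p.1 / p.1 * cutR1 j p.1|
          + α ^ 2 * |c p.1 / p.1 * cutR2 j p.1| + 5 * α * |c p.1 / p.1 * cutR1 j p.1| := by
        have hα2 : |α| = α := abs_of_pos hα0
        refine (abs_add_le _ _).trans (add_le_add ((abs_sub _ _).trans (add_le_add ?_ ?_)) ?_)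
        · rw [abs_mul, abs_mul, abs_pow, hα2]; norm_num
        · rw [abs_mul, abs_pow, hα2]
        · rw [abs_mul, abs_mul, hα2]; norm_num
      rw [abs_mul κ] at v0
      linarith
    · refine tendsto_const_nhds.congr' ((eventually_cutR hp.1).mono fun j hj => ?_)
      simp only []
      rw [AD j p.1 hp.1, hj.1, hj.2.1, hj.2.2]; ring
  have z : ∀ j, ∫ p, Ψ p * (adjOp α n (ψ j) p.1 * kK n p.2) ∂stripMeasure = 0 := fun j => by
    rw [h n _ (hψ j)]; simp
  simp_rw [z] at key
  have := tendsto_nhds_unique key tendsto_const_nhds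
  have e2 : ∫ p, Ψ p * ((κ * g p.1) * kK n p.2) ∂stripMeasure
      = κ * ∫ p, Ψ p * (g p.1 * kK n p.2) ∂stripMeasure := by
    rw [← integral_const_mul]; congr 1; ext p; ring
  rw [e2] at this
  exact (mul_eq_zero.1 this).resolve_left (by positivity)

/-- Uniqueness: all moments of the slices vanish. -/
lemma VW.eq_zero {α : ℝ} (hα0 : 0 < α) (hα : α ≤ 1 / 4) {Ψ : ℝ × ℝ → ℝ}
    (hΨ : MemLp Ψ 2 stripMeasure) (h : VW α (fun _ => 0) Ψ) : ∀ᵐ p ∂stripMeasure, Ψ p = 0 := by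
  set G : ℝ × ℝ → ℝ := fun p => Real.cos p.2 * Real.sin (2 * p.2) * Ψ p with hGdef
  have hG : MemLp G 2 stripMeasure := MemLp.mul_bounded hΨ
    (b := fun p => Real.cos p.2 * Real.sin (2 * p.2)) (by fun_prop) (K := 1) fun p _ => by
      rw [abs_mul]
      exact mul_le_one₀ (Real.abs_cos_le_one _) (abs_nonneg _) (Real.abs_sin_le_one _)
  have a1 := ae_slice_moments hG 0 fun n _ ψ hψ => by
    rw [← h.moment_eq_zero hα0 hα hΨ n hψ]
    congr 1; ext p; simp only [hGdef, kK, kU]; ring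
  have hsq := hG.integrable_sq
  have e : ∫ p, G p ^ 2 ∂stripMeasure = 0 := by
    rw [integral_strip hsq]
    refine integral_eq_zero_of_ae ?_
    filter_upwards [a1, ae_slice_memLp hG] with R h1 h2
    refine integral_eq_zero_of_ae ?_
    filter_upwards [ae_eq_zero_of_eigenpoly_moments h2 fun n => h1 n n.zero_le] with θ hθ
    rw [hθ]; simp
  rw [integral_eq_zero_iff_of_nonneg (fun p => sq_nonneg _) hsq] at e
  filter_upwards [e, ae_restrict_mem measurableSet_strip] with p hp hps
  have h1 := cos_pos_of_mem hps.2
  have h2 := sin_two_mul_pos hps.2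
  have : G p = 0 := by simpa using hp
  exact (mul_eq_zero.1 this).resolve_left (by positivity)

lemma VW.unique {α : ℝ} (hα0 : 0 < α) (hα : α ≤ 1 / 4) {F Ψ Φ : ℝ × ℝ → ℝ}
    (hΨ : MemLp Ψ 2 stripMeasure) (hΦ : MemLp Φ 2 stripMeasure) (h : VW α F Ψ) (h' : VW α F Φ) :
    Ψ =ᵐ[stripMeasure] Φ := by
  have := VW.eq_zero hα0 hα (hΨ.sub hΦ) fun n ψ hψ => by
    have e := integral_sub (integrable_tensor hΨ (hψ.adjOp (α := α) (n := n)) (kK_contDiff n).continuous)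
      (integrable_tensor hΦ (hψ.adjOp (α := α) (n := n)) (kK_contDiff n).continuous)
    rw [h n ψ hψ, h' n ψ hψ, sub_self] at e
    simp only [zero_mul, integral_zero]
    rw [← e]; congr 1; ext p; simp only [Pi.sub_apply]; ring
  exact this.mono fun p hp => sub_eq_zero.1 hp

/-- Very weak solutions are compatible with `R ∂_R`. -/
lemma VW.radial_deriv {α : ℝ} {F Ψ u v : ℝ × ℝ → ℝ} (hΨ : MemLp Ψ 2 stripMeasure)
    (hF : MemLp F 2 stripMeasure) (h : VW α F Ψ) (hu : HasWeakDeriv dirR Ψ u)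
    (hv : HasWeakDeriv dirR F v) (mu : MemLp (fun p => p.1 * u p) 2 stripMeasure)
    (mv : MemLp (fun p => p.1 * v p) 2 stripMeasure) :
    VW α (fun p => p.1 * v p) (fun p => p.1 * u p) := by
  intro n ψ hψ
  have e1 := hu.radial_parts hΨ mu (hψ.adjOp (α := α) (n := n)) (kK_contDiff n)
  have e2 := hv.radial_parts hF mv hψ (kK_contDiff n)
  rw [dlt_adjOp hψ, h n _ hψ.dlt, e2] at e1
  linarith

/-! ### The two differential operators -/

lemma contDiffOn_inv_fst : ContDiffOn ℝ ∞ (fun R : ℝ => R⁻¹) (Ioi 0) :=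
  contDiffOn_id.inv fun _ hR => ne_of_gt hR

lemma contDiffOn_inv_sin : ContDiffOn ℝ ∞ (fun θ : ℝ => (Real.sin (2 * θ))⁻¹) (Ioo 0 (Real.pi / 2)) :=
  ContDiffOn.inv (Real.contDiff_sin.comp (contDiff_const.mul contDiff_id)).contDiffOn
    fun _ hθ => (sin_two_mul_pos hθ).ne'

lemma IsDR.hasWeakDeriv {f g : ℝ × ℝ → ℝ} (h : IsDR f g) :
    HasWeakDeriv dirR f (fun p => p.1⁻¹ * g p) := by
  obtain ⟨u, hu, hg⟩ := h
  refine hu.congr ae_eq_rfl ?_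
  filter_upwards [hg, ae_restrict_mem measurableSet_strip] with p hp hs
  have : p.1 ≠ 0 := ne_of_gt hs.1
  rw [hp]; field_simp

lemma isDR_of_hasWeakDeriv {f g : ℝ × ℝ → ℝ} (h : HasWeakDeriv dirR f (fun p => p.1⁻¹ * g p)) :
    IsDR f g :=
  ⟨_, h, ae_strip_of_forall fun p hp => by
    have : p.1 ≠ 0 := ne_of_gt hp.1
    field_simp⟩

lemma IsDTheta.hasWeakDeriv {f g : ℝ × ℝ → ℝ} (h : IsDTheta f g) :
    HasWeakDeriv dirTheta f (fun p => (Real.sin (2 * p.2))⁻¹ * g p) := by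
  obtain ⟨u, hu, hg⟩ := h
  refine hu.congr ae_eq_rfl ?_
  filter_upwards [hg, ae_restrict_mem measurableSet_strip] with p hp hs
  have := (sin_two_mul_pos hs.2).ne'
  rw [hp]; field_simp

lemma isDTheta_of_hasWeakDeriv {f g : ℝ × ℝ → ℝ}
    (h : HasWeakDeriv dirTheta f (fun p => (Real.sin (2 * p.2))⁻¹ * g p)) : IsDTheta f g :=
  ⟨_, h, ae_strip_of_forall fun p hp => by
    have := (sin_two_mul_pos hp.2).ne'
    field_simp⟩

lemma IsDR.locInt {f g : ℝ × ℝ → ℝ} (h : IsDR f g) : LocallyIntegrableOn g strip := by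
  obtain ⟨u, hu, hg⟩ := h
  exact LocInt.congr (LocInt.mul (b := fun p => p.1) hu.2.1 continuousOn_fst) hg.symm

lemma IsDTheta.locInt {f g : ℝ × ℝ → ℝ} (h : IsDTheta f g) : LocallyIntegrableOn g strip := by
  obtain ⟨u, hu, hg⟩ := h
  exact LocInt.congr (LocInt.mul (b := fun p => Real.sin (2 * p.2)) hu.2.1 (by fun_prop)) hg.symm

lemma IsDR.congr {f g f' g' : ℝ × ℝ → ℝ} (h : IsDR f g) (hf : f =ᵐ[stripMeasure] f')
    (hg : g =ᵐ[stripMeasure] g') : IsDR f' g' := by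
  obtain ⟨u, hu, hgu⟩ := h
  exact ⟨u, hu.congr hf ae_eq_rfl, hg.symm.trans hgu⟩

lemma IsDTheta.congr {f g f' g' : ℝ × ℝ → ℝ} (h : IsDTheta f g) (hf : f =ᵐ[stripMeasure] f')
    (hg : g =ᵐ[stripMeasure] g') : IsDTheta f' g' := by
  obtain ⟨u, hu, hgu⟩ := h
  exact ⟨u, hu.congr hf ae_eq_rfl, hg.symm.trans hgu⟩

lemma IsDR.unique {f g h : ℝ × ℝ → ℝ} (hg : IsDR f g) (hh : IsDR f h) : g =ᵐ[stripMeasure] h := by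
  obtain ⟨u, hu, hgu⟩ := hg
  obtain ⟨v, hv, hhv⟩ := hh
  filter_upwards [hgu, hhv, hu.unique hv] with p h1 h2 h3
  rw [h1, h2, h3]

lemma IsDTheta.unique {f g h : ℝ × ℝ → ℝ} (hg : IsDTheta f g) (hh : IsDTheta f h) :
    g =ᵐ[stripMeasure] h := by
  obtain ⟨u, hu, hgu⟩ := hg
  obtain ⟨v, hv, hhv⟩ := hh
  filter_upwards [hgu, hhv, hu.unique hv] with p h1 h2 h3
  rw [h1, h2, h3]

lemma IsDR.add {f g f' g' : ℝ × ℝ → ℝ} (h : IsDR f g) (h' : IsDR f' g') :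
    IsDR (fun p => f p + f' p) (fun p => g p + g' p) :=
  isDR_of_hasWeakDeriv ((h.hasWeakDeriv.add h'.hasWeakDeriv).congr ae_eq_rfl
    (ae_of_all _ fun p => by ring))

lemma IsDR.const_mul {f g : ℝ × ℝ → ℝ} (h : IsDR f g) (c : ℝ) :
    IsDR (fun p => c * f p) (fun p => c * g p) :=
  isDR_of_hasWeakDeriv ((h.hasWeakDeriv.const_mul c).congr ae_eq_rfl (ae_of_all _ fun p => by ring))

lemma IsDTheta.add {f g f' g' : ℝ × ℝ → ℝ} (h : IsDTheta f g) (h' : IsDTheta f' g') :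
    IsDTheta (fun p => f p + f' p) (fun p => g p + g' p) :=
  isDTheta_of_hasWeakDeriv ((h.hasWeakDeriv.add h'.hasWeakDeriv).congr ae_eq_rfl
    (ae_of_all _ fun p => by ring))

lemma IsDTheta.mul_theta {f g : ℝ × ℝ → ℝ} {b b' : ℝ → ℝ} (h : IsDTheta f g)
    (hb : ContDiffOn ℝ ∞ b (Ioo 0 (Real.pi / 2)))
    (hb' : ∀ θ ∈ Ioo 0 (Real.pi / 2), HasDerivAt b (b' θ) θ) :
    IsDTheta (fun p => b p.2 * f p) (fun p => b p.2 * g p + Real.sin (2 * p.2) * b' p.2 * f p) :=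
  isDTheta_of_hasWeakDeriv ((h.hasWeakDeriv.mul_theta hb hb').congr ae_eq_rfl
    (ae_strip_of_forall fun p hp => by
      have := (sin_two_mul_pos hp.2).ne'
      field_simp))

/-- The two operators commute; the missing derivative exists. -/
lemma IsDR.swap {f g f₁ h : ℝ × ℝ → ℝ} (hR : IsDR f f₁) (hT : IsDTheta f g) (hRT : IsDR g h) :
    IsDTheta f₁ h := by
  have h1 := hRT.hasWeakDeriv.mul_theta_dirR contDiffOn_inv_sin
  have h2 := (hR.hasWeakDeriv.swap hT.hasWeakDeriv h1).mul_R_dirTheta (b := fun R => R) contDiffOn_id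
  refine isDTheta_of_hasWeakDeriv (h2.congr (ae_strip_of_forall fun p hp => ?_)
    (ae_strip_of_forall fun p hp => ?_))
  · have : p.1 ≠ 0 := ne_of_gt hp.1
    field_simp
  · have : p.1 ≠ 0 := ne_of_gt hp.1
    field_simp

lemma IsDTheta.swap {f g f₁ h : ℝ × ℝ → ℝ} (hT : IsDTheta f g) (hR : IsDR f f₁) (hTR : IsDTheta f₁ h) :
    IsDR g h := by
  have h1 := hTR.hasWeakDeriv.mul_R_dirTheta contDiffOn_inv_fst
  have h2 := (hT.hasWeakDeriv.swap hR.hasWeakDeriv h1).mul_theta_dirR (b := fun θ => Real.sin (2 * θ))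
    (Real.contDiff_sin.comp (contDiff_const.mul contDiff_id)).contDiffOn
  refine isDR_of_hasWeakDeriv (h2.congr (ae_strip_of_forall fun p hp => ?_)
    (ae_strip_of_forall fun p hp => ?_))
  · have := (sin_two_mul_pos hp.2).ne'
    field_simp
  · have := (sin_two_mul_pos hp.2).ne'
    field_simp

lemma isDTheta_of_deriv {f g : ℝ × ℝ → ℝ} (h : HasWeakDeriv dirTheta f g) :
    IsDTheta f (fun p => Real.sin (2 * p.2) * g p) := ⟨g, h, ae_eq_rfl⟩

/-! ### Properties of solutions -/

namespace Sol

variable {α : ℝ} {F Ψ Ψ₁ Ψ₂ Θ Θ₁ Y : ℝ × ℝ → ℝ}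

lemma isDR (h : Sol α F Ψ Ψ₁ Ψ₂ Θ Θ₁ Y) : IsDR Ψ (fun p => α⁻¹ * Ψ₁ p) :=
  isDR_of_hasWeakDeriv (h.dR.congr ae_eq_rfl (ae_of_all _ fun p => by ring))

lemma isDR₁ (h : Sol α F Ψ Ψ₁ Ψ₂ Θ Θ₁ Y) : IsDR Ψ₁ (fun p => α⁻¹ * Ψ₂ p) :=
  isDR_of_hasWeakDeriv (h.dR₁.congr ae_eq_rfl (ae_of_all _ fun p => by ring))

/-- The second radial derivative of a solution. -/
lemma dRR (h : Sol α F Ψ Ψ₁ Ψ₂ Θ Θ₁ Y) : HasWeakDeriv dirR (fun p => α⁻¹ / p.1 * Ψ₁ p)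
    (fun p => (p.1 ^ 2)⁻¹ * (α⁻¹ ^ 2 * Ψ₂ p + -α⁻¹ * Ψ₁ p)) := by
  have hd : ∀ R ∈ Ioi (0 : ℝ), HasDerivAt (fun R : ℝ => α⁻¹ / R) (-(α⁻¹ / R ^ 2)) R := by
    intro R hR
    have hR0 : R ≠ 0 := ne_of_gt hR
    refine ((hasDerivAt_inv hR0).const_mul α⁻¹).congr_deriv ?_
    field_simp
  have := h.dR₁.mul_R (b := fun R => α⁻¹ / R) (contDiffOn_const.div contDiffOn_id fun R hR => ne_of_gt hR) hd
  refine this.congr ae_eq_rfl (ae_strip_of_forall fun p hp => ?_)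
  have : p.1 ≠ 0 := ne_of_gt hp.1
  field_simp

/-- The term `∂_θ (tan θ Ψ)` equals `Ψ + sin θ Y`. -/
lemma isL2Solution (hα0 : 0 < α) (h : Sol α F Ψ Ψ₁ Ψ₂ Θ Θ₁ Y) : IsL2Solution α F Ψ where
  memLp := h.memΨ.memLp eta_pos.le
  dirichlet := ⟨Θ, h.memΘ.memLp eta_pos.le, h.dir⟩
  equation := by
    have ht : ∀ θ ∈ Ioo 0 (Real.pi / 2), HasDerivAt Real.tan (1 / Real.cos θ ^ 2) θ := fun θ hθ =>
      Real.hasDerivAt_tan (cos_pos_of_mem hθ).ne'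
    have htc : ContDiffOn ℝ ∞ Real.tan (Ioo 0 (Real.pi / 2)) := fun θ hθ =>
      (Real.contDiffAt_tan.2 (cos_pos_of_mem hθ).ne').contDiffWithinAt
    refine ⟨_, _, _, _, h.dR, h.dRR, ⟨Θ, h.dT, h.dTT⟩, h.dT.mul_theta htc ht, ?_⟩
    filter_upwards [h.relY, ae_restrict_mem measurableSet_strip] with p hY hp
    have hc := (cos_pos_of_mem hp.2).ne'
    have hR : p.1 ≠ 0 := ne_of_gt hp.1
    have hα : α ≠ 0 := hα0.ne'
    have e1 : Real.tan p.2 * Θ p + 1 / Real.cos p.2 ^ 2 * Ψ p = Real.sin p.2 * Y p + Ψ p := by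
      rw [Real.tan_eq_sin_div_cos]
      have := Real.sin_sq_add_cos_sq p.2
      field_simp
      linear_combination (-Real.sin p.2) * hY - Ψ p * this
    rw [e1]
    field_simp
    ring

lemma vw (hα0 : 0 < α) (h : Sol α F Ψ Ψ₁ Ψ₂ Θ Θ₁ Y) (hF : MemLp F 2 stripMeasure) : VW α F Ψ :=
  (h.isL2Solution hα0).vw hF

variable {G Φ Φ₁ Φ₂ Ξ Ξ₁ W : ℝ × ℝ → ℝ}

/-- The solution with right-hand side `D_R F` is `D_R` of the solution. -/
lemma radial (hα0 : 0 < α) (hα : α ≤ 1 / 4) (h : Sol α F Ψ Ψ₁ Ψ₂ Θ Θ₁ Y) (h' : Sol α G Φ Φ₁ Φ₂ Ξ Ξ₁ W)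
    (hF : MemLp F 2 stripMeasure) (hG : MemLp G 2 stripMeasure) (hFG : IsDR F G) :
    IsDR Ψ Φ ∧ IsDR Ψ₁ Φ₁ ∧ IsDR Ψ₂ Φ₂ ∧ IsDR Θ Ξ ∧
    Ψ₁ =ᵐ[stripMeasure] (fun p => α * Φ p) ∧ Ψ₂ =ᵐ[stripMeasure] (fun p => α * Φ₁ p) ∧
    Θ₁ =ᵐ[stripMeasure] (fun p => α * Ξ p) := by
  have hα' : α ≠ 0 := hα0.ne'
  have e0 : Ψ₁ =ᵐ[stripMeasure] fun p => α * Φ p := by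
    have eG : (fun p : ℝ × ℝ => p.1 * (p.1⁻¹ * G p)) =ᵐ[stripMeasure] G := ae_strip_of_forall fun p hp => by
      have : p.1 ≠ 0 := ne_of_gt hp.1
      field_simp
    have eΨ : (fun p : ℝ × ℝ => p.1 * (p.1⁻¹ * (α⁻¹ * Ψ₁ p))) =ᵐ[stripMeasure] fun p => α⁻¹ * Ψ₁ p :=
      ae_strip_of_forall fun p hp => by
        have : p.1 ≠ 0 := ne_of_gt hp.1
        field_simp
    have m1 : MemLp (fun p => α⁻¹ * Ψ₁ p) 2 stripMeasure := (h.memΨ₁.memLp eta_pos.le).const_mul _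
    have v := (h.vw hα0 hF).radial_deriv (h.memΨ.memLp eta_pos.le) hF h.isDR.hasWeakDeriv hFG.hasWeakDeriv
      (m1.ae_eq eΨ.symm) (hG.ae_eq eG.symm)
    have v' : VW α (fun p : ℝ × ℝ => p.1 * (p.1⁻¹ * G p)) Φ := fun n ψ hψ => by
      rw [h'.vw hα0 hG n ψ hψ]
      exact integral_congr_ae (eG.mono fun p hp => by simp only [] at hp ⊢; rw [hp])
    have := VW.unique hα0 hα (m1.ae_eq eΨ.symm) (h'.memΨ.memLp eta_pos.le) v v'
    filter_upwards [this, eΨ] with p h1 h2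
    rw [h2] at h1
    rw [← h1]; field_simp
  have e1 : Ψ₂ =ᵐ[stripMeasure] fun p => α * Φ₁ p := by
    have := h.isDR₁.unique ((h'.isDR.const_mul α).congr e0.symm ae_eq_rfl)
    filter_upwards [this] with p hp
    field_simp at hp
    linarith
  have e2 : Θ₁ =ᵐ[stripMeasure] fun p => α * Ξ p :=
    h.dT₁.unique ((h'.dT.const_mul α).congr e0.symm ae_eq_rfl)
  have a0 : IsDR Ψ Φ := h.isDR.congr ae_eq_rfl (e0.mono fun p hp => by simp only [hp]; field_simp)
  have a1 : IsDR Ψ₁ Φ₁ := h.isDR₁.congr ae_eq_rfl (e1.mono fun p hp => by simp only [hp]; field_simp)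
  refine ⟨a0, a1, ?_, ?_, e0, e1, e2⟩
  · refine (h'.isDR₁.const_mul α).congr e1.symm (ae_of_all _ fun p => ?_)
    field_simp
  · have b1 : HasWeakDeriv dirTheta (fun p => p.1⁻¹ * Φ p) (fun p => p.1⁻¹ * Ξ p) :=
      h'.dT.mul_R_dirTheta contDiffOn_inv_fst
    exact isDR_of_hasWeakDeriv (h.dT.swap a0.hasWeakDeriv b1)

/-- `∂_θθ Ψ`, by the equation. -/
lemma radial_dTT (h : Sol α F Ψ Ψ₁ Ψ₂ Θ Θ₁ Y) (h' : Sol α G Φ Φ₁ Φ₂ Ξ Ξ₁ W) (hd : IsDR Θ Ξ) :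
    IsDR (fun p => Real.sin p.2 * Y p - 5 * Ψ p - (F p + Ψ₂ p + 5 * Ψ₁ p))
      (fun p => Real.sin p.2 * W p - 5 * Φ p - (G p + Φ₂ p + 5 * Φ₁ p)) :=
  isDR_of_hasWeakDeriv (h.dTT.swap hd.hasWeakDeriv (h'.dTT.mul_R_dirTheta contDiffOn_inv_fst))

/-- The first order equation for `Y`, `D_θ Y = 6 sin² θ Y - 2 sin θ Q`. -/
lemma isDTheta_Y (h : Sol α F Ψ Ψ₁ Ψ₂ Θ Θ₁ Y) :
    IsDTheta Y (fun p => 6 * Real.sin p.2 ^ 2 * Y p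
      - 2 * Real.sin p.2 * (F p + 4 * Ψ p + Ψ₂ p + 5 * Ψ₁ p)) := by
  have s1 : ContDiffOn ℝ ∞ (fun θ => (Real.cos θ)⁻¹) (Ioo 0 (Real.pi / 2)) :=
    Real.contDiff_cos.contDiffOn.inv fun θ hθ => (cos_pos_of_mem hθ).ne'
  have d1 : ∀ θ ∈ Ioo 0 (Real.pi / 2), HasDerivAt (fun θ => (Real.cos θ)⁻¹)
      (Real.sin θ / Real.cos θ ^ 2) θ := fun θ hθ =>
    ((Real.hasDerivAt_cos θ).inv (cos_pos_of_mem hθ).ne').congr_deriv (by ring)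
  have s2 : ContDiffOn ℝ ∞ (fun θ => Real.sin θ / Real.cos θ ^ 2) (Ioo 0 (Real.pi / 2)) :=
    Real.contDiff_sin.contDiffOn.div (Real.contDiff_cos.pow 2).contDiffOn
      fun θ hθ => (pow_pos (cos_pos_of_mem hθ) 2).ne'
  have d2 : ∀ θ ∈ Ioo 0 (Real.pi / 2), HasDerivAt (fun θ => Real.sin θ / Real.cos θ ^ 2)
      ((Real.cos θ)⁻¹ + 2 * Real.sin θ ^ 2 / Real.cos θ ^ 3) θ := fun θ hθ => by
    have hc := (cos_pos_of_mem hθ).ne'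
    refine ((Real.hasDerivAt_sin θ).div ((Real.hasDerivAt_cos θ).pow 2) (pow_ne_zero 2 hc)).congr_deriv ?_
    simp only [Pi.pow_apply]
    field_simp
    push_cast
    ring
  have key := (h.dTT.mul_theta s1 d1).add (h.dT.mul_theta s2 d2)
  have eY : (fun p => (Real.cos p.2)⁻¹ * Θ p + Real.sin p.2 / Real.cos p.2 ^ 2 * Ψ p)
      =ᵐ[stripMeasure] Y := by
    filter_upwards [h.relY, ae_restrict_mem measurableSet_strip] with p hY hp
    have hc := (cos_pos_of_mem hp.2).ne'
    field_simp
    linarith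
  refine isDTheta_of_hasWeakDeriv (key.congr eY ?_)
  filter_upwards [h.relY, ae_restrict_mem measurableSet_strip] with p hY hp
  have hc := (cos_pos_of_mem hp.2).ne'
  have hs := (sin_pos_of_mem hp.2).ne'
  rw [Real.sin_two_mul]
  field_simp
  linear_combination (-4 * Real.sin p.2) * hY

end Sol

/-! ### A Hardy inequality for weak derivatives in the angle -/

/-- Powers of `sin θ` may be used as test functions when the factor `cos³ θ` kills the boundary term
at `π/2`. -/
lemma integral_sin_pow_eq_zero {V E : ℝ × ℝ → ℝ} (hV : MemLp V 2 stripMeasure) (hE : MemLp E 2 stripMeasure)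
    (h : HasWeakDeriv dirTheta (fun p => Real.cos p.2 ^ 3 * V p) (fun p => Real.cos p.2 ^ 2 * E p))
    (n : ℕ) {ψ : ℝ → ℝ} (hψ : IsTestR ψ) :
    ∫ p, ((2 * (n : ℝ) + 3) * Real.sin p.2 ^ (2 * n + 2) * Real.cos p.2 ^ 4 * V p
      + Real.sin p.2 ^ (2 * n + 3) * Real.cos p.2 ^ 2 * E p) * ψ p.1 ∂stripMeasure = 0 := by
  set a : ℝ → ℝ := fun θ => (2 * (n : ℝ) + 3) * Real.sin θ ^ (2 * n + 2) * Real.cos θ ^ 4 with ha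
  set b : ℝ → ℝ := fun θ => Real.sin θ ^ (2 * n + 3) * Real.cos θ ^ 2 with hb
  have hac : Continuous a := by fun_prop
  have hbc : Continuous b := by fun_prop
  have hk : ContDiff ℝ ∞ fun θ => Real.sin θ ^ (2 * n + 3) := Real.contDiff_sin.pow _
  have t1 := tendsto_integral_cut hV hψ hac
  have t2 := tendsto_integral_cut' hV hψ (k := fun θ => Real.sin θ ^ (2 * n + 2) * Real.cos θ ^ 2) (by fun_prop)
  have t3 := tendsto_integral_cut hE hψ hbc
  have key : ∀ j, ∫ p, V p * (ψ p.1 * (a p.2 * cutTheta j p.2)) ∂stripMeasure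
      + ∫ p, V p * (ψ p.1 * (Real.sin p.2 ^ (2 * n + 2) * Real.cos p.2 ^ 2 *
          (Real.sin p.2 * Real.cos p.2 * cutTheta' j p.2))) ∂stripMeasure
      = -∫ p, E p * (ψ p.1 * (b p.2 * cutTheta j p.2)) ∂stripMeasure := by
    intro j
    have hc1 := cutTheta'_continuous j
    have hc0 := (cutTheta_contDiff j).continuous
    have hd : ∀ θ, HasDerivAt (fun θ => Real.sin θ ^ (2 * n + 3) * cutTheta j θ)
        ((2 * (n : ℝ) + 3) * Real.sin θ ^ (2 * n + 2) * Real.cos θ * cutTheta j θ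
          + Real.sin θ ^ (2 * n + 3) * cutTheta' j θ) θ := fun θ => by
      refine (((Real.hasDerivAt_sin θ).pow (2 * n + 3)).mul (hasDerivAt_cutTheta j θ)).congr_deriv ?_
      simp only [Pi.pow_apply, show 2 * n + 3 - 1 = 2 * n + 2 by omega]
      push_cast; ring
    have := h.2.2 _ (hψ.tensor_cut hk j)
    simp only [fun p : ℝ × ℝ => (fderiv_tensor (hψ.hasDerivAt p.1) (hd p.2)).2] at this
    rw [← integral_add (integrable_tensor hV hψ (b := fun θ => a θ * cutTheta j θ) (by fun_prop))
      (integrable_tensor hV hψ (b := fun θ => Real.sin θ ^ (2 * n + 2) * Real.cos θ ^ 2 *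
        (Real.sin θ * Real.cos θ * cutTheta' j θ)) (by fun_prop))]
    refine Eq.trans (Eq.trans (integral_congr_ae (ae_of_all _ fun p => ?_)) this)
      (congrArg _ (integral_congr_ae (ae_of_all _ fun p => ?_)))
    · simp only [ha]; ring
    · simp only [hb]; ring
  have := tendsto_nhds_unique ((t1.add t2).congr key) t3.neg
  rw [add_zero] at this
  have i1 := integrable_tensor hV hψ (b := a) hac
  have i2 := integrable_tensor hE hψ (b := b) hbc
  have s := integral_add i1 i2
  rw [this, neg_add_cancel] at s
  rw [← s]
  refine integral_congr_ae (ae_of_all _ fun p => ?_)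
  simp only [ha, hb]; ring

/-- A weak primitive on `(0, π/2)`, identified through its moments. -/
lemma ae_eq_primitive {U e : ℝ → ℝ} (hU : IntegrableOn U (Ioo 0 (Real.pi / 2)))
    (he : IntegrableOn e (Ioo 0 (Real.pi / 2)))
    (h : ∀ n : ℕ, ∫ θ in Ioo 0 (Real.pi / 2), ((2 * (n : ℝ) + 3) * Real.sin θ ^ (2 * n + 2) * Real.cos θ ^ 4 * U θ
      + Real.sin θ ^ (2 * n + 3) * Real.cos θ ^ 2 * e θ) = 0) :
    ∀ᵐ θ ∂(volume.restrict (Ioo 0 (Real.pi / 2))),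
      Real.cos θ ^ 3 * U θ = ∫ t in (Real.pi / 2)..θ, Real.cos t ^ 2 * e t := by
  have hpi : (0 : ℝ) ≤ Real.pi / 2 := by positivity
  set e' : ℝ → ℝ := fun t => Real.cos t ^ 2 * e t with he'
  have he'i : IntervalIntegrable e' volume 0 (Real.pi / 2) := by
    rw [intervalIntegrable_iff_integrableOn_Ioo_of_le hpi]
    exact (integrableOn_mul_continuous he (b := fun t => Real.cos t ^ 2) (by fun_prop)).congr_fun
      (fun t _ => mul_comm _ _) measurableSet_Ioo
  set P : ℝ → ℝ := fun θ => ∫ t in (Real.pi / 2)..θ, e' t with hP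
  have hPac : AbsolutelyContinuousOnInterval P 0 (Real.pi / 2) :=
    he'i.absolutelyContinuousOnInterval_intervalIntegral right_mem_uIcc
  have hPc : ContinuousOn P (Icc 0 (Real.pi / 2)) := by simpa [uIcc_of_le hpi] using hPac.continuousOn
  have hPi : IntegrableOn P (Ioo 0 (Real.pi / 2)) := (hPc.integrableOn_Icc).mono_set Ioo_subset_Icc_self
  have hPd : ∀ᵐ t, t ∈ uIcc 0 (Real.pi / 2) → deriv P t = e' t :=
    (he'i.ae_hasDerivAt_integral).mono fun t ht hm => (ht hm _ right_mem_uIcc).deriv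
  have hH : IntegrableOn (fun θ => Real.sin θ ^ 2 * Real.cos θ * (Real.cos θ ^ 3 * U θ - P θ))
      (Ioo 0 (Real.pi / 2)) := by
    have i1 := integrableOn_mul_continuous hU (b := fun θ => Real.sin θ ^ 2 * Real.cos θ ^ 4) (by fun_prop)
    have i2 := integrableOn_mul_continuous hPi (b := fun θ => Real.sin θ ^ 2 * Real.cos θ) (by fun_prop)
    refine (i1.sub i2).congr (ae_of_all _ fun θ => ?_)
    simp only [Pi.sub_apply]; ring
  have hX : ∀ n : ℕ, momentMap hH (Polynomial.X ^ n) = 0 := by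
    intro n
    have hK : AbsolutelyContinuousOnInterval (fun θ => Real.sin θ ^ (2 * n + 3)) 0 (Real.pi / 2) :=
      ((Real.contDiff_sin (n := 1)).pow _).contDiffOn.absolutelyContinuousOnInterval
    have hKd : ∀ θ, deriv (fun θ => Real.sin θ ^ (2 * n + 3)) θ
        = (2 * (n : ℝ) + 3) * Real.sin θ ^ (2 * n + 2) * Real.cos θ := fun θ => by
      refine (((Real.hasDerivAt_sin θ).pow (2 * n + 3)).congr_deriv ?_).deriv
      simp only [show 2 * n + 3 - 1 = 2 * n + 2 by omega]
      push_cast; ring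
    have ibp := hPac.integral_mul_deriv_eq_deriv_mul hK
    have z1 : P (Real.pi / 2) = 0 := intervalIntegral.integral_same
    rw [z1] at ibp
    simp only [hKd, Real.sin_zero, zero_mul, ne_eq, Nat.add_eq_zero_iff, OfNat.ofNat_ne_zero, and_false,
      not_false_eq_true, zero_pow, mul_zero, sub_zero, zero_sub] at ibp
    have e1 : ∫ x in (0 : ℝ)..(Real.pi / 2), deriv P x * Real.sin x ^ (2 * n + 3)
        = ∫ x in (0 : ℝ)..(Real.pi / 2), e' x * Real.sin x ^ (2 * n + 3) := by
      refine intervalIntegral.integral_congr_ae (hPd.mono fun t ht hm => ?_)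
      rw [ht (uIoc_subset_uIcc hm)]
    rw [e1, intervalIntegral.integral_of_le hpi, intervalIntegral.integral_of_le hpi,
      integral_Ioc_eq_integral_Ioo, integral_Ioc_eq_integral_Ioo] at ibp
    have i1 := integrableOn_mul_continuous hU (b := fun θ => (2 * (n : ℝ) + 3) * Real.sin θ ^ (2 * n + 2) *
      Real.cos θ ^ 4) (by fun_prop)
    have i2 := integrableOn_mul_continuous hPi (b := fun θ => (2 * (n : ℝ) + 3) * Real.sin θ ^ (2 * n + 2) *
      Real.cos θ) (by fun_prop)
    have i3 := integrableOn_mul_continuous he (b := fun θ => Real.cos θ ^ 2 * Real.sin θ ^ (2 * n + 3)) (by fun_prop)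
    have h0 : (∫ θ in Ioo 0 (Real.pi / 2), U θ * ((2 * (n : ℝ) + 3) * Real.sin θ ^ (2 * n + 2) * Real.cos θ ^ 4))
        + ∫ θ in Ioo 0 (Real.pi / 2), e' θ * Real.sin θ ^ (2 * n + 3) = 0 := by
      rw [← integral_add i1 (i3.congr (g := fun θ => e' θ * Real.sin θ ^ (2 * n + 3))
        (ae_of_all _ fun θ => by simp only [he']; ring))]
      refine Eq.trans ?_ (h n)
      congr 1; ext θ; simp only [he']; ring
    have h1 : (2 * (n : ℝ) + 3) * momentMap hH (Polynomial.X ^ n)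
        = (∫ θ in Ioo 0 (Real.pi / 2), U θ * ((2 * (n : ℝ) + 3) * Real.sin θ ^ (2 * n + 2) * Real.cos θ ^ 4))
        - ∫ θ in Ioo 0 (Real.pi / 2), P θ * ((2 * (n : ℝ) + 3) * Real.sin θ ^ (2 * n + 2) * Real.cos θ) := by
      rw [← integral_sub i1 i2, momentMap]
      simp only [LinearMap.coe_mk, AddHom.coe_mk]
      rw [← integral_const_mul]
      congr 1; ext θ; simp only [ang, Polynomial.eval_pow, Polynomial.eval_X]
      ring
    have : (2 * (n : ℝ) + 3) * momentMap hH (Polynomial.X ^ n) = 0 := by rw [h1, ibp]; linarith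
    exact (mul_eq_zero.1 this).resolve_left (by positivity)
  have hall : ∀ p, momentMap hH p = 0 := fun p => by
    induction p using Polynomial.induction_on' with
    | add p q hp hq => rw [map_add, hp, hq, add_zero]
    | monomial n c => rw [← Polynomial.C_mul_X_pow_eq_monomial, ← Polynomial.smul_eq_C_mul, map_smul, hX, smul_zero]
  filter_upwards [ae_eq_zero_of_moments hH hall, ae_restrict_mem measurableSet_Ioo] with θ hθ hm
  have hs := sin_pos_of_mem hm
  have hc := cos_pos_of_mem hm
  exact sub_eq_zero.1 ((mul_eq_zero.1 hθ).resolve_left (by positivity))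

lemma sq_lintegral_le {e : ℝ → ℝ} {a b : ℝ}
    (he : AEStronglyMeasurable e (volume.restrict (Ioo a b))) :
    (∫⁻ t in Ioo a b, ‖e t‖ₑ) ^ 2 ≤ (∫⁻ t in Ioo a b, ‖e t‖ₑ ^ 2) * ENNReal.ofReal (b - a) := by
  have h := eLpNorm_le_eLpNorm_mul_rpow_measure_univ (p := 1) (q := 2) one_le_two he
  rw [eLpNorm_one_eq_lintegral_enorm] at h
  have h2 : eLpNorm e 2 (volume.restrict (Ioo a b)) ^ 2 = ∫⁻ t in Ioo a b, ‖e t‖ₑ ^ 2 := by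
    simpa using eLpNorm_nnreal_pow_eq_lintegral (p := 2) (f := e) (μ := volume.restrict (Ioo a b)) two_ne_zero
  rw [← h2]
  refine (pow_le_pow_left' h 2).trans (le_of_eq ?_)
  rw [mul_pow]
  congr 1
  rw [← ENNReal.rpow_natCast, ← ENNReal.rpow_mul]
  norm_num

/-- The kernel of the Hardy inequality, integrated explicitly. -/
lemma lintegral_sin_cos_rpow_le {γ : ℝ} (hγ : 1 ≤ γ) {t : ℝ} (ht : t ∈ Ioo 0 (Real.pi / 2)) :
    ∫⁻ θ in Ioo 0 t, ENNReal.ofReal (2 * Real.sin θ * Real.cos θ ^ (-γ - 1))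
      ≤ ENNReal.ofReal (2 * Real.cos t ^ (-γ)) := by
  have hc : ∀ θ ∈ Icc 0 t, 0 < Real.cos θ := fun θ hθ =>
    Real.cos_pos_of_mem_Ioo ⟨by linarith [hθ.1, Real.pi_pos], by linarith [hθ.2, ht.2]⟩
  have hcont : ContinuousOn (fun θ => 2 * Real.sin θ * Real.cos θ ^ (-γ - 1)) (Icc 0 t) :=
    ContinuousOn.mul (by fun_prop) (Real.continuous_cos.continuousOn.rpow_const fun θ hθ => Or.inl (hc θ hθ).ne')
  have hd : ∀ θ ∈ uIcc 0 t, HasDerivAt (fun θ => 2 / γ * Real.cos θ ^ (-γ))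
      (2 * Real.sin θ * Real.cos θ ^ (-γ - 1)) θ := fun θ hθ => by
    rw [uIcc_of_le ht.1.le] at hθ
    refine (((Real.hasDerivAt_cos θ).rpow_const (Or.inl (hc θ hθ).ne')).const_mul (2 / γ)).congr_deriv ?_
    field_simp
  rw [← ofReal_integral_eq_lintegral_ofReal (hcont.integrableOn_Icc.mono_set Ioo_subset_Icc_self)
    ((ae_restrict_mem measurableSet_Ioo).mono fun θ hθ => ?_)]
  · refine ENNReal.ofReal_le_ofReal ?_
    rw [← integral_Ioc_eq_integral_Ioo, ← intervalIntegral.integral_of_le ht.1.le,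
      intervalIntegral.integral_eq_sub_of_hasDerivAt hd (by
        rw [← uIcc_of_le ht.1.le] at hcont; exact hcont.intervalIntegrable)]
    have h1 := Real.rpow_pos_of_pos (hc t ⟨ht.1.le, le_rfl⟩) (-γ)
    have h2 : 2 / γ ≤ 2 := by rw [div_le_iff₀ (by linarith)]; linarith
    rw [Real.cos_zero, Real.one_rpow]
    have : 0 ≤ 2 / γ := by positivity
    nlinarith
  · have h1 := Real.rpow_pos_of_pos (hc θ (Ioo_subset_Icc_self hθ)) (-γ - 1)
    have h2 := sin_pos_of_mem (⟨hθ.1, hθ.2.trans ht.2⟩ : θ ∈ Ioo 0 (Real.pi / 2))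
    simp only [Pi.zero_apply]; positivity

/-- Hardy's inequality on `(0, π/2)` for a function `U` with `(cos³ U)' = cos² e`, with the primitive
taken from `π/2`. -/
lemma hardy_slice {γ : ℝ} (hγ : 1 ≤ γ) (hγ' : γ ≤ 5 / 4) {U e : ℝ → ℝ}
    (he : IntegrableOn e (Ioo 0 (Real.pi / 2)))
    (h : ∀ᵐ θ ∂(volume.restrict (Ioo 0 (Real.pi / 2))),
      Real.cos θ ^ 3 * U θ = ∫ t in (Real.pi / 2)..θ, Real.cos t ^ 2 * e t) :
    ∫⁻ θ in Ioo 0 (Real.pi / 2), ‖Real.sin θ ^ 2 * U θ‖ₑ ^ 2 * ENNReal.ofReal (Real.sin (2 * θ) ^ (-γ))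
      ≤ 9 * ∫⁻ θ in Ioo 0 (Real.pi / 2), ‖e θ‖ₑ ^ 2 * ENNReal.ofReal (Real.sin (2 * θ) ^ (-γ)) := by
  set g : ℝ → ℝ≥0∞ := fun θ => ENNReal.ofReal (2 * Real.sin θ * Real.cos θ ^ (-γ - 1)) with hg
  have hgm : Measurable g := by fun_prop
  set f : ℝ → ℝ≥0∞ := fun t => ‖e t‖ₑ ^ 2 with hf
  have hfm : AEMeasurable f (volume.restrict (Ioo 0 (Real.pi / 2))) := he.aestronglyMeasurable.enorm.pow_const 2
  have h1 : ∀ᵐ θ ∂(volume.restrict (Ioo 0 (Real.pi / 2))),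
      ‖Real.sin θ ^ 2 * U θ‖ₑ ^ 2 * ENNReal.ofReal (Real.sin (2 * θ) ^ (-γ))
        ≤ g θ * ∫⁻ t in Ioo θ (Real.pi / 2), f t := by
    filter_upwards [h, ae_restrict_mem measurableSet_Ioo] with θ hθ hm
    have hs := sin_pos_of_mem hm
    have hc := cos_pos_of_mem hm
    have hsub : Ioo θ (Real.pi / 2) ⊆ Ioo 0 (Real.pi / 2) := Ioo_subset_Ioo_left hm.1.le
    have he' := he.mono_set hsub
    set I := ∫⁻ t in Ioo θ (Real.pi / 2), ‖e t‖ₑ with hI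
    have b1 : ‖∫ t in (Real.pi / 2)..θ, Real.cos t ^ 2 * e t‖ₑ ≤ ENNReal.ofReal (Real.cos θ ^ 2) * I := by
      rw [intervalIntegral.integral_symm, enorm_neg, intervalIntegral.integral_of_le hm.2.le,
        integral_Ioc_eq_integral_Ioo]
      refine (enorm_integral_le_lintegral_enorm _).trans ?_
      rw [hI, ← lintegral_const_mul' _ _ ENNReal.ofReal_ne_top]
      refine lintegral_mono_ae ((ae_restrict_mem measurableSet_Ioo).mono fun t ht => ?_)
      rw [enorm_mul]
      refine mul_le_mul_left ?_ _
      have hct := cos_pos_of_mem (hsub ht)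
      rw [Real.enorm_of_nonneg (by positivity)]
      refine ENNReal.ofReal_le_ofReal (pow_le_pow_left₀ hct.le ?_ 2)
      exact Real.cos_le_cos_of_nonneg_of_le_pi hm.1.le (by linarith [ht.2, Real.pi_pos]) ht.1.le
    have b2 : I ^ 2 ≤ (∫⁻ t in Ioo θ (Real.pi / 2), f t) * ENNReal.ofReal (Real.pi / 2 - θ) :=
      sq_lintegral_le he'.aestronglyMeasurable
    have b3 : Real.pi / 2 - θ ≤ Real.pi / 2 * Real.cos θ := by
      have := Real.mul_le_sin (x := Real.pi / 2 - θ) (by linarith [hm.2]) (by linarith [hm.1])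
      rw [Real.sin_pi_div_two_sub] at this
      have hpi := Real.pi_pos
      calc Real.pi / 2 - θ = Real.pi / 2 * (2 / Real.pi * (Real.pi / 2 - θ)) := by field_simp
        _ ≤ _ := by gcongr
    have e1 : ‖Real.sin θ ^ 2 * U θ‖ₑ = ENNReal.ofReal (Real.sin θ ^ 2 / Real.cos θ ^ 3)
        * ‖∫ t in (Real.pi / 2)..θ, Real.cos t ^ 2 * e t‖ₑ := by
      rw [← Real.enorm_of_nonneg (show 0 ≤ Real.sin θ ^ 2 / Real.cos θ ^ 3 by positivity), ← enorm_mul, ← hθ]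
      congr 1; field_simp
    have hreal : (Real.sin θ ^ 2 / Real.cos θ ^ 3) ^ 2 * (Real.cos θ ^ 2) ^ 2 * (Real.pi / 2 * Real.cos θ)
        * Real.sin (2 * θ) ^ (-γ) ≤ 2 * Real.sin θ * Real.cos θ ^ (-γ - 1) := by
      rw [Real.sin_two_mul, Real.mul_rpow (by positivity) hc.le, Real.mul_rpow (by positivity) hs.le,
        Real.rpow_sub hc, Real.rpow_one]
      have a1 : (2 : ℝ) ^ (-γ) ≤ 1 := Real.rpow_le_one_of_one_le_of_nonpos (by norm_num) (by linarith)
      have a2 : Real.sin θ ^ 4 * Real.sin θ ^ (-γ) ≤ Real.sin θ := by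
        rw [← Real.rpow_natCast, ← Real.rpow_add hs]
        conv_rhs => rw [← Real.rpow_one (Real.sin θ)]
        exact Real.rpow_le_rpow_of_exponent_ge hs (Real.sin_le_one _) (by push_cast; linarith)
      have a3 := Real.rpow_pos_of_pos hc (-γ)
      have a4 := Real.rpow_pos_of_pos hs (-γ)
      have a5 : Real.pi / 2 ≤ 2 := by linarith [Real.pi_le_four]
      have e2 : (Real.sin θ ^ 2 / Real.cos θ ^ 3) ^ 2 * (Real.cos θ ^ 2) ^ 2 * (Real.pi / 2 * Real.cos θ)
        * (2 ^ (-γ) * Real.sin θ ^ (-γ) * Real.cos θ ^ (-γ))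
          = (Real.pi / 2 * 2 ^ (-γ)) * (Real.sin θ ^ 4 * Real.sin θ ^ (-γ)) * (Real.cos θ ^ (-γ) / Real.cos θ) := by
        field_simp
      rw [e2, mul_div_assoc']
      rw [mul_div_assoc' (2 * Real.sin θ)]
      gcongr
      have : (2 : ℝ) ^ (-γ) > 0 := by positivity
      nlinarith [Real.pi_pos]
    calc ‖Real.sin θ ^ 2 * U θ‖ₑ ^ 2 * ENNReal.ofReal (Real.sin (2 * θ) ^ (-γ))
        ≤ (ENNReal.ofReal (Real.sin θ ^ 2 / Real.cos θ ^ 3) * (ENNReal.ofReal (Real.cos θ ^ 2) * I)) ^ 2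
          * ENNReal.ofReal (Real.sin (2 * θ) ^ (-γ)) := by rw [e1]; gcongr
      _ ≤ ENNReal.ofReal (Real.sin θ ^ 2 / Real.cos θ ^ 3) ^ 2 * ENNReal.ofReal (Real.cos θ ^ 2) ^ 2
          * ((∫⁻ t in Ioo θ (Real.pi / 2), f t) * ENNReal.ofReal (Real.pi / 2 * Real.cos θ))
          * ENNReal.ofReal (Real.sin (2 * θ) ^ (-γ)) := by
        rw [mul_pow, mul_pow, ← mul_assoc]
        gcongr
        exact b2.trans (by gcongr)
      _ = ENNReal.ofReal ((Real.sin θ ^ 2 / Real.cos θ ^ 3) ^ 2 * (Real.cos θ ^ 2) ^ 2 * (Real.pi / 2 * Real.cos θ)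
        * Real.sin (2 * θ) ^ (-γ)) * ∫⁻ t in Ioo θ (Real.pi / 2), f t := by
        have split : ∀ a b c d : ℝ, 0 ≤ a → 0 ≤ b → 0 ≤ c → ENNReal.ofReal (a ^ 2 * b ^ 2 * c * d)
            = ENNReal.ofReal a ^ 2 * ENNReal.ofReal b ^ 2 * ENNReal.ofReal c * ENNReal.ofReal d := by
          intro a b c d ha hb hc
          rw [ENNReal.ofReal_mul (by positivity), ENNReal.ofReal_mul (by positivity),
            ENNReal.ofReal_mul (by positivity), ENNReal.ofReal_pow ha, ENNReal.ofReal_pow hb]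
        rw [split _ _ _ _ (by positivity) (by positivity) (by positivity)]
        ring
      _ ≤ g θ * ∫⁻ t in Ioo θ (Real.pi / 2), f t := by
        gcongr
        exact ENNReal.ofReal_le_ofReal hreal
  refine (lintegral_mono_ae h1).trans ?_
  -- exchange the order of integration over `θ < t`
  have sw : ∫⁻ θ in Ioo 0 (Real.pi / 2), g θ * ∫⁻ t in Ioo θ (Real.pi / 2), f t
      = ∫⁻ t in Ioo 0 (Real.pi / 2), f t * ∫⁻ θ in Ioo 0 t, g θ := by
    have l1 : ∫⁻ θ in Ioo 0 (Real.pi / 2), g θ * ∫⁻ t in Ioo θ (Real.pi / 2), f t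
        = ∫⁻ θ in Ioo 0 (Real.pi / 2), ∫⁻ t in Ioo 0 (Real.pi / 2),
          {q : ℝ × ℝ | q.1 < q.2}.indicator (fun q => g q.1 * f q.2) (θ, t) := by
      refine lintegral_congr_ae ((ae_restrict_mem measurableSet_Ioo).mono fun θ hm => ?_)
      simp only []
      rw [← lintegral_const_mul' _ _ ENNReal.ofReal_ne_top, ← lintegral_indicator measurableSet_Ioo,
        ← lintegral_indicator measurableSet_Ioo]
      refine lintegral_congr fun t => ?_
      by_cases h1 : θ < t
      · have h0 : 0 < t := hm.1.trans h1
        simp [indicator, h1, h0, mem_Ioo, hg]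
      · simp [indicator, h1, mem_Ioo]
    have l2 : ∫⁻ t in Ioo 0 (Real.pi / 2), f t * ∫⁻ θ in Ioo 0 t, g θ
        = ∫⁻ t in Ioo 0 (Real.pi / 2), ∫⁻ θ in Ioo 0 (Real.pi / 2),
          {q : ℝ × ℝ | q.1 < q.2}.indicator (fun q => g q.1 * f q.2) (θ, t) := by
      refine lintegral_congr_ae ((ae_restrict_mem measurableSet_Ioo).mono fun t hm => ?_)
      simp only []
      rw [← lintegral_const_mul _ hgm, ← lintegral_indicator measurableSet_Ioo,
        ← lintegral_indicator measurableSet_Ioo]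
      refine lintegral_congr fun θ => ?_
      by_cases h1 : θ < t
      · have h0 : θ < Real.pi / 2 := h1.trans hm.2
        simp [indicator, h1, h0, mem_Ioo, mul_comm]
      · simp [indicator, h1, mem_Ioo]
    rw [l1, l2]
    refine lintegral_lintegral_swap (AEMeasurable.indicator ?_ (measurableSet_lt measurable_fst measurable_snd))
    exact (hgm.comp measurable_fst).aemeasurable.mul (hfm.comp_snd)
  rw [sw, ← lintegral_const_mul' _ _ (by norm_num)]
  refine lintegral_mono_ae ((ae_restrict_mem measurableSet_Ioo).mono fun t ht => ?_)
  refine (mul_le_mul_right (lintegral_sin_cos_rpow_le hγ ht) _).trans ?_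
  have hs := sin_pos_of_mem ht
  have hc := cos_pos_of_mem ht
  have hσ := sin_two_mul_pos ht
  have c1 : 2 * Real.cos t ^ (-γ) ≤ 9 * Real.sin (2 * t) ^ (-γ) := by
    have c2 : (2 * Real.cos t) ^ (-γ) ≤ Real.sin (2 * t) ^ (-γ) := by
      refine Real.rpow_le_rpow_of_nonpos hσ ?_ (by linarith)
      rw [Real.sin_two_mul]; nlinarith [Real.sin_le_one t]
    rw [Real.mul_rpow (by norm_num) hc.le] at c2
    have c3 : (1 / 4 : ℝ) ≤ 2 ^ (-γ) := by
      calc (1 / 4 : ℝ) = 2 ^ (-2 : ℝ) := by rw [Real.rpow_neg (by norm_num)]; norm_num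
        _ ≤ _ := Real.rpow_le_rpow_of_exponent_le (by norm_num) (by linarith)
    have c4 := Real.rpow_pos_of_pos hc (-γ)
    nlinarith
  calc f t * ENNReal.ofReal (2 * Real.cos t ^ (-γ)) ≤ f t * ENNReal.ofReal (9 * Real.sin (2 * t) ^ (-γ)) := by
        gcongr
    _ = 9 * (f t * ENNReal.ofReal (Real.sin (2 * t) ^ (-γ))) := by
        rw [ENNReal.ofReal_mul (by norm_num)]
        norm_num
        ring

/-- The weighted norm as an integral over slices. -/
lemma nrm_sq {β : ℝ} {f : ℝ × ℝ → ℝ} (hf : AEStronglyMeasurable f stripMeasure) :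
    nrm β f ^ 2 = ∫⁻ R in Ioi 0, ENNReal.ofReal (w R ^ 2) *
      ∫⁻ θ in Ioo 0 (Real.pi / 2), ‖f (R, θ)‖ₑ ^ 2 * ENNReal.ofReal (Real.sin (2 * θ) ^ (-β)) := by
  have h2 : nrm β f ^ 2 = ∫⁻ p, ‖f p * wt β p‖ₑ ^ 2 ∂stripMeasure := by
    simpa [nrm] using eLpNorm_nnreal_pow_eq_lintegral (p := 2) (f := fun p => f p * wt β p)
      (μ := stripMeasure) two_ne_zero
  have hm := ((aesm_mul_wt (β := β) hf).enorm.pow_const 2)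
  rw [h2]
  rw [stripMeasure_eq_prod] at hm ⊢
  rw [lintegral_prod _ hm]
  refine lintegral_congr_ae ((ae_restrict_mem measurableSet_Ioi).mono fun R hR => ?_)
  simp only []
  rw [← lintegral_const_mul' _ _ ENNReal.ofReal_ne_top]
  refine lintegral_congr_ae ((ae_restrict_mem measurableSet_Ioo).mono fun θ hθ => ?_)
  have hσ := sin_two_mul_pos hθ
  simp only []
  rw [enorm_mul, mul_pow, Real.enorm_of_nonneg (wt_pos ⟨hR, hθ⟩).le, ← ENNReal.ofReal_pow (wt_pos ⟨hR, hθ⟩).le,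
    mul_left_comm, ← ENNReal.ofReal_mul (by positivity)]
  congr 2
  rw [wt, div_pow, ← Real.rpow_natCast (Real.sin (2 * θ) ^ (β / 2)) 2, ← Real.rpow_mul hσ.le,
    Real.rpow_neg hσ.le]
  push_cast
  rw [div_mul_cancel₀ _ two_ne_zero, div_eq_mul_inv]

/-- Hardy's inequality in the angle: the weak derivative of `cos³ θ V` controls `V` in the more singular
weight. -/
lemma nrm_sin_sq_mul_le {γ : ℝ} (hγ : 1 ≤ γ) (hγ' : γ ≤ 5 / 4) {V E : ℝ × ℝ → ℝ}
    (hV : MemLp V 2 stripMeasure) (hE : MemLp E 2 stripMeasure)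
    (h : HasWeakDeriv dirTheta (fun p => Real.cos p.2 ^ 3 * V p) (fun p => Real.cos p.2 ^ 2 * E p)) :
    nrm γ (fun p => Real.sin p.2 ^ 2 * V p) ≤ 3 * nrm γ E := by
  have hsV : AEStronglyMeasurable (fun p : ℝ × ℝ => Real.sin p.2 ^ 2 * V p) stripMeasure :=
    (by fun_prop : Continuous fun p : ℝ × ℝ => Real.sin p.2 ^ 2).aestronglyMeasurable.mul hV.1
  have hmom : ∀ᵐ R ∂(volume.restrict (Ioi (0 : ℝ))), ∀ n : ℕ, ∫ θ in Ioo 0 (Real.pi / 2),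
      ((2 * (n : ℝ) + 3) * Real.sin θ ^ (2 * n + 2) * Real.cos θ ^ 4 * V (R, θ)
      + Real.sin θ ^ (2 * n + 3) * Real.cos θ ^ 2 * E (R, θ)) = 0 := by
    refine ae_all_iff.2 fun n => ?_
    have m1 : MemLp (fun p : ℝ × ℝ => ((2 * (n : ℝ) + 3) * Real.sin p.2 ^ (2 * n + 2) * Real.cos p.2 ^ 4) * V p)
        2 stripMeasure := by
      refine MemLp.mul_bounded hV (b := fun p => (2 * (n : ℝ) + 3) * Real.sin p.2 ^ (2 * n + 2) *
        Real.cos p.2 ^ 4) (by fun_prop) (K := (2 * (n : ℝ) + 3) * 1 * 1) fun p _ => ?_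
      rw [abs_mul, abs_mul, abs_pow, abs_pow, abs_of_nonneg (show 0 ≤ 2 * (n : ℝ) + 3 by positivity)]
      gcongr
      · exact pow_le_one₀ (abs_nonneg _) (Real.abs_sin_le_one _)
      · exact pow_le_one₀ (abs_nonneg _) (Real.abs_cos_le_one _)
    have m2 : MemLp (fun p : ℝ × ℝ => (Real.sin p.2 ^ (2 * n + 3) * Real.cos p.2 ^ 2) * E p) 2 stripMeasure := by
      refine MemLp.mul_bounded hE (b := fun p => Real.sin p.2 ^ (2 * n + 3) * Real.cos p.2 ^ 2)
        (by fun_prop) (K := 1 * 1) fun p _ => ?_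
      rw [abs_mul, abs_pow, abs_pow]
      gcongr
      · exact pow_le_one₀ (abs_nonneg _) (Real.abs_sin_le_one _)
      · exact pow_le_one₀ (abs_nonneg _) (Real.abs_cos_le_one _)
    exact ae_slice_integral_eq_zero (m1.add m2) fun ψ hψ => integral_sin_pow_eq_zero hV hE h n hψ
  have hpow : nrm γ (fun p => Real.sin p.2 ^ 2 * V p) ^ 2 ≤ (3 * nrm γ E) ^ 2 := by
    rw [mul_pow, nrm_sq hsV, nrm_sq hE.1, ← lintegral_const_mul' _ _ (by norm_num)]
    refine lintegral_mono_ae ?_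
    filter_upwards [hmom, ae_slice_memLp hV, ae_slice_memLp hE] with R h1 h2 h3
    rw [mul_left_comm]
    gcongr
    refine (hardy_slice hγ hγ' h3 (ae_eq_primitive h2 h3 h1)).trans (le_of_eq ?_)
    norm_num
  exact (ENNReal.pow_le_pow_left_iff two_ne_zero).1 hpow

/-! ### Angular regularity classes -/

/-- `f` has `i` derivatives `D_θ^l f`; `f` itself is bounded by `M` in the norm with exponent `β`, the
derivatives of positive order are bounded by `M` in the norm with exponent `γ`. -/
def Reg (γ : ℝ) : ℕ → ℝ → (ℝ × ℝ → ℝ) → ℝ≥0∞ → Prop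
  | 0, β, f, M => LocallyIntegrableOn f strip ∧ nrm β f ≤ M
  | i + 1, β, f, M => nrm β f ≤ M ∧ ∃ g, IsDTheta f g ∧ Reg γ i γ g M

lemma IsDTheta.locInt_left {f g : ℝ × ℝ → ℝ} (h : IsDTheta f g) : LocallyIntegrableOn f strip := by
  obtain ⟨u, hu, -⟩ := h
  exact hu.1

namespace Reg

variable {γ β : ℝ} {f g : ℝ × ℝ → ℝ} {M N : ℝ≥0∞}

lemma locInt : ∀ {i : ℕ}, Reg γ i β f M → LocallyIntegrableOn f strip
  | 0, h => h.1
  | _ + 1, h => h.2.choose_spec.1.locInt_left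

lemma nrm_le : ∀ {i : ℕ}, Reg γ i β f M → nrm β f ≤ M
  | 0, h => h.2
  | _ + 1, h => h.1

lemma pred {i : ℕ} (h : Reg γ (i + 1) β f M) : Reg γ i β f M := by
  induction i generalizing β f with
  | zero => exact ⟨h.locInt, h.1⟩
  | succ i ih =>
    obtain ⟨h1, g, hg, hr⟩ := h
    exact ⟨h1, g, hg, ih hr⟩

lemma mono {i : ℕ} (h : Reg γ i β f M) (hMN : M ≤ N) : Reg γ i β f N := by
  induction i generalizing β f with
  | zero => exact ⟨h.1, h.2.trans hMN⟩
  | succ i ih =>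
    obtain ⟨h1, g, hg, hr⟩ := h
    exact ⟨h1.trans hMN, g, hg, ih hr⟩

lemma congr {i : ℕ} (h : Reg γ i β f M) (hfg : f =ᵐ[stripMeasure] g) : Reg γ i β g M := by
  cases i with
  | zero => exact ⟨LocInt.congr h.1 hfg, (nrm_congr hfg).symm.trans_le h.2⟩
  | succ i =>
    obtain ⟨h1, u, hu, hr⟩ := h
    exact ⟨(nrm_congr hfg).symm.trans_le h1, u, hu.congr hfg ae_eq_rfl, hr⟩

lemma add {i : ℕ} (hf : Reg γ i β f M) (hg : Reg γ i β g N) : Reg γ i β (fun p => f p + g p) (M + N) := by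
  induction i generalizing β f g with
  | zero => exact ⟨hf.1.add hg.1, (nrm_add_le (LocInt.aesm hf.1) (LocInt.aesm hg.1)).trans (add_le_add hf.2 hg.2)⟩
  | succ i ih =>
    have hl := LocInt.aesm hf.locInt
    have hl' := LocInt.aesm hg.locInt
    obtain ⟨h1, u, hu, hr⟩ := hf
    obtain ⟨h1', u', hu', hr'⟩ := hg
    exact ⟨(nrm_add_le hl hl').trans (add_le_add h1 h1'), _, hu.add hu', ih hr hr'⟩

/-- A function whose weak derivative `∂_θ f` is regular. -/
lemma of_hasWeakDeriv {i : ℕ} (hf : nrm β f ≤ M) (h : HasWeakDeriv dirTheta f g)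
    (hg : Reg γ i γ (fun p => Real.sin (2 * p.2) * g p) M) : Reg γ (i + 1) β f M :=
  ⟨hf, _, isDTheta_of_deriv h, hg⟩

end Reg

lemma exists_bound_comp_snd {a : ℝ → ℝ} (ha : Continuous a) :
    ∃ K : ℝ≥0, ∀ p ∈ strip, |a p.2| ≤ K := by
  obtain ⟨K, hK⟩ := (isCompact_Icc (a := (0 : ℝ)) (b := Real.pi / 2)).exists_bound_of_continuousOn
    ha.continuousOn
  exact ⟨K.toNNReal, fun p hp => (hK p.2 (Ioo_subset_Icc_self hp.2)).trans (Real.le_coe_toNNReal K)⟩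

lemma hasDerivAt_deriv {a : ℝ → ℝ} (ha : ContDiff ℝ ∞ a) (θ : ℝ) : HasDerivAt a (deriv a θ) θ :=
  (ha.differentiable (by norm_num)).differentiableAt.hasDerivAt

lemma contDiff_sin_two_mul : ContDiff ℝ ∞ fun θ : ℝ => Real.sin (2 * θ) :=
  Real.contDiff_sin.comp (contDiff_const.mul contDiff_id)

lemma contDiff_cos_two_mul : ContDiff ℝ ∞ fun θ : ℝ => Real.cos (2 * θ) :=
  Real.contDiff_cos.comp (contDiff_const.mul contDiff_id)

lemma nrm_mul_le' {β : ℝ} {f b : ℝ × ℝ → ℝ} {K : ℝ≥0} (hK : ∀ p ∈ strip, |b p| ≤ K) :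
    nrm β (fun p => b p * f p) ≤ K * nrm β f := by
  simpa using nrm_mul_le (f := f) (β := β) hK

/-- Smooth functions of the angle are multipliers. -/
lemma exists_reg_mul (i : ℕ) {a : ℝ → ℝ} (ha : ContDiff ℝ ∞ a) :
    ∃ K : ℝ≥0, ∀ γ f M, Reg γ i γ f M → Reg γ i γ (fun p => a p.2 * f p) (K * M) := by
  induction i generalizing a with
  | zero =>
    obtain ⟨K, hK⟩ := exists_bound_comp_snd ha.continuous
    exact ⟨K, fun γ f M h => ⟨LocInt.mul (b := fun p => a p.2) h.1 (ha.continuous.comp continuous_snd).continuousOn,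
      (nrm_mul_le' hK).trans (by gcongr; exact h.2)⟩⟩
  | succ i ih =>
    obtain ⟨K, hK⟩ := exists_bound_comp_snd ha.continuous
    obtain ⟨K₁, h1⟩ := ih ha
    have ha' : ContDiff ℝ ∞ fun θ => Real.sin (2 * θ) * deriv a θ :=
      contDiff_sin_two_mul.mul (contDiff_infty_iff_deriv.1 ha).2
    obtain ⟨K₂, h2⟩ := ih ha'
    refine ⟨K + K₁ + K₂, fun γ f M h => ?_⟩
    have hp := h.pred
    obtain ⟨hn, g, hg, hr⟩ := h
    refine ⟨(nrm_mul_le' hK).trans ?_, _, hg.mul_theta ha.contDiffOn (fun θ _ => hasDerivAt_deriv ha θ),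
      ((h1 γ g M hr).add (h2 γ f M hp)).mono ?_⟩
    · push_cast
      rw [add_mul, add_mul, add_assoc]
      exact le_add_right (by gcongr)
    · push_cast
      rw [add_mul, add_mul, add_assoc]
      exact le_add_self

/-- The factor `sin(2θ)` compensates the change of weight. -/
lemma nrm_sin_mul_le {γ : ℝ} (hγ' : γ ≤ 5 / 4) (f : ℝ × ℝ → ℝ) :
    nrm γ (fun p => Real.sin (2 * p.2) * f p) ≤ nrm eta f := by
  refine eLpNorm_mono_ae (ae_strip_of_forall fun p hp => ?_)
  have hs := sin_two_mul_pos hp.2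
  have h1 : Real.sin (2 * p.2) * wt γ p ≤ wt eta p := by
    rw [wt, wt, ← mul_div_assoc, div_le_div_iff₀ (Real.rpow_pos_of_pos hs _) (Real.rpow_pos_of_pos hs _),
      mul_comm (Real.sin _), mul_assoc]
    refine mul_le_mul_of_nonneg_left ?_ (w_pos hp.1).le
    conv_lhs => rw [← Real.rpow_one (Real.sin (2 * p.2)), ← Real.rpow_mul hs.le, ← Real.rpow_add hs]
    exact Real.rpow_le_rpow_of_exponent_ge hs (Real.sin_le_one _) (by norm_num [eta]; linarith)
  rw [norm_mul, norm_mul, norm_mul, Real.norm_of_nonneg hs.le, Real.norm_of_nonneg (wt_pos hp).le,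
    Real.norm_of_nonneg (wt_pos hp).le, mul_comm (Real.sin _), mul_assoc]
  exact mul_le_mul_of_nonneg_left h1 (norm_nonneg _)

/-- The factor `sin(2θ)` turns the weight `η` into the weight `γ` without loss of derivatives. -/
lemma exists_reg_sin_mul (i : ℕ) :
    ∃ K : ℝ≥0, ∀ γ, γ ≤ 5 / 4 → ∀ f M, Reg γ i eta f M →
      Reg γ i γ (fun p => Real.sin (2 * p.2) * f p) (K * M) := by
  induction i with
  | zero =>
    refine ⟨1, fun γ hγ' f M h => ⟨LocInt.mul (b := fun p => Real.sin (2 * p.2)) h.1 (by fun_prop), ?_⟩⟩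
    simpa using (nrm_sin_mul_le hγ' f).trans h.2
  | succ i ih =>
    obtain ⟨K₁, h1⟩ := exists_reg_mul i contDiff_sin_two_mul
    obtain ⟨K₂, h2⟩ := ih
    obtain ⟨K₃, h3⟩ := exists_reg_mul i (a := fun θ => 2 * Real.cos (2 * θ)) (contDiff_const.mul contDiff_cos_two_mul)
    refine ⟨1 + K₁ + K₃ * K₂, fun γ hγ' f M h => ?_⟩
    have hp := h.pred
    obtain ⟨hn, g, hg, hr⟩ := h
    refine ⟨((nrm_sin_mul_le hγ' f).trans hn).trans ?_, _,
      (hg.mul_theta contDiff_sin_two_mul.contDiffOn fun θ _ => hasDerivAt_sin_two_mul θ).congr ae_eq_rfl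
        (g' := fun p => Real.sin (2 * p.2) * g p + 2 * Real.cos (2 * p.2) * (Real.sin (2 * p.2) * f p))
        (ae_of_all _ fun p => by ring),
      ((h1 γ g M hr).add (h3 γ _ _ (h2 γ hγ' f M hp))).mono ?_⟩
    · push_cast
      rw [add_mul, add_mul, one_mul, add_assoc]
      exact le_self_add
    · push_cast
      rw [add_mul, add_mul, add_assoc, mul_assoc]
      exact le_add_self

/-- Smooth functions of the angle are multipliers for the weight `η` as well: where the derivative falls
on the factor, `D_θ` supplies the `sin(2θ)` that is needed. -/
lemma exists_reg_mul_eta (i : ℕ) {a : ℝ → ℝ} (ha : ContDiff ℝ ∞ a) :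
    ∃ K : ℝ≥0, ∀ γ, γ ≤ 5 / 4 → ∀ f M, Reg γ i eta f M → Reg γ i eta (fun p => a p.2 * f p) (K * M) := by
  obtain ⟨K, hK⟩ := exists_bound_comp_snd ha.continuous
  cases i with
  | zero =>
    exact ⟨K, fun γ _ f M h => ⟨LocInt.mul (b := fun p => a p.2) h.1 (ha.continuous.comp continuous_snd).continuousOn,
      (nrm_mul_le' hK).trans (by gcongr; exact h.2)⟩⟩
  | succ i =>
    obtain ⟨K₁, h1⟩ := exists_reg_mul i ha
    obtain ⟨K₂, h2⟩ := exists_reg_sin_mul i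
    obtain ⟨K₃, h3⟩ := exists_reg_mul i (contDiff_infty_iff_deriv.1 ha).2
    refine ⟨K + K₁ + K₃ * K₂, fun γ hγ' f M h => ?_⟩
    have hp := h.pred
    obtain ⟨hn, g, hg, hr⟩ := h
    refine ⟨(nrm_mul_le' hK).trans ?_, _,
      (hg.mul_theta ha.contDiffOn fun θ _ => hasDerivAt_deriv ha θ).congr ae_eq_rfl
        (g' := fun p => a p.2 * g p + deriv a p.2 * (Real.sin (2 * p.2) * f p))
        (ae_of_all _ fun p => by ring),
      ((h1 γ g M hr).add (h3 γ _ _ (h2 γ hγ' f M hp))).mono ?_⟩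
    · push_cast
      rw [add_mul, add_mul, add_assoc]
      exact le_add_right (by gcongr)
    · push_cast
      rw [add_mul, add_mul, add_assoc, mul_assoc]
      exact le_add_self

lemma Reg.const_mul_of_abs_le {γ : ℝ} : ∀ {i : ℕ} {β : ℝ} {f : ℝ × ℝ → ℝ} {M : ℝ≥0∞}, Reg γ i β f M →
    ∀ {c : ℝ} {K : ℝ≥0}, |c| ≤ K → Reg γ i β (fun p => c * f p) (K * M)
  | 0, β, f, M, h, c, K, hc => ⟨LocInt.const_mul h.1 c, (nrm_mul_le' (b := fun _ => c)
      fun p _ => hc).trans (by gcongr; exact h.2)⟩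
  | i + 1, β, f, M, h, c, K, hc => by
    obtain ⟨hn, g, hg, hr⟩ := h
    refine ⟨(nrm_mul_le' (b := fun _ => c) fun p _ => hc).trans (by gcongr), _, ?_,
      hr.const_mul_of_abs_le hc⟩
    refine (hg.mul_theta (b := fun _ => c) (b' := fun _ => 0) contDiffOn_const
      fun θ _ => hasDerivAt_const _ _).congr ae_eq_rfl (ae_of_all _ fun p => by ring)

lemma Reg.const_mul {γ β : ℝ} {i : ℕ} {f : ℝ × ℝ → ℝ} {M : ℝ≥0∞} (h : Reg γ i β f M) (c : ℝ≥0) :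
    Reg γ i β (fun p => (c : ℝ) * f p) (c * M) :=
  h.const_mul_of_abs_le (by simp)

/-! ### Regularity of solutions -/

/-- The equation `D_θ Y = 6 sin² θ Y - 2 sin θ Q` improves the weight of `D_θ Y` from `η` to `γ`: away from
`θ = 0` by Hardy's inequality, and near `θ = 0` because `D_θ Y` is there a multiple of `sin(2θ)`. -/
lemma nrm_dTheta_Y_le {γ : ℝ} {Y Q : ℝ × ℝ → ℝ} {M : ℝ≥0∞} (hγ : 1 ≤ γ) (hγ' : γ ≤ 5 / 4) {Q' : ℝ × ℝ → ℝ} (hM : M ≠ ⊤) (hY : nrm eta Y ≤ M)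
    (hQ : nrm eta Q ≤ M) (hQ' : nrm γ Q' ≤ M)
    (hd : IsDTheta Y (fun p => 6 * Real.sin p.2 ^ 2 * Y p - 2 * Real.sin p.2 * Q p)) (hdQ : IsDTheta Q Q') :
    nrm γ (fun p => 6 * Real.sin p.2 ^ 2 * Y p - 2 * Real.sin p.2 * Q p) ≤ (50 : ℝ≥0) * M := by
  have lY := LocInt.aesm hd.locInt_left
  have lQ := LocInt.aesm hdQ.locInt_left
  have lQ' := LocInt.aesm hdQ.locInt
  have xY : MemX eta Y := ⟨aesm_mul_wt lY, hY.trans_lt hM.lt_top⟩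
  have xQ : MemX eta Q := ⟨aesm_mul_wt lQ, hQ.trans_lt hM.lt_top⟩
  have cont : ∀ {b : ℝ → ℝ}, Continuous b → ContinuousOn (fun p : ℝ × ℝ => b p.2) strip :=
    fun hb => (hb.comp continuous_snd).continuousOn
  have as : ∀ {b : ℝ → ℝ} {f : ℝ × ℝ → ℝ}, Continuous b → AEStronglyMeasurable f stripMeasure →
      AEStronglyMeasurable (fun p => b p.2 * f p) stripMeasure := fun hb hf =>
    (aesm_of_continuousOn (cont hb)).mul hf
  have s1 : ∀ θ, |Real.sin θ| ≤ 1 := Real.abs_sin_le_one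
  have c1 : ∀ θ, |Real.cos θ| ≤ 1 := Real.abs_cos_le_one
  -- the weighted norm of `sin(2θ)(b₁ Y + b₂ Q)`
  have lin : ∀ {b₁ b₂ : ℝ → ℝ} {K₁ K₂ : ℝ≥0}, Continuous b₁ → Continuous b₂ → (∀ θ, |b₁ θ| ≤ K₁) →
      (∀ θ, |b₂ θ| ≤ K₂) → AEStronglyMeasurable (fun p : ℝ × ℝ => Real.sin (2 * p.2) * (b₁ p.2 * Y p + b₂ p.2 * Q p)) stripMeasure ∧
      nrm γ (fun p => Real.sin (2 * p.2) * (b₁ p.2 * Y p + b₂ p.2 * Q p)) ≤ (K₁ + K₂ : ℝ≥0) * M := by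
    intro b₁ b₂ K₁ K₂ hb₁ hb₂ h1 h2
    refine ⟨as (b := fun θ => Real.sin (2 * θ)) (by fun_prop) ((as hb₁ lY).add (as hb₂ lQ)), ?_⟩
    refine (nrm_sin_mul_le hγ' _).trans ((nrm_add_le (as hb₁ lY) (as hb₂ lQ)).trans ?_)
    push_cast
    rw [add_mul]
    exact add_le_add ((nrm_mul_le' fun p _ => h1 p.2).trans (by gcongr))
      ((nrm_mul_le' fun p _ => h2 p.2).trans (by gcongr))
  set E : ℝ × ℝ → ℝ := fun p => Real.sin (2 * p.2) * (9 * (Real.cos p.2 * Real.sin p.2) * Y p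
    + -2 * Real.cos p.2 * Q p) + -Real.sin p.2 * Q' p with hE
  obtain ⟨lE1, nE1⟩ := lin (b₁ := fun θ => 9 * (Real.cos θ * Real.sin θ)) (b₂ := fun θ => -2 * Real.cos θ)
    (K₁ := 9) (K₂ := 2) (by fun_prop) (by fun_prop) (fun θ => by
      have := mul_le_one₀ (c1 θ) (abs_nonneg _) (s1 θ)
      rw [abs_mul, abs_mul]; norm_num; linarith) (fun θ => by rw [abs_mul]; norm_num; exact c1 θ)
  have lE2 := as (b := fun θ => -Real.sin θ) (by fun_prop) lQ'
  have nE2 : nrm γ (fun p => -Real.sin p.2 * Q' p) ≤ (1 : ℝ≥0) * M :=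
    (nrm_mul_le' (K := 1) fun p _ => by rw [abs_neg]; exact s1 p.2).trans (by gcongr)
  have nE : nrm γ E ≤ (12 : ℝ≥0) * M := by
    refine (nrm_add_le lE1 lE2).trans ((add_le_add nE1 nE2).trans (le_of_eq ?_))
    rw [← add_mul, ← ENNReal.coe_add]; norm_num
  have mE : MemLp E 2 stripMeasure := by
    have : MemX γ E := ⟨aesm_mul_wt (lE1.add lE2), nE.trans_lt (ENNReal.mul_lt_top ENNReal.coe_lt_top hM.lt_top)⟩
    exact this.memLp (by linarith)
  set V : ℝ × ℝ → ℝ := fun p => Real.sin p.2 * (6 * Real.sin p.2 ^ 2 * Y p - 2 * Real.sin p.2 * Q p) with hV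
  have mV : MemLp V 2 stripMeasure := by
    have a1 := MemLp.mul_bounded (xY.memLp eta_pos.le) (b := fun p => 6 * Real.sin p.2 ^ 3) (by fun_prop) (K := 6)
      fun p _ => by
        rw [abs_mul, abs_pow]; norm_num; exact pow_le_one₀ (abs_nonneg _) (s1 _)
    have a2 := MemLp.mul_bounded (xQ.memLp eta_pos.le) (b := fun p => 2 * Real.sin p.2 ^ 2) (by fun_prop) (K := 2)
      fun p _ => by
        rw [abs_mul, abs_pow]; norm_num; exact (s1 _)
    refine (a1.sub a2).ae_eq (ae_of_all _ fun p => ?_)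
    simp only [hV, Pi.sub_apply]; ring
  have hw : HasWeakDeriv dirTheta (fun p => Real.cos p.2 ^ 3 * V p) (fun p => Real.cos p.2 ^ 2 * E p) := by
    have d1 : ∀ θ : ℝ, HasDerivAt (fun θ => 6 * (Real.cos θ * Real.sin θ) ^ 3)
        (18 * (Real.cos θ * Real.sin θ) ^ 2 * (Real.cos θ ^ 2 - Real.sin θ ^ 2)) θ := fun θ => by
      refine ((((Real.hasDerivAt_cos θ).mul (Real.hasDerivAt_sin θ)).pow 3).const_mul 6).congr_deriv ?_
      simp only [Pi.mul_apply]; push_cast; ring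
    have d2 : ∀ θ : ℝ, HasDerivAt (fun θ => -2 * (Real.cos θ ^ 3 * Real.sin θ ^ 2))
        (6 * Real.cos θ ^ 2 * Real.sin θ ^ 3 - 4 * Real.cos θ ^ 4 * Real.sin θ) θ := fun θ => by
      refine ((((Real.hasDerivAt_cos θ).pow 3).mul ((Real.hasDerivAt_sin θ).pow 2)).const_mul (-2)).congr_deriv ?_
      simp only [Pi.pow_apply]; push_cast; ring
    have k1 := hd.hasWeakDeriv.mul_theta (b := fun θ => 6 * (Real.cos θ * Real.sin θ) ^ 3)
      (contDiff_const.mul ((Real.contDiff_cos.mul Real.contDiff_sin).pow 3)).contDiffOn fun θ _ => d1 θ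
    have k2 := hdQ.hasWeakDeriv.mul_theta (b := fun θ => -2 * (Real.cos θ ^ 3 * Real.sin θ ^ 2))
      (contDiff_const.mul ((Real.contDiff_cos.pow 3).mul (Real.contDiff_sin.pow 2))).contDiffOn fun θ _ => d2 θ
    refine (k1.add k2).congr (ae_of_all _ fun p => ?_) (ae_strip_of_forall fun p hp => ?_)
    · simp only [hV]; ring
    · have hc := (cos_pos_of_mem hp.2).ne'
      have hs := (sin_pos_of_mem hp.2).ne'
      simp only [hE, Real.sin_two_mul]
      field_simp
      ring
  have hardy := nrm_sin_sq_mul_le hγ hγ' mV mE hw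
  obtain ⟨l1, n1⟩ := lin (b₁ := fun θ => 3 * ((1 + Real.sin θ ^ 2) * Real.cos θ * Real.sin θ))
    (b₂ := fun θ => -((1 + Real.sin θ ^ 2) * Real.cos θ))
    (K₁ := 6) (K₂ := 2) (by fun_prop) (by fun_prop) (fun θ => by
      have h1 := mul_le_one₀ (c1 θ) (abs_nonneg _) (s1 θ)
      have h2 : |1 + Real.sin θ ^ 2| ≤ 2 := by
        rw [abs_of_nonneg (by positivity)]; linarith [Real.sin_sq_le_one θ]
      rw [abs_mul, mul_assoc, abs_mul, abs_mul (Real.cos θ)]; norm_num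
      nlinarith [abs_nonneg (1 + Real.sin θ ^ 2), mul_nonneg (abs_nonneg (Real.cos θ)) (abs_nonneg (Real.sin θ))])
    (fun θ => by
      have h2 : |1 + Real.sin θ ^ 2| ≤ 2 := by
        rw [abs_of_nonneg (by positivity)]; linarith [Real.sin_sq_le_one θ]
      rw [abs_neg, abs_mul]; norm_num
      nlinarith [abs_nonneg (1 + Real.sin θ ^ 2), abs_nonneg (Real.cos θ), c1 θ])
  have mV2 : AEStronglyMeasurable (fun p : ℝ × ℝ => Real.sin p.2 ^ 2 * V p) stripMeasure :=
    as (b := fun θ => Real.sin θ ^ 2) (by fun_prop) mV.1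
  have l2 := as (b := fun θ => Real.sin θ) (by fun_prop) mV2
  have n2 : nrm γ (fun p => Real.sin p.2 * (Real.sin p.2 ^ 2 * V p)) ≤ (36 : ℝ≥0) * M := by
    refine (nrm_mul_le' (K := 1) fun p _ => s1 p.2).trans ?_
    rw [ENNReal.coe_one, one_mul]
    refine (hardy.trans (mul_le_mul_right nE _)).trans (le_of_eq ?_)
    rw [← mul_assoc]; norm_num
  -- `Z = s⁴ Z + c² (1 + s²) Z` and `c² Z = c sin(2θ) (3 s Y - Q)`
  have dec : (fun p => 6 * Real.sin p.2 ^ 2 * Y p - 2 * Real.sin p.2 * Q p) = fun p : ℝ × ℝ =>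
      Real.sin p.2 * (Real.sin p.2 ^ 2 * V p) + Real.sin (2 * p.2) *
        (3 * ((1 + Real.sin p.2 ^ 2) * Real.cos p.2 * Real.sin p.2) * Y p
          + -((1 + Real.sin p.2 ^ 2) * Real.cos p.2) * Q p) := by
    ext p
    simp only [hV, Real.sin_two_mul]
    have h := Real.cos_sq' p.2
    linear_combination (-(6 * Real.sin p.2 ^ 2 * Y p - 2 * Real.sin p.2 * Q p) * (1 + Real.sin p.2 ^ 2)) * h
  rw [dec]
  refine (nrm_add_le l2 l1).trans ((add_le_add n2 n1).trans ?_)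
  rw [← add_mul, ← ENNReal.coe_add]
  gcongr
  norm_num

/-- The derivatives of `Z = D_θ Y`, by the equation
`D_θ Z = 6 sin² θ Z + 6 sin²(2θ) Y - 2 cos θ sin(2θ) Q - 2 sin θ D_θ Q`. -/
lemma exists_reg_dTheta_Y (i : ℕ) : ∃ K : ℝ≥0, ∀ γ, 1 ≤ γ → γ ≤ 5 / 4 → ∀ Y Q M, M ≠ ⊤ →
    IsDTheta Y (fun p => 6 * Real.sin p.2 ^ 2 * Y p - 2 * Real.sin p.2 * Q p) →
    Reg γ i eta Y M → Reg γ (i + 1) eta Q M →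
    Reg γ i γ (fun p => 6 * Real.sin p.2 ^ 2 * Y p - 2 * Real.sin p.2 * Q p) (K * M) := by
  have base : ∀ γ, 1 ≤ γ → γ ≤ 5 / 4 → ∀ Y Q M, M ≠ ⊤ → ∀ {i : ℕ},
      IsDTheta Y (fun p => 6 * Real.sin p.2 ^ 2 * Y p - 2 * Real.sin p.2 * Q p) →
      Reg γ i eta Y M → Reg γ (i + 1) eta Q M →
      nrm γ (fun p => 6 * Real.sin p.2 ^ 2 * Y p - 2 * Real.sin p.2 * Q p) ≤ (50 : ℝ≥0) * M := by
    intro γ hγ hγ' Y Q M hM i hd hY hQ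
    obtain ⟨hn, Q', hQ', hr⟩ := hQ
    exact nrm_dTheta_Y_le hγ hγ' hM hY.nrm_le hn hr.nrm_le hd hQ'
  induction i with
  | zero => exact ⟨50, fun γ hγ hγ' Y Q M hM hd hY hQ => ⟨hd.locInt, base γ hγ hγ' Y Q M hM hd hY hQ⟩⟩
  | succ i ih =>
    obtain ⟨K₀, h0⟩ := ih
    obtain ⟨K₁, h1⟩ := exists_reg_mul i (a := fun θ => 6 * Real.sin θ ^ 2) (contDiff_const.mul (Real.contDiff_sin.pow 2))
    obtain ⟨K₂, h2⟩ := exists_reg_mul i (a := fun θ => -2 * Real.sin θ) (contDiff_const.mul Real.contDiff_sin)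
    obtain ⟨K₃, h3⟩ := exists_reg_mul i (a := fun θ => 12 * Real.sin θ * Real.cos θ)
      ((contDiff_const.mul Real.contDiff_sin).mul Real.contDiff_cos)
    obtain ⟨K₄, h4⟩ := exists_reg_mul i (a := fun θ => -2 * Real.cos θ) (contDiff_const.mul Real.contDiff_cos)
    obtain ⟨S, hS⟩ := exists_reg_sin_mul i
    refine ⟨50 + (K₁ * K₀ + K₂ + K₃ * S + K₄ * S), fun γ hγ hγ' Y Q M hM hd hY hQ => ?_⟩
    have hn := base γ hγ hγ' Y Q M hM hd hY hQ
    have hYp := hY.pred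
    have hQp := hQ.pred
    obtain ⟨-, Q', hQ', hr⟩ := hQ
    have a1 := h1 γ _ _ (h0 γ hγ hγ' Y Q M hM hd hYp hQp)
    have a2 := h2 γ _ _ hr.pred
    have a3 := h3 γ _ _ (hS γ hγ' Y M hYp)
    have a4 := h4 γ _ _ (hS γ hγ' Q M hQp.pred)
    have d1 := hd.mul_theta (b := fun θ => 6 * Real.sin θ ^ 2) (b' := fun θ => 12 * Real.sin θ * Real.cos θ)
      (contDiff_const.mul (Real.contDiff_sin.pow 2)).contDiffOn fun θ _ =>
        (((Real.hasDerivAt_sin θ).pow 2).const_mul 6).congr_deriv (by push_cast; ring)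
    have d2 := hQ'.mul_theta (b := fun θ => -2 * Real.sin θ) (b' := fun θ => -2 * Real.cos θ)
      (contDiff_const.mul Real.contDiff_sin).contDiffOn fun θ _ => (Real.hasDerivAt_sin θ).const_mul (-2)
    refine ⟨hn.trans (mul_le_mul_left (by push_cast; exact le_self_add) _), _,
      (d1.add d2).congr (ae_of_all _ fun p => by ring) (ae_of_all _ fun p => ?_),
      (((a1.add a2).add a3).add a4).mono ?_⟩
    · ring
    · push_cast
      calc _ = (K₁ * K₀ + K₂ + K₃ * S + K₄ * S : ℝ≥0∞) * M := by ring
        _ ≤ _ := mul_le_mul_left le_add_self _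

/-- Regularity of `Y` from that of `Q`. -/
lemma exists_reg_Y (i : ℕ) : ∃ K : ℝ≥0, ∀ γ, 1 ≤ γ → γ ≤ 5 / 4 → ∀ Y Q M, M ≠ ⊤ →
    IsDTheta Y (fun p => 6 * Real.sin p.2 ^ 2 * Y p - 2 * Real.sin p.2 * Q p) →
    nrm eta Y ≤ M → Reg γ i eta Q M → Reg γ i eta Y (K * M) := by
  induction i with
  | zero => exact ⟨1, fun γ _ _ Y Q M _ hd hY _ => ⟨hd.locInt_left, by simpa using hY⟩⟩
  | succ i ih =>
    obtain ⟨K₀, h0⟩ := ih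
    obtain ⟨K₁, h1⟩ := exists_reg_dTheta_Y i
    refine ⟨1 + K₁ * (K₀ + 1), fun γ hγ hγ' Y Q M hM hd hY hQ => ?_⟩
    have a0 := h0 γ hγ hγ' Y Q M hM hd hY hQ.pred
    have a1 := h1 γ hγ hγ' Y Q ((K₀ + 1 : ℝ≥0) * M) (ENNReal.mul_ne_top ENNReal.coe_ne_top hM) hd
      (a0.mono (by push_cast; rw [add_mul]; exact le_self_add))
      (hQ.mono (by push_cast; rw [add_mul, one_mul]; exact le_add_self))
    refine ⟨hY.trans ?_, _, hd, a1.mono ?_⟩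
    · push_cast
      rw [add_mul, one_mul]; exact le_self_add
    · push_cast
      rw [add_mul 1, mul_assoc]; exact le_add_self

/-- Right-hand sides with `m` radial derivatives, `D_R^j F` having `m - j` derivatives in the angle, all
orthogonal to `cos² θ sin θ`. -/
def Tower (γ : ℝ) : ℕ → (ℝ × ℝ → ℝ) → ℝ≥0∞ → Prop
  | 0, F, M => OrthW F ∧ Reg γ 0 eta F M
  | m + 1, F, M => OrthW F ∧ Reg γ (m + 1) eta F M ∧ ∃ G, IsDR F G ∧ Tower γ m G M

namespace Tower

variable {γ : ℝ} {F : ℝ × ℝ → ℝ} {M : ℝ≥0∞}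

lemma orthW : ∀ {m : ℕ}, Tower γ m F M → OrthW F
  | 0, h => h.1
  | _ + 1, h => h.1

lemma reg : ∀ {m : ℕ}, Tower γ m F M → Reg γ m eta F M
  | 0, h => h.2
  | _ + 1, h => h.2.1

lemma pred {m : ℕ} (h : Tower γ (m + 1) F M) : Tower γ m F M := by
  induction m generalizing F with
  | zero => exact ⟨h.1, h.2.1.pred⟩
  | succ m ih =>
    obtain ⟨h1, h2, G, hG, hT⟩ := h
    exact ⟨h1, h2.pred, G, hG, ih hT⟩

lemma memX {m : ℕ} (h : Tower γ m F M) (hM : M ≠ ⊤) : MemX eta F :=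
  ⟨aesm_mul_wt (LocInt.aesm h.reg.locInt), h.reg.nrm_le.trans_lt hM.lt_top⟩

end Tower

/-- Regularity of a solution and of its derivatives. -/
structure RegSol (γ : ℝ) (m : ℕ) (F Ψ Ψ₁ Ψ₂ Θ Θ₁ Y : ℝ × ℝ → ℝ) (M : ℝ≥0∞) : Prop where
  regΨ : Reg γ m eta Ψ M
  regΨ₁ : Reg γ m eta Ψ₁ M
  regΨ₂ : Reg γ m eta Ψ₂ M
  regΘ : Reg γ m eta Θ M
  regΘ₁ : Reg γ m eta Θ₁ M
  regY : Reg γ m eta Y M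
  regΨθθ : Reg γ m eta (fun p => Real.sin p.2 * Y p - 5 * Ψ p - (F p + Ψ₂ p + 5 * Ψ₁ p)) M

lemma exists_reg_dTT (m : ℕ) : ∃ K : ℝ≥0, ∀ γ, γ ≤ 5 / 4 → ∀ F Ψ Ψ₁ Ψ₂ Y M,
    Reg γ m eta F M → Reg γ m eta Ψ M → Reg γ m eta Ψ₁ M → Reg γ m eta Ψ₂ M → Reg γ m eta Y M →
    Reg γ m eta (fun p => Real.sin p.2 * Y p - 5 * Ψ p - (F p + Ψ₂ p + 5 * Ψ₁ p)) (K * M) := by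
  obtain ⟨K₁, h1⟩ := exists_reg_mul_eta m Real.contDiff_sin
  obtain ⟨K₂, h2⟩ := exists_reg_mul_eta m (a := fun _ => -1) contDiff_const
  refine ⟨K₁ + K₂ * 12, fun γ hγ' F Ψ Ψ₁ Ψ₂ Y M hF hΨ hΨ₁ hΨ₂ hY => ?_⟩
  have := (h1 γ hγ' Y M hY).add (h2 γ hγ' _ _ (((((hΨ.const_mul 5).add hF).add hΨ₂).add (hΨ₁.const_mul 5))))
  refine (this.congr (ae_of_all _ fun p => ?_)).mono (le_of_eq ?_)
  · push_cast; ring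
  · push_cast; ring

/-- Regularity estimate. Each step uses that `D_R` of the solution is the solution for `D_R F`, so that
the radial derivatives on the right of `∂_θ Ψ₂ = α Θ₁(D_R F)` and `∂_θ Θ₁ = α ∂_θθ Ψ(D_R F)` are known from
the previous step. -/
lemma exists_regSol (m : ℕ) : ∃ C : ℝ≥0, ∀ γ, 1 ≤ γ → γ ≤ 5 / 4 → ∀ α, 0 < α → α ≤ 1 / 4 →
    ∀ F M, M ≠ ⊤ → Tower γ m F M → ∀ Ψ Ψ₁ Ψ₂ Θ Θ₁ Y, Sol α F Ψ Ψ₁ Ψ₂ Θ Θ₁ Y →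
      RegSol γ m F Ψ Ψ₁ Ψ₂ Θ Θ₁ Y (C * M) := by
  set A : ℝ≥0 := (Real.sqrt apC2).toNNReal with hA
  have hAC : apC = A := rfl
  have bound : ∀ {F f : ℝ × ℝ → ℝ} {M : ℝ≥0∞}, nrm eta F ≤ M → nrm eta f ≤ apC * nrm eta F →
      nrm eta f ≤ A * M := fun h1 h2 => h2.trans (by rw [hAC]; gcongr)
  induction m with
  | zero =>
    obtain ⟨K, hK⟩ := exists_reg_dTT 0
    refine ⟨(A + 1) + K * (A + 1), fun γ hγ hγ' α hα0 hα F M hM hT Ψ Ψ₁ Ψ₂ Θ Θ₁ Y h => ?_⟩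
    have r : ∀ {f : ℝ × ℝ → ℝ}, MemX eta f → nrm eta f ≤ apC * nrm eta F → Reg γ 0 eta f ((A + 1 : ℝ≥0) * M) :=
      fun hm hn => ⟨LocInt.of_memLp (hm.memLp eta_pos.le), (bound hT.reg.nrm_le hn).trans (by
        push_cast; rw [add_mul]; exact le_self_add)⟩
    have rF : Reg γ 0 eta F ((A + 1 : ℝ≥0) * M) := hT.reg.mono (by push_cast; rw [add_mul, one_mul]; exact le_add_self)
    have e1 : ((A + 1 : ℝ≥0) : ℝ≥0∞) * M ≤ ((A + 1) + K * (A + 1) : ℝ≥0) * M := by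
      exact mul_le_mul_left (ENNReal.coe_le_coe.2 le_self_add) _
    have aΨ := r h.memΨ h.leΨ
    have aΨ₁ := r h.memΨ₁ h.leΨ₁
    have aΨ₂ := r h.memΨ₂ h.leΨ₂
    have aY := r h.memY h.leY
    exact ⟨aΨ.mono e1, aΨ₁.mono e1, aΨ₂.mono e1, (r h.memΘ h.leΘ).mono e1, (r h.memΘ₁ h.leΘ₁).mono e1, aY.mono e1,
      (hK γ hγ' F Ψ Ψ₁ Ψ₂ Y _ rF aΨ aΨ₁ aΨ₂ aY).mono (by
        rw [← mul_assoc, ← ENNReal.coe_mul]; exact mul_le_mul_left (ENNReal.coe_le_coe.2 le_add_self) _)⟩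
  | succ m ih =>
    obtain ⟨C, hC⟩ := ih
    obtain ⟨S, hS⟩ := exists_reg_sin_mul m
    obtain ⟨KY, hKY⟩ := exists_reg_Y (m + 1)
    obtain ⟨K, hK⟩ := exists_reg_dTT (m + 1)
    set L : ℝ≥0 := A + C + S * C + 1 with hL
    set L₂ : ℝ≥0 := KY * (11 * L) + L with hL₂
    refine ⟨L₂ + K * L₂, fun γ hγ hγ' α hα0 hα F M hM hT Ψ Ψ₁ Ψ₂ Θ Θ₁ Y h => ?_⟩
    have s0 := hC γ hγ hγ' α hα0 hα F M hM hT.pred Ψ Ψ₁ Ψ₂ Θ Θ₁ Y h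
    have xF := hT.memX hM
    have hFn := hT.reg.nrm_le
    have hrF := hT.reg
    obtain ⟨-, -, G, hFG, hG⟩ := hT
    have xG := hG.memX hM
    obtain ⟨Φ, Φ₁, Φ₂, Ξ, Ξ₁, W, h'⟩ := exists_sol hα0 hα xG hG.orthW
    have s1 := hC γ hγ hγ' α hα0 hα G M hM hG Φ Φ₁ Φ₂ Ξ Ξ₁ W h'
    obtain ⟨-, -, -, -, e0, e1, e2⟩ := h.radial hα0 hα h' (xF.memLp eta_pos.le) (xG.memLp eta_pos.le) hFG
    have up : ∀ {f g : ℝ × ℝ → ℝ}, nrm eta f ≤ apC * nrm eta F → HasWeakDeriv dirTheta f g →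
        Reg γ m eta g (C * M) → Reg γ (m + 1) eta f (L * M) := by
      intro f g hf hfg hg
      refine Reg.of_hasWeakDeriv ((bound hFn hf).trans ?_) hfg ((hS γ hγ' g _ hg).mono ?_)
      · gcongr
        exact le_add_right (le_add_right le_self_add)
      · rw [← mul_assoc, ← ENNReal.coe_mul]
        gcongr
        exact le_add_right le_add_self
    have small : ∀ {g : ℝ × ℝ → ℝ}, Reg γ m eta g (C * M) → Reg γ m eta (fun p => α * g p) (C * M) := by
      intro g hg
      have := hg.const_mul α.toNNReal
      rw [Real.coe_toNNReal _ hα0.le] at this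
      refine this.mono (mul_le_of_le_one_left' (ENNReal.coe_le_one_iff.2 ?_))
      exact Real.toNNReal_le_one.2 (by linarith)
    have aΨ : Reg γ (m + 1) eta Ψ (L * M) := up h.leΨ h.dT s0.regΘ
    have aΨ₁ : Reg γ (m + 1) eta Ψ₁ (L * M) := up h.leΨ₁ h.dT₁ s0.regΘ₁
    have aΨ₂ : Reg γ (m + 1) eta Ψ₂ (L * M) :=
      up h.leΨ₂ ((h'.dT₁.const_mul α).congr e1.symm ae_eq_rfl) (small s1.regΘ₁)
    have aΘ : Reg γ (m + 1) eta Θ (L * M) := up h.leΘ h.dTT s0.regΨθθ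
    have aΘ₁ : Reg γ (m + 1) eta Θ₁ (L * M) :=
      up h.leΘ₁ ((h'.dTT.const_mul α).congr e2.symm ae_eq_rfl) (small s1.regΨθθ)
    have aF : Reg γ (m + 1) eta F (L * M) := hrF.mono (by
      rw [hL]; push_cast; rw [add_mul _ 1, one_mul]; exact le_add_self)
    have aQ : Reg γ (m + 1) eta (fun p => F p + 4 * Ψ p + Ψ₂ p + 5 * Ψ₁ p) ((11 * L : ℝ≥0) * M) := by
      refine ((((aF.add (aΨ.const_mul 4)).add aΨ₂).add (aΨ₁.const_mul 5)).congr
        (ae_of_all _ fun p => ?_)).mono (le_of_eq ?_)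
      · push_cast; ring
      · push_cast; ring
    have nY : nrm eta Y ≤ (11 * L : ℝ≥0) * M := (bound hFn h.leY).trans (by
      gcongr
      calc A ≤ L := le_add_right (le_add_right le_self_add)
        _ = 1 * L := (one_mul L).symm
        _ ≤ 11 * L := by gcongr; norm_num)
    have aY := hKY γ hγ hγ' Y _ _ (ENNReal.mul_ne_top ENNReal.coe_ne_top hM) h.isDTheta_Y nY aQ
    have i1 : (L : ℝ≥0∞) * M ≤ L₂ * M := by gcongr; exact le_add_self
    have aY' : Reg γ (m + 1) eta Y (L₂ * M) := aY.mono (by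
      rw [← mul_assoc, ← ENNReal.coe_mul]; gcongr; exact le_self_add)
    have i2 : (L₂ : ℝ≥0∞) * M ≤ (L₂ + K * L₂ : ℝ≥0) * M := by gcongr; exact le_self_add
    exact ⟨(aΨ.mono i1).mono i2, (aΨ₁.mono i1).mono i2, (aΨ₂.mono i1).mono i2, (aΘ.mono i1).mono i2,
      (aΘ₁.mono i1).mono i2, aY'.mono i2,
      (hK γ hγ' F Ψ Ψ₁ Ψ₂ Y _ (aF.mono i1) (aΨ.mono i1) (aΨ₁.mono i1) (aΨ₂.mono i1) aY').mono (by
        rw [← mul_assoc, ← ENNReal.coe_mul]; gcongr; exact le_add_self)⟩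

/-! ### Mixed derivatives and the norms -/

lemma IsIterate.unique {D : (ℝ × ℝ → ℝ) → (ℝ × ℝ → ℝ) → Prop}
    (hc : ∀ {f f' g}, D f g → f =ᵐ[stripMeasure] f' → D f' g)
    (hu : ∀ {f g h}, D f g → D f h → g =ᵐ[stripMeasure] h) :
    ∀ {n : ℕ} {f f' g g' : ℝ × ℝ → ℝ}, IsIterate D n f g → IsIterate D n f' g' → f =ᵐ[stripMeasure] f' →
      g =ᵐ[stripMeasure] g'
  | 0, _, _, _, _, h, h', hf => h.2.trans (hf.trans h'.2.symm)
  | _ + 1, _, _, _, _, ⟨_, h1, h2⟩, ⟨_, h1', h2'⟩, hf =>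
    hu (hc h2 (IsIterate.unique (D := D) hc hu h1 h1' hf)) h2'

lemma IsIterate.unique_dR {n : ℕ} {f f' g g' : ℝ × ℝ → ℝ} (h : IsIterate IsDR n f g)
    (h' : IsIterate IsDR n f' g') (hf : f =ᵐ[stripMeasure] f') : g =ᵐ[stripMeasure] g' :=
  IsIterate.unique (fun h1 h2 => h1.congr h2 ae_eq_rfl) (fun h1 h2 => h1.unique h2) h h' hf

lemma IsIterate.unique_dTheta {n : ℕ} {f f' g g' : ℝ × ℝ → ℝ} (h : IsIterate IsDTheta n f g)
    (h' : IsIterate IsDTheta n f' g') (hf : f =ᵐ[stripMeasure] f') : g =ᵐ[stripMeasure] g' :=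
  IsIterate.unique (fun h1 h2 => h1.congr h2 ae_eq_rfl) (fun h1 h2 => h1.unique h2) h h' hf

lemma IsMixed.unique {j i : ℕ} {f g g' : ℝ × ℝ → ℝ} (h : IsMixed j i f g) (h' : IsMixed j i f g') :
    g =ᵐ[stripMeasure] g' := by
  obtain ⟨u, h1, h2⟩ := h
  obtain ⟨u', h1', h2'⟩ := h'
  exact h2.unique_dR h2' (h1.unique_dTheta h1' ae_eq_rfl)

/-- The infimum in the definition of `mixedNorm` is attained by every representative. -/
lemma IsMixed.mixedNorm_eq {j i : ℕ} {f g : ℝ × ℝ → ℝ} (h : IsMixed j i f g) (β : ℝ) :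
    mixedNorm β j i f = nrm β g :=
  le_antisymm (iInf₂_le g h) (le_iInf₂ fun _ hg' => (nrm_congr (h.unique hg')).le)

lemma exists_isMixed {β : ℝ} {j i : ℕ} {f : ℝ × ℝ → ℝ} (h : mixedNorm β j i f < ⊤) : ∃ g, IsMixed j i f g := by
  by_contra hn
  push Not at hn
  refine h.ne ?_
  rw [mixedNorm]
  simp [hn]

lemma mixedNorm_le_hkNorm {γ : ℝ} {k i : ℕ} (f : ℝ × ℝ → ℝ) (hi : i ≤ k) :
    mixedNorm eta i 0 f ≤ hkNorm γ k f := by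
  rw [hkNorm, ← ENNReal.rpow_le_rpow_iff (z := 2) (by norm_num), ← ENNReal.rpow_mul]
  norm_num
  exact le_add_right (Finset.single_le_sum (f := fun i => mixedNorm eta i 0 f ^ 2) (fun _ _ => zero_le)
    (Finset.mem_range.2 (by omega)))

lemma mixedNorm_le_hkNorm' {γ : ℝ} {k j i : ℕ} (f : ℝ × ℝ → ℝ) (hi : 1 ≤ i) (hj : j + i ≤ k) :
    mixedNorm γ j i f ≤ hkNorm γ k f := by
  rw [hkNorm, ← ENNReal.rpow_le_rpow_iff (z := 2) (by norm_num), ← ENNReal.rpow_mul]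
  norm_num
  refine le_add_left ((Finset.single_le_sum (f := fun j => mixedNorm γ j i f ^ 2) (fun _ _ => zero_le)
    (Finset.mem_range.2 (by omega : j < k - i + 1))).trans ?_)
  exact Finset.single_le_sum (f := fun i => ∑ j ∈ Finset.range (k - i + 1), mixedNorm γ j i f ^ 2)
    (fun _ _ => zero_le) (Finset.mem_Icc.2 ⟨hi, by omega⟩)

lemma hkNorm_le {γ : ℝ} {k : ℕ} {f : ℝ × ℝ → ℝ} {N : ℝ≥0∞} (h0 : ∀ j ≤ k, mixedNorm eta j 0 f ≤ N)
    (h1 : ∀ i j, 1 ≤ i → j + i ≤ k → mixedNorm γ j i f ≤ N) : hkNorm γ k f ≤ (k + 1 : ℝ≥0) * N := by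
  rw [hkNorm, ← ENNReal.rpow_le_rpow_iff (z := 2) (by norm_num), ← ENNReal.rpow_mul]
  norm_num
  have a0 : ∑ i ∈ Finset.range (k + 1), mixedNorm eta i 0 f ^ 2 ≤ ((k : ℝ≥0∞) + 1) * N ^ 2 := by
    refine (Finset.sum_le_card_nsmul _ _ (N ^ 2) fun j hj => ?_).trans (by simp)
    have := h0 j (by simpa [Nat.lt_succ_iff] using hj)
    gcongr
  have a1 : ∑ i ∈ Finset.Icc 1 k, ∑ j ∈ Finset.range (k - i + 1), mixedNorm γ j i f ^ 2
      ≤ (k : ℝ≥0∞) * (((k : ℝ≥0∞) + 1) * N ^ 2) := by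
    refine (Finset.sum_le_card_nsmul _ _ (((k : ℝ≥0∞) + 1) * N ^ 2) fun i hi => ?_).trans (by simp)
    rw [Finset.mem_Icc] at hi
    refine (Finset.sum_le_card_nsmul _ _ (N ^ 2) fun j hj => ?_).trans ?_
    · have := h1 i j hi.1 (by have := Finset.mem_range.1 hj; omega)
      gcongr
    · rw [Finset.card_range, nsmul_eq_mul]
      gcongr
      exact_mod_cast (by omega : k - i + 1 ≤ k + 1)
  refine (add_le_add a0 a1).trans (le_of_eq ?_)
  ring

/-- Functions with `m` radial derivatives, `D_R^j q` having `m - j` derivatives in the angle. -/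
def RTower (γ : ℝ) : ℕ → (ℝ × ℝ → ℝ) → ℝ≥0∞ → Prop
  | 0, q, M => Reg γ 0 eta q M
  | m + 1, q, M => Reg γ (m + 1) eta q M ∧ ∃ q₁, IsDR q q₁ ∧ RTower γ m q₁ M

namespace RTower

variable {γ : ℝ} {f g : ℝ × ℝ → ℝ} {M N : ℝ≥0∞}

lemma reg : ∀ {m : ℕ}, RTower γ m f M → Reg γ m eta f M
  | 0, h => h
  | _ + 1, h => h.1

lemma mono {m : ℕ} (h : RTower γ m f M) (hMN : M ≤ N) : RTower γ m f N := by
  induction m generalizing f with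
  | zero => exact Reg.mono h hMN
  | succ m ih =>
    obtain ⟨h1, g, hg, hr⟩ := h
    exact ⟨h1.mono hMN, g, hg, ih hr⟩

lemma congr {m : ℕ} (h : RTower γ m f M) (hfg : f =ᵐ[stripMeasure] g) : RTower γ m g M := by
  cases m with
  | zero => exact Reg.congr h hfg
  | succ m =>
    obtain ⟨h1, u, hu, hr⟩ := h
    exact ⟨h1.congr hfg, u, hu.congr hfg ae_eq_rfl, hr⟩

lemma add {m : ℕ} (hf : RTower γ m f M) (hg : RTower γ m g N) : RTower γ m (fun p => f p + g p) (M + N) := by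
  induction m generalizing f g with
  | zero => exact Reg.add hf hg
  | succ m ih =>
    obtain ⟨h1, u, hu, hr⟩ := hf
    obtain ⟨h1', u', hu', hr'⟩ := hg
    exact ⟨h1.add h1', _, hu.add hu', ih hr hr'⟩

lemma const_mul {m : ℕ} (hf : RTower γ m f M) {c : ℝ} {K : ℝ≥0} (hc : |c| ≤ K) :
    RTower γ m (fun p => c * f p) (K * M) := by
  induction m generalizing f with
  | zero => exact Reg.const_mul_of_abs_le hf hc
  | succ m ih =>
    obtain ⟨h1, u, hu, hr⟩ := hf
    exact ⟨h1.const_mul_of_abs_le hc, _, hu.const_mul c, ih hr⟩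

lemma exists_seq {m : ℕ} (h : RTower γ m f M) : ∃ q : ℕ → ℝ × ℝ → ℝ, q 0 = f ∧
    (∀ j, j ≤ m → Reg γ (m - j) eta (q j) M) ∧ ∀ j, j < m → IsDR (q j) (q (j + 1)) := by
  induction m generalizing f with
  | zero => exact ⟨fun _ => f, rfl, fun j hj => by obtain rfl := Nat.le_zero.1 hj; exact h, fun j hj => absurd hj (by omega)⟩
  | succ m ih =>
    obtain ⟨h1, u, hu, hr⟩ := h
    obtain ⟨q, q0, hq, hd⟩ := ih hr
    refine ⟨fun j => Nat.casesOn j f q, rfl, fun j hj => ?_, fun j hj => ?_⟩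
    · cases j with
      | zero => exact h1
      | succ j => simpa using hq j (by omega)
    · cases j with
      | zero => simpa [q0] using hu
      | succ j => exact hd j (by omega)

end RTower

lemma Reg.exists_seq {γ β : ℝ} {m : ℕ} {f : ℝ × ℝ → ℝ} {M : ℝ≥0∞} (h : Reg γ m β f M) :
    ∃ u : ℕ → ℝ × ℝ → ℝ, u 0 = f ∧ (∀ i, i < m → IsDTheta (u i) (u (i + 1))) ∧
      ∀ i, 1 ≤ i → i ≤ m → nrm γ (u i) ≤ M := by
  induction m generalizing f β with
  | zero => exact ⟨fun _ => f, rfl, fun i hi => absurd hi (by omega), fun i h1 h2 => absurd h1 (by omega)⟩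
  | succ m ih =>
    obtain ⟨-, g, hg, hr⟩ := h
    obtain ⟨u, u0, hu, hn⟩ := ih hr
    refine ⟨fun i => Nat.casesOn i f u, rfl, fun i hi => ?_, fun i h1 h2 => ?_⟩
    · cases i with
      | zero => simpa [u0] using hg
      | succ i => exact hu i (by omega)
    · cases i with
      | zero => omega
      | succ i =>
        cases i with
        | zero => simpa [u0] using hr.nrm_le
        | succ i => exact hn (i + 1) (by omega) (by omega)

lemma isIterate_of_seq {D : (ℝ × ℝ → ℝ) → (ℝ × ℝ → ℝ) → Prop} {u : ℕ → ℝ × ℝ → ℝ}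
    (h0 : LocallyIntegrableOn (u 0) strip) : ∀ {n : ℕ}, (∀ i < n, D (u i) (u (i + 1))) → IsIterate D n (u 0) (u n)
  | 0, _ => ⟨h0, ae_eq_rfl⟩
  | n + 1, h => ⟨_, isIterate_of_seq h0 fun i hi => h i (by omega), h n (by omega)⟩

/-- The `ℋ^k` norm is controlled by the regularity of the radial derivatives; the mixed derivatives are
identified by exchanging `D_R` and `D_θ`. -/
lemma RTower.hkNorm_le {γ : ℝ} {k : ℕ} {f : ℝ × ℝ → ℝ} {M : ℝ≥0∞} (h : RTower γ k f M) :
    hkNorm γ k f ≤ (k + 1 : ℝ≥0) * M := by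
  obtain ⟨q, rfl, hq, hd⟩ := h.exists_seq
  have ex : ∀ j, ∃ u : ℕ → ℝ × ℝ → ℝ, j ≤ k → u 0 = q j ∧ (∀ i, i < k - j → IsDTheta (u i) (u (i + 1))) ∧
      ∀ i, 1 ≤ i → i ≤ k - j → nrm γ (u i) ≤ M := by
    intro j
    by_cases hj : j ≤ k
    · obtain ⟨u, hu⟩ := (hq j hj).exists_seq
      exact ⟨u, fun _ => hu⟩
    · exact ⟨0, fun h => absurd h hj⟩
  choose u hu using ex
  have hR : ∀ i j, j + 1 + i ≤ k → IsDR (u j i) (u (j + 1) i) := by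
    intro i
    induction i with
    | zero =>
      intro j hj
      rw [(hu j (by omega)).1, (hu (j + 1) (by omega)).1]
      exact hd j (by omega)
    | succ i ih =>
      intro j hj
      exact ((hu j (by omega)).2.1 i (by omega)).swap (ih j (by omega)) ((hu (j + 1) (by omega)).2.1 i (by omega))
  have l0 : LocallyIntegrableOn (u 0 0) strip := by rw [(hu 0 (by omega)).1]; exact h.reg.locInt
  have li : ∀ i, i ≤ k → LocallyIntegrableOn (u 0 i) strip := by
    intro i hi
    cases i with
    | zero => exact l0
    | succ i => exact ((hu 0 (by omega)).2.1 i (by omega)).locInt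
  have mix : ∀ j i, j + i ≤ k → IsMixed j i (q 0) (u j i) := by
    intro j i hji
    refine ⟨u 0 i, ?_, isIterate_of_seq (D := IsDR) (u := fun j => u j i) (li i (by omega)) fun l hl => hR i l (by omega)⟩
    rw [← (hu 0 (by omega)).1]
    exact isIterate_of_seq l0 fun l hl => (hu 0 (by omega)).2.1 l (by omega)
  refine PolarBS.hkNorm_le (fun j hj => ?_) fun i j hi hj => ?_
  · rw [(mix j 0 (by omega)).mixedNorm_eq, (hu j hj).1]
    exact (hq j hj).nrm_le
  · rw [(mix j i hj).mixedNorm_eq]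
    exact (hu j (by omega)).2.2 i hi (by omega)

/-- Orthogonality is inherited by radial derivatives. -/
lemma OrthW.isDR {F G : ℝ × ℝ → ℝ} (hO : OrthW F) (hF : MemLp F 2 stripMeasure) (hG : MemLp G 2 stripMeasure)
    (h : IsDR F G) : OrthW G := by
  intro ψ hψ
  have eG : G =ᵐ[stripMeasure] fun p => p.1 * (p.1⁻¹ * G p) := ae_strip_of_forall fun p hp => by
    have : p.1 ≠ 0 := ne_of_gt hp.1
    field_simp
  have := h.hasWeakDeriv.radial_parts hF (hG.ae_eq eG) hψ (k := fun θ => Real.cos θ ^ 2 * Real.sin θ)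
    ((Real.contDiff_cos.pow 2).mul Real.contDiff_sin)
  have e1 : ∫ p, F p * (dlt ψ p.1 * (Real.cos p.2 ^ 2 * Real.sin p.2)) ∂stripMeasure = 0 := by
    rw [← hO _ hψ.dlt]; congr 1; ext p; ring
  rw [e1, zero_eq_neg] at this
  rw [← this]
  refine integral_congr_ae (eG.mono fun p hp => ?_)
  simp only [] at hp ⊢
  rw [← hp]; ring

/-- Functions with finite `ℋ^k` norm. -/
lemma tower_of_hkNorm {γ : ℝ} {k : ℕ} {F : ℝ × ℝ → ℝ} (hO : OrthW F) (h : hkNorm γ k F < ⊤) :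
    Tower γ k F (hkNorm γ k F) := by
  set M := hkNorm γ k F
  have ex : ∀ j i, ∃ g, j + i ≤ k → IsMixed j i F g := by
    intro j i
    by_cases hji : j + i ≤ k
    · rcases Nat.eq_zero_or_pos i with rfl | hi
      · obtain ⟨g, hg⟩ := exists_isMixed ((mixedNorm_le_hkNorm (γ := γ) F (by omega : j ≤ k)).trans_lt h)
        exact ⟨g, fun _ => hg⟩
      · obtain ⟨g, hg⟩ := exists_isMixed ((mixedNorm_le_hkNorm' (γ := γ) F hi hji).trans_lt h)
        exact ⟨g, fun _ => hg⟩
    · exact ⟨0, fun h => absurd h hji⟩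
  choose u hu using ex
  have hR : ∀ j i, j + 1 + i ≤ k → IsDR (u j i) (u (j + 1) i) := by
    intro j i hji
    obtain ⟨v, h1, h2⟩ := hu j i (by omega)
    obtain ⟨v', h1', w, h2', h3⟩ := hu (j + 1) i hji
    exact h3.congr (h2'.unique_dR h2 (h1'.unique_dTheta h1 ae_eq_rfl)) ae_eq_rfl
  have hT : ∀ j i, j + i + 1 ≤ k → IsDTheta (u j i) (u j (i + 1)) := by
    intro j
    induction j with
    | zero =>
      intro i hi
      obtain ⟨v, h1, h2⟩ := hu 0 i (by omega)
      obtain ⟨v', ⟨w, h1', h3⟩, h2'⟩ := hu 0 (i + 1) (by omega)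
      exact h3.congr ((h1'.unique_dTheta h1 ae_eq_rfl).trans h2.2.symm) h2'.2.symm
    | succ j ih =>
      intro i hi
      exact (hR j i (by omega)).swap (ih i (by omega)) (hR j (i + 1) (by omega))
  have n0 : ∀ j, j ≤ k → nrm eta (u j 0) ≤ M := fun j hj => by
    rw [← (hu j 0 hj).mixedNorm_eq]; exact mixedNorm_le_hkNorm F hj
  have n1 : ∀ j i, 1 ≤ i → j + i ≤ k → nrm γ (u j i) ≤ M := fun j i hi hj => by
    rw [← (hu j i hj).mixedNorm_eq]; exact mixedNorm_le_hkNorm' F hi hj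
  have e0 : u 0 0 =ᵐ[stripMeasure] F := by
    obtain ⟨v, h1, h2⟩ := hu 0 0 (by omega)
    exact h2.2.trans h1.2
  have l0 : LocallyIntegrableOn F strip := by
    obtain ⟨v, h1, h2⟩ := hu 0 0 (by omega)
    exact h1.1
  have lu : ∀ j i, j + i ≤ k → LocallyIntegrableOn (u j i) strip := by
    intro j i hji
    cases j with
    | succ j => exact (hR j i hji).locInt
    | zero =>
      cases i with
      | succ i => exact (hT 0 i (by omega)).locInt
      | zero => exact LocInt.congr l0 e0.symm
  have rγ : ∀ l j i, 1 ≤ i → j + i + l ≤ k → Reg γ l γ (u j i) M := by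
    intro l
    induction l with
    | zero => exact fun j i hi hl => ⟨lu j i hl, n1 j i hi hl⟩
    | succ l ih => exact fun j i hi hl => ⟨n1 j i hi (by omega), _, hT j i (by omega), ih j (i + 1) (by omega) (by omega)⟩
  have rη : ∀ l j, j + l ≤ k → Reg γ l eta (u j 0) M := by
    intro l j hl
    cases l with
    | zero => exact ⟨lu j 0 hl, n0 j hl⟩
    | succ l => exact ⟨n0 j (by omega), _, hT j 0 (by omega), rγ l j 1 le_rfl (by omega)⟩
  have mem : ∀ j, j ≤ k → MemLp (u j 0) 2 stripMeasure := fun j hj =>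
    MemX.memLp eta_pos.le ⟨aesm_mul_wt (LocInt.aesm (lu j 0 hj)), (n0 j hj).trans_lt h⟩
  have orth : ∀ j, j ≤ k → OrthW (u j 0) := by
    intro j
    induction j with
    | zero =>
      intro _ ψ hψ
      rw [← hO ψ hψ]
      exact integral_congr_ae (e0.mono fun p hp => by simp only [hp])
    | succ j ih => exact fun hj => (ih (by omega)).isDR (mem j (by omega)) (mem (j + 1) hj) (hR j 0 hj)
  have tow : ∀ l j, j + l ≤ k → Tower γ l (u j 0) M := by
    intro l
    induction l with
    | zero => exact fun j hj => ⟨orth j hj, rη 0 j hj⟩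
    | succ l ih => exact fun j hj => ⟨orth j (by omega), rη (l + 1) j hj, _, hR j 0 (by omega), ih (j + 1) (by omega)⟩
  have t := tow k 0 (by omega)
  cases k with
  | zero => exact ⟨hO, t.2.congr e0⟩
  | succ k =>
    obtain ⟨-, h2, G, h3, h4⟩ := t
    exact ⟨hO, h2.congr e0, G, h3.congr e0 ae_eq_rfl, h4⟩

/-- The radial derivatives of a solution are the solutions for the radial derivatives of the right-hand
side, so the regularity estimate applies to each of them. -/
lemma exists_rTower_sol (m : ℕ) : ∃ C : ℝ≥0, ∀ γ, 1 ≤ γ → γ ≤ 5 / 4 → ∀ α, 0 < α → α ≤ 1 / 4 →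
    ∀ F M, M ≠ ⊤ → Tower γ m F M → ∀ Ψ Ψ₁ Ψ₂ Θ Θ₁ Y, Sol α F Ψ Ψ₁ Ψ₂ Θ Θ₁ Y →
      RTower γ m Ψ₁ (C * M) ∧ RTower γ m Ψ₂ (C * M) ∧
      RTower γ m (fun p => Real.sin p.2 * Y p - 5 * Ψ p - (F p + Ψ₂ p + 5 * Ψ₁ p)) (C * M) := by
  induction m with
  | zero =>
    obtain ⟨C, hC⟩ := exists_regSol 0
    refine ⟨C, fun γ hγ hγ' α hα0 hα F M hM hT Ψ Ψ₁ Ψ₂ Θ Θ₁ Y h => ?_⟩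
    have := hC γ hγ hγ' α hα0 hα F M hM hT Ψ Ψ₁ Ψ₂ Θ Θ₁ Y h
    exact ⟨this.regΨ₁, this.regΨ₂, this.regΨθθ⟩
  | succ m ih =>
    obtain ⟨C, hC⟩ := exists_regSol (m + 1)
    obtain ⟨C', hC'⟩ := ih
    refine ⟨C + C', fun γ hγ hγ' α hα0 hα F M hM hT Ψ Ψ₁ Ψ₂ Θ Θ₁ Y h => ?_⟩
    have r := hC γ hγ hγ' α hα0 hα F M hM hT Ψ Ψ₁ Ψ₂ Θ Θ₁ Y h
    have xF := hT.memX hM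
    obtain ⟨-, -, G, hFG, hG⟩ := hT
    have xG := hG.memX hM
    obtain ⟨Φ, Φ₁, Φ₂, Ξ, Ξ₁, W, h'⟩ := exists_sol hα0 hα xG hG.orthW
    obtain ⟨t1, t2, t3⟩ := hC' γ hγ hγ' α hα0 hα G M hM hG Φ Φ₁ Φ₂ Ξ Ξ₁ W h'
    obtain ⟨-, d1, d2, d3, -, -, -⟩ := h.radial hα0 hα h' (xF.memLp eta_pos.le) (xG.memLp eta_pos.le) hFG
    have i1 : (C : ℝ≥0∞) * M ≤ (C + C' : ℝ≥0) * M := mul_le_mul_left (ENNReal.coe_le_coe.2 le_self_add) _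
    have i2 : (C' : ℝ≥0∞) * M ≤ (C + C' : ℝ≥0) * M := mul_le_mul_left (ENNReal.coe_le_coe.2 le_add_self) _
    exact ⟨⟨r.regΨ₁.mono i1, _, d1, t1.mono i2⟩, ⟨r.regΨ₂.mono i1, _, d2, t2.mono i2⟩,
      ⟨r.regΨθθ.mono i1, _, h.radial_dTT h' d3, t3.mono i2⟩⟩

lemma orthW_of_slices {F : ℝ × ℝ → ℝ} (hF : MemLp F 2 stripMeasure)
    (h : ∀ᵐ R ∂(volume.restrict (Ioi (0 : ℝ))),
      ∫ θ in (0 : ℝ)..(Real.pi / 2), F (R, θ) * Real.cos θ ^ 2 * Real.sin θ = 0) : OrthW F := by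
  intro ψ hψ
  have hi := integrable_tensor hF hψ (b := fun θ => Real.cos θ ^ 2 * Real.sin θ) (by fun_prop)
  have e : (fun p : ℝ × ℝ => F p * (Real.cos p.2 ^ 2 * Real.sin p.2) * ψ p.1)
      = fun p => F p * (ψ p.1 * (Real.cos p.2 ^ 2 * Real.sin p.2)) := by ext p; ring
  rw [e, integral_strip hi]
  refine integral_eq_zero_of_ae (h.mono fun R hR => ?_)
  rw [intervalIntegral.integral_of_le (by positivity), integral_Ioc_eq_integral_Ioo] at hR
  simp only [Pi.zero_apply]
  refine Eq.trans ?_ (mul_eq_zero_of_right (ψ R) hR)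
  rw [← integral_const_mul]
  congr 1; ext θ; ring

/-- The radial second derivative `R² ∂_RR Ψ = α⁻² Ψ₂ - α⁻¹ Ψ₁`, with the factor `α²`. -/
lemma ofReal_sq_mul_hkNorm_le {γ α : ℝ} {k : ℕ} {Ψ₁ Ψ₂ : ℝ × ℝ → ℝ} {N : ℝ≥0∞} (hα0 : 0 < α) (hα : α ≤ 1)
    (h1 : RTower γ k Ψ₁ N) (h2 : RTower γ k Ψ₂ N) :
    ENNReal.ofReal (α ^ 2) * hkNorm γ k (fun p => p.1 ^ 2 * ((p.1 ^ 2)⁻¹ * (α⁻¹ ^ 2 * Ψ₂ p + -α⁻¹ * Ψ₁ p)))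
      ≤ (k + 1 : ℝ≥0) * (2 * N) := by
  have hα1 : 1 ≤ α⁻¹ := (one_le_inv₀ hα0).2 hα
  have hK : ((Real.toNNReal (α⁻¹ ^ 2) : ℝ≥0) : ℝ) = α⁻¹ ^ 2 := Real.coe_toNNReal _ (by positivity)
  have b2 := h2.const_mul (c := α⁻¹ ^ 2) (K := Real.toNNReal (α⁻¹ ^ 2)) (by
    rw [hK, abs_of_nonneg (by positivity)])
  have b1 := h1.const_mul (c := -α⁻¹) (K := Real.toNNReal (α⁻¹ ^ 2)) (by
    rw [hK, abs_neg, abs_of_nonneg (by positivity)]; nlinarith)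
  have b := ((b2.add b1).congr (g := fun p => p.1 ^ 2 * ((p.1 ^ 2)⁻¹ * (α⁻¹ ^ 2 * Ψ₂ p + -α⁻¹ * Ψ₁ p)))
    (ae_strip_of_forall fun p hp => by
      have : p.1 ≠ 0 := ne_of_gt hp.1
      simp only []
      rw [mul_inv_cancel_left₀ (pow_ne_zero 2 this)])).hkNorm_le
  refine (mul_le_mul_right b _).trans (le_of_eq ?_)
  have hinv : ENNReal.ofReal (α ^ 2) * ((Real.toNNReal (α⁻¹ ^ 2) : ℝ≥0) : ℝ≥0∞) = 1 := by
    rw [show ((Real.toNNReal (α⁻¹ ^ 2) : ℝ≥0) : ℝ≥0∞) = ENNReal.ofReal (α⁻¹ ^ 2) from rfl,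
      ← ENNReal.ofReal_mul (by positivity), ← mul_pow, mul_inv_cancel₀ hα0.ne', one_pow, ENNReal.ofReal_one]
  calc _ = (ENNReal.ofReal (α ^ 2) * ((Real.toNNReal (α⁻¹ ^ 2) : ℝ≥0) : ℝ≥0∞)) * ((k + 1 : ℝ≥0) * (2 * N)) := by ring
    _ = _ := by rw [hinv, one_mul]

end PolarBS

end

theorem mainTheorem4 (k : ℕ) (hk : 2 ≤ k) :
    ∃ C : ℝ, 0 < C ∧
      ∀ α γ : ℝ, 0 < α → α ≤ 1 / 4 → 1 < γ → γ ≤ 5 / 4 →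
      ∀ F : ℝ × ℝ → ℝ, MemLp F 2 PolarBS.stripMeasure →
        (∀ᵐ R ∂(volume.restrict (Ioi (0 : ℝ))),
          ∫ θ in (0 : ℝ)..(Real.pi / 2), F (R, θ) * Real.cos θ ^ 2 * Real.sin θ = 0) →
        PolarBS.hkNorm γ k F < ⊤ →
        (∃ Ψ, PolarBS.IsL2Solution α F Ψ) ∧
        (∀ Ψ₁ Ψ₂, PolarBS.IsL2Solution α F Ψ₁ → PolarBS.IsL2Solution α F Ψ₂ →
          Ψ₁ =ᵐ[PolarBS.stripMeasure] Ψ₂) ∧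
        ∀ Ψ, PolarBS.IsL2Solution α F Ψ →
          ∃ ΨRR Ψθθ : ℝ × ℝ → ℝ,
            PolarBS.HasWeakDeriv2 PolarBS.dirR Ψ ΨRR ∧
            PolarBS.HasWeakDeriv2 PolarBS.dirTheta Ψ Ψθθ ∧
            ENNReal.ofReal (α ^ 2) * PolarBS.hkNorm γ k (fun p => p.1 ^ 2 * ΨRR p) +
                PolarBS.hkNorm γ k Ψθθ ≤
              ENNReal.ofReal C * PolarBS.hkNorm γ k F := by
  obtain ⟨C, hC⟩ := PolarBS.exists_rTower_sol k
  refine ⟨3 * (k + 1) * C + 1, by positivity, fun α γ hα0 hα hγ hγ' F hF hsl hfin => ?_⟩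
  have hT := PolarBS.tower_of_hkNorm (PolarBS.orthW_of_slices hF hsl) hfin
  obtain ⟨Ψ₀, Ψ₁, Ψ₂, Θ, Θ₁, Y, h⟩ := PolarBS.exists_sol hα0 hα (hT.memX hfin.ne) hT.orthW
  refine ⟨⟨Ψ₀, h.isL2Solution hα0⟩, fun Φ Φ' hΦ hΦ' =>
    PolarBS.VW.unique hα0 hα hΦ.memLp hΦ'.memLp (hΦ.vw hF) (hΦ'.vw hF), fun Ψ hΨ => ?_⟩
  have e : Ψ₀ =ᵐ[PolarBS.stripMeasure] Ψ :=
    PolarBS.VW.unique hα0 hα (h.memΨ.memLp PolarBS.eta_pos.le) hΨ.memLp (h.vw hα0 hF) (hΨ.vw hF)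
  refine ⟨_, _, ⟨_, h.dR.congr e ae_eq_rfl, h.dRR⟩, ⟨Θ, h.dT.congr e ae_eq_rfl, h.dTT⟩, ?_⟩
  obtain ⟨t1, t2, t3⟩ := hC γ hγ.le hγ' α hα0 hα F _ hfin.ne hT Ψ₀ Ψ₁ Ψ₂ Θ Θ₁ Y h
  refine (add_le_add (PolarBS.ofReal_sq_mul_hkNorm_le hα0 (by linarith) t1 t2) t3.hkNorm_le).trans ?_
  have hreal : ENNReal.ofReal (3 * (k + 1) * C + 1)
      = ((3 * (k + 1) * C + 1 : NNReal) : ENNReal) := by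
    rw [← ENNReal.ofReal_coe_nnreal]; push_cast; rfl
  rw [hreal]
  push_cast
  calc _ = (3 * ((k : ENNReal) + 1) * C) * PolarBS.hkNorm γ k F := by ring
    _ ≤ _ := mul_le_mul_left le_self_add _
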